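/- Let $n,m$ be coprime integers, $\theta\in\mathbb R$ with $n-m\theta\neq0$ (automatic for irrational $\theta$), $\tau\in\mathbb C$ with $\operatorname{Im}\tau\ne0$, and put $\mu=\frac{m}{n-m\theta}$. **Basic module.** For $m\ne0$ let $\mathcal E_{n,m}(\theta)$ be the Schwartz space $\mathcal S(\mathbb R\times\mathbb Z/m\mathbb Z)$ with $(U_1f)(s,\alpha)=f(s-(\tfrac nm-\theta),\alpha-n)$ and $(U_2f)(s,\alpha)=e^{2\pi is}e^{-2\pi i\alpha/m}f(s,\alpha)$, so that $U_1U_2=e^{2\pi i\theta}U_2U_1$, with the $L^2$ Hermitian form and the reference connection $\nabla_1=2\pi i\mu s$, $\nabla_2=\frac{d}{ds}$. For $m=0$ let $\mathcal E_{n,0}(\theta)$ be the algebra $A_\theta$ of rapidly convergent series $\sum a_{ij}U_1^iU_2^j$ as a free left module of rank one, with the Hermitian form $\sum\overline{a_{ij}}\,b_{ij}$ and with $\nabla_k=\delta_k$, $\delta_k(U_l)=2\pi i\,\delta_{kl}U_l$. A *standard holomorphic structure* on $\mathcal E_{n,m}(\theta)$ is an operator $\tau D_1+D_2$, where $D_1,D_2$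 are linear operators, skew-adjoint for the Hermitian form, with $[D_k,U_l]=2\pi i\,\delta_{kl}U_l$ and $[D_1,D_2]=-2\pi i\mu$. Let $\mathcal M^s_{n,m}(\theta)$ be the set of standard holomorphic structures (with the topology of pointwise convergence on the Fréchet space $\mathcal E_{n,m}(\theta)$) modulo isomorphism, i.e. modulo conjugation by linear homeomorphisms commuting with $U_1,U_2$, with the quotient topology. **Supercycles.** A supercycle of slope $m/n$ is a line $\mathcal L=\{(X_0+ns,\,Y_0+ms):s\in\mathbb R/\mathbb Z\}$ in $\widehat X_\tau\cong\mathbb R^2/\mathbb Z^2$ with a flat $U(1)$-connection $d+A$, $A=2\pi i\,h(s)\,ds$, $h$ real and smooth, on the trivial line bundle over $\mathcal L$. Let $\mathcal{SM}_{n,m}$ be the space of supercycles modulo equality of lines and gauge equivalence of connections, with the quotient topology (of the uniform topology on $h$ and the usual one on $(X_0,Y_0)$). **Leafwise paths.** A leafwise path of the $\theta^{-1}$-Kronecker foliation $dy=\theta^{-1}dx$ from the line $y=0$ to $\mathcal L$ is a triple $(x,t,s)$, $x,s\in\mathbb R/\mathbb Z$, $t\in\mathbb R$: it starts at $(x,0)$,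 follows the leaf in direction $(\theta,1)$ for the signed height $t$, and ends at the point $(x+\theta t,t)$ of $\mathcal L$, whose parameter is $s$. On Schwartz functions on the one-manifold $P_{\mathcal L}$ of these paths put $$(U_1f)(x,t,s)=f(x+\theta,t-1,s),\quad (U_2f)(x,t,s)=e^{2\pi ix}f(x,t,s),\quad \nabla_1f=2\pi i\,t f,\quad \nabla_2f=\frac{1}{n-m\theta}\Big(\frac{\partial f}{\partial s}+2\pi i\,h(s)f\Big),$$ where $\partial/\partial s$ is the derivative along $P_{\mathcal L}$, parametrized by the end point: $v\mapsto(x+(n-m\theta)v,\,t+mv,\,s+v)$. **Theorem.** 1. If $(X,Y)$ is a point of $\mathcal L$, there is a leafwise path to $\mathcal L$ with start $x$ and height $t$ if and only if $m(x-X)+nY\equiv(n-m\theta)t$ modulo $1$. In particular, if $\mathcal L$ has $x$-intercept $R_1$, the condition is $m(x-R_1)\equiv(n-m\theta)t$ modulo $1$. 2. There is a homeomorphism $\Phi:\mathcal{SM}_{n,m}\to\mathcal M^s_{n,m}(\theta)$ such that: * (geometric construction) for every supercycle $(\mathcal L,A)$ and every standard holomorphic structure $\overline\nabla$ on $\mathcal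 E_{n,m}(\theta)$, one has $\Phi[\mathcal L,A]=[\overline\nabla]$ if and only if the Schwartz space of $P_{\mathcal L}$ with $U_1,U_2$ and $\tau\nabla_1+\nabla_2$ as above is isomorphic (by a linear homeomorphism commuting with $U_1,U_2$ and the holomorphic structures) to $(\mathcal E_{n,m}(\theta),\overline\nabla)$; * (translations) for every supercycle $(\mathcal L,A)$ and every point $(X,Y)$ of $\mathcal L$, $\Phi[\mathcal L,A]$ is the class of the standard holomorphic structure $\tau(\nabla_1+2\pi ir_1)+(\nabla_2+2\pi ir_2)$ on $\mathcal E_{n,m}(\theta)$ with $$r_1=-\frac{mX-nY}{n-m\theta},\qquad r_2=\frac{1}{n-m\theta}\int_0^1h(s)\,ds .$$ In particular a line with $x$-intercept $R_1$ and the connection $A=2\pi iR_2\,dx$ correspond to the translations $r_1=-\mu R_1$ of $\nabla_1$ and $r_2=\frac{n}{n-m\theta}R_2$ of $\nabla_2$. -/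

import Mathlib

open scoped SchwartzMap ContDiff ComplexConjugate

noncomputable section

/-! ## Modules over the noncommutative torus -/

/-- A concrete (left) module over the noncommutative torus `T²_θ`, whose generators act by operators
with `U₁ U₂ = e^{2πiθ} U₂ U₁`. It carries its Fréchet topology, its Hermitian form
and a reference pair of operators `(∇₁, ∇₂)`. -/
structure TorusModule (θ : ℝ) where
  E : Type
  [acg : AddCommGroup E]
  [mod : Module ℂ E]
  [top : TopologicalSpace E]
  U₁ : Module.End ℂ E
  U₂ : Module.End ℂ E
  rel : ∀ ξ, U₁ (U₂ ξ) = Complex.exp (2 * Real.pi * Complex.I * θ) • U₂ (U₁ ξ)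
  herm : E → E → ℂ
  nabla₁ : Module.End ℂ E
  nabla₂ : Module.End ℂ E

attribute [instance] TorusModule.acg TorusModule.mod TorusModule.top

/-! ### The basic module for `m ≠ 0`: the Schwartz space of `ℝ × ℤ/m` -/

namespace SchwartzModule

/-- `s ↦ e^{2πis}` -/
def character (s : ℝ) : ℂ := Complex.exp (2 * Real.pi * Complex.I * s)

theorem character_hasTemperateGrowth : character.HasTemperateGrowth := by
  refine ⟨?_, ?_⟩
  · unfold character
    exact Complex.contDiff_exp.comp (contDiff_const.mul Complex.ofRealCLM.contDiff)
  · intro n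
    refine ⟨0, (2 * Real.pi) ^ n, fun x => ?_⟩
    have key : iteratedDeriv n character
        = fun s : ℝ => (2 * Real.pi * Complex.I) ^ n * character s := by
      induction n with
      | zero => funext s; simp
      | succ k ih =>
        rw [iteratedDeriv_succ, ih]
        funext s
        have h1 : HasDerivAt character (character s * (2 * Real.pi * Complex.I)) s := by
          unfold character
          have := ((hasDerivAt_id s).ofReal_comp.const_mul (2 * (Real.pi : ℂ) * Complex.I)).cexp
          simpa using this
        rw [(h1.const_mul _).deriv]
        ring
    rw [norm_iteratedFDeriv_eq_norm_iteratedDeriv, key]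
    have h2 : ‖character x‖ = 1 := by
      unfold character
      rw [show 2 * (Real.pi : ℂ) * Complex.I * x = ((2 * Real.pi * x : ℝ) : ℂ) * Complex.I by
        push_cast; ring]
      exact Complex.norm_exp_ofReal_mul_I _
    rw [norm_mul, h2, norm_pow]
    simp [abs_of_pos Real.pi_pos]

/-- An element `f` of the Schwartz space of `ℝ × ℤ/m`; `f α s` is its value at `(s, α)`. -/
abbrev Space (m : ℤ) : Type := ZMod m.natAbs → 𝓢(ℝ, ℂ)

/-- `U₁ = V₁ ⊗ W₁`, that is `(U₁ f)(s, α) = f(s - (n/m - θ), α - n)`. -/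
def U₁ (n m : ℤ) (θ : ℝ) : Module.End ℂ (Space m) where
  toFun f α := SchwartzMap.compSubConstCLM ℂ ((n : ℝ) / m - θ) (f (α - (n : ZMod m.natAbs)))
  map_add' f g := by funext α; simp
  map_smul' c f := by funext α; simp

/-- `U₂ = V₂ ⊗ W₂`, that is `(U₂ f)(s, α) = e^{2πis} e^{-2πiα/m} f(s, α)`. -/
def U₂ (m : ℤ) : Module.End ℂ (Space m) where
  toFun f α := Complex.exp (-(2 * Real.pi * Complex.I * α.val / m)) •
    SchwartzMap.smulLeftCLM ℂ character (f α)
  map_add' f g := by funext α; simp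
  map_smul' c f := by funext α; simp [smul_comm c]

/-- `(∇₁ f)(s, α) = 2πi (m / (n - mθ)) s f(s, α)` -/
def nabla₁ (n m : ℤ) (θ : ℝ) : Module.End ℂ (Space m) where
  toFun f α := (2 * Real.pi * Complex.I * (m / (n - m * θ))) •
    SchwartzMap.smulLeftCLM ℂ (fun s : ℝ => (s : ℂ)) (f α)
  map_add' f g := by funext α; simp
  map_smul' c f := by funext α; simp [smul_comm c]

/-- `(∇₂ f)(s, α) = (∂f/∂s)(s, α)` -/
def nabla₂ (m : ℤ) : Module.End ℂ (Space m) where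
  toFun f α := SchwartzMap.derivCLM ℂ ℂ (f α)
  map_add' f g := by funext α; simp
  map_smul' c f := by funext α; simp

/-- The `L²` Hermitian form `∑_α ∫ conj(f) g`. -/
def herm (m : ℤ) (hm : m ≠ 0) (f g : Space m) : ℂ :=
  haveI : NeZero m.natAbs := ⟨Int.natAbs_ne_zero.mpr hm⟩
  ∑ α : ZMod m.natAbs, ∫ s : ℝ, conj (f α s) * g α s

theorem U₁_apply (n m : ℤ) (θ : ℝ) (f : Space m) (α : ZMod m.natAbs) (s : ℝ) :
    U₁ n m θ f α s = f (α - (n : ZMod m.natAbs)) (s - ((n : ℝ) / m - θ)) := by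
  simp [U₁]

theorem U₂_apply (m : ℤ) (f : Space m) (α : ZMod m.natAbs) (s : ℝ) :
    U₂ m f α s = Complex.exp (-(2 * Real.pi * Complex.I * α.val / m)) *
      (Complex.exp (2 * Real.pi * Complex.I * s) * f α s) := by
  simp [U₂, SchwartzMap.smulLeftCLM_apply_apply character_hasTemperateGrowth, character]

theorem nabla₁_apply (n m : ℤ) (θ : ℝ) (f : Space m) (α : ZMod m.natAbs) (s : ℝ) :
    nabla₁ n m θ f α s = 2 * Real.pi * Complex.I * (m / (n - m * θ)) * (s * f α s) := by
  have h : (fun s : ℝ => (s : ℂ)).HasTemperateGrowth := by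
    exact Complex.ofRealCLM.hasTemperateGrowth
  simp [nabla₁, SchwartzMap.smulLeftCLM_apply_apply h]

theorem nabla₂_apply (m : ℤ) (f : Space m) (α : ZMod m.natAbs) (s : ℝ) :
    nabla₂ m f α s = deriv (f α) s := by
  simp [nabla₂]

theorem exp_val_shift (n m : ℤ) (hm : m ≠ 0) (α : ZMod m.natAbs) :
    Complex.exp (-(2 * Real.pi * Complex.I * (α - (n : ZMod m.natAbs)).val / m)) =
      Complex.exp (2 * Real.pi * Complex.I * (n / m)) *
        Complex.exp (-(2 * Real.pi * Complex.I * α.val / m)) := by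
  have : NeZero m.natAbs := ⟨Int.natAbs_ne_zero.mpr hm⟩
  have h0 : (((α - (n : ZMod m.natAbs)).val : ℤ) : ZMod m.natAbs)
      = (((α.val : ℤ) - n : ℤ) : ZMod m.natAbs) := by
    push_cast
    simp
  have h1 : (m.natAbs : ℤ) ∣ ((α.val : ℤ) - n) - ((α - (n : ZMod m.natAbs)).val : ℤ) :=
    (ZMod.intCast_eq_intCast_iff_dvd_sub _ _ _).mp h0
  obtain ⟨k, hk⟩ := Int.natAbs_dvd.mp h1
  have hk' : ((α.val : ℂ) - n) - ((α - (n : ZMod m.natAbs)).val : ℂ) = m * k := by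
    exact_mod_cast hk
  have hmC : (m : ℂ) ≠ 0 := by exact_mod_cast hm
  rw [← Complex.exp_add, Complex.exp_eq_exp_iff_exists_int]
  refine ⟨k, ?_⟩
  have : ((α - (n : ZMod m.natAbs)).val : ℂ) = α.val - n - m * k := by
    rw [← hk']; ring
  rw [this]
  field_simp
  ring

end SchwartzModule

/-- The basic module on the Schwartz space of `ℝ × ℤ/m`, `m ≠ 0`. -/
def schwartzModule (n m : ℤ) (θ : ℝ) (hm : m ≠ 0) : TorusModule θ where
  E := SchwartzModule.Space m
  U₁ := SchwartzModule.U₁ n m θ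
  U₂ := SchwartzModule.U₂ m
  rel f := by
    funext α
    ext s
    have hmC : (m : ℂ) ≠ 0 := by exact_mod_cast hm
    have h : Complex.exp (2 * Real.pi * Complex.I * ((s - ((n : ℝ) / m - θ) : ℝ) : ℂ)) =
        Complex.exp (2 * Real.pi * Complex.I * s) *
          (Complex.exp (-(2 * Real.pi * Complex.I * (n / m))) *
            Complex.exp (2 * Real.pi * Complex.I * θ)) := by
      rw [← Complex.exp_add, ← Complex.exp_add]
      congr 1
      push_cast
      ring
    have h2 : Complex.exp (2 * Real.pi * Complex.I * (n / m)) *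
        Complex.exp (-(2 * Real.pi * Complex.I * (n / m))) = 1 := by
      rw [← Complex.exp_add]; simp
    rw [SchwartzModule.U₁_apply, SchwartzModule.U₂_apply, Pi.smul_apply, smul_apply,
      SchwartzModule.U₂_apply, SchwartzModule.U₁_apply, SchwartzModule.exp_val_shift n m hm α, h,
      smul_eq_mul]
    linear_combination (Complex.exp (-(2 * Real.pi * Complex.I * α.val / m)) *
      Complex.exp (2 * Real.pi * Complex.I * s) * Complex.exp (2 * Real.pi * Complex.I * θ) *
      f (α - (n : ZMod m.natAbs)) (s - ((n : ℝ) / m - θ))) * h2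
  herm := SchwartzModule.herm m hm
  nabla₁ := SchwartzModule.nabla₁ n m θ
  nabla₂ := SchwartzModule.nabla₂ m

/-! ### The basic module for `m = 0`: the algebra `A_θ` as a free module of rank one -/

namespace FreeModule

/-- The weight `1 + |i| + |j|` on `ℤ²`. -/
def weight (p : ℤ × ℤ) : ℝ := 1 + |(p.1 : ℝ)| + |(p.2 : ℝ)|

theorem one_le_weight (p : ℤ × ℤ) : 1 ≤ weight p := by
  unfold weight
  linarith [abs_nonneg (p.1 : ℝ), abs_nonneg (p.2 : ℝ)]

theorem weight_le (p q : ℤ × ℤ) : weight p ≤ weight q * weight (p - q) := by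
  unfold weight
  have h1 : |(p.1 : ℝ)| ≤ |(q.1 : ℝ)| + |((p - q).1 : ℝ)| := by
    have := abs_add_le (q.1 : ℝ) ((p - q).1 : ℝ)
    simpa using this
  have h2 : |(p.2 : ℝ)| ≤ |(q.2 : ℝ)| + |((p - q).2 : ℝ)| := by
    have := abs_add_le (q.2 : ℝ) ((p - q).2 : ℝ)
    simpa using this
  nlinarith [abs_nonneg (q.1 : ℝ), abs_nonneg (q.2 : ℝ), abs_nonneg ((p - q).1 : ℝ),
    abs_nonneg ((p - q).2 : ℝ), mul_nonneg (abs_nonneg (q.1 : ℝ)) (abs_nonneg ((p - q).1 : ℝ)),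
    mul_nonneg (abs_nonneg (q.1 : ℝ)) (abs_nonneg ((p - q).2 : ℝ)),
    mul_nonneg (abs_nonneg (q.2 : ℝ)) (abs_nonneg ((p - q).1 : ℝ)),
    mul_nonneg (abs_nonneg (q.2 : ℝ)) (abs_nonneg ((p - q).2 : ℝ))]

/-- Rapidly decreasing families `a : ℤ² → ℂ`; `a` stands for `∑ a (i, j) U₁^i U₂^j` in `A_θ`. -/
def Space : Submodule ℂ (ℤ × ℤ → ℂ) where
  carrier := {a | ∀ k : ℕ, ∃ C : ℝ, ∀ p, weight p ^ k * ‖a p‖ ≤ C}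
  zero_mem' k := ⟨0, fun p => by simp⟩
  add_mem' {a b} ha hb k := by
    obtain ⟨C, hC⟩ := ha k
    obtain ⟨C', hC'⟩ := hb k
    refine ⟨C + C', fun p => ?_⟩
    have hw : 0 ≤ weight p ^ k := pow_nonneg (zero_le_one.trans (one_le_weight p)) k
    calc weight p ^ k * ‖(a + b) p‖ ≤ weight p ^ k * (‖a p‖ + ‖b p‖) :=
          mul_le_mul_of_nonneg_left (norm_add_le _ _) hw
      _ ≤ C + C' := by rw [mul_add]; exact add_le_add (hC p) (hC' p)
  smul_mem' c a ha k := by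
    obtain ⟨C, hC⟩ := ha k
    refine ⟨‖c‖ * C, fun p => ?_⟩
    rw [Pi.smul_apply, norm_smul, mul_left_comm]
    exact mul_le_mul_of_nonneg_left (hC p) (norm_nonneg c)

/-- The topology of the seminorms `sup_p (1 + |p|)^k |a p|`. -/
instance : TopologicalSpace Space :=
  ⨅ k : ℕ, TopologicalSpace.induced
    (fun a : Space => UniformFun.ofFun fun p : ℤ × ℤ => (weight p ^ k : ℂ) * a.1 p) inferInstance

/-- A shift followed by multiplication with a family of modulus one. -/
theorem shift_mem (q : ℤ × ℤ) (c : ℤ × ℤ → ℂ) (hc : ∀ p, ‖c p‖ = 1) (a : Space) :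
    (fun p => c p * a.1 (p - q)) ∈ Space := by
  intro k
  obtain ⟨C, hC⟩ := a.2 k
  refine ⟨weight q ^ k * C, fun p => ?_⟩
  have hq : 0 ≤ weight q := zero_le_one.trans (one_le_weight q)
  have hp : 0 ≤ weight p := zero_le_one.trans (one_le_weight p)
  rw [norm_mul, hc, one_mul]
  calc weight p ^ k * ‖a.1 (p - q)‖ ≤ (weight q * weight (p - q)) ^ k * ‖a.1 (p - q)‖ :=
        mul_le_mul_of_nonneg_right (pow_le_pow_left₀ hp (weight_le p q) k) (norm_nonneg _)
    _ = weight q ^ k * (weight (p - q) ^ k * ‖a.1 (p - q)‖) := by rw [mul_pow]; ring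
    _ ≤ weight q ^ k * C := mul_le_mul_of_nonneg_left (hC _) (pow_nonneg hq k)

theorem deriv_mem (c : ℤ × ℤ → ℂ) (hc : ∀ p, ‖c p‖ ≤ 2 * Real.pi * weight p) (a : Space) :
    (fun p => c p * a.1 p) ∈ Space := by
  intro k
  obtain ⟨C, hC⟩ := a.2 (k + 1)
  refine ⟨2 * Real.pi * C, fun p => ?_⟩
  have hp : 0 ≤ weight p := zero_le_one.trans (one_le_weight p)
  rw [norm_mul]
  calc weight p ^ k * (‖c p‖ * ‖a.1 p‖) ≤ weight p ^ k * (2 * Real.pi * weight p * ‖a.1 p‖) := by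
        gcongr
        exact hc p
    _ = 2 * Real.pi * (weight p ^ (k + 1) * ‖a.1 p‖) := by ring
    _ ≤ 2 * Real.pi * C := by
        have := Real.pi_pos
        have := hC p
        exact mul_le_mul_of_nonneg_left this (by positivity)

/-- Left multiplication by `U₁`. -/
def U₁ : Module.End ℂ Space where
  toFun a := ⟨fun p => 1 * a.1 (p - (1, 0)), shift_mem (1, 0) (fun _ => 1) (by simp) a⟩
  map_add' a b := by ext p; simp
  map_smul' c a := by ext p; simp

/-- Left multiplication by `U₂`; note `U₂ U₁^i U₂^(j-1) = e^{-2πiθi} U₁^i U₂^j`. -/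
def U₂ (θ : ℝ) : Module.End ℂ Space where
  toFun a := ⟨fun p => Complex.exp (((-(2 * Real.pi * θ * p.1) : ℝ) : ℂ) * Complex.I) *
      a.1 (p - (0, 1)),
    shift_mem (0, 1) _ (fun _ => Complex.norm_exp_ofReal_mul_I _) a⟩
  map_add' a b := by ext p; simp [mul_add]
  map_smul' c a := by ext p; simp [mul_left_comm]

/-- The derivation `δ₁`: `U₁^i U₂^j ↦ 2πi · i · U₁^i U₂^j`. -/
def nabla₁ : Module.End ℂ Space where
  toFun a := ⟨fun p => (2 * Real.pi * Complex.I * p.1) * a.1 p, deriv_mem _ (fun p => by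
    have h : |(p.1 : ℝ)| ≤ weight p := by unfold weight; linarith [abs_nonneg (p.2 : ℝ)]
    have := Real.pi_pos
    simp only [norm_mul, Complex.norm_I, Complex.norm_intCast, Complex.norm_ofNat,
      Complex.norm_real, Real.norm_eq_abs, abs_of_pos Real.pi_pos, mul_one]
    gcongr) a⟩
  map_add' a b := by ext p; simp [mul_add]
  map_smul' c a := by ext p; simp [mul_left_comm]

/-- The derivation `δ₂`: `U₁^i U₂^j ↦ 2πi · j · U₁^i U₂^j`. -/
def nabla₂ : Module.End ℂ Space where
  toFun a := ⟨fun p => (2 * Real.pi * Complex.I * p.2) * a.1 p, deriv_mem _ (fun p => by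
    have h : |(p.2 : ℝ)| ≤ weight p := by unfold weight; linarith [abs_nonneg (p.1 : ℝ)]
    have := Real.pi_pos
    simp only [norm_mul, Complex.norm_I, Complex.norm_intCast, Complex.norm_ofNat,
      Complex.norm_real, Real.norm_eq_abs, abs_of_pos Real.pi_pos, mul_one]
    gcongr) a⟩
  map_add' a b := by ext p; simp [mul_add]
  map_smul' c a := by ext p; simp [mul_left_comm]

end FreeModule

/-- `A_θ` as a free module of rank one, with the derivations `δ₁, δ₂`. -/
def freeModule (θ : ℝ) : TorusModule θ where
  E := FreeModule.Space
  U₁ := FreeModule.U₁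
  U₂ := FreeModule.U₂ θ
  rel a := by
    ext p
    have h : Complex.exp (((-(2 * Real.pi * θ * (p.1 - 1)) : ℝ) : ℂ) * Complex.I) =
        Complex.exp (2 * Real.pi * Complex.I * θ) *
          Complex.exp (((-(2 * Real.pi * θ * p.1) : ℝ) : ℂ) * Complex.I) := by
      rw [← Complex.exp_add]
      congr 1
      push_cast
      ring
    have h' : p - (1, 0) - (0, 1) = p - (0, 1) - (1, 0) := by abel
    simp only [FreeModule.U₁, FreeModule.U₂, LinearMap.coe_mk, AddHom.coe_mk, one_mul,
      Submodule.coe_smul, Pi.smul_apply, smul_eq_mul, h', Prod.fst_sub, Int.cast_sub, Int.cast_one]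
    rw [h]
    ring
  herm a b := ∑' p, conj (a.1 p) * b.1 p
  nabla₁ := FreeModule.nabla₁
  nabla₂ := FreeModule.nabla₂

/-- The basic module `𝓔_{n,m}(θ)`, for coprime `n, m`. -/
def basicModule (n m : ℤ) (θ : ℝ) : TorusModule θ :=
  if hm : m = 0 then freeModule θ else schwartzModule n m θ hm

/-! ### Connections and standard holomorphic structures -/

/-- `(D₁, D₂)` is a Hermitian connection on `M`, of constant curvature `-2πi c`. -/
structure IsConstCurvConnection {θ : ℝ} (M : TorusModule θ) (c : ℝ) (D₁ D₂ : Module.End ℂ M.E) :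
    Prop where
  leibniz₁₁ : ∀ ξ, D₁ (M.U₁ ξ) = M.U₁ (D₁ ξ) + (2 * Real.pi * Complex.I) • M.U₁ ξ
  leibniz₁₂ : ∀ ξ, D₁ (M.U₂ ξ) = M.U₂ (D₁ ξ)
  leibniz₂₁ : ∀ ξ, D₂ (M.U₁ ξ) = M.U₁ (D₂ ξ)
  leibniz₂₂ : ∀ ξ, D₂ (M.U₂ ξ) = M.U₂ (D₂ ξ) + (2 * Real.pi * Complex.I) • M.U₂ ξ
  skew₁ : ∀ ξ η, M.herm (D₁ ξ) η = -M.herm ξ (D₁ η)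
  skew₂ : ∀ ξ η, M.herm (D₂ ξ) η = -M.herm ξ (D₂ η)
  curvature : ∀ ξ, D₁ (D₂ ξ) - D₂ (D₁ ξ) = (-(2 * Real.pi * Complex.I * c)) • ξ

/-- Standard holomorphic structures on `𝓔_{n,m}(θ)`: the operators `τ∇₁ + ∇₂` of the Hermitian
connections with constant curvature `-2πi m / (n - mθ)`. -/
def StdHolStructure (n m : ℤ) (θ : ℝ) (τ : ℂ) : Type :=
  {D : Module.End ℂ (basicModule n m θ).E // ∃ D₁ D₂ : Module.End ℂ (basicModule n m θ).E,
    IsConstCurvConnection (basicModule n m θ) (m / (n - m * θ)) D₁ D₂ ∧ D = τ • D₁ + D₂}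

/-- The topology of pointwise convergence of operators. -/
instance (n m : ℤ) (θ : ℝ) (τ : ℂ) : TopologicalSpace (StdHolStructure n m θ τ) :=
  TopologicalSpace.induced (fun D (ξ : (basicModule n m θ).E) => D.1 ξ) inferInstance

/-- Two standard holomorphic structures are equivalent if an automorphism of the module
carries one to the other. -/
instance stdHolSetoid (n m : ℤ) (θ : ℝ) (τ : ℂ) : Setoid (StdHolStructure n m θ τ) where
  r D D' := ∃ g : (basicModule n m θ).E ≃L[ℂ] (basicModule n m θ).E,
    (∀ ξ, g ((basicModule n m θ).U₁ ξ) = (basicModule n m θ).U₁ (g ξ)) ∧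
    (∀ ξ, g ((basicModule n m θ).U₂ ξ) = (basicModule n m θ).U₂ (g ξ)) ∧
    ∀ ξ, g (D.1 ξ) = D'.1 (g ξ)
  iseqv :=
    { refl := fun D => ⟨ContinuousLinearEquiv.refl ℂ _, fun _ => rfl, fun _ => rfl, fun _ => rfl⟩
      symm := by
        rintro D D' ⟨g, h1, h2, h3⟩
        refine ⟨g.symm, fun ξ => ?_, fun ξ => ?_, fun ξ => ?_⟩ <;> apply g.injective
        · rw [h1]; simp
        · rw [h2]; simp
        · rw [h3]; simp
      trans := by
        rintro D D' D'' ⟨g, h1, h2, h3⟩ ⟨g', h1', h2', h3'⟩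
        refine ⟨g.trans g', fun ξ => ?_, fun ξ => ?_, fun ξ => ?_⟩
        · simp [h1, h1']
        · simp [h2, h2']
        · simp [h3, h3'] }

/-- The moduli space `𝓜ˢ_{n,m}(θ)`, with the quotient topology. -/
abbrev StdHolModuli (n m : ℤ) (θ : ℝ) (τ : ℂ) : Type := Quotient (stdHolSetoid n m θ τ)

/-! ## Supercycles on the mirror torus `ℝ²/ℤ²` -/

/-- A supercycle of slope `m/n`: the line `{base + (n s, m s) : s ∈ ℝ/ℤ}` in `ℝ²/ℤ²`, with the flat
`U(1)`-connection `d + A`, `A = 2πi · form(s) ds`, on the trivial line bundle over it. -/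
structure Supercycle (n m : ℤ) where
  base : UnitAddCircle × UnitAddCircle
  form : C(UnitAddCircle, ℝ)
  smooth : ContDiff ℝ ∞ fun s : ℝ => form (s : UnitAddCircle)

namespace Supercycle

variable {n m : ℤ}

/-- The point of the line with parameter `s`. -/
def point (C : Supercycle n m) (s : UnitAddCircle) : UnitAddCircle × UnitAddCircle :=
  (C.base.1 + n • s, C.base.2 + m • s)

/-- The underlying special Lagrangian line. -/
def line (C : Supercycle n m) : Set (UnitAddCircle × UnitAddCircle) := Set.range C.point

instance : TopologicalSpace (Supercycle n m) :=
  TopologicalSpace.induced (fun C => (C.base, C.form)) inferInstance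

/-- Two supercycles are equivalent if they have the same line (the base point of the second is the
point of parameter `c` of the first, so that the parameter `s` of the second corresponds to `s + c`
of the first) and their connections on it differ by a gauge transformation `u`,
that is `A' = A + u⁻¹ du`. -/
instance setoid (n m : ℤ) : Setoid (Supercycle n m) where
  r C C' := ∃ c : ℝ, C'.base = C.point (c : UnitAddCircle) ∧ ∃ u : UnitAddCircle → Circle,
    ∀ s : ℝ, HasDerivAt (fun v : ℝ => (u (v : UnitAddCircle) : ℂ))
      (2 * Real.pi * Complex.I * (C'.form (s : UnitAddCircle) -
        C.form ((s + c : ℝ) : UnitAddCircle)) * u (s : UnitAddCircle)) s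
  iseqv :=
    { refl := fun C => ⟨0, by simp [point], fun _ => 1, fun s => by
        simpa using hasDerivAt_const s (1 : ℂ)⟩
      symm := by
        rintro C C' ⟨c, hc, u, hu⟩
        refine ⟨-c, ?_, fun s => (u (s - (c : UnitAddCircle)))⁻¹, fun s => ?_⟩
        · simp only [point, hc]; ext <;> simp
        · have h1 := (hu (s - c)).comp_sub_const s c
          have hne : (u ((s - c : ℝ) : UnitAddCircle) : ℂ) ≠ 0 := Circle.coe_ne_zero _
          have h2 := h1.fun_inv hne
          simp only [Circle.coe_inv, ← AddCircle.coe_sub, sub_add_cancel] at h2 ⊢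
          refine h2.congr_deriv ?_
          rw [← sub_eq_add_neg]
          field_simp
          ring
      trans := by
        rintro C C' C'' ⟨c, hc, u, hu⟩ ⟨c', hc', u', hu'⟩
        refine ⟨c + c', ?_, fun s => u (s + (c' : UnitAddCircle)) * u' s, fun s => ?_⟩
        · rw [hc']; simp only [point, hc]; ext <;> simp [add_assoc]
        · have h1 := ((hu (s + c')).comp_add_const s c').mul (hu' s)
          simp only [Circle.coe_mul, ← AddCircle.coe_add]
          refine h1.congr_deriv ?_
          rw [show s + (c + c') = s + c' + c by ring]
          ring }

end Supercycle

/-- The moduli space `𝓢𝓜_{n,m}` of supercycles of slope `m/n`, with the quotient topology. -/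
abbrev SupercycleModuli (n m : ℤ) : Type := Quotient (Supercycle.setoid n m)

/-! ## Leafwise paths of the `θ⁻¹`-Kronecker foliation -/

/-- Leafwise paths from the line `y = 0` to the line of `C`. The leaves of `dy = θ⁻¹ dx` have
direction `(θ, 1)`; the triple `(x, t, s)` is the path `[0, 1] ∋ v ↦ (x + θ t v, t v)`, of signed
height `t`, from `(x, 0)` to `(x + θ t, t)`, which is the point of the line with parameter `s`. -/
def LeafPath {n m : ℤ} (θ : ℝ) (C : Supercycle n m) : Type :=
  {q : UnitAddCircle × ℝ × UnitAddCircle //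
    C.point q.2.2 = (q.1 + ((θ * q.2.1 : ℝ) : UnitAddCircle), (q.2.1 : UnitAddCircle))}

namespace LeafPath

variable {n m : ℤ} {θ : ℝ} {C : Supercycle n m}

/-- The starting point `(x, 0)`. -/
def start (p : LeafPath θ C) : UnitAddCircle := p.1.1
/-- The signed height `t`. -/
def height (p : LeafPath θ C) : ℝ := p.1.2.1
/-- The parameter `s` of the end point. -/
def param (p : LeafPath θ C) : UnitAddCircle := p.1.2.2

/-- Moving the end point along the line, `s ↦ s + v`; it is the
parametrisation of the component of `p` in the manifold of leafwise paths. -/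
def move (p : LeafPath θ C) (v : ℝ) : LeafPath θ C :=
  ⟨(p.start + (((n - m * θ) * v : ℝ) : UnitAddCircle), p.height + m * v,
    p.param + (v : UnitAddCircle)), by
    have h := p.2
    simp only [Supercycle.point, Prod.mk.injEq] at h ⊢
    obtain ⟨h1, h2⟩ := h
    have e1 : n • (v : UnitAddCircle) = ((n * v : ℝ) : UnitAddCircle) := by
      rw [← AddCircle.coe_zsmul, zsmul_eq_mul]
    have e2 : m • (v : UnitAddCircle) = ((m * v : ℝ) : UnitAddCircle) := by
      rw [← AddCircle.coe_zsmul, zsmul_eq_mul]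
    constructor
    · rw [param, start, height, smul_add, ← add_assoc, h1, e1, add_assoc, add_assoc,
        ← AddCircle.coe_add, ← AddCircle.coe_add]
      congr 2
      ring
    · rw [param, height, smul_add, ← add_assoc, h2, e2, ← AddCircle.coe_add]⟩

/-- The action of the foliation: the starting point moves along its leaf to the next
intersection `(x + θ, 0)` with `y = 0`, the end point is kept. -/
def next (p : LeafPath θ C) : LeafPath θ C :=
  ⟨(p.start + (θ : UnitAddCircle), p.height - 1, p.param), by
    have h := p.2
    simp only [Prod.ext_iff] at h ⊢
    obtain ⟨h1, h2⟩ := h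
    constructor
    · rw [param, h1, start, height, add_assoc, ← AddCircle.coe_add]
      congr 2
      ring
    · rw [param, h2, height, AddCircle.coe_sub, AddCircle.coe_period, sub_zero]⟩

/-- The `l`-th derivative of `f` along the manifold of leafwise paths, times `t^k`. -/
def term (k l : ℕ) (f : LeafPath θ C → ℂ) (p : LeafPath θ C) : ℂ :=
  (p.height : ℂ) ^ k * iteratedDeriv l (fun v : ℝ => f (p.move v)) 0

/-- The Schwartz space of the manifold of leafwise paths. -/
def Schwartz (θ : ℝ) (C : Supercycle n m) : Submodule ℂ (LeafPath θ C → ℂ) where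
  carrier := {f | (∀ p : LeafPath θ C, ContDiff ℝ ∞ fun v : ℝ => f (p.move v)) ∧
    ∀ k l : ℕ, ∃ B : ℝ, ∀ p, ‖term k l f p‖ ≤ B}
  zero_mem' := ⟨fun _ => contDiff_const, fun k l => ⟨0, fun p => by
    have : iteratedDeriv l (fun _ : ℝ => (0 : ℂ)) 0 = 0 := by
      rw [iteratedDeriv_const]; split_ifs <;> rfl
    simp [term, this]⟩⟩
  add_mem' {f g} hf hg := ⟨fun p => (hf.1 p).add (hg.1 p), fun k l => by
    obtain ⟨B, hB⟩ := hf.2 k l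
    obtain ⟨B', hB'⟩ := hg.2 k l
    refine ⟨B + B', fun p => ?_⟩
    have : term k l (f + g) p = term k l f p + term k l g p := by
      have h := iteratedDeriv_fun_add (n := l) (x := (0 : ℝ))
        (((hf.1 p).of_le (by exact_mod_cast le_top)).contDiffAt)
        (((hg.1 p).of_le (by exact_mod_cast le_top)).contDiffAt)
      simp only [term, Pi.add_apply, h, mul_add]
    rw [this]
    exact (norm_add_le _ _).trans (add_le_add (hB p) (hB' p))⟩
  smul_mem' c f hf := ⟨fun p => contDiff_const.mul (hf.1 p), fun k l => by
    obtain ⟨B, hB⟩ := hf.2 k l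
    refine ⟨‖c‖ * B, fun p => ?_⟩
    have : term k l (c • f) p = c * term k l f p := by
      have h := iteratedDeriv_const_mul_field (n := l) (x := (0 : ℝ)) c (fun v : ℝ => f (p.move v))
      simp only [term, Pi.smul_apply, smul_eq_mul, h]
      ring
    rw [this, norm_mul]
    exact mul_le_mul_of_nonneg_left (hB p) (norm_nonneg c)⟩

/-- The topology of the seminorms `sup_p |t^k ∂^l f|`. -/
instance : TopologicalSpace (Schwartz θ C) :=
  ⨅ (k : ℕ) (l : ℕ), TopologicalSpace.induced
    (fun f : Schwartz θ C => UniformFun.ofFun (term k l f.1)) inferInstance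

end LeafPath

/-- The holomorphic module of leafwise paths of `C` is isomorphic to `𝓔_{n,m}(θ)` with the
holomorphic structure `D`. On Schwartz functions `f` of leafwise paths `(x, t, s)`:
`U₁` acts by the foliation, `(U₁ f)(x, t, s) = f(x + θ, t - 1, s)`;
`U₂` acts by functions on the line `y = 0`, `(U₂ f)(x, t, s) = e^{2πix} f(x, t, s)`;
`∇₁ f = 2πi t f`;
`∇₂ f` is the covariant derivative for the connection of `C` at the end point, along the vector
that moves the starting point with unit speed: `∇₂ f = (n - mθ)⁻¹ (∂f/∂s + 2πi form(s) f)`;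
and the holomorphic structure is `τ∇₁ + ∇₂`. -/
def IsLeafPathModel {n m : ℤ} {θ : ℝ} {τ : ℂ} (C : Supercycle n m) (D : StdHolStructure n m θ τ) :
    Prop :=
  ∃ ψ : (basicModule n m θ).E ≃L[ℂ] LeafPath.Schwartz θ C,
    (∀ ξ p, (ψ ((basicModule n m θ).U₁ ξ)).1 p = (ψ ξ).1 p.next) ∧
    (∀ ξ p, (ψ ((basicModule n m θ).U₂ ξ)).1 p =
      (AddCircle.toCircle p.start : ℂ) * (ψ ξ).1 p) ∧
    ∀ ξ p, (ψ (D.1 ξ)).1 p =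
      τ * (2 * Real.pi * Complex.I * p.height * (ψ ξ).1 p) +
        ((n : ℂ) - m * θ)⁻¹ * (deriv (fun v : ℝ => (ψ ξ).1 (p.move v)) 0 +
          2 * Real.pi * Complex.I * C.form p.param * (ψ ξ).1 p)

/-- The operator `τ(∇₁ + 2πi r₁) + (∇₂ + 2πi r₂)` on `𝓔_{n,m}(θ)`, for the reference `∇₁, ∇₂`. -/
def translatedStructure (n m : ℤ) (θ : ℝ) (τ : ℂ) (r₁ r₂ : ℝ) :
    Module.End ℂ (basicModule n m θ).E :=
  τ • ((basicModule n m θ).nabla₁ + (2 * Real.pi * Complex.I * r₁) • LinearMap.id) +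
    ((basicModule n m θ).nabla₂ + (2 * Real.pi * Complex.I * r₂) • LinearMap.id)

end

/-! Both moduli spaces are tori `ℝ²/ℤ²`, with matching coordinates, and `Φ` is the composite of the
two identifications.

Supercycles. A line is determined by the value of `nY - mX` modulo 1 at any of its points: by
coprimality the multiples `(ns, ms)` form the whole kernel of this homomorphism on the torus. A flat
connection on a given line is determined up to gauge by `∫ h` modulo 1. A section with constant
connections shows that the resulting bijection is a homeomorphism (`Supercycle.exists_homeomorph`).

Holomorphic structures. The commutant of `U₁, U₂` on the basic module is again a noncommutative
torus, consisting of the operators `ρ(a) = ∑ a_q W_q` with `a` rapidly decreasing, and the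
commutator with the reference connection acts on it as `κδ₁, κδ₂` with `κ = ±1/(n - mθ)`.
`CommutantModel` collects these facts. For `m = 0` they are elementary, since `A_θ` acts on itself
from the other side. For `m ≠ 0` they rest on Poisson summation in the form of the duality
`IsDual.series_coeff` and on an explicit finite frame.

A standard connection differs from the reference one by skew elements of the commutant
(`exists_symbol`). Since the curvatures agree, the operators `D_k = κδ_k + a_k` on rapidly
decreasing sequences commute. The analytic core is `exists_joint_eigenvector`: with `P = D₁ + iD₂`,
an elliptic operator, `P*P` has a nonzero finite dimensional eigenspace of rapidly decreasing
sequences, and the commuting operators `D₁, D₂` preserve it. If `u` is a joint eigenvector, then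
`u*u` is killed by the derivations, so it is a scalar. A trace argument shows that `uu*` is the same
scalar, so a multiple of `u` is unitary and carries the connection to a translate of the reference
connection by real constants `(r₁, r₂)`.

Two translates are conjugate exactly when they differ by `κℤ²`: the `W_q` realise these shifts, and
conversely any intertwiner is a series in the `W_q`, each term of which obeys a scalar equation `τx
+ y = 0` with `x, y` real; here `Im τ ≠ 0` is used. Thus the moduli space is a torus as a set. That
the class depends continuously on the structure under pointwise convergence is `eventually_close`:
testing on the finitely many gauge-transformed frame vectors already controls an `ℓ²` norm in the
commutant, and this norm bounds the distance of the parameters modulo the lattice.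

Leafwise paths. By part 1 the manifold of paths is a copy of `ℝ × ℤ/m` if `m ≠ 0`, and of `ℤ × ℝ/ℤ`
if `m = 0`. In these coordinates, after Fourier expansion in the second case, `U₁` and `U₂` become
the operators of the basic module, and the heights carry the offset `r₁`. A gauge transformation
replaces `h` by its mean value, which gives `r₂`. Hence the module of `(𝓛, A)` is the translate with
`(n - mθ)(r₁, r₂) = (nY - mX, ∫ h)`, and this is the coordinate used for supercycles. -/

noncomputable section

/-! ## Rapidly decreasing sequences on `ℤ²` -/

open FreeModule

/-- Rapidly decreasing families on `ℤ²`. -/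
abbrev RapidSeq : Type := FreeModule.Space

namespace FreeModule

theorem weight_pos (p : ℤ × ℤ) : 0 < weight p := zero_lt_one.trans_le (one_le_weight p)

theorem weight_nonneg (p : ℤ × ℤ) : 0 ≤ weight p := (weight_pos p).le

theorem weight_pow_nonneg (p : ℤ × ℤ) (k : ℕ) : 0 ≤ weight p ^ k := pow_nonneg (weight_nonneg p) k

theorem weight_neg (p : ℤ × ℤ) : weight (-p) = weight p := by simp [weight]

theorem weight_pow_le (p q : ℤ × ℤ) (k : ℕ) :
    weight p ^ k ≤ weight q ^ k * weight (p - q) ^ k := by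
  rw [← mul_pow]
  exact pow_le_pow_left₀ (weight_nonneg p) (weight_le p q) k

theorem abs_fst_le_weight (p : ℤ × ℤ) : |(p.1 : ℝ)| ≤ weight p := by
  unfold weight; linarith [abs_nonneg (p.2 : ℝ)]

theorem abs_snd_le_weight (p : ℤ × ℤ) : |(p.2 : ℝ)| ≤ weight p := by
  unfold weight; linarith [abs_nonneg (p.1 : ℝ)]

theorem summable_inv_one_add_abs_sq : Summable fun i : ℤ => ((1 + |(i : ℝ)|) ^ 2)⁻¹ := by
  have h : Summable fun i : ℤ => 1 / (i : ℝ) ^ 2 :=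
    Real.summable_one_div_int_pow.mpr one_lt_two
  have h0 : Summable fun i : ℤ => (if i = 0 then (1 : ℝ) else 0) :=
    summable_of_ne_finset_zero (s := {0}) (fun b hb => by simpa using hb)
  refine Summable.of_nonneg_of_le (fun i => by positivity) (fun i => ?_) (h0.add h)
  rcases eq_or_ne i 0 with rfl | hi
  · simp
  · have hi' : 0 < |(i : ℝ)| := abs_pos.mpr (by exact_mod_cast hi)
    rw [if_neg hi, zero_add, one_div, ← sq_abs (i : ℝ)]
    exact inv_anti₀ (by positivity) (pow_le_pow_left₀ hi'.le (by linarith) 2)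

/-- The weight dominates `1 + |p₁|` and `1 + |p₂|` separately, so its fourth power dominates the
product of the two squares, and the double series factors. -/
theorem summable_inv_weight_pow_four : Summable fun p : ℤ × ℤ => (weight p ^ 4)⁻¹ := by
  have h := summable_inv_one_add_abs_sq.mul_of_nonneg summable_inv_one_add_abs_sq
    (fun i => by positivity) (fun i => by positivity)
  refine Summable.of_nonneg_of_le (fun p => inv_nonneg.mpr (weight_pow_nonneg p 4))
    (fun p => ?_) h
  rw [← mul_inv]
  have h1 : (1 + |(p.1 : ℝ)|) ≤ weight p := by unfold weight; linarith [abs_nonneg (p.2 : ℝ)]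
  have h2 : (1 + |(p.2 : ℝ)|) ≤ weight p := by unfold weight; linarith [abs_nonneg (p.1 : ℝ)]
  gcongr
  calc (1 + |(p.1 : ℝ)|) ^ 2 * (1 + |(p.2 : ℝ)|) ^ 2 ≤ weight p ^ 2 * weight p ^ 2 := by gcongr
    _ = weight p ^ 4 := by ring

theorem summable_of_weight_bound {u : ℤ × ℤ → ℝ} (hu : ∀ p, 0 ≤ u p) {C : ℝ}
    (h : ∀ p, weight p ^ 4 * u p ≤ C) : Summable u := by
  refine Summable.of_nonneg_of_le hu (fun p => ?_) (summable_inv_weight_pow_four.mul_left C)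
  rw [← div_eq_mul_inv, le_div_iff₀ (pow_pos (weight_pos p) 4), mul_comm]
  exact h p

end FreeModule

namespace RapidSeq

theorem summable_weight_mul (a : RapidSeq) (k : ℕ) :
    Summable fun p => weight p ^ k * ‖a.1 p‖ := by
  obtain ⟨C, hC⟩ := a.2 (k + 4)
  refine summable_of_weight_bound (C := C) (fun p => mul_nonneg (weight_pow_nonneg p k)
    (norm_nonneg _)) (fun p => ?_)
  refine le_trans (le_of_eq ?_) (hC p)
  ring

theorem summable_norm (a : RapidSeq) : Summable fun p => ‖a.1 p‖ := by
  simpa using summable_weight_mul a 0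

theorem summable_mul_of_bounded (a : RapidSeq) {F : ℤ × ℤ → ℂ} {C : ℝ} (hF : ∀ p, ‖F p‖ ≤ C) :
    Summable fun p => a.1 p * F p := by
  refine Summable.of_norm_bounded (g := fun p => ‖a.1 p‖ * C) ((summable_norm a).mul_right C)
    (fun p => ?_)
  rw [norm_mul]
  exact mul_le_mul_of_nonneg_left (hF p) (norm_nonneg _)

theorem exists_bound (a : RapidSeq) : ∃ C : ℝ, ∀ p, ‖a.1 p‖ ≤ C := by
  simpa using a.2 0

/-- The sequence supported at `q`, with value one. -/
def single (q : ℤ × ℤ) : RapidSeq := ⟨Pi.single q 1, fun k => ⟨weight q ^ k, fun p => by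
  rcases eq_or_ne p q with rfl | h
  · simp
  · simpa [h] using weight_pow_nonneg q k⟩⟩

theorem single_apply (q p : ℤ × ℤ) : (single q).1 p = if p = q then 1 else 0 := by
  simp [single, Pi.single_apply]

end RapidSeq

/-! ### Twisted convolution -/

/-- The bicharacter `e^{-2πi ϑ p₁ q₂}` on `ℤ²`. -/
def twist (ϑ : ℝ) (p q : ℤ × ℤ) : ℂ :=
  Complex.exp (((-(2 * Real.pi * ϑ * p.1 * q.2) : ℝ) : ℂ) * Complex.I)

theorem norm_twist (ϑ : ℝ) (p q : ℤ × ℤ) : ‖twist ϑ p q‖ = 1 := Complex.norm_exp_ofReal_mul_I _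

theorem twist_ne_zero (ϑ : ℝ) (p q : ℤ × ℤ) : twist ϑ p q ≠ 0 := Complex.exp_ne_zero _

theorem twist_add_left (ϑ : ℝ) (p p' q : ℤ × ℤ) :
    twist ϑ (p + p') q = twist ϑ p q * twist ϑ p' q := by
  unfold twist; rw [← Complex.exp_add]; congr 1; push_cast [Prod.fst_add]; ring

theorem twist_add_right (ϑ : ℝ) (p q q' : ℤ × ℤ) :
    twist ϑ p (q + q') = twist ϑ p q * twist ϑ p q' := by
  unfold twist; rw [← Complex.exp_add]; congr 1; push_cast [Prod.snd_add]; ring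

theorem conj_twist (ϑ : ℝ) (p q : ℤ × ℤ) : conj (twist ϑ p q) = twist ϑ (-p) q := by
  unfold twist; rw [← Complex.exp_conj]; congr 1; simp [Complex.conj_ofNat]

theorem twist_neg_right (ϑ : ℝ) (p q : ℤ × ℤ) : twist ϑ p (-q) = twist ϑ (-p) q := by
  unfold twist; congr 1; simp

theorem twist_zero_left (ϑ : ℝ) (q : ℤ × ℤ) : twist ϑ 0 q = 1 := by simp [twist]

theorem twist_zero_right (ϑ : ℝ) (q : ℤ × ℤ) : twist ϑ q 0 = 1 := by simp [twist]

theorem twist_mul_twist_neg (ϑ : ℝ) (p q : ℤ × ℤ) : twist ϑ p q * twist ϑ (-p) q = 1 := by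
  rw [← twist_add_left, add_neg_cancel, twist_zero_left]

/-- Twisted convolution of a rapidly decreasing sequence with an arbitrary one. -/
def convFun (ϑ : ℝ) (a : RapidSeq) (v : ℤ × ℤ → ℂ) (p : ℤ × ℤ) : ℂ :=
  ∑' q, a.1 q * (twist ϑ q (p - q) * v (p - q))

theorem summable_convFun (ϑ : ℝ) (a : RapidSeq) {v : ℤ × ℤ → ℂ} {C : ℝ} (hv : ∀ p, ‖v p‖ ≤ C)
    (p : ℤ × ℤ) : Summable fun q => a.1 q * (twist ϑ q (p - q) * v (p - q)) :=
  RapidSeq.summable_mul_of_bounded a (C := C) fun q => by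
    rw [norm_mul, norm_twist, one_mul]; exact hv _

/-- The weight is submultiplicative, so `weight p ^ k` splits over the two factors of the
convolution. Only a weighted bound on `v` is needed, not membership in `RapidSeq`; the bootstrap for
`ℓ²` solutions depends on this. -/
theorem weight_mul_convFun_le (ϑ : ℝ) (a : RapidSeq) {v : ℤ × ℤ → ℂ} (k : ℕ) {C : ℝ}
    (hv : ∀ p, weight p ^ k * ‖v p‖ ≤ C) (p : ℤ × ℤ) :
    weight p ^ k * ‖convFun ϑ a v p‖ ≤ (∑' q, weight q ^ k * ‖a.1 q‖) * C := by
  have hs := (RapidSeq.summable_weight_mul a k).mul_right C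
  have hb : ∀ q, weight p ^ k * ‖a.1 q * (twist ϑ q (p - q) * v (p - q))‖
      ≤ weight q ^ k * ‖a.1 q‖ * C := fun q => by
    rw [norm_mul, norm_mul, norm_twist, one_mul]
    calc weight p ^ k * (‖a.1 q‖ * ‖v (p - q)‖)
        ≤ (weight q ^ k * weight (p - q) ^ k) * (‖a.1 q‖ * ‖v (p - q)‖) := by
          gcongr; exact weight_pow_le p q k
      _ = weight q ^ k * ‖a.1 q‖ * (weight (p - q) ^ k * ‖v (p - q)‖) := by ring
      _ ≤ weight q ^ k * ‖a.1 q‖ * C := by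
          gcongr
          · exact mul_nonneg (weight_pow_nonneg q k) (norm_nonneg _)
          · exact hv _
  have hw := weight_pow_nonneg p k
  have h := tsum_of_norm_bounded (f := fun q => (weight p ^ k : ℂ) *
    (a.1 q * (twist ϑ q (p - q) * v (p - q)))) hs.hasSum (fun q => by
      rw [norm_mul, norm_pow, Complex.norm_real, Real.norm_of_nonneg (weight_nonneg p)]
      exact hb q)
  rw [tsum_mul_left, tsum_mul_right, norm_mul, norm_pow, Complex.norm_real,
    Real.norm_of_nonneg (weight_nonneg p)] at h
  exact h

theorem convFun_add (ϑ : ℝ) (a : RapidSeq) {u v : ℤ × ℤ → ℂ} {C C' : ℝ} (hu : ∀ p, ‖u p‖ ≤ C)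
    (hv : ∀ p, ‖v p‖ ≤ C') (p : ℤ × ℤ) :
    convFun ϑ a (fun p => u p + v p) p = convFun ϑ a u p + convFun ϑ a v p := by
  unfold convFun
  rw [← (summable_convFun ϑ a hu p).tsum_add (summable_convFun ϑ a hv p)]
  exact tsum_congr fun q => by ring

theorem convFun_smul (ϑ : ℝ) (a : RapidSeq) (c : ℂ) (v : ℤ × ℤ → ℂ) (p : ℤ × ℤ) :
    convFun ϑ a (fun p => c * v p) p = c * convFun ϑ a v p := by
  unfold convFun
  rw [← tsum_mul_left]
  exact tsum_congr fun q => by ring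

namespace RapidSeq

/-- Twisted convolution with `a` from the left. -/
def conv (ϑ : ℝ) (a : RapidSeq) : RapidSeq →ₗ[ℂ] RapidSeq where
  toFun b := ⟨convFun ϑ a b.1, fun k => by
    obtain ⟨C, hC⟩ := b.2 k
    exact ⟨_, weight_mul_convFun_le ϑ a k hC⟩⟩
  map_add' b c := by
    obtain ⟨C, hC⟩ := exists_bound b
    obtain ⟨C', hC'⟩ := exists_bound c
    ext p
    exact convFun_add ϑ a hC hC' p
  map_smul' c b := by
    ext p
    exact convFun_smul ϑ a c b.1 p

theorem conv_apply (ϑ : ℝ) (a b : RapidSeq) (p : ℤ × ℤ) :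
    (conv ϑ a b).1 p = ∑' q, a.1 q * (twist ϑ q (p - q) * b.1 (p - q)) := rfl

/-- The adjoint sequence for twisted convolution. -/
def adj (ϑ : ℝ) (a : RapidSeq) : RapidSeq :=
  ⟨fun p => conj (a.1 (-p)) * twist ϑ p p, fun k => by
    obtain ⟨C, hC⟩ := a.2 k
    refine ⟨C, fun p => ?_⟩
    rw [norm_mul, norm_twist, mul_one, RCLike.norm_conj, ← weight_neg]
    exact hC _⟩

theorem adj_apply (ϑ : ℝ) (a : RapidSeq) (p : ℤ × ℤ) :
    (adj ϑ a).1 p = conj (a.1 (-p)) * twist ϑ p p := rfl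

theorem adj_adj (ϑ : ℝ) (a : RapidSeq) : adj ϑ (adj ϑ a) = a := by
  ext p
  simp only [adj_apply, map_mul, Complex.conj_conj, neg_neg, conj_twist]
  rw [twist_neg_right, mul_assoc, mul_comm (twist ϑ (-p) p), twist_mul_twist_neg, mul_one]

/-- Fubini and the substitution `r = p + q`. With `F r = ⟨ξ, W_r η⟩` this becomes the
multiplicativity of `ρ`. -/
theorem tsum_conv (ϑ : ℝ) (a b : RapidSeq) {F : ℤ × ℤ → ℂ} {C : ℝ} (hF : ∀ p, ‖F p‖ ≤ C) :
    ∑' p, a.1 p * ∑' q, b.1 q * (twist ϑ p q * F (p + q)) = ∑' r, (conv ϑ a b).1 r * F r := by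
  have hab : Summable fun x : (ℤ × ℤ) × (ℤ × ℤ) => ‖a.1 x.1‖ * ‖b.1 x.2‖ :=
    (summable_norm a).mul_of_nonneg (summable_norm b) (fun _ => norm_nonneg _)
      (fun _ => norm_nonneg _)
  have hs : Summable fun x : (ℤ × ℤ) × (ℤ × ℤ) =>
      a.1 x.1 * (b.1 x.2 * (twist ϑ x.1 x.2 * F (x.1 + x.2))) := by
    refine Summable.of_norm_bounded (hab.mul_right C) (fun x => ?_)
    rw [norm_mul, norm_mul, norm_mul, norm_twist, one_mul, ← mul_assoc]
    exact mul_le_mul_of_nonneg_left (hF _) (by positivity)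
  let e : (ℤ × ℤ) × (ℤ × ℤ) ≃ (ℤ × ℤ) × (ℤ × ℤ) :=
    { toFun := fun x => (x.2, x.1 - x.2)
      invFun := fun y => (y.1 + y.2, y.1)
      left_inv := fun x => by simp
      right_inv := fun y => by simp }
  have he : Summable fun x : (ℤ × ℤ) × (ℤ × ℤ) =>
      a.1 x.2 * (b.1 (x.1 - x.2) * (twist ϑ x.2 (x.1 - x.2) * F x.1)) := by
    have h := hs.comp_injective e.injective
    refine h.congr fun x => ?_
    simp [e]
  calc ∑' p, a.1 p * ∑' q, b.1 q * (twist ϑ p q * F (p + q))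
      = ∑' p, ∑' q, a.1 p * (b.1 q * (twist ϑ p q * F (p + q))) :=
        tsum_congr fun p => tsum_mul_left.symm
    _ = ∑' x : (ℤ × ℤ) × (ℤ × ℤ), a.1 x.1 * (b.1 x.2 * (twist ϑ x.1 x.2 * F (x.1 + x.2))) :=
        hs.tsum_prod.symm
    _ = ∑' x : (ℤ × ℤ) × (ℤ × ℤ),
        a.1 x.2 * (b.1 (x.1 - x.2) * (twist ϑ x.2 (x.1 - x.2) * F x.1)) := by
        rw [← e.tsum_eq]
        exact tsum_congr fun x => by simp [e]
    _ = ∑' r, ∑' q, a.1 q * (b.1 (r - q) * (twist ϑ q (r - q) * F r)) := he.tsum_prod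
    _ = _ := by
        refine tsum_congr fun r => ?_
        rw [conv_apply, ← tsum_mul_right]
        exact tsum_congr fun q => by ring

theorem conv_single_zero (ϑ : ℝ) (b : RapidSeq) : conv ϑ (single 0) b = b := by
  ext p
  rw [conv_apply, tsum_eq_single 0 (fun q hq => by simp [single_apply, hq])]
  simp [single_apply, twist_zero_left]

/-- The coefficient at zero is the canonical trace of the noncommutative torus. Its positivity here,
and the same value for `a a*` below, are what later make `ρ` faithful and isometries unitary. -/
theorem conv_adj_self_zero (ϑ : ℝ) (a : RapidSeq) :
    (conv ϑ (adj ϑ a) a).1 0 = ((∑' p, ‖a.1 p‖ ^ 2 : ℝ) : ℂ) := by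
  rw [conv_apply, Complex.ofReal_tsum, ← (Equiv.neg (ℤ × ℤ)).tsum_eq]
  refine tsum_congr fun p => ?_
  simp only [adj_apply, Equiv.neg_apply, neg_neg, zero_sub]
  rw [twist_neg_right]
  have h := twist_mul_twist_neg ϑ (-p) p
  rw [neg_neg] at h
  have h1 : conj (a.1 p) * a.1 p = ((‖a.1 p‖ ^ 2 : ℝ) : ℂ) := by
    rw [Complex.conj_mul']; norm_cast
  rw [neg_neg]
  linear_combination (conj (a.1 p) * a.1 p) * h + h1

theorem conv_self_adj_zero (ϑ : ℝ) (a : RapidSeq) :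
    (conv ϑ a (adj ϑ a)).1 0 = ((∑' p, ‖a.1 p‖ ^ 2 : ℝ) : ℂ) := by
  rw [conv_apply, Complex.ofReal_tsum]
  refine tsum_congr fun p => ?_
  simp only [adj_apply, zero_sub, neg_neg]
  rw [twist_neg_right ϑ (-p) p, twist_neg_right, neg_neg]
  have h := twist_mul_twist_neg ϑ p p
  have h1 : conj (a.1 p) * a.1 p = ((‖a.1 p‖ ^ 2 : ℝ) : ℂ) := by
    rw [Complex.conj_mul']; norm_cast
  linear_combination (conj (a.1 p) * a.1 p) * h + h1

theorem summable_norm_sq (a : RapidSeq) : Summable fun p => ‖a.1 p‖ ^ 2 := by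
  obtain ⟨C, hC⟩ := exists_bound a
  refine Summable.of_nonneg_of_le (fun p => by positivity) (fun p => ?_)
    ((summable_norm a).mul_left C)
  rw [sq]
  exact mul_le_mul_of_nonneg_right (hC p) (norm_nonneg _)

end RapidSeq

end

noncomputable section

open FreeModule RapidSeq

/-! ## Elliptic theory on `ℓ²(ℤ²)` -/

/-- The Hilbert space `ℓ²(ℤ²)`. -/
abbrev SqSum : Type := lp (fun _ : ℤ × ℤ => ℂ) 2

namespace SqSum

theorem sum_sq_le (v : SqSum) (s : Finset (ℤ × ℤ)) : ∑ p ∈ s, ‖v p‖ ^ 2 ≤ ‖v‖ ^ 2 := by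
  have h := lp.sum_rpow_le_norm_rpow (p := 2) (by norm_num) v s
  simpa using h

theorem memLp_of_sum_sq_le {f : ℤ × ℤ → ℂ} {C : ℝ} (h : ∀ s : Finset (ℤ × ℤ),
    ∑ p ∈ s, ‖f p‖ ^ 2 ≤ C) : Memℓp f 2 :=
  memℓp_gen' (C := C) fun s => by simpa using h s

/-- A bounded operator on `ℓ²(ℤ²)` given by its action on coordinates. -/
def operator (T : SqSum →ₗ[ℂ] (ℤ × ℤ → ℂ)) (C : ℝ) (hC : 0 ≤ C)
    (h : ∀ v (s : Finset (ℤ × ℤ)), ∑ p ∈ s, ‖T v p‖ ^ 2 ≤ (C * ‖v‖) ^ 2) : SqSum →L[ℂ] SqSum :=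
  LinearMap.mkContinuous
    { toFun := fun v => ⟨T v, memLp_of_sum_sq_le (h v)⟩
      map_add' := fun v w => by ext p; exact congrFun (map_add T v w) p
      map_smul' := fun c v => by ext p; exact congrFun (map_smul T c v) p } C
    (fun v => lp.norm_le_of_forall_sum_le (p := 2) (by norm_num) (by positivity)
      (fun s => by simpa using h v s))

theorem norm_operator_le (T : SqSum →ₗ[ℂ] (ℤ × ℤ → ℂ)) (C : ℝ) (hC : 0 ≤ C)
    (h : ∀ v (s : Finset (ℤ × ℤ)), ∑ p ∈ s, ‖T v p‖ ^ 2 ≤ (C * ‖v‖) ^ 2) :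
    ‖operator T C hC h‖ ≤ C := LinearMap.mkContinuous_norm_le _ hC _

/-- Multiplication by a bounded sequence. -/
def multiplier (m : ℤ × ℤ → ℂ) (C : ℝ) (hm : ∀ p, ‖m p‖ ≤ C) : SqSum →L[ℂ] SqSum :=
  operator
    { toFun := fun v p => m p * v p
      map_add' := fun v w => by ext p; simp [mul_add]
      map_smul' := fun c v => by ext p; simp [mul_left_comm] } C
    ((norm_nonneg _).trans (hm 0)) (fun v s => by
      calc ∑ p ∈ s, ‖m p * v p‖ ^ 2 ≤ ∑ p ∈ s, C ^ 2 * ‖v p‖ ^ 2 := by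
            refine Finset.sum_le_sum fun p _ => ?_
            rw [norm_mul, mul_pow]
            gcongr
            exact hm p
        _ = C ^ 2 * ∑ p ∈ s, ‖v p‖ ^ 2 := by rw [Finset.mul_sum]
        _ ≤ C ^ 2 * ‖v‖ ^ 2 := by gcongr; exact sum_sq_le v s
        _ = (C * ‖v‖) ^ 2 := by ring)

theorem multiplier_apply (m : ℤ × ℤ → ℂ) (C : ℝ) (hm : ∀ p, ‖m p‖ ≤ C) (v : SqSum) (p : ℤ × ℤ) :
    multiplier m C hm v p = m p * v p := rfl

theorem inner_multiplier (m : ℤ × ℤ → ℂ) (C : ℝ) (hm : ∀ p, ‖m p‖ ≤ C) (v w : SqSum) :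
    inner ℂ (multiplier m C hm v) w =
      inner ℂ v (multiplier (fun p => conj (m p)) C (fun p => by simpa using hm p) w) := by
  rw [lp.inner_eq_tsum, lp.inner_eq_tsum]
  refine tsum_congr fun p => ?_
  simp only [multiplier_apply, RCLike.inner_apply, map_mul]
  ring

/-- The rank one operator `v ↦ c v(q) e_q`. -/
theorem isCompactOperator_coordinate (q : ℤ × ℤ) (c : ℂ) :
    IsCompactOperator
      ((lp.singleContinuousLinearMap ℂ (fun _ : ℤ × ℤ => ℂ) 2 q ∘L (c • lp.evalCLM ℂ (fun _ : ℤ × ℤ => ℂ) 2 q) :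
        SqSum →L[ℂ] SqSum)) := by
  have h : IsCompactOperator (lp.singleContinuousLinearMap ℂ (fun _ : ℤ × ℤ => ℂ) 2 q) :=
    isCompactOperator_of_locallyCompactSpace_rng _
  exact h.comp_clm (c • lp.evalCLM ℂ (fun _ : ℤ × ℤ => ℂ) 2 q)

/-- The operator is a norm limit of its finite rank truncations: outside a finite set of frequencies
the multiplier is small, and the supremum of a multiplier bounds the operator norm. -/
theorem isCompactOperator_multiplier (m : ℤ × ℤ → ℂ) (C : ℝ) (hm : ∀ p, ‖m p‖ ≤ C)
    (h0 : Filter.Tendsto m Filter.cofinite (nhds 0)) : IsCompactOperator (multiplier m C hm) := by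
  let F : Finset (ℤ × ℤ) → SqSum →L[ℂ] SqSum := fun s => ∑ q ∈ s,
    (lp.singleContinuousLinearMap ℂ (fun _ : ℤ × ℤ => ℂ) 2 q ∘L (m q • lp.evalCLM ℂ (fun _ : ℤ × ℤ => ℂ) 2 q))
  have hF : ∀ s v p, F s v p = if p ∈ s then m p * v p else 0 := fun s v p => by
    simp only [F, sum_apply, lp.coeFn_sum, Finset.sum_apply,
      ContinuousLinearMap.comp_apply]
    simp [lp.evalCLM, lp.single_apply, Pi.single_apply]
  refine isCompactOperator_of_tendsto (l := Filter.atTop) (F := F) ?_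
    (Filter.Eventually.of_forall fun s => ?_)
  · rw [Metric.tendsto_atTop]
    intro ε hε
    have hfin : {p | ¬ ‖m p‖ < ε / 2}.Finite := by
      have := (Metric.tendsto_nhds.mp h0) (ε / 2) (by positivity)
      simpa [Filter.eventually_cofinite] using this
    refine ⟨hfin.toFinset, fun s hs => ?_⟩
    rw [dist_eq_norm]
    refine lt_of_le_of_lt (ContinuousLinearMap.opNorm_le_bound _ (by positivity : 0 ≤ ε / 2)
      fun v => ?_) (by linarith)
    refine lp.norm_le_of_forall_sum_le (p := 2) (by norm_num) (by positivity) (fun t => ?_)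
    simp only [ENNReal.toReal_ofNat, Real.rpow_ofNat]
    calc ∑ p ∈ t, ‖((F s - multiplier m C hm) v : SqSum) p‖ ^ 2
        ≤ ∑ p ∈ t, (ε / 2) ^ 2 * ‖v p‖ ^ 2 := by
          refine Finset.sum_le_sum fun p _ => ?_
          rw [← mul_pow]
          refine pow_le_pow_left₀ (norm_nonneg _) ?_ 2
          rw [sub_apply, lp.coeFn_sub, Pi.sub_apply, hF, multiplier_apply]
          split_ifs with hp
          · simp only [sub_self, norm_zero]; positivity
          · rw [zero_sub, norm_neg, norm_mul]
            have : ‖m p‖ < ε / 2 := by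
              by_contra hcon
              exact hp (hs (by simpa using hcon))
            gcongr
      _ = (ε / 2) ^ 2 * ∑ p ∈ t, ‖v p‖ ^ 2 := by rw [Finset.mul_sum]
      _ ≤ (ε / 2) ^ 2 * ‖v‖ ^ 2 := by gcongr; exact sum_sq_le v t
      _ = (ε / 2 * ‖v‖) ^ 2 := by ring
  · simp only [F]
    refine (compactOperator (RingHom.id ℂ) SqSum SqSum).sum_mem fun q _ => ?_
    exact isCompactOperator_coordinate q (m q)

/-- The twisted shift by `q`. -/
def shift (ϑ : ℝ) (q : ℤ × ℤ) : SqSum →L[ℂ] SqSum :=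
  operator
    { toFun := fun v p => twist ϑ q (p - q) * v (p - q)
      map_add' := fun v w => by ext p; simp [mul_add]
      map_smul' := fun c v => by ext p; simp [mul_left_comm] } 1 zero_le_one (fun v s => by
      calc ∑ p ∈ s, ‖twist ϑ q (p - q) * v (p - q)‖ ^ 2
          = ∑ p ∈ s.map (Equiv.subRight q).toEmbedding, ‖v p‖ ^ 2 := by
            rw [Finset.sum_map]
            refine Finset.sum_congr rfl fun p _ => ?_
            rw [norm_mul, norm_twist, one_mul]; rfl
        _ ≤ (1 * ‖v‖) ^ 2 := by rw [one_mul]; exact sum_sq_le v _)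

theorem shift_apply (ϑ : ℝ) (q : ℤ × ℤ) (v : SqSum) (p : ℤ × ℤ) :
    shift ϑ q v p = twist ϑ q (p - q) * v (p - q) := rfl

/-- The adjoint of a twisted shift is the opposite shift up to the value of the bicharacter at `(q,
q)`; this scalar is the reason for the factor `twist ϑ p p` in `adj`. -/
theorem inner_shift (ϑ : ℝ) (q : ℤ × ℤ) (v w : SqSum) :
    inner ℂ (shift ϑ q v) w = twist ϑ q q * inner ℂ v (shift ϑ (-q) w) := by
  rw [lp.inner_eq_tsum, lp.inner_eq_tsum, ← tsum_mul_left, ← (Equiv.addRight q).tsum_eq]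
  refine tsum_congr fun p => ?_
  simp only [shift_apply, RCLike.inner_apply, map_mul, Equiv.coe_addRight, add_sub_cancel_right,
    sub_neg_eq_add, conj_twist, twist_add_right]
  linear_combination (-(w (p + q) * twist ϑ (-q) p * conj (v p))) * twist_mul_twist_neg ϑ q q

/-- Twisted convolution with a rapidly decreasing sequence. -/
def convOp (ϑ : ℝ) (a : RapidSeq) : SqSum →L[ℂ] SqSum := ∑' q, a.1 q • shift ϑ q

theorem hasSum_convOp (ϑ : ℝ) (a : RapidSeq) :
    HasSum (fun q => a.1 q • shift ϑ q) (convOp ϑ a) := by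
  refine Summable.hasSum (Summable.of_norm_bounded (summable_norm a) fun q => ?_)
  rw [norm_smul]
  exact mul_le_of_le_one_right (norm_nonneg _) (norm_operator_le _ _ _ _)

theorem hasSum_convOp_apply (ϑ : ℝ) (a : RapidSeq) (v : SqSum) :
    HasSum (fun q => a.1 q • shift ϑ q v) (convOp ϑ a v) := by
  simpa using (hasSum_convOp ϑ a).mapL (ContinuousLinearMap.apply ℂ SqSum v)

theorem convOp_apply (ϑ : ℝ) (a : RapidSeq) (v : SqSum) (p : ℤ × ℤ) :
    convOp ϑ a v p = convFun ϑ a v p := by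
  have h := (hasSum_convOp_apply ϑ a v).mapL (lp.evalCLM ℂ (fun _ : ℤ × ℤ => ℂ) 2 p)
  exact h.tsum_eq.symm

theorem inner_convOp (ϑ : ℝ) (a : RapidSeq) (v w : SqSum) :
    inner ℂ (convOp ϑ a v) w = inner ℂ v (convOp ϑ (adj ϑ a) w) := by
  have h1 := (hasSum_convOp_apply ϑ a v).mapL (innerSL ℂ w)
  have h2 := (hasSum_convOp_apply ϑ (adj ϑ a) w).mapL (innerSL ℂ v)
  have h3 := h1.map (starRingEnd ℂ) Complex.continuous_conj
  simp only [innerSL_apply_apply, inner_conj_symm] at h3 h2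
  rw [← (Equiv.neg (ℤ × ℤ)).hasSum_iff] at h2
  refine h3.unique (h2.congr_fun fun q => ?_)
  simp only [Function.comp_apply, Equiv.neg_apply, inner_smul_right, adj_apply, neg_neg, map_mul,
    inner_conj_symm, inner_shift]
  rw [twist_neg_right, neg_neg]
  ring

/-- Rapidly decreasing sequences are square summable. -/
def ofRapid : RapidSeq →ₗ[ℂ] SqSum where
  toFun a := ⟨a.1, memLp_of_sum_sq_le fun s =>
    (summable_norm_sq a).sum_le_tsum s (fun p _ => by positivity)⟩
  map_add' a b := rfl
  map_smul' c a := rfl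

theorem ofRapid_apply (a : RapidSeq) (p : ℤ × ℤ) : ofRapid a p = a.1 p := rfl

theorem ofRapid_injective : Function.Injective ofRapid := fun a b h => by
  ext p
  exact congrArg (fun v : SqSum => v p) h

theorem convOp_ofRapid (ϑ : ℝ) (a b : RapidSeq) :
    convOp ϑ a (ofRapid b) = ofRapid (conv ϑ a b) := by
  ext p
  exact convOp_apply ϑ a _ p

end SqSum

end

noncomputable section

open FreeModule RapidSeq SqSum

/-! ### First order elliptic operators -/

/-- A multiplier of first order which is elliptic. -/
structure EllipticSymbol where
  toFun : ℤ × ℤ → ℂ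
  upper : ℝ
  lower : ℝ
  upper_nonneg : 0 ≤ upper
  lower_nonneg : 0 ≤ lower
  norm_le : ∀ p, ‖toFun p‖ ≤ upper * weight p
  weight_le : ∀ p, weight p ≤ 1 + lower * ‖toFun p‖

namespace EllipticSymbol

variable (l : EllipticSymbol)

/-- The conjugate symbol. -/
def star : EllipticSymbol where
  toFun p := conj (l.toFun p)
  upper := l.upper
  lower := l.lower
  upper_nonneg := l.upper_nonneg
  lower_nonneg := l.lower_nonneg
  norm_le p := by simpa using l.norm_le p
  weight_le p := by simpa using l.weight_le p

/-- Multiplication by the symbol. -/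
def mulSymbol : RapidSeq →ₗ[ℂ] RapidSeq where
  toFun u := ⟨fun p => l.toFun p * u.1 p, fun k => by
    obtain ⟨C, hC⟩ := u.2 (k + 1)
    refine ⟨l.upper * C, fun p => ?_⟩
    rw [norm_mul]
    calc weight p ^ k * (‖l.toFun p‖ * ‖u.1 p‖)
        ≤ weight p ^ k * (l.upper * weight p * ‖u.1 p‖) := by
          have := weight_pow_nonneg p k
          gcongr
          exact l.norm_le p
      _ = l.upper * (weight p ^ (k + 1) * ‖u.1 p‖) := by ring
      _ ≤ l.upper * C := mul_le_mul_of_nonneg_left (hC p) l.upper_nonneg⟩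
  map_add' u v := by ext p; exact mul_add _ _ _
  map_smul' c u := by ext p; exact mul_left_comm _ _ _

/-- The operator `u ↦ l u + a * u`. -/
def perturbed (ϑ : ℝ) (a : RapidSeq) : RapidSeq →ₗ[ℂ] RapidSeq := l.mulSymbol + conv ϑ a

theorem perturbed_apply (ϑ : ℝ) (a u : RapidSeq) (p : ℤ × ℤ) :
    (l.perturbed ϑ a u).1 p = l.toFun p * u.1 p + (conv ϑ a u).1 p := rfl

/-- Elliptic regularity by bootstrap. The two equations form a first order system for `v` and `d`:
decay of order `k` for both bounds the products with the symbol at order `k`, and ellipticity turns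
this into order `k + 1`. Splitting the second order equation in this way avoids commutators of the
symbol with the convolution. -/
theorem exists_weight_bound (ϑ : ℝ) (a a' : RapidSeq) (c : ℂ) {v d : ℤ × ℤ → ℂ} {C₀ : ℝ}
    (hv : ∀ p, ‖v p‖ ≤ C₀) (hd : ∀ p, ‖d p‖ ≤ C₀)
    (h1 : ∀ p, l.toFun p * v p + convFun ϑ a v p = d p)
    (h2 : ∀ p, conj (l.toFun p) * d p + convFun ϑ a' d p = c * v p) (k : ℕ) :
    ∃ C : ℝ, ∀ p, weight p ^ k * ‖v p‖ ≤ C ∧ weight p ^ k * ‖d p‖ ≤ C := by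
  induction k with
  | zero => exact ⟨C₀, fun p => by simpa using ⟨hv p, hd p⟩⟩
  | succ k ih =>
    obtain ⟨C, hC⟩ := ih
    have hcv := weight_mul_convFun_le ϑ a k (fun p => (hC p).1)
    have hcd := weight_mul_convFun_le ϑ a' k (fun p => (hC p).2)
    set K := (∑' q, weight q ^ k * ‖a.1 q‖) * C
    set K' := (∑' q, weight q ^ k * ‖a'.1 q‖) * C
    have hl := l.lower_nonneg
    -- The gain of one order, used for both equations; `z` stands for the symbol or for its
    -- conjugate, and only its modulus matters.
    have step : ∀ (z x y e : ℂ) (p : ℤ × ℤ) (X Y E : ℝ), ‖z‖ = ‖l.toFun p‖ → z * x + y = e →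
        weight p ^ k * ‖x‖ ≤ X → weight p ^ k * ‖y‖ ≤ Y → weight p ^ k * ‖e‖ ≤ E →
        weight p ^ (k + 1) * ‖x‖ ≤ X + l.lower * (E + Y) := by
      intro z x y e p X Y E hz he hx hy hE
      have hzx : ‖l.toFun p‖ * ‖x‖ ≤ ‖e‖ + ‖y‖ := by
        rw [← hz, ← norm_mul, show z * x = e - y by rw [← he]; ring]
        exact norm_sub_le _ _
      have hw := weight_pow_nonneg p k
      calc weight p ^ (k + 1) * ‖x‖ = weight p ^ k * (weight p * ‖x‖) := by ring
        _ ≤ weight p ^ k * ((1 + l.lower * ‖l.toFun p‖) * ‖x‖) := by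
          gcongr
          exact l.weight_le p
        _ = weight p ^ k * ‖x‖ + l.lower * (weight p ^ k * (‖l.toFun p‖ * ‖x‖)) := by ring
        _ ≤ weight p ^ k * ‖x‖ + l.lower * (weight p ^ k * (‖e‖ + ‖y‖)) := by gcongr
        _ = weight p ^ k * ‖x‖ + l.lower * (weight p ^ k * ‖e‖ + weight p ^ k * ‖y‖) := by ring
        _ ≤ X + l.lower * (E + Y) := by gcongr
    refine ⟨max (C + l.lower * (C + K)) (C + l.lower * (‖c‖ * C + K')), fun p => ⟨?_, ?_⟩⟩
    · exact (step (l.toFun p) (v p) _ (d p) p C K C rfl (h1 p) (hC p).1 (hcv p) (hC p).2).trans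
        (le_max_left _ _)
    · refine (step (conj (l.toFun p)) (d p) _ (c * v p) p C K' (‖c‖ * C) (by simp) (h2 p) (hC p).2
        (hcd p) ?_).trans (le_max_right _ _)
      rw [norm_mul, mul_left_comm]
      exact mul_le_mul_of_nonneg_left (hC p).1 (norm_nonneg c)

/-- Multiplication by the inverse of the weight. -/
def invWeight : SqSum →L[ℂ] SqSum :=
  multiplier (fun p => ((weight p)⁻¹ : ℝ)) 1 (fun p => by
    rw [Complex.norm_real, norm_inv, Real.norm_of_nonneg (weight_nonneg p)]
    exact inv_le_one_of_one_le₀ (one_le_weight p))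

theorem invWeight_apply (v : SqSum) (p : ℤ × ℤ) :
    invWeight v p = ((weight p)⁻¹ : ℝ) * v p := rfl

theorem inner_invWeight (v w : SqSum) : inner ℂ (invWeight v) w = inner ℂ v (invWeight w) := by
  unfold invWeight
  rw [inner_multiplier]
  simp only [Complex.conj_ofReal]

theorem isCompactOperator_invWeight : IsCompactOperator invWeight := by
  refine isCompactOperator_multiplier _ _ _ ?_
  have h := summable_inv_weight_pow_four.tendsto_cofinite_zero
  rw [tendsto_zero_iff_norm_tendsto_zero]
  have h2 : Filter.Tendsto (fun p : ℤ × ℤ => ((weight p ^ 4)⁻¹) ^ ((1 : ℝ) / 4))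
      Filter.cofinite (nhds 0) := by
    have h3 := h.rpow_const (p := (1 : ℝ) / 4) (Or.inr (by norm_num))
    simpa using h3
  refine h2.congr fun p => ?_
  rw [Complex.norm_real, norm_inv, Real.norm_of_nonneg (weight_nonneg p),
    Real.inv_rpow (weight_pow_nonneg p 4), ← Real.rpow_natCast, ← Real.rpow_mul (weight_nonneg p)]
  norm_num

/-- The bounded operator with symbol `l / weight`. -/
def normalized : SqSum →L[ℂ] SqSum :=
  multiplier (fun p => ((weight p)⁻¹ : ℝ) * l.toFun p) l.upper (fun p => by
    rw [norm_mul, Complex.norm_real, norm_inv, Real.norm_of_nonneg (weight_nonneg p),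
      inv_mul_le_iff₀ (weight_pos p), mul_comm]
    exact l.norm_le p)

theorem normalized_apply (v : SqSum) (p : ℤ × ℤ) :
    l.normalized v p = ((weight p)⁻¹ : ℝ) * l.toFun p * v p := rfl

theorem inner_normalized (v w : SqSum) :
    inner ℂ (l.normalized v) w = inner ℂ v (l.star.normalized w) := by
  unfold normalized
  rw [inner_multiplier]
  simp only [map_mul, Complex.conj_ofReal, star]

/-- The bounded operator `v ↦ (l + a *) (weight⁻¹ v)`. -/
def halfOp (ϑ : ℝ) (a : RapidSeq) : SqSum →L[ℂ] SqSum :=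
  l.normalized + convOp ϑ a ∘L invWeight

/-- The adjoint of `halfOp`. -/
def halfOpAdj (ϑ : ℝ) (a : RapidSeq) : SqSum →L[ℂ] SqSum :=
  l.star.normalized + invWeight ∘L convOp ϑ (adj ϑ a)

theorem inner_halfOp (ϑ : ℝ) (a : RapidSeq) (v w : SqSum) :
    inner ℂ (l.halfOp ϑ a v) w = inner ℂ v (l.halfOpAdj ϑ a w) := by
  simp only [halfOp, halfOpAdj, add_apply, ContinuousLinearMap.comp_apply, inner_add_left,
    inner_add_right, inner_normalized, inner_convOp, inner_invWeight]

/-- The second order operator, normalised to have order zero. -/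
def laplacian (ϑ : ℝ) (a : RapidSeq) : SqSum →L[ℂ] SqSum :=
  l.halfOpAdj ϑ a ∘L l.halfOp ϑ a + invWeight ∘L invWeight

theorem inner_laplacian (ϑ : ℝ) (a : RapidSeq) (v w : SqSum) :
    inner ℂ (l.laplacian ϑ a v) w = inner ℂ (l.halfOp ϑ a v) (l.halfOp ϑ a w) +
      inner ℂ (invWeight v) (invWeight w) := by
  have h : ∀ x y, inner ℂ (l.halfOpAdj ϑ a x) y = inner ℂ x (l.halfOp ϑ a y) := fun x y => by
    rw [← inner_conj_symm, ← inner_halfOp, inner_conj_symm]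
  simp only [laplacian, add_apply, ContinuousLinearMap.comp_apply, inner_add_left, h]
  rw [inner_invWeight (invWeight v)]

theorem inner_laplacian_symm (ϑ : ℝ) (a : RapidSeq) (v w : SqSum) :
    inner ℂ (l.laplacian ϑ a v) w = inner ℂ v (l.laplacian ϑ a w) := by
  rw [inner_laplacian, ← inner_conj_symm v, inner_laplacian, map_add, inner_conj_symm,
    inner_conj_symm]

/-- A Gårding inequality, normalised to order zero: up to the compact term `invWeight v`, the norm
of `v` is controlled by the elliptic operator. -/
theorem norm_le_halfOp (ϑ : ℝ) (a : RapidSeq) (v : SqSum) :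
    ‖v‖ ≤ l.lower * ‖l.halfOp ϑ a v‖ + (1 + l.lower * ‖convOp ϑ a‖) * ‖invWeight v‖ := by
  have hl := l.lower_nonneg
  -- Chosen so that `1 = 1/weight + m · (l/weight)`. Where `l` vanishes, ellipticity forces `weight
  -- = 1`, so the value `0` given by division by zero is the right one.
  let m : ℤ × ℤ → ℂ := fun p => ((weight p - 1 : ℝ) : ℂ) / l.toFun p
  have hm : ∀ p, ‖m p‖ ≤ l.lower := fun p => by
    have h1 : 0 ≤ weight p - 1 := by linarith [one_le_weight p]
    simp only [m]
    rw [norm_div, Complex.norm_real, Real.norm_of_nonneg h1]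
    exact div_le_of_le_mul₀ (norm_nonneg _) hl (by linarith [l.weight_le p])
  have hv : v = invWeight v + multiplier m l.lower hm (l.normalized v) := by
    ext p
    rw [lp.coeFn_add, Pi.add_apply, invWeight_apply, multiplier_apply, normalized_apply]
    have hw : ((weight p : ℝ) : ℂ) ≠ 0 := by exact_mod_cast (weight_pos p).ne'
    simp only [m]
    by_cases h : l.toFun p = 0
    · have h1 : weight p = 1 := by
        have := l.weight_le p
        rw [h, norm_zero, mul_zero, add_zero] at this
        exact le_antisymm this (one_le_weight p)
      simp [h, h1]
    · push_cast
      field_simp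
      ring
  have h2 : ‖l.normalized v‖ ≤ ‖l.halfOp ϑ a v‖ + ‖convOp ϑ a‖ * ‖invWeight v‖ := by
    have : l.normalized v = l.halfOp ϑ a v - convOp ϑ a (invWeight v) := by
      simp [halfOp]
    rw [this]
    exact (norm_sub_le _ _).trans (by gcongr; exact ContinuousLinearMap.le_opNorm _ _)
  calc ‖v‖ ≤ ‖invWeight v‖ + ‖multiplier m l.lower hm (l.normalized v)‖ := by
        conv_lhs => rw [hv]
        exact norm_add_le _ _
    _ ≤ ‖invWeight v‖ + l.lower * ‖l.normalized v‖ := by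
        gcongr
        exact (ContinuousLinearMap.le_opNorm _ _).trans
          (mul_le_mul_of_nonneg_right (norm_operator_le _ _ _ _) (norm_nonneg _))
    _ ≤ ‖invWeight v‖ + l.lower * (‖l.halfOp ϑ a v‖ + ‖convOp ϑ a‖ * ‖invWeight v‖) := by gcongr
    _ = _ := by ring

/-- The quadratic form of this operator is `‖halfOp v‖² + ‖invWeight v‖²`, which is coercive by the
Gårding inequality, so the Lax–Milgram principle applies. -/
theorem isUnit_laplacian (ϑ : ℝ) (a : RapidSeq) : IsUnit (l.laplacian ϑ a) := by
  have hl := l.lower_nonneg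
  set A := l.lower + (1 + l.lower * ‖convOp ϑ a‖)
  have hA : 0 < A := by positivity
  -- The constant comes from `‖v‖ ≤ A (x + y)` together with `(x + y)² ≤ 2 (x² + y²)`.
  refine ContinuousLinearMap.isUnit_of_forall_le_norm_inner_map _
    (c := ⟨(2 * A ^ 2)⁻¹, by positivity⟩) (show (0 : ℝ) < (2 * A ^ 2)⁻¹ by positivity) (fun v => ?_)
  have h1 : ‖v‖ ≤ A * (‖l.halfOp ϑ a v‖ + ‖invWeight v‖) := by
    refine (l.norm_le_halfOp ϑ a v).trans ?_
    have h2 : l.lower ≤ A := by simp only [A]; nlinarith [norm_nonneg (convOp ϑ a)]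
    have h3 : 1 + l.lower * ‖convOp ϑ a‖ ≤ A := by simp only [A]; linarith
    rw [mul_add]
    gcongr
  have h2 : inner ℂ (l.laplacian ϑ a v) v
      = ((‖l.halfOp ϑ a v‖ ^ 2 + ‖invWeight v‖ ^ 2 : ℝ) : ℂ) := by
    rw [inner_laplacian, inner_self_eq_norm_sq_to_K, inner_self_eq_norm_sq_to_K]
    push_cast
    rfl
  rw [h2, Complex.norm_real, Real.norm_of_nonneg (by positivity)]
  change ‖v‖ ^ 2 * (2 * A ^ 2)⁻¹ ≤ _
  rw [← div_eq_mul_inv, div_le_iff₀ (by positivity)]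
  calc ‖v‖ ^ 2 ≤ (A * (‖l.halfOp ϑ a v‖ + ‖invWeight v‖)) ^ 2 := by gcongr
    _ = A ^ 2 * (‖l.halfOp ϑ a v‖ + ‖invWeight v‖) ^ 2 := by ring
    _ ≤ A ^ 2 * (2 * (‖l.halfOp ϑ a v‖ ^ 2 + ‖invWeight v‖ ^ 2)) := by
        gcongr
        nlinarith [sq_nonneg (‖l.halfOp ϑ a v‖ - ‖invWeight v‖)]
    _ = _ := by ring

/-- With `P = l + a *`, the operator `laplacian` is `weight⁻¹ (P*P + 1) weight⁻¹`. Its inverse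
therefore yields a bounded model of the resolvent `(P*P + 1)⁻¹`, which is compact, symmetric and
nonzero. The spectral theorem gives it an eigenvalue `μ ≠ 0` with finite dimensional eigenspace, and
`μ⁻¹ - 1` is an eigenvalue of `P*P`. The two halves below transport eigenvectors in both directions.
-/
theorem exists_finiteDimensional_eigenspace (ϑ : ℝ) (a : RapidSeq) :
    ∃ c : ℂ, ∃ V : Submodule ℂ RapidSeq, FiniteDimensional ℂ V ∧ V ≠ ⊥ ∧
      ∀ u, u ∈ V ↔ l.star.perturbed ϑ (adj ϑ a) (l.perturbed ϑ a u) = c • u := by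
  obtain ⟨N, hN⟩ := l.isUnit_laplacian ϑ a
  set R : SqSum →L[ℂ] SqSum := ↑N⁻¹
  have hNR : ∀ v, l.laplacian ϑ a (R v) = v := fun v => by
    rw [← hN, ← mul_apply_eq_comp, Units.mul_inv, one_apply_eq_self]
  have hRN : ∀ v, R (l.laplacian ϑ a v) = v := fun v => by
    rw [← hN, ← mul_apply_eq_comp, Units.inv_mul, one_apply_eq_self]
  -- This is the resolvent `(P*P + 1)⁻¹`; compactness is inherited from `invWeight`.
  let G : SqSum →L[ℂ] SqSum := invWeight ∘L R ∘L invWeight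
  have hGc : IsCompactOperator G :=
    isCompactOperator_invWeight.comp_clm (R ∘L invWeight)
  have hGs : G.IsSymmetric := fun v w => by
    change inner ℂ (invWeight (R (invWeight v))) w = inner ℂ v (invWeight (R (invWeight w)))
    rw [inner_invWeight, ← inner_invWeight v]
    calc inner ℂ (R (invWeight v)) (invWeight w)
        = inner ℂ (R (invWeight v)) (l.laplacian ϑ a (R (invWeight w))) := by rw [hNR]
      _ = inner ℂ (invWeight v) (R (invWeight w)) := by rw [← inner_laplacian_symm, hNR]
  have hwne : ∀ p, (((weight p)⁻¹ : ℝ) : ℂ) ≠ 0 := fun p => by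
    exact_mod_cast inv_ne_zero (weight_pos p).ne'
  have hinj : ∀ v, invWeight v = 0 → v = 0 := fun v hv => by
    ext p
    have := congrArg (fun u : SqSum => u p) hv
    simp only [invWeight_apply, lp.coeFn_zero, Pi.zero_apply] at this
    exact (mul_eq_zero.mp this).resolve_left (hwne p)
  have hG0 : G ≠ 0 := fun h => by
    have h1 : G (ofRapid (single 0)) = 0 := by rw [h]; rfl
    have h2 := hinj _ h1
    have h3 : invWeight (ofRapid (single 0)) = 0 := by
      have := hNR (invWeight (ofRapid (single 0)))
      rw [← this]
      change l.laplacian ϑ a (R (invWeight (ofRapid (single 0)))) = 0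
      have h4 : R (invWeight (ofRapid (single 0))) = 0 := h2
      rw [h4, map_zero]
    have h5 := congrArg (fun u : SqSum => u 0) (hinj _ h3)
    simp [ofRapid_apply, single_apply] at h5
  obtain ⟨μ, hμ, hμ0⟩ : ∃ μ, Module.End.HasEigenvalue (G : Module.End ℂ SqSum) μ ∧ μ ≠ 0 := by
    by_contra hcon
    push Not at hcon
    exact hG0 ((ContinuousLinearMap.eq_zero_of_forall_hasEigenvalue_eq_zero hGc hGs).mp hcon)
  have hfd := ContinuousLinearMap.finite_dimensional_eigenspace hGc μ hμ0
  set c : ℂ := μ⁻¹ - 1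
  let V : Submodule ℂ RapidSeq := LinearMap.ker
    (l.star.perturbed ϑ (adj ϑ a) ∘ₗ l.perturbed ϑ a - c • LinearMap.id)
  have hV : ∀ u, u ∈ V ↔ l.star.perturbed ϑ (adj ϑ a) (l.perturbed ϑ a u) = c • u := fun u => by
    simp [V, LinearMap.mem_ker, sub_eq_zero]
  refine ⟨c, V, ?_, ?_, hV⟩
  · have hmem : ∀ u ∈ V, ofRapid u ∈ Module.End.eigenspace (G : Module.End ℂ SqSum) μ := by
      intro u hu
      rw [Module.End.mem_eigenspace_iff]
      -- `laplacian` acts on weighted sequences, so the vector to feed into it is `y = μ · weight ·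
      -- u`, for which `invWeight y = μ u`.
      let y : RapidSeq := ⟨fun p => μ * (weight p : ℂ) * u.1 p, fun k => by
        obtain ⟨C, hC⟩ := u.2 (k + 1)
        refine ⟨‖μ‖ * C, fun p => ?_⟩
        rw [norm_mul, norm_mul, Complex.norm_real, Real.norm_of_nonneg (weight_nonneg p)]
        calc weight p ^ k * (‖μ‖ * weight p * ‖u.1 p‖)
            = ‖μ‖ * (weight p ^ (k + 1) * ‖u.1 p‖) := by ring
          _ ≤ ‖μ‖ * C := mul_le_mul_of_nonneg_left (hC p) (norm_nonneg _)⟩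
      have hwy : invWeight (ofRapid y) = μ • ofRapid u := by
        ext p
        have hw : ((weight p : ℝ) : ℂ) ≠ 0 := by exact_mod_cast (weight_pos p).ne'
        simp only [invWeight_apply, ofRapid_apply, y, lp.coeFn_smul, Pi.smul_apply, smul_eq_mul]
        push_cast
        field_simp
      have hhalf : l.halfOp ϑ a (ofRapid y) = μ • ofRapid (l.perturbed ϑ a u) := by
        have h1 : l.halfOp ϑ a (ofRapid y) = l.normalized (ofRapid y)
            + convOp ϑ a (invWeight (ofRapid y)) := rfl
        rw [h1, hwy, map_smul, convOp_ofRapid]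
        ext p
        have hw : ((weight p : ℝ) : ℂ) ≠ 0 := by exact_mod_cast (weight_pos p).ne'
        simp only [lp.coeFn_add, Pi.add_apply, normalized_apply, ofRapid_apply, y, lp.coeFn_smul,
          Pi.smul_apply, smul_eq_mul, perturbed_apply]
        push_cast
        field_simp
      have hN' : l.laplacian ϑ a (ofRapid y) = invWeight (ofRapid u) := by
        have h1 : l.laplacian ϑ a (ofRapid y) = l.star.normalized (l.halfOp ϑ a (ofRapid y))
            + invWeight (convOp ϑ (adj ϑ a) (l.halfOp ϑ a (ofRapid y)))
            + invWeight (invWeight (ofRapid y)) := rfl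
        rw [h1, hhalf, hwy, map_smul, map_smul, map_smul, map_smul, convOp_ofRapid]
        ext p
        have h2 := congrArg (fun z : RapidSeq => z.1 p) ((hV u).mp hu)
        simp only [perturbed_apply l.star, Submodule.coe_smul, Pi.smul_apply, smul_eq_mul, c] at h2
        simp only [lp.coeFn_add, Pi.add_apply, lp.coeFn_smul, Pi.smul_apply, smul_eq_mul,
          normalized_apply, invWeight_apply, ofRapid_apply]
        have h3 : μ * (μ⁻¹ - 1) = 1 - μ := by field_simp
        linear_combination (μ * ((weight p)⁻¹ : ℝ)) * h2 + ((weight p)⁻¹ : ℝ) * u.1 p * h3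
      change invWeight (R (invWeight (ofRapid u))) = μ • ofRapid u
      rw [← hN', hRN, hwy]
    let f : V →ₗ[ℂ] Module.End.eigenspace (G : Module.End ℂ SqSum) μ :=
      (ofRapid ∘ₗ V.subtype).codRestrict _ (fun u => hmem u.1 u.2)
    refine FiniteDimensional.of_injective f fun u v h => ?_
    have := congrArg Subtype.val h
    exact Subtype.ext (ofRapid_injective this)
  · obtain ⟨v, hv, hv0⟩ := hμ.exists_hasEigenvector
    rw [Module.End.mem_eigenspace_iff] at hv
    have hGv : invWeight (R (invWeight v)) = μ • v := hv
    set y := R (invWeight v)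
    have hNy : l.laplacian ϑ a y = invWeight v := hNR _
    -- Since `invWeight y = μ v`, this is `P v`. Together with `v` it solves the first order system
    -- of `exists_weight_bound`, which then shows that the `ℓ²` eigenvector is rapidly decreasing.
    set d := μ⁻¹ • l.halfOp ϑ a y
    have hwy : ∀ p, (((weight p)⁻¹ : ℝ) : ℂ) * y p = μ * v p := fun p => by
      have := congrArg (fun u : SqSum => u p) hGv
      simpa [invWeight_apply] using this
    have e1 : ∀ p, l.toFun p * v p + convFun ϑ a v p = d p := fun p => by
      have h1 : l.halfOp ϑ a y = l.normalized y + convOp ϑ a (invWeight y) := rfl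
      simp only [d]
      rw [h1, hGv, map_smul, lp.coeFn_smul, Pi.smul_apply, lp.coeFn_add, Pi.add_apply,
        normalized_apply, lp.coeFn_smul, Pi.smul_apply, smul_eq_mul, smul_eq_mul, convOp_apply]
      have h3 : μ⁻¹ * μ = 1 := inv_mul_cancel₀ hμ0
      linear_combination (-(μ⁻¹ * l.toFun p)) * hwy p
        - (l.toFun p * v p + convFun ϑ a v p) * h3
    have e2 : ∀ p, conj (l.toFun p) * d p + convFun ϑ (adj ϑ a) d p = c * v p := fun p => by
      have h1 : l.laplacian ϑ a y = l.star.normalized (l.halfOp ϑ a y)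
            + invWeight (convOp ϑ (adj ϑ a) (l.halfOp ϑ a y))
            + invWeight (invWeight y) := rfl
      have hd : l.halfOp ϑ a y = μ • d := by simp [d, hμ0]
      rw [h1, hd, hGv, map_smul l.star.normalized μ d, map_smul (convOp ϑ (adj ϑ a)) μ d,
        map_smul invWeight μ (convOp ϑ (adj ϑ a) d), map_smul invWeight μ v] at hNy
      have h2 := congrArg (fun u : SqSum => u p) hNy
      simp only [lp.coeFn_add, Pi.add_apply, lp.coeFn_smul, Pi.smul_apply, smul_eq_mul,
        normalized_apply, invWeight_apply, convOp_apply] at h2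
      have h3 : μ * μ⁻¹ = 1 := mul_inv_cancel₀ hμ0
      have h4 : μ * (conj (l.toFun p) * d p + convFun ϑ (adj ϑ a) d p + v p) = v p := by
        apply mul_left_cancel₀ (hwne p)
        simp only [star] at h2
        linear_combination h2
      simp only [c]
      linear_combination μ⁻¹ * h4 - (conj (l.toFun p) * d p + convFun ϑ (adj ϑ a) d p + v p) * h3
    have hb := l.exists_weight_bound ϑ a (adj ϑ a) c (C₀ := max ‖v‖ ‖d‖)
      (fun p => (lp.norm_apply_le_norm two_ne_zero v p).trans (le_max_left _ _))
      (fun p => (lp.norm_apply_le_norm two_ne_zero d p).trans (le_max_right _ _)) e1 e2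
    let u : RapidSeq := ⟨v, fun k => (hb k).imp fun C hC p => (hC p).1⟩
    have hu : l.perturbed ϑ a u = ⟨d, fun k => (hb k).imp fun C hC p => (hC p).2⟩ := by
      ext p
      exact e1 p
    intro hbot
    have huV : u ∈ V := by
      rw [hV, hu]
      ext p
      exact e2 p
    rw [hbot, Submodule.mem_bot] at huV
    apply hv0
    ext p
    exact congrArg (fun z : RapidSeq => z.1 p) huV

end EllipticSymbol

end

/-! ### Flat Hermitian connections on the noncommutative torus and their joint eigenvectors. -/

noncomputable section

open FreeModule RapidSeq SqSum

namespace RapidSeq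

theorem conv_add_left (ϑ : ℝ) (a b u : RapidSeq) : conv ϑ (a + b) u = conv ϑ a u + conv ϑ b u := by
  obtain ⟨C, hC⟩ := exists_bound u
  ext p
  simp only [Submodule.coe_add, Pi.add_apply, conv_apply]
  rw [← (summable_convFun ϑ a hC p).tsum_add (summable_convFun ϑ b hC p)]
  exact tsum_congr fun q => by ring

theorem conv_smul_left (ϑ : ℝ) (c : ℂ) (a u : RapidSeq) : conv ϑ (c • a) u = c • conv ϑ a u := by
  ext p
  simp only [Submodule.coe_smul, Pi.smul_apply, smul_eq_mul, conv_apply]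
  rw [← tsum_mul_left]
  exact tsum_congr fun q => by ring

theorem conv_neg_left (ϑ : ℝ) (a u : RapidSeq) : conv ϑ (-a) u = -conv ϑ a u := by
  ext p
  simp only [Submodule.coe_neg, Pi.neg_apply, conv_apply, neg_mul, tsum_neg]

theorem adj_add (ϑ : ℝ) (a b : RapidSeq) : adj ϑ (a + b) = adj ϑ a + adj ϑ b := by
  ext p
  simp [adj_apply, add_mul]

theorem adj_smul (ϑ : ℝ) (c : ℂ) (a : RapidSeq) : adj ϑ (c • a) = conj c • adj ϑ a := by
  ext p
  simp [adj_apply, mul_assoc]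

theorem nabla₁_coe (u : RapidSeq) (p : ℤ × ℤ) :
    (nabla₁ u).1 p = 2 * Real.pi * Complex.I * p.1 * u.1 p := rfl

theorem nabla₂_coe (u : RapidSeq) (p : ℤ × ℤ) :
    (nabla₂ u).1 p = 2 * Real.pi * Complex.I * p.2 * u.1 p := rfl

/-- The operator `κ δ₁ + a *`. -/
def connection₁ (ϑ κ : ℝ) (a : RapidSeq) : Module.End ℂ RapidSeq :=
  (κ : ℂ) • nabla₁ + conv ϑ a

/-- The operator `κ δ₂ + a *`. -/
def connection₂ (ϑ κ : ℝ) (a : RapidSeq) : Module.End ℂ RapidSeq :=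
  (κ : ℂ) • nabla₂ + conv ϑ a

theorem connection₁_apply (ϑ κ : ℝ) (a u : RapidSeq) (p : ℤ × ℤ) :
    (connection₁ ϑ κ a u).1 p = κ * (2 * Real.pi * Complex.I * p.1 * u.1 p) + (conv ϑ a u).1 p :=
  rfl

theorem connection₂_apply (ϑ κ : ℝ) (a u : RapidSeq) (p : ℤ × ℤ) :
    (connection₂ ϑ κ a u).1 p = κ * (2 * Real.pi * Complex.I * p.2 * u.1 p) + (conv ϑ a u).1 p :=
  rfl

/-- Both summands are skew: the multiplier because it is imaginary, the convolution because `a` is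
skew. The images are named as rapidly decreasing sequences `u', v'`, since `m` itself may be
unbounded on `ℓ²`. -/
theorem inner_add_imaginary_multiplier {ϑ : ℝ} {a : RapidSeq} (ha : adj ϑ a = -a)
    {u v u' v' : RapidSeq} {m : ℤ × ℤ → ℂ} (hm : ∀ p, conj (m p) = -m p)
    (hu : ∀ p, u'.1 p = m p * u.1 p + (conv ϑ a u).1 p)
    (hv : ∀ p, v'.1 p = m p * v.1 p + (conv ϑ a v).1 p) :
    inner ℂ (ofRapid u') (ofRapid v) = -inner ℂ (ofRapid u) (ofRapid v') := by
  have h1 : inner ℂ (ofRapid (conv ϑ a u)) (ofRapid v)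
      = -inner ℂ (ofRapid u) (ofRapid (conv ϑ a v)) := by
    rw [← convOp_ofRapid, inner_convOp, ha, convOp_ofRapid, conv_neg_left, map_neg, inner_neg_right]
  have h2 : inner ℂ (ofRapid (u' - conv ϑ a u)) (ofRapid v)
      = -inner ℂ (ofRapid u) (ofRapid (v' - conv ϑ a v)) := by
    rw [lp.inner_eq_tsum, lp.inner_eq_tsum, ← tsum_neg]
    refine tsum_congr fun p => ?_
    simp only [ofRapid_apply, Submodule.coe_sub, Pi.sub_apply, hu, hv, RCLike.inner_apply,
      add_sub_cancel_right, map_mul, hm]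
    ring
  rw [map_sub, map_sub, inner_sub_left, inner_sub_right] at h2
  linear_combination h1 + h2

theorem eq_two_pi_I_mul_of_conj_eq_neg {z : ℂ} (hz : conj z = -z) :
    ∃ r : ℝ, z = 2 * Real.pi * Complex.I * r := by
  have h0 : z.re = 0 := by
    have := congrArg Complex.re hz
    simp only [Complex.conj_re, Complex.neg_re] at this
    linarith
  refine ⟨z.im / (2 * Real.pi), ?_⟩
  have hpi : (Real.pi : ℂ) ≠ 0 := by exact_mod_cast Real.pi_ne_zero
  push_cast
  field_simp
  apply Complex.ext <;> simp [h0]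

theorem exists_real_eigenvalue {ϑ : ℝ} {a : RapidSeq} (ha : adj ϑ a = -a)
    {u v : RapidSeq} (hu0 : u ≠ 0) {m : ℤ × ℤ → ℂ} (hm : ∀ p, conj (m p) = -m p)
    (hu : ∀ p, v.1 p = m p * u.1 p + (conv ϑ a u).1 p) {z : ℂ} (hz : v = z • u) :
    ∃ r : ℝ, z = 2 * Real.pi * Complex.I * r := by
  apply eq_two_pi_I_mul_of_conj_eq_neg
  have h := inner_add_imaginary_multiplier ha hm hu hu
  rw [hz, map_smul, inner_smul_left, inner_smul_right] at h
  have h0 : inner ℂ (ofRapid u) (ofRapid u) ≠ 0 := by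
    rw [inner_self_ne_zero]
    exact fun h => hu0 (ofRapid_injective (by rw [h, map_zero]))
  apply mul_right_cancel₀ h0
  linear_combination h

end RapidSeq

/-- The symbol of `κ (δ₁ + i δ₂)`. -/
def dolbeaultSymbol (κ : ℝ) (hκ : κ ≠ 0) : EllipticSymbol where
  toFun p := κ * (2 * Real.pi * Complex.I * p.1 + Complex.I * (2 * Real.pi * Complex.I * p.2))
  upper := |κ| * (2 * Real.pi)
  lower := (|κ| * Real.pi)⁻¹
  upper_nonneg := by positivity
  lower_nonneg := by positivity
  norm_le p := by
    have h : ‖2 * (Real.pi : ℂ) * Complex.I * p.1 + Complex.I * (2 * Real.pi * Complex.I * p.2)‖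
        ≤ 2 * Real.pi * |(p.1 : ℝ)| + 2 * Real.pi * |(p.2 : ℝ)| := by
      refine (norm_add_le _ _).trans (le_of_eq ?_)
      simp [abs_of_pos Real.pi_pos, Complex.norm_intCast]
    rw [norm_mul, Complex.norm_real, Real.norm_eq_abs, mul_assoc |κ|]
    refine mul_le_mul_of_nonneg_left ?_ (abs_nonneg κ)
    refine h.trans ?_
    unfold weight
    nlinarith [Real.pi_pos]
  weight_le p := by
    set z := 2 * (Real.pi : ℂ) * Complex.I * p.1 + Complex.I * (2 * Real.pi * Complex.I * p.2)
    -- The two frequencies are the imaginary and the negated real part of `z / 2π`. Each is at most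
    -- `‖z‖ / 2π` in absolute value, so their sum is at most `‖z‖ / π`; this is the source of
    -- `lower`.
    have hz : z = ((-(2 * Real.pi * p.2) : ℝ) : ℂ) + ((2 * Real.pi * p.1 : ℝ) : ℂ) * Complex.I := by
      simp only [z]
      push_cast
      linear_combination (2 * Real.pi * p.2 : ℂ) * Complex.I_mul_I
    have h1 : |2 * Real.pi * p.1| ≤ ‖z‖ := by
      have := Complex.abs_im_le_norm z
      rwa [hz, Complex.add_im, Complex.ofReal_im, Complex.im_ofReal_mul, Complex.I_im, mul_one,
        zero_add, ← hz] at this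
    have h2 : |2 * Real.pi * p.2| ≤ ‖z‖ := by
      have := Complex.abs_re_le_norm z
      rwa [hz, Complex.add_re, Complex.ofReal_re, Complex.re_ofReal_mul, Complex.I_re, mul_zero,
        add_zero, ← hz, abs_neg] at this
    have hp := Real.pi_pos
    rw [abs_mul, abs_of_pos (by positivity)] at h1 h2
    rw [norm_mul, Complex.norm_real, Real.norm_eq_abs]
    have hk : 0 < |κ| := abs_pos.mpr hκ
    have : (|κ| * Real.pi)⁻¹ * (|κ| * ‖z‖) = ‖z‖ / Real.pi := by field_simp
    rw [this]
    unfold weight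
    have : |(p.1 : ℝ)| + |(p.2 : ℝ)| ≤ ‖z‖ / Real.pi := by
      rw [le_div_iff₀ hp]
      linarith
    linarith

theorem exists_joint_eigenvector_of_commute {V : Type*} [AddCommGroup V] [Module ℂ V]
    [FiniteDimensional ℂ V] [Nontrivial V] (A B : Module.End ℂ V) (h : ∀ v, A (B v) = B (A v)) :
    ∃ v ≠ 0, ∃ z w : ℂ, A v = z • v ∧ B v = w • v := by
  obtain ⟨z, hz⟩ := Module.End.exists_eigenvalue A
  have hmem : ∀ v ∈ Module.End.eigenspace A z, B v ∈ Module.End.eigenspace A z := fun v hv => by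
    rw [Module.End.mem_eigenspace_iff] at hv ⊢
    rw [h, hv, map_smul]
  have : Nontrivial (Module.End.eigenspace A z) := Submodule.nontrivial_iff_ne_bot.mpr hz
  obtain ⟨w, hw⟩ := Module.End.exists_eigenvalue (B.restrict hmem)
  obtain ⟨v, hv, hv0⟩ := hw.exists_hasEigenvector
  refine ⟨v, fun h0 => hv0 (Subtype.ext h0), z, w, Module.End.mem_eigenspace_iff.mp v.2, ?_⟩
  rw [Module.End.mem_eigenspace_iff] at hv
  exact congrArg Subtype.val hv

/-- A flat Hermitian connection on the noncommutative torus has a joint eigenvector. -/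
theorem exists_joint_eigenvector {ϑ κ : ℝ} (hκ : κ ≠ 0) {a₁ a₂ : RapidSeq} (h₁ : adj ϑ a₁ = -a₁)
    (h₂ : adj ϑ a₂ = -a₂) (hc : ∀ u, connection₁ ϑ κ a₁ (connection₂ ϑ κ a₂ u) =
      connection₂ ϑ κ a₂ (connection₁ ϑ κ a₁ u)) :
    ∃ u : RapidSeq, u ≠ 0 ∧ ∃ r₁ r₂ : ℝ,
      connection₁ ϑ κ a₁ u = (2 * Real.pi * Complex.I * r₁) • u ∧
      connection₂ ϑ κ a₂ u = (2 * Real.pi * Complex.I * r₂) • u := by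
  let l := dolbeaultSymbol κ hκ
  let D₁ := connection₁ ϑ κ a₁
  let D₂ := connection₂ ϑ κ a₂
  -- The elliptic operator is `P = D₁ + iD₂`; as `D₁, D₂` are skew, its formal adjoint is `-D₁ +
  -- iD₂`.
  have hP : ∀ u, l.perturbed ϑ (a₁ + Complex.I • a₂) u = D₁ u + Complex.I • D₂ u := fun u => by
    ext p
    rw [EllipticSymbol.perturbed_apply, conv_add_left, conv_smul_left]
    simp only [Submodule.coe_add, Submodule.coe_smul, Pi.add_apply, Pi.smul_apply, smul_eq_mul, D₁,
      D₂, connection₁_apply, connection₂_apply, l, dolbeaultSymbol]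
    ring
  have hQ : ∀ u, l.star.perturbed ϑ (adj ϑ (a₁ + Complex.I • a₂)) u = -D₁ u + Complex.I • D₂ u :=
    fun u => by
      ext p
      rw [EllipticSymbol.perturbed_apply, adj_add, adj_smul, h₁, h₂, conv_add_left, conv_smul_left,
        conv_neg_left, conv_neg_left]
      simp only [Submodule.coe_add, Submodule.coe_smul, Submodule.coe_neg, Pi.add_apply,
        Pi.smul_apply, Pi.neg_apply, smul_eq_mul, D₁, D₂, connection₁_apply, connection₂_apply, l,
        dolbeaultSymbol, EllipticSymbol.star, map_mul, map_add, Complex.conj_ofReal, Complex.conj_I,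
        map_intCast, Complex.conj_ofNat]
      ring
  obtain ⟨c, V, hfd, hne, hV⟩ := l.exists_finiteDimensional_eigenspace ϑ (a₁ + Complex.I • a₂)
  have hc' : ∀ u, D₁ (D₂ u) = D₂ (D₁ u) := hc
  -- `V` is an eigenspace of `P*P`, a polynomial in the commuting operators `D₁, D₂`, so both
  -- preserve it.
  have hV₁ : ∀ u ∈ V, D₁ u ∈ V := fun u hu => by
    rw [hV, hP, hQ] at hu ⊢
    rw [← map_smul D₁ c u, ← hu]
    simp only [map_add, map_smul, map_neg, hc']
  have hV₂ : ∀ u ∈ V, D₂ u ∈ V := fun u hu => by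
    rw [hV, hP, hQ] at hu ⊢
    rw [← map_smul D₂ c u, ← hu]
    simp only [map_add, map_smul, map_neg, hc']
  have : Nontrivial V := Submodule.nontrivial_iff_ne_bot.mpr hne
  obtain ⟨u, hu0, z, w, hz, hw⟩ := exists_joint_eigenvector_of_commute (V := V)
    (D₁.restrict (p := V) hV₁) (D₂.restrict (p := V) hV₂) (fun v => Subtype.ext (hc' v))
  have hu0' : (u : RapidSeq) ≠ 0 := fun h => hu0 (Subtype.ext h)
  have hz' : D₁ u = z • (u : RapidSeq) := congrArg Subtype.val hz
  have hw' : D₂ u = w • (u : RapidSeq) := congrArg Subtype.val hw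
  obtain ⟨r₁, hr₁⟩ := exists_real_eigenvalue h₁ hu0'
    (m := fun p => κ * (2 * Real.pi * Complex.I * p.1))
    (fun p => by simp [Complex.conj_ofNat])
    (fun p => by rw [mul_assoc]; exact connection₁_apply ϑ κ a₁ u p) hz'
  obtain ⟨r₂, hr₂⟩ := exists_real_eigenvalue h₂ hu0'
    (m := fun p => κ * (2 * Real.pi * Complex.I * p.2))
    (fun p => by simp [Complex.conj_ofNat])
    (fun p => by rw [mul_assoc]; exact connection₂_apply ϑ κ a₂ u p) hw'
  exact ⟨u, hu0', r₁, r₂, hr₁ ▸ hz', hr₂ ▸ hw'⟩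

end

noncomputable section

open FreeModule RapidSeq

/-! ## The commutant of a basic module -/

/-- The data that identify the commutant of `U₁, U₂` on a module with a noncommutative torus
`{∑ c_q W_q}` on which the reference connection induces the derivations `κ δ₁, κ δ₂`. -/
structure CommutantModel {θ : ℝ} (M : TorusModule θ) (c κ ϑ : ℝ) where
  topAddGroup : IsTopologicalAddGroup M.E
  contSMul : ContinuousSMul ℂ M.E
  connection : IsConstCurvConnection M c M.nabla₁ M.nabla₂
  herm_add : ∀ ξ η η', M.herm ξ (η + η') = M.herm ξ η + M.herm ξ η'
  herm_smul : ∀ (z : ℂ) (ξ η), M.herm ξ (z • η) = z * M.herm ξ η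
  herm_conj : ∀ ξ η, conj (M.herm ξ η) = M.herm η ξ
  herm_ext : ∀ η, (∀ ξ, M.herm ξ η = 0) → η = 0
  herm_continuous : ∀ ξ, Continuous (M.herm ξ)
  herm_diag : Filter.Tendsto (fun ξ => M.herm ξ ξ) (nhds 0) (nhds 0)
  U₁_adj : ∃ V : M.E → M.E, ∀ ξ η, M.herm ξ (M.U₁ η) = M.herm (V ξ) η
  U₂_adj : ∃ V : M.E → M.E, ∀ ξ η, M.herm ξ (M.U₂ η) = M.herm (V ξ) η
  W : ℤ × ℤ → Module.End ℂ M.E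
  W_zero : ∀ ξ, W 0 ξ = ξ
  W_mul : ∀ p q ξ, W p (W q ξ) = twist ϑ p q • W (p + q) ξ
  W_adj : ∀ q ξ η, M.herm (W q ξ) η = twist ϑ q q * M.herm ξ (W (-q) η)
  W_U₁ : ∀ q ξ, W q (M.U₁ ξ) = M.U₁ (W q ξ)
  W_U₂ : ∀ q ξ, W q (M.U₂ ξ) = M.U₂ (W q ξ)
  W_nabla₁ : ∀ q ξ, M.nabla₁ (W q ξ) = W q (M.nabla₁ ξ) +
    (κ * (2 * Real.pi * Complex.I * (q.1 : ℂ))) • W q ξ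
  W_nabla₂ : ∀ q ξ, M.nabla₂ (W q ξ) = W q (M.nabla₂ ξ) +
    (κ * (2 * Real.pi * Complex.I * (q.2 : ℂ))) • W q ξ
  W_bound : ∀ ξ η, ∃ C : ℝ, ∀ q, ‖M.herm ξ (W q η)‖ ≤ C
  rho : RapidSeq → Module.End ℂ M.E
  herm_rho : ∀ a ξ η, M.herm ξ (rho a η) = ∑' q, a.1 q * M.herm ξ (W q η)
  rho_continuous : ∀ a, Continuous (rho a)
  commutant : ∀ T : Module.End ℂ M.E, (∀ ξ, T (M.U₁ ξ) = M.U₁ (T ξ)) →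
    (∀ ξ, T (M.U₂ ξ) = M.U₂ (T ξ)) → (∀ ξ, Continuous fun η => M.herm ξ (T η)) → ∃ a, T = rho a
  frameSize : ℕ
  frame : Fin frameSize → M.E
  density : ℝ
  density_pos : 0 < density
  frame_trace : ∀ q, ∑ i, M.herm (frame i) (W q (frame i)) = if q = 0 then (density : ℂ) else 0

namespace CommutantModel

variable {θ : ℝ} {M : TorusModule θ} {c κ ϑ : ℝ} (S : CommutantModel M c κ ϑ)

section Hermitian

include S

theorem herm_add_left (ξ ξ' η : M.E) : M.herm (ξ + ξ') η = M.herm ξ η + M.herm ξ' η := by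
  rw [← S.herm_conj, S.herm_add, map_add, S.herm_conj, S.herm_conj]

theorem herm_smul_left (z : ℂ) (ξ η : M.E) : M.herm (z • ξ) η = conj z * M.herm ξ η := by
  rw [← S.herm_conj, S.herm_smul, map_mul, S.herm_conj]

theorem herm_neg (ξ η : M.E) : M.herm ξ (-η) = -M.herm ξ η := by
  have h := S.herm_smul (-1) ξ η
  rwa [neg_one_smul, neg_one_mul] at h

theorem herm_neg_left (ξ η : M.E) : M.herm (-ξ) η = -M.herm ξ η := by
  rw [← S.herm_conj, S.herm_neg, map_neg, S.herm_conj]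

theorem herm_sub (ξ η η' : M.E) : M.herm ξ (η - η') = M.herm ξ η - M.herm ξ η' := by
  rw [sub_eq_add_neg, S.herm_add, S.herm_neg, sub_eq_add_neg]

theorem herm_sub_left (ξ ξ' η : M.E) : M.herm (ξ - ξ') η = M.herm ξ η - M.herm ξ' η := by
  rw [sub_eq_add_neg, S.herm_add_left, S.herm_neg_left, sub_eq_add_neg]

theorem eq_of_herm {η η' : M.E} (h : ∀ ξ, M.herm ξ η = M.herm ξ η') : η = η' := by
  rw [← sub_eq_zero]
  exact S.herm_ext _ fun ξ => by rw [S.herm_sub, h, sub_self]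

end Hermitian

theorem herm_W (q : ℤ × ℤ) (ξ η : M.E) :
    M.herm ξ (S.W q η) = conj (twist ϑ q q) * M.herm (S.W (-q) ξ) η := by
  rw [← S.herm_conj (S.W q η), S.W_adj, map_mul, S.herm_conj]

theorem summable_rho (a : RapidSeq) (ξ η : M.E) :
    Summable fun q => a.1 q * M.herm ξ (S.W q η) := by
  obtain ⟨C, hC⟩ := S.W_bound ξ η
  exact summable_mul_of_bounded a hC

theorem rho_add (a b : RapidSeq) (η : M.E) : S.rho (a + b) η = S.rho a η + S.rho b η := by
  refine S.eq_of_herm fun ξ => ?_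
  rw [S.herm_add, S.herm_rho, S.herm_rho, S.herm_rho,
    ← (S.summable_rho a ξ η).tsum_add (S.summable_rho b ξ η)]
  exact tsum_congr fun q => by simp [add_mul]

theorem rho_smul (z : ℂ) (a : RapidSeq) (η : M.E) : S.rho (z • a) η = z • S.rho a η := by
  refine S.eq_of_herm fun ξ => ?_
  rw [S.herm_smul, S.herm_rho, S.herm_rho, ← tsum_mul_left]
  exact tsum_congr fun q => by simp [mul_assoc]

theorem rho_neg (a : RapidSeq) (η : M.E) : S.rho (-a) η = -S.rho a η := by
  refine S.eq_of_herm fun ξ => ?_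
  rw [S.herm_neg, S.herm_rho, S.herm_rho, ← tsum_neg]
  exact tsum_congr fun q => by simp

theorem rho_sub (a b : RapidSeq) (η : M.E) : S.rho (a - b) η = S.rho a η - S.rho b η := by
  rw [sub_eq_add_neg, S.rho_add, S.rho_neg, sub_eq_add_neg]

theorem rho_single (q : ℤ × ℤ) (η : M.E) : S.rho (single q) η = S.W q η := by
  refine S.eq_of_herm fun ξ => ?_
  rw [S.herm_rho, tsum_eq_single q (fun p hp => by simp [single_apply, hp])]
  simp [single_apply]

theorem rho_single_zero (η : M.E) : S.rho (single 0) η = η := by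
  rw [S.rho_single, S.W_zero]

theorem rho_U₁ (a : RapidSeq) (η : M.E) : S.rho a (M.U₁ η) = M.U₁ (S.rho a η) := by
  obtain ⟨V, hV⟩ := S.U₁_adj
  refine S.eq_of_herm fun ξ => ?_
  rw [hV, S.herm_rho, S.herm_rho]
  exact tsum_congr fun q => by rw [← hV, S.W_U₁]

theorem rho_U₂ (a : RapidSeq) (η : M.E) : S.rho a (M.U₂ η) = M.U₂ (S.rho a η) := by
  obtain ⟨V, hV⟩ := S.U₂_adj
  refine S.eq_of_herm fun ξ => ?_
  rw [hV, S.herm_rho, S.herm_rho]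
  exact tsum_congr fun q => by rw [← hV, S.W_U₂]

theorem rho_mul (a b : RapidSeq) (η : M.E) : S.rho a (S.rho b η) = S.rho (conv ϑ a b) η := by
  refine S.eq_of_herm fun ξ => ?_
  obtain ⟨C, hC⟩ := S.W_bound ξ η
  rw [S.herm_rho, S.herm_rho, ← tsum_conv ϑ a b hC]
  refine tsum_congr fun p => ?_
  rw [S.herm_W, S.herm_rho, ← tsum_mul_left]
  congr 1
  refine tsum_congr fun q => ?_
  rw [mul_left_comm, ← S.herm_W, S.W_mul, S.herm_smul]

theorem rho_adj (a : RapidSeq) (ξ η : M.E) :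
    M.herm (S.rho a ξ) η = M.herm ξ (S.rho (adj ϑ a) η) := by
  rw [← S.herm_conj, S.herm_rho, S.herm_rho, Complex.conj_tsum, ← (Equiv.neg (ℤ × ℤ)).tsum_eq]
  refine tsum_congr fun q => ?_
  rw [map_mul, S.herm_conj, S.W_adj, adj_apply]
  simp only [Equiv.neg_apply, neg_neg]
  rw [twist_neg_right, neg_neg]
  ring

/-- A derivation formula for an infinite sum, obtained without continuity of `∇₁`: skewness moves
`∇₁` to the other argument of the form, where the weak expansion of `ρ(a)` can be used term by term.
-/
theorem rho_nabla₁ (a : RapidSeq) (η : M.E) :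
    M.nabla₁ (S.rho a η) = S.rho a (M.nabla₁ η) + S.rho ((κ : ℂ) • nabla₁ a) η := by
  refine S.eq_of_herm fun ξ => ?_
  have h := S.connection.skew₁
  rw [← neg_eq_iff_eq_neg.mpr (h ξ _), S.herm_rho, S.herm_add, S.herm_rho, S.herm_rho,
    ← (S.summable_rho a ξ _).tsum_add (S.summable_rho _ ξ η), ← tsum_neg]
  refine tsum_congr fun q => ?_
  rw [h, S.W_nabla₁, S.herm_add, S.herm_smul, Submodule.coe_smul, Pi.smul_apply, nabla₁_coe,
    smul_eq_mul]
  ring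

theorem rho_nabla₂ (a : RapidSeq) (η : M.E) :
    M.nabla₂ (S.rho a η) = S.rho a (M.nabla₂ η) + S.rho ((κ : ℂ) • nabla₂ a) η := by
  refine S.eq_of_herm fun ξ => ?_
  have h := S.connection.skew₂
  rw [← neg_eq_iff_eq_neg.mpr (h ξ _), S.herm_rho, S.herm_add, S.herm_rho, S.herm_rho,
    ← (S.summable_rho a ξ _).tsum_add (S.summable_rho _ ξ η), ← tsum_neg]
  refine tsum_congr fun q => ?_
  rw [h, S.W_nabla₂, S.herm_add, S.herm_smul, Submodule.coe_smul, Pi.smul_apply, nabla₂_coe,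
    smul_eq_mul]
  ring

/-- Summation over the frame computes the trace of the commutant, up to the density. Norms of
finitely many vectors of the module thereby control the `ℓ²` norm of coefficients. -/
theorem sum_herm_rho_frame (a : RapidSeq) :
    ∑ i, M.herm (S.frame i) (S.rho a (S.frame i)) = S.density * a.1 0 := by
  simp only [S.herm_rho]
  rw [← Summable.tsum_finsetSum fun i _ => S.summable_rho a _ _]
  simp only [← Finset.mul_sum, S.frame_trace]
  rw [tsum_eq_single 0 (fun q hq => by simp [hq])]
  simp [mul_comm]

theorem sum_herm_rho_frame_self (a : RapidSeq) :
    ∑ i, M.herm (S.rho a (S.frame i)) (S.rho a (S.frame i)) =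
      ((S.density * ∑' q, ‖a.1 q‖ ^ 2 : ℝ) : ℂ) := by
  simp only [S.rho_adj, S.rho_mul]
  rw [S.sum_herm_rho_frame, conv_adj_self_zero]
  push_cast
  rfl

theorem eq_zero_of_tsum_norm_sq {a : RapidSeq} (h : ∑' q, ‖a.1 q‖ ^ 2 = 0) : a = 0 := by
  ext q
  have h1 := (hasSum_zero_iff_of_nonneg (fun q => by positivity)).mp
    (h ▸ (summable_norm_sq a).hasSum)
  have := congrFun h1 q
  simpa using this

/-- The trace is faithful: applied to `ρ(a)*ρ(a)` on the frame it returns a positive multiple of `∑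
‖a_q‖²`. -/
theorem rho_eq_zero {a : RapidSeq} (h : ∀ ξ, S.rho a ξ = 0) : a = 0 := by
  have h1 := S.sum_herm_rho_frame_self a
  have h0 : M.herm (0 : M.E) 0 = 0 := by
    have := S.herm_smul 0 0 0
    simpa using this
  simp only [h, h0, Finset.sum_const_zero] at h1
  have h2 : S.density * ∑' q, ‖a.1 q‖ ^ 2 = 0 := by exact_mod_cast h1.symm
  exact eq_zero_of_tsum_norm_sq ((mul_eq_zero.mp h2).resolve_left S.density_pos.ne')

theorem rho_injective {a b : RapidSeq} (h : ∀ ξ, S.rho a ξ = S.rho b ξ) : a = b := by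
  rw [← sub_eq_zero]
  exact S.rho_eq_zero fun ξ => by rw [S.rho_sub, h, sub_self]

/-! ### Gauge equivalence with a translate of the reference connection -/

/-- `ρ(a)` is unitary. -/
def IsUnitary (ϑ : ℝ) (a : RapidSeq) : Prop :=
  conv ϑ (adj ϑ a) a = single 0 ∧ conv ϑ a (adj ϑ a) = single 0

/-- The difference of two connections satisfies no Leibniz term, so it commutes with `U₁, U₂` and
lies in the commutant. -/
theorem exists_symbol {D₁ D₂ : Module.End ℂ M.E} (hD : IsConstCurvConnection M c D₁ D₂) :
    (∃ a, (∀ ξ, D₁ ξ = M.nabla₁ ξ + S.rho a ξ) ∧ adj ϑ a = -a) ∧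
    (∃ a, (∀ ξ, D₂ ξ = M.nabla₂ ξ + S.rho a ξ) ∧ adj ϑ a = -a) := by
  have hS := S.connection
  have key : ∀ A : Module.End ℂ M.E, (∀ ξ, A (M.U₁ ξ) = M.U₁ (A ξ)) →
      (∀ ξ, A (M.U₂ ξ) = M.U₂ (A ξ)) → (∀ ξ η, M.herm (A ξ) η = -M.herm ξ (A η)) →
      ∃ a, (∀ ξ, A ξ = S.rho a ξ) ∧ adj ϑ a = -a := by
    intro A h1 h2 h3
    -- Connection operators are not assumed to be continuous; skewness rewrites `⟨ξ, Aη⟩` as `-⟨Aξ,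
    -- η⟩`, which is continuous in `η`, and weak continuity is all that `commutant` requires.
    obtain ⟨a, ha⟩ := S.commutant A h1 h2 fun ξ => by
      have : (fun η => M.herm ξ (A η)) = fun η => -M.herm (A ξ) η := by
        funext η
        rw [h3, neg_neg]
      rw [this]
      exact (S.herm_continuous _).neg
    refine ⟨a, fun ξ => by rw [ha], S.rho_injective fun η => S.eq_of_herm fun ξ => ?_⟩
    rw [← S.rho_adj, ← ha, h3, S.rho_neg, S.herm_neg, ← ha]
  constructor
  · obtain ⟨a, ha, ha'⟩ := key (D₁ - M.nabla₁)
      (fun ξ => by simp only [LinearMap.sub_apply, hD.leibniz₁₁, hS.leibniz₁₁, map_sub]; abel)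
      (fun ξ => by simp only [LinearMap.sub_apply, hD.leibniz₁₂, hS.leibniz₁₂, map_sub])
      (fun ξ η => by
        simp only [LinearMap.sub_apply, S.herm_sub, S.herm_sub_left, hD.skew₁, hS.skew₁]; ring)
    exact ⟨a, fun ξ => by rw [← ha]; simp, ha'⟩
  · obtain ⟨a, ha, ha'⟩ := key (D₂ - M.nabla₂)
      (fun ξ => by simp only [LinearMap.sub_apply, hD.leibniz₂₁, hS.leibniz₂₁, map_sub])
      (fun ξ => by simp only [LinearMap.sub_apply, hD.leibniz₂₂, hS.leibniz₂₂, map_sub]; abel)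
      (fun ξ η => by
        simp only [LinearMap.sub_apply, S.herm_sub, S.herm_sub_left, hD.skew₂, hS.skew₂]; ring)
    exact ⟨a, fun ξ => by rw [← ha]; simp, ha'⟩

theorem eq_smul_single_of_nabla_eq_zero {e : RapidSeq} (h₁ : nabla₁ e = 0) (h₂ : nabla₂ e = 0) :
    e = e.1 0 • single 0 := by
  have hpi : (2 * Real.pi * Complex.I : ℂ) ≠ 0 := Complex.two_pi_I_ne_zero
  ext q
  rw [Submodule.coe_smul, Pi.smul_apply, single_apply, smul_eq_mul]
  by_cases hq : q = 0
  · simp [hq]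
  · rw [if_neg hq, mul_zero]
    have e1 := congrArg (fun z : RapidSeq => z.1 q) h₁
    have e2 := congrArg (fun z : RapidSeq => z.1 q) h₂
    simp only [nabla₁_coe, nabla₂_coe, Submodule.coe_zero, Pi.zero_apply, mul_eq_zero, hpi,
      false_or, Int.cast_eq_zero] at e1 e2
    by_contra hne
    exact hq (Prod.ext (e1.resolve_right hne) (e2.resolve_right hne))

/-- First `u*u` commutes with the reference connection, so its derivatives vanish and it is a scalar
`t`, the squared `ℓ²` norm of `u`. Then `f = uu*` is self-adjoint with `f² = tf` and trace `t`, so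
`∑ ‖f_p‖² = t²` is already exhausted by the coefficient at zero, and `f` is the scalar `t` as well.
No invertibility of `u` has to be known in advance. -/
theorem isUnitary_of_intertwines (hκ : κ ≠ 0) {D₁ D₂ : Module.End ℂ M.E}
    (hD : IsConstCurvConnection M c D₁ D₂) {u : RapidSeq} (hu : u ≠ 0) {r₁ r₂ : ℝ}
    (h₁ : ∀ ξ, D₁ (S.rho u ξ) = S.rho u (M.nabla₁ ξ + (2 * Real.pi * Complex.I * r₁) • ξ))
    (h₂ : ∀ ξ, D₂ (S.rho u ξ) = S.rho u (M.nabla₂ ξ + (2 * Real.pi * Complex.I * r₂) • ξ)) :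
    ∃ s : ℝ, s ≠ 0 ∧ IsUnitary ϑ ((s : ℂ) • u) := by
  set e := conv ϑ (adj ϑ u) u with he
  -- Evaluating `⟨uη, D uξ⟩` by moving `D` through either factor gives two expressions. The constant
  -- `2πir` is imaginary, so it contributes equally to both and cancels.
  have key : ∀ (D N : Module.End ℂ M.E) (r : ℝ), (∀ ξ η, M.herm (D ξ) η = -M.herm ξ (D η)) →
      (∀ ξ η, M.herm (N ξ) η = -M.herm ξ (N η)) →
      (∀ ξ, D (S.rho u ξ) = S.rho u (N ξ + (2 * Real.pi * Complex.I * r) • ξ)) →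
      ∀ ξ, N (S.rho e ξ) = S.rho e (N ξ) := by
    intro D N r hDs hNs h ξ
    refine S.eq_of_herm fun η => ?_
    have hz : conj (2 * Real.pi * Complex.I * r : ℂ) = -(2 * Real.pi * Complex.I * r) := by
      simp [Complex.conj_ofNat]
    have a1 : M.herm (S.rho u η) (D (S.rho u ξ)) = M.herm η (S.rho e (N ξ))
        + (2 * Real.pi * Complex.I * r) * M.herm η (S.rho e ξ) := by
      rw [h, S.rho_adj, S.rho_mul, map_add, map_smul, S.herm_add, S.herm_smul]
    have a2 : M.herm (S.rho u η) (D (S.rho u ξ)) = M.herm η (N (S.rho e ξ))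
        + (2 * Real.pi * Complex.I * r) * M.herm η (S.rho e ξ) := by
      rw [← neg_eq_iff_eq_neg.mpr (hDs _ _), h, S.rho_adj, S.rho_mul, S.herm_add_left,
        S.herm_smul_left, hz, hNs]
      ring
    exact add_right_cancel (a2.symm.trans a1)
  have hκ' : (κ : ℂ) ≠ 0 := by exact_mod_cast hκ
  have e1 : nabla₁ e = 0 := by
    have h := key D₁ M.nabla₁ r₁ hD.skew₁ S.connection.skew₁ h₁
    have h0 : (κ : ℂ) • nabla₁ e = 0 := S.rho_eq_zero fun ξ => by
      have := h ξ
      rwa [S.rho_nabla₁, add_eq_left] at this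
    exact (smul_eq_zero.mp h0).resolve_left hκ'
  have e2 : nabla₂ e = 0 := by
    have h := key D₂ M.nabla₂ r₂ hD.skew₂ S.connection.skew₂ h₂
    have h0 : (κ : ℂ) • nabla₂ e = 0 := S.rho_eq_zero fun ξ => by
      have := h ξ
      rwa [S.rho_nabla₂, add_eq_left] at this
    exact (smul_eq_zero.mp h0).resolve_left hκ'
  set t : ℝ := ∑' p, ‖u.1 p‖ ^ 2
  have he' : e = (t : ℂ) • single 0 := by
    rw [eq_smul_single_of_nabla_eq_zero e1 e2, he, conv_adj_self_zero]
  have ht : 0 < t := by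
    refine lt_of_le_of_ne (tsum_nonneg fun p => by positivity) fun h => hu ?_
    exact eq_zero_of_tsum_norm_sq h.symm
  set f := conv ϑ u (adj ϑ u) with hf
  have hff : conv ϑ f f = (t : ℂ) • f := S.rho_injective fun ξ => by
    rw [← S.rho_mul, hf, ← S.rho_mul, ← S.rho_mul, S.rho_mul (adj ϑ u) u, ← he, he', S.rho_smul,
      S.rho_single_zero, map_smul, S.rho_mul, S.rho_smul]
  have hfa : adj ϑ f = f := S.rho_injective fun η => S.eq_of_herm fun ξ => by
    rw [← S.rho_adj, hf, ← S.rho_mul, ← S.rho_mul, S.rho_adj, S.rho_adj, adj_adj]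
  have hf0 : f.1 0 = t := conv_self_adj_zero ϑ u
  -- The trace of `f*f = f² = tf`.
  have hft : ∑' p, ‖f.1 p‖ ^ 2 = t ^ 2 := by
    have h1 := conv_adj_self_zero ϑ f
    rw [hfa, hff, Submodule.coe_smul, Pi.smul_apply, hf0, smul_eq_mul] at h1
    have h2 : ((t * t : ℝ) : ℂ) = ((∑' p, ‖f.1 p‖ ^ 2 : ℝ) : ℂ) := by push_cast at h1 ⊢; exact h1
    rw [← Complex.ofReal_injective h2]
    ring
  have hf' : f = (t : ℂ) • single 0 := by
    ext q
    rw [Submodule.coe_smul, Pi.smul_apply, single_apply, smul_eq_mul]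
    by_cases hq : q = 0
    · simp [hq, hf0]
    · rw [if_neg hq, mul_zero]
      have h1 := (summable_norm_sq f).sum_le_tsum {0, q} (fun p _ => by positivity)
      rw [Finset.sum_pair (Ne.symm hq), hft, hf0, Complex.norm_real, Real.norm_of_nonneg ht.le] at h1
      have h2 : ‖f.1 q‖ ^ 2 = 0 := le_antisymm (by linarith) (by positivity)
      simpa using h2
  have hs : ((√t)⁻¹ : ℝ) * ((√t)⁻¹ : ℝ) * t = 1 := by
    rw [← mul_inv, Real.mul_self_sqrt ht.le, inv_mul_cancel₀ ht.ne']
  have hs' : (((√t)⁻¹ : ℝ) : ℂ) * (((√t)⁻¹ : ℝ) : ℂ) * (t : ℂ) = 1 := by exact_mod_cast hs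
  refine ⟨(√t)⁻¹, inv_ne_zero (Real.sqrt_ne_zero'.mpr ht), ?_, ?_⟩
  · rw [adj_smul, conv_smul_left, map_smul, ← he, he', Complex.conj_ofReal, smul_smul, smul_smul,
      hs', one_smul]
  · rw [adj_smul, conv_smul_left, map_smul, ← hf, hf', Complex.conj_ofReal, smul_smul, smul_smul,
      hs', one_smul]

/-- On the elements `ρ(u)` of the commutant the connection acts through `κδ_k + a_k`. A joint
eigenvector `u` is then an intertwiner with a translate of the reference connection, and the
preceding lemma makes it unitary after rescaling. -/
theorem exists_gauge (hκ : κ ≠ 0) {D₁ D₂ : Module.End ℂ M.E}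
    (hD : IsConstCurvConnection M c D₁ D₂) :
    ∃ (v : RapidSeq) (r₁ r₂ : ℝ), IsUnitary ϑ v ∧
      (∀ ξ, D₁ (S.rho v ξ) = S.rho v (M.nabla₁ ξ + (2 * Real.pi * Complex.I * r₁) • ξ)) ∧
      (∀ ξ, D₂ (S.rho v ξ) = S.rho v (M.nabla₂ ξ + (2 * Real.pi * Complex.I * r₂) • ξ)) := by
  obtain ⟨⟨a₁, ha₁, has₁⟩, ⟨a₂, ha₂, has₂⟩⟩ := S.exists_symbol hD
  have hc₁ : ∀ u ξ, D₁ (S.rho u ξ) = S.rho u (M.nabla₁ ξ) + S.rho (connection₁ ϑ κ a₁ u) ξ :=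
    fun u ξ => by
      rw [ha₁, S.rho_mul, S.rho_nabla₁, add_assoc, ← S.rho_add]
      rfl
  have hc₂ : ∀ u ξ, D₂ (S.rho u ξ) = S.rho u (M.nabla₂ ξ) + S.rho (connection₂ ϑ κ a₂ u) ξ :=
    fun u ξ => by
      rw [ha₂, S.rho_mul, S.rho_nabla₂, add_assoc, ← S.rho_add]
      rfl
  -- Both connections have the same constant curvature, which cancels; the mixed terms in `∇` and
  -- `a` are symmetric, so only the commutator of the induced operators remains.
  have hcomm : ∀ u, connection₁ ϑ κ a₁ (connection₂ ϑ κ a₂ u) =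
      connection₂ ϑ κ a₂ (connection₁ ϑ κ a₁ u) := fun u => S.rho_injective fun ξ => by
    have h1 := hD.curvature (S.rho u ξ)
    have h2 := congrArg (S.rho u) (S.connection.curvature ξ)
    rw [map_sub, map_smul] at h2
    rw [hc₁, hc₂, map_add, map_add, hc₁, hc₁, hc₂, hc₂] at h1
    rw [← h2] at h1
    have h3 := sub_eq_zero.mpr h1
    rw [← sub_eq_zero, ← h3]
    abel
  obtain ⟨u, hu, r₁, r₂, hr₁, hr₂⟩ := exists_joint_eigenvector hκ has₁ has₂ hcomm
  have k₁ : ∀ ξ, D₁ (S.rho u ξ) = S.rho u (M.nabla₁ ξ + (2 * Real.pi * Complex.I * r₁) • ξ) :=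
    fun ξ => by rw [hc₁, hr₁, S.rho_smul, map_add, map_smul]
  have k₂ : ∀ ξ, D₂ (S.rho u ξ) = S.rho u (M.nabla₂ ξ + (2 * Real.pi * Complex.I * r₂) • ξ) :=
    fun ξ => by rw [hc₂, hr₂, S.rho_smul, map_add, map_smul]
  obtain ⟨s, -, hs⟩ := S.isUnitary_of_intertwines hκ hD hu k₁ k₂
  refine ⟨_, r₁, r₂, hs, fun ξ => ?_, fun ξ => ?_⟩
  · rw [S.rho_smul, S.rho_smul, map_smul, k₁]
  · rw [S.rho_smul, S.rho_smul, map_smul, k₂]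

end CommutantModel

end

noncomputable section

open FreeModule RapidSeq

/-! ## The moduli of standard holomorphic structures -/

namespace TorusModule

variable {θ : ℝ} (M : TorusModule θ)

/-- The translate `τ(∇₁ + 2πi r₁) + (∇₂ + 2πi r₂)` of the reference structure. -/
def translated (τ : ℂ) (r : ℝ × ℝ) : Module.End ℂ M.E :=
  τ • (M.nabla₁ + (2 * Real.pi * Complex.I * r.1) • LinearMap.id) +
    (M.nabla₂ + (2 * Real.pi * Complex.I * r.2) • LinearMap.id)

theorem translated_apply (τ : ℂ) (r : ℝ × ℝ) (ξ : M.E) :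
    M.translated τ r ξ = τ • M.nabla₁ ξ + M.nabla₂ ξ +
      (2 * Real.pi * Complex.I * (τ * r.1 + r.2)) • ξ := by
  simp only [translated, LinearMap.add_apply, LinearMap.smul_apply, LinearMap.id_apply]
  module

/-- Standard holomorphic structures on `M`. -/
def IsStandard (c : ℝ) (τ : ℂ) (D : Module.End ℂ M.E) : Prop :=
  ∃ D₁ D₂ : Module.End ℂ M.E, IsConstCurvConnection M c D₁ D₂ ∧ D = τ • D₁ + D₂

/-- Conjugacy by automorphisms of `M`. -/
def Conjugate (D D' : Module.End ℂ M.E) : Prop :=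
  ∃ g : M.E ≃L[ℂ] M.E, (∀ ξ, g (M.U₁ ξ) = M.U₁ (g ξ)) ∧ (∀ ξ, g (M.U₂ ξ) = M.U₂ (g ξ)) ∧
    ∀ ξ, g (D ξ) = D' (g ξ)

variable {M}

theorem Conjugate.symm {D D' : Module.End ℂ M.E} (h : M.Conjugate D D') : M.Conjugate D' D := by
  obtain ⟨g, h1, h2, h3⟩ := h
  refine ⟨g.symm, fun ξ => ?_, fun ξ => ?_, fun ξ => ?_⟩ <;> apply g.injective
  · rw [h1]; simp
  · rw [h2]; simp
  · rw [h3]; simp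

theorem Conjugate.trans {D D' D'' : Module.End ℂ M.E} (h : M.Conjugate D D')
    (h' : M.Conjugate D' D'') : M.Conjugate D D'' := by
  obtain ⟨g, h1, h2, h3⟩ := h
  obtain ⟨g', h1', h2', h3'⟩ := h'
  refine ⟨g.trans g', fun ξ => ?_, fun ξ => ?_, fun ξ => ?_⟩
  · simp [h1, h1']
  · simp [h2, h2']
  · simp [h3, h3']

end TorusModule

/-! ### Conjugacy classes of translates and their dependence on the structure. -/

namespace CommutantModel

open TorusModule

variable {θ : ℝ} {M : TorusModule θ} {c κ ϑ : ℝ} (S : CommutantModel M c κ ϑ)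

include S in
theorem isStandard_translated (τ : ℂ) (r : ℝ × ℝ) : M.IsStandard c τ (M.translated τ r) := by
  have h := S.connection
  have hz : ∀ x : ℝ, conj (2 * Real.pi * Complex.I * x : ℂ) = -(2 * Real.pi * Complex.I * x) :=
    fun x => by simp [Complex.conj_ofNat]
  refine ⟨_, _, ⟨fun ξ => ?_, fun ξ => ?_, fun ξ => ?_, fun ξ => ?_, fun ξ η => ?_, fun ξ η => ?_,
    fun ξ => ?_⟩, rfl⟩
  · simp only [LinearMap.add_apply, LinearMap.smul_apply, LinearMap.id_apply, map_add, map_smul,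
      h.leibniz₁₁]
    abel
  · simp only [LinearMap.add_apply, LinearMap.smul_apply, LinearMap.id_apply, map_add, map_smul,
      h.leibniz₁₂]
  · simp only [LinearMap.add_apply, LinearMap.smul_apply, LinearMap.id_apply, map_add, map_smul,
      h.leibniz₂₁]
  · simp only [LinearMap.add_apply, LinearMap.smul_apply, LinearMap.id_apply, map_add, map_smul,
      h.leibniz₂₂]
    abel
  · simp only [LinearMap.add_apply, LinearMap.smul_apply, LinearMap.id_apply, S.herm_add,
      S.herm_add_left, S.herm_smul, S.herm_smul_left, h.skew₁, hz]
    ring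
  · simp only [LinearMap.add_apply, LinearMap.smul_apply, LinearMap.id_apply, S.herm_add,
      S.herm_add_left, S.herm_smul, S.herm_smul_left, h.skew₂, hz]
    ring
  · simp only [LinearMap.add_apply, LinearMap.smul_apply, LinearMap.id_apply, map_add, map_smul]
    rw [← h.curvature]
    module

/-- A unitary sequence acts by an automorphism. -/
def unitaryEquiv (v : RapidSeq) (hv : IsUnitary ϑ v) : M.E ≃L[ℂ] M.E where
  toFun := S.rho v
  invFun := S.rho (adj ϑ v)
  map_add' := map_add _
  map_smul' := map_smul _
  left_inv ξ := by rw [S.rho_mul, hv.1, S.rho_single_zero]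
  right_inv ξ := by rw [S.rho_mul, hv.2, S.rho_single_zero]
  continuous_toFun := S.rho_continuous v
  continuous_invFun := S.rho_continuous _

include S in
theorem exists_gauge_translated (hκ : κ ≠ 0) {τ : ℂ} {D : Module.End ℂ M.E}
    (hD : M.IsStandard c τ D) : ∃ (v : RapidSeq) (r : ℝ × ℝ), IsUnitary ϑ v ∧
      ∀ ξ, D (S.rho v ξ) = S.rho v (M.translated τ r ξ) := by
  obtain ⟨D₁, D₂, hc, rfl⟩ := hD
  obtain ⟨v, r₁, r₂, hv, h1, h2⟩ := S.exists_gauge hκ hc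
  refine ⟨v, (r₁, r₂), hv, fun ξ => ?_⟩
  simp only [LinearMap.add_apply, LinearMap.smul_apply, h1, h2, translated_apply, map_add, map_smul]
  module

theorem conjugate_of_isUnitary {v : RapidSeq} (hv : IsUnitary ϑ v) {D D' : Module.End ℂ M.E}
    (h : ∀ ξ, D' (S.rho v ξ) = S.rho v (D ξ)) : M.Conjugate D D' :=
  ⟨S.unitaryEquiv v hv, S.rho_U₁ v, S.rho_U₂ v, fun ξ => (h ξ).symm⟩

include S in
theorem exists_conjugate_translated (hκ : κ ≠ 0) {τ : ℂ} {D : Module.End ℂ M.E}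
    (hD : M.IsStandard c τ D) : ∃ r, M.Conjugate (M.translated τ r) D := by
  obtain ⟨v, r, hv, h⟩ := S.exists_gauge_translated hκ hD
  exact ⟨r, S.conjugate_of_isUnitary hv h⟩

/-- In the basis `W_q` the commutator with the reference connection is diagonal, so an intertwining
relation becomes a scalar equation for each `q`. The defect `t` is kept so that the same identity
serves exact intertwiners (`t = 0`) and approximate ones. -/
theorem translated_rho (τ : ℂ) (r r' : ℝ × ℝ) {y t : RapidSeq}
    (h : ∀ ξ, M.translated τ r (S.rho y ξ) = S.rho y (M.translated τ r' ξ) + S.rho t ξ)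
    (q : ℤ × ℤ) : t.1 q = 2 * Real.pi * Complex.I * (τ * ((κ * q.1 + r.1 - r'.1 : ℝ) : ℂ) +
      ((κ * q.2 + r.2 - r'.2 : ℝ) : ℂ)) * y.1 q := by
  have ht : t = τ • ((κ : ℂ) • nabla₁ y) + (κ : ℂ) • nabla₂ y + (2 * Real.pi * Complex.I *
      (τ * (r.1 - r'.1) + (r.2 - r'.2))) • y := S.rho_injective fun ξ => by
    have h1 := h ξ
    rw [translated_apply, translated_apply, S.rho_nabla₁, S.rho_nabla₂, map_add, map_add, map_smul,
      map_smul] at h1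
    simp only [S.rho_add, S.rho_smul] at h1 ⊢
    rw [← sub_eq_iff_eq_add'] at h1
    rw [← h1]
    module
  rw [ht]
  simp only [Submodule.coe_add, Submodule.coe_smul, Pi.add_apply, Pi.smul_apply, smul_eq_mul,
    nabla₁_coe, nabla₂_coe]
  push_cast
  ring

/-- The role of `Im τ ≠ 0`: one complex equation contains both real ones, so the holomorphic
structure remembers both translations. -/
theorem eq_zero_of_mul_add_eq_zero {τ : ℂ} (hτ : τ.im ≠ 0) {x y : ℝ}
    (h : τ * (x : ℂ) + (y : ℂ) = 0) : x = 0 ∧ y = 0 := by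
  have h1 := congrArg Complex.im h
  simp only [Complex.add_im, Complex.im_mul_ofReal, Complex.ofReal_im, add_zero, Complex.zero_im,
    mul_eq_zero, hτ, false_or] at h1
  subst h1
  exact ⟨rfl, by simpa using h⟩

include S in
-- An isomorphism commutes with `U₁, U₂` and is continuous, so it is some `ρ(y)` with `y ≠ 0`; any
-- `q` in the support of `y` is the required lattice vector.
theorem exists_lattice_of_conjugate {τ : ℂ} (hτ : τ.im ≠ 0) {r r' : ℝ × ℝ}
    (h : M.Conjugate (M.translated τ r') (M.translated τ r)) :
    ∃ q : ℤ × ℤ, κ * q.1 + r.1 - r'.1 = 0 ∧ κ * q.2 + r.2 - r'.2 = 0 := by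
  obtain ⟨g, h1, h2, h3⟩ := h
  obtain ⟨y, hy⟩ := S.commutant g.toLinearMap h1 h2
    (fun ξ => (S.herm_continuous ξ).comp g.continuous)
  have hg : ∀ ξ, S.rho y ξ = g ξ := fun ξ => by rw [← hy]; rfl
  have hy0 : y ≠ 0 := by
    rintro rfl
    have h0 : ∀ ξ : M.E, ξ = 0 := fun ξ => by
      apply g.injective
      rw [← hg, map_zero]
      have := S.rho_smul 0 0 ξ
      simpa using this
    have h5 : single 0 = (0 : RapidSeq) := S.rho_eq_zero fun ξ => h0 _
    have := congrArg (fun z : RapidSeq => z.1 0) h5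
    simp [single_apply] at this
  have hk := S.translated_rho τ r r' (y := y) (t := 0) fun ξ => by
    have h6 : S.rho (0 : RapidSeq) ξ = 0 := by
      have := S.rho_smul 0 0 ξ
      simpa using this
    rw [hg, hg, h6, add_zero, h3]
  obtain ⟨q, hq⟩ : ∃ q, y.1 q ≠ 0 := by
    by_contra hcon
    push Not at hcon
    exact hy0 (Subtype.ext (funext hcon))
  have h7 := hk q
  simp only [Submodule.coe_zero, Pi.zero_apply] at h7
  have h8 := (mul_eq_zero.mp h7.symm).resolve_right hq
  exact ⟨q, eq_zero_of_mul_add_eq_zero hτ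
    ((mul_eq_zero.mp h8).resolve_left Complex.two_pi_I_ne_zero)⟩

include S in
theorem isUnitary_single (q : ℤ × ℤ) : IsUnitary ϑ (single q) := by
  have h : ∀ ξ, S.rho (adj ϑ (single q)) ξ = twist ϑ q q • S.W (-q) ξ := fun ξ => by
    refine S.eq_of_herm fun η => ?_
    rw [← S.rho_adj, S.rho_single, S.W_adj, S.herm_smul]
  have e1 : twist ϑ q q * twist ϑ (-q) q = 1 := twist_mul_twist_neg ϑ q q
  constructor
  · refine S.rho_injective fun ξ => ?_
    rw [← S.rho_mul, h, S.rho_single, S.W_mul, smul_smul, e1, one_smul, neg_add_cancel, S.W_zero,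
      S.rho_single_zero]
  · refine S.rho_injective fun ξ => ?_
    rw [← S.rho_mul, h, S.rho_single, map_smul, S.W_mul, smul_smul, twist_neg_right, e1, one_smul,
      add_neg_cancel, S.W_zero, S.rho_single_zero]

include S in
theorem conjugate_translated_of_lattice (τ : ℂ) {r r' : ℝ × ℝ} {q : ℤ × ℤ}
    (h₁ : κ * q.1 + r.1 - r'.1 = 0) (h₂ : κ * q.2 + r.2 - r'.2 = 0) :
    M.Conjugate (M.translated τ r') (M.translated τ r) := by
  refine S.conjugate_of_isUnitary (S.isUnitary_single q) fun ξ => ?_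
  have e1 : r'.1 = κ * q.1 + r.1 := by linarith
  have e2 : r'.2 = κ * q.2 + r.2 := by linarith
  rw [S.rho_single, S.rho_single, translated_apply, translated_apply, map_add, map_add, map_smul,
    map_smul, S.W_nabla₁, S.W_nabla₂, e1, e2]
  push_cast
  module

include S in
theorem tsum_norm_sq_conv_isUnitary {v : RapidSeq} (hv : IsUnitary ϑ v) (t : RapidSeq) :
    ∑' q, ‖(conv ϑ (adj ϑ v) t).1 q‖ ^ 2 = ∑' q, ‖t.1 q‖ ^ 2 := by
  have h : conv ϑ (adj ϑ (conv ϑ (adj ϑ v) t)) (conv ϑ (adj ϑ v) t) = conv ϑ (adj ϑ t) t :=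
    S.rho_injective fun η => S.eq_of_herm fun ξ => by
      rw [← S.rho_mul, ← S.rho_adj, ← S.rho_mul, ← S.rho_mul, ← S.rho_mul, S.rho_adj, adj_adj,
        S.rho_mul v, hv.2, S.rho_single_zero, S.rho_adj]
  have h2 := conv_adj_self_zero ϑ (conv ϑ (adj ϑ v) t)
  rw [h, conv_adj_self_zero] at h2
  exact (Complex.ofReal_injective h2).symm

theorem tsum_norm_sq_isUnitary {v : RapidSeq} (hv : IsUnitary ϑ v) : ∑' q, ‖v.1 q‖ ^ 2 = 1 := by
  have h2 := conv_adj_self_zero ϑ v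
  rw [hv.1, single_apply, if_pos rfl] at h2
  exact_mod_cast h2.symm

/-- An averaging argument: the `‖y q‖²` are probability weights, and `∑ ‖t q‖²` is the mean of `‖x
q‖²`, so some value lies below any strict upper bound of the mean. -/
theorem exists_norm_lt {x : ℤ × ℤ → ℂ} {y t : RapidSeq} (hy : ∑' q, ‖y.1 q‖ ^ 2 = 1)
    (ht : ∀ q, t.1 q = x q * y.1 q) {B : ℝ} (hB : ∑' q, ‖t.1 q‖ ^ 2 < B) :
    ∃ q, ‖x q‖ ^ 2 < B := by
  by_contra hcon
  push Not at hcon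
  have h : ∑' q, B * ‖y.1 q‖ ^ 2 ≤ ∑' q, ‖t.1 q‖ ^ 2 := by
    refine Summable.tsum_le_tsum (fun q => ?_) ((summable_norm_sq y).mul_left B)
      (summable_norm_sq t)
    rw [ht, norm_mul, mul_pow]
    exact mul_le_mul_of_nonneg_right (hcon q) (by positivity)
  rw [tsum_mul_left, hy, mul_one] at h
  linarith

/-- The quantitative form of the injectivity of `(x, y) ↦ τx + y` on real pairs. The imaginary part
controls `x`, and then `y` is estimated from what is left; the factor `2(1 + ‖τ‖)` makes both errors
fit into `δ`. -/
theorem exists_bound_of_norm_mul_add_lt {τ : ℂ} (hτ : τ.im ≠ 0) {δ : ℝ} (hδ : 0 < δ) :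
    ∃ η > 0, ∀ x y : ℝ, ‖τ * (x : ℂ) + (y : ℂ)‖ < η → |x| < δ ∧ |y| < δ := by
  have hi : 0 < |τ.im| := abs_pos.mpr hτ
  refine ⟨min (|τ.im| * (δ / (2 * (1 + ‖τ‖)))) (δ / 2), by positivity, fun x y h => ?_⟩
  have hn : (0 : ℝ) < 1 + ‖τ‖ := by positivity
  have h1 : |τ.im| * |x| ≤ ‖τ * (x : ℂ) + (y : ℂ)‖ := by
    have := Complex.abs_im_le_norm (τ * (x : ℂ) + (y : ℂ))
    rwa [Complex.add_im, Complex.im_mul_ofReal, Complex.ofReal_im, add_zero, abs_mul] at this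
  have hx : |x| < δ / (2 * (1 + ‖τ‖)) :=
    lt_of_mul_lt_mul_left (h1.trans_lt (h.trans_le (min_le_left _ _))) hi.le
  have hx' : |x| * (2 * (1 + ‖τ‖)) < δ := (lt_div_iff₀ (by positivity)).mp hx
  have hxτ : ‖τ‖ * |x| < δ / 2 := by nlinarith [abs_nonneg x, norm_nonneg τ]
  refine ⟨by nlinarith [abs_nonneg x, norm_nonneg τ], ?_⟩
  have h2 : |y| ≤ ‖τ * (x : ℂ) + (y : ℂ)‖ + ‖τ‖ * |x| := by
    have h3 : ((y : ℝ) : ℂ) = (τ * (x : ℂ) + (y : ℂ)) - τ * (x : ℂ) := by ring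
    have h4 : ‖((y : ℝ) : ℂ)‖ = |y| := Complex.norm_real y
    rw [← h4, h3]
    refine (norm_sub_le _ _).trans (le_of_eq ?_)
    rw [norm_mul, Complex.norm_real, Real.norm_eq_abs]
    simp
  linarith [h.trans_le (min_le_right _ _)]

include S in
/-- The class of a standard holomorphic structure depends continuously on the structure. -/
theorem eventually_close (hκ : κ ≠ 0) {τ : ℂ} (hτ : τ.im ≠ 0) {ι : Type*} {l : Filter ι}
    {F : ι → Module.End ℂ M.E} {D : Module.End ℂ M.E} (hD : M.IsStandard c τ D)
    (hF : ∀ i, M.IsStandard c τ (F i))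
    (hl : ∀ ξ, Filter.Tendsto (fun i => F i ξ) l (nhds (D ξ))) {r₀ : ℝ × ℝ}
    (h₀ : M.Conjugate (M.translated τ r₀) D) {δ : ℝ} (hδ : 0 < δ) :
    ∀ᶠ i in l, ∀ r, M.Conjugate (M.translated τ r) (F i) →
      ∃ q : ℤ × ℤ, |κ * q.1 + r.1 - r₀.1| < δ ∧ |κ * q.2 + r.2 - r₀.2| < δ := by
  have := S.topAddGroup
  obtain ⟨u, s, hu, hus⟩ := S.exists_gauge_translated hκ hD
  obtain ⟨η, hη, hη'⟩ := exists_bound_of_norm_mul_add_lt hτ hδ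
  obtain ⟨q₀, hq₀⟩ := S.exists_lattice_of_conjugate hτ (h₀.trans (S.conjugate_of_isUnitary hu hus).symm)
  set B : ℝ := (2 * Real.pi * η) ^ 2
  have hB : 0 < B := by have := Real.pi_pos; positivity
  -- Only the finitely many vectors `ρ(u) χ_j` are tested, so pointwise convergence is enough,
  -- without any uniformity.
  have hsmall : Filter.Tendsto (fun i => ∑ j, M.herm ((F i - D) (S.rho u (S.frame j)))
      ((F i - D) (S.rho u (S.frame j)))) l (nhds 0) := by
    rw [← Finset.sum_const_zero (s := (Finset.univ : Finset (Fin S.frameSize)))]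
    refine tendsto_finsetSum _ fun j _ => S.herm_diag.comp ?_
    have h1 := (hl (S.rho u (S.frame j))).sub_const (D (S.rho u (S.frame j)))
    rwa [sub_self] at h1
  have hev := (Metric.tendsto_nhds.mp hsmall) (S.density * B) (mul_pos S.density_pos hB)
  filter_upwards [hev] with i hi r hr
  obtain ⟨v, s', hv, hvs⟩ := S.exists_gauge_translated hκ (hF i)
  obtain ⟨q₁, hq₁⟩ := S.exists_lattice_of_conjugate hτ
    ((S.conjugate_of_isUnitary hv hvs).trans hr.symm)
  -- Although `F i - D` need not be skew, it is a complex combination of differences of connections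
  -- and lies in the commutant.
  obtain ⟨b, hb⟩ : ∃ b, ∀ ξ, F i ξ = D ξ + S.rho b ξ := by
    obtain ⟨D₁, D₂, hDc, hDe⟩ := hD
    obtain ⟨F₁, F₂, hFc, hFe⟩ := hF i
    obtain ⟨⟨a₁, ha₁, -⟩, ⟨a₂, ha₂, -⟩⟩ := S.exists_symbol hDc
    obtain ⟨⟨a₁', ha₁', -⟩, ⟨a₂', ha₂', -⟩⟩ := S.exists_symbol hFc
    refine ⟨τ • (a₁' - a₁) + (a₂' - a₂), fun ξ => ?_⟩
    rw [hDe, hFe, S.rho_add, S.rho_smul, S.rho_sub, S.rho_sub]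
    simp only [LinearMap.add_apply, LinearMap.smul_apply, ha₁, ha₂, ha₁', ha₂']
    module
  set t := conv ϑ b u
  have ht : ∀ ξ, (F i - D) (S.rho u ξ) = S.rho t ξ := fun ξ => by
    rw [LinearMap.sub_apply, hb, add_sub_cancel_left, S.rho_mul]
  simp only [ht, S.sum_herm_rho_frame_self, dist_zero_right, Complex.norm_real] at hi
  have hi' : ∑' q, ‖t.1 q‖ ^ 2 < B :=
    lt_of_mul_lt_mul_left ((le_abs_self _).trans_lt hi) S.density_pos.le
  have hi2 : ∑' q, ‖(conv ϑ (adj ϑ v) t).1 q‖ ^ 2 < B := by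
    rwa [S.tsum_norm_sq_conv_isUnitary hv]
  have hy : ∑' q, ‖(conv ϑ (adj ϑ v) u).1 q‖ ^ 2 = 1 := by
    rw [S.tsum_norm_sq_conv_isUnitary hv, tsum_norm_sq_isUnitary hu]
  -- The unitaries `u` and `v` carry `D` and `F i` to the translates by `s` and `s'`, so `v*u`
  -- intertwines these translates up to the defect `v*(F i - D)u`. The defect has small `ℓ²` norm
  -- and `v*u` has norm one.
  have hrel := S.translated_rho τ s' s (y := conv ϑ (adj ϑ v) u) (t := conv ϑ (adj ϑ v) t)
    fun ξ => by
      have h1 : ∀ ξ, S.rho v (S.rho (adj ϑ v) ξ) = ξ := fun ξ => by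
        rw [S.rho_mul, hv.2, S.rho_single_zero]
      have h2 : ∀ ξ, S.rho (adj ϑ v) (S.rho v ξ) = ξ := fun ξ => by
        rw [S.rho_mul, hv.1, S.rho_single_zero]
      rw [← S.rho_mul, ← S.rho_mul, ← S.rho_mul, ← h2 (M.translated τ s' _), ← hvs, h1, ← ht,
        ← map_add, ← hus, LinearMap.sub_apply, add_sub_cancel]
  obtain ⟨q, hq⟩ := exists_norm_lt hy hrel hi2
  rw [norm_mul, mul_pow, ← mul_pow] at hq
  have hq' := lt_of_pow_lt_pow_left₀ 2 (by have := Real.pi_pos; positivity) hq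
  rw [norm_mul, norm_mul, Complex.norm_I, mul_one, Complex.norm_real,
    Real.norm_of_nonneg Real.pi_pos.le, Complex.norm_ofNat] at hq'
  have hq'' := lt_of_mul_lt_mul_left hq' (by have := Real.pi_pos; positivity)
  obtain ⟨hx1, hx2⟩ := hη' _ _ hq''
  -- `q₀` accounts for `s` against `r₀`, `q₁` for `r` against `s'`, and `q` for the near coincidence
  -- of `s` and `s'`.
  refine ⟨q + q₀ + q₁, ?_, ?_⟩
  · convert hx1 using 2
    push_cast [Prod.fst_add]
    linarith [hq₀.1, hq₁.1]
  · convert hx2 using 2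
    push_cast [Prod.snd_add]
    linarith [hq₀.2, hq₁.2]

end CommutantModel

end

noncomputable section

open FreeModule RapidSeq

/-! ## Topologies of uniform convergence -/

section SupTopology

variable {E X : Type*} {ι : Sort*} [AddCommGroup E] [Module ℂ E]

/-- The topology on `E` of uniform convergence of all the `φ i`. -/
@[reducible]
def supTopology (φ : ι → E →ₗ[ℂ] (X → ℂ)) : TopologicalSpace E :=
  ⨅ i, TopologicalSpace.induced (fun a => UniformFun.ofFun (φ i a)) inferInstance

theorem tendsto_supTopology {φ : ι → E →ₗ[ℂ] (X → ℂ)} {β : Type*} {l : Filter β} {F : β → E}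
    {a : E} : Filter.Tendsto F l (@nhds E (supTopology φ) a) ↔
      ∀ i, ∀ ε > 0, ∀ᶠ n in l, ∀ x, ‖φ i (F n) x - φ i a x‖ < ε := by
  unfold supTopology
  rw [nhds_iInf, Filter.tendsto_iInf]
  refine forall_congr' fun i => ?_
  rw [nhds_induced, Filter.tendsto_comap_iff, UniformFun.tendsto_iff_tendstoUniformly,
    Metric.tendstoUniformly_iff]
  refine forall₂_congr fun ε hε => ?_
  refine Filter.eventually_congr (Filter.Eventually.of_forall fun n => forall_congr' fun x => ?_)
  rw [dist_comm, dist_eq_norm]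
  rfl

theorem isTopologicalAddGroup_supTopology (φ : ι → E →ₗ[ℂ] (X → ℂ)) :
    @IsTopologicalAddGroup E (supTopology φ) _ :=
  topologicalAddGroup_iInf fun i => topologicalAddGroup_induced
    (G := UniformFun X ℂ) ((φ i).toAddMonoidHom : E →+ UniformFun X ℂ)

theorem continuousSMul_supTopology {φ : ι → E →ₗ[ℂ] (X → ℂ)}
    (h : ∀ i a, ∃ C : ℝ, ∀ x, ‖φ i a x‖ ≤ C) :
    @ContinuousSMul ℂ E _ _ (supTopology φ) := by
  refine continuousSMul_iInf fun i => ?_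
  let : TopologicalSpace E :=
    TopologicalSpace.induced (fun a => UniformFun.ofFun (φ i a)) inferInstance
  refine UniformFun.continuousSMul_induced_of_range_bounded ℂ X ℂ E (φ i) ⟨rfl⟩ fun u => ?_
  obtain ⟨C, hC⟩ := h i u
  rw [NormedSpace.isVonNBounded_iff']
  exact ⟨C, by rintro _ ⟨x, rfl⟩; exact hC x⟩

/-- A linear map into a topology of uniform convergence is continuous if it is bounded by functions
that are small near zero. -/
theorem continuous_supTopology {φ : ι → E →ₗ[ℂ] (X → ℂ)} {F : Type*} [AddCommGroup F] [Module ℂ F]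
    [TopologicalSpace F] [IsTopologicalAddGroup F] (T : F →ₗ[ℂ] E)
    (h : ∀ i, ∃ g : F → ℝ, Filter.Tendsto g (nhds 0) (nhds 0) ∧ ∀ a x, ‖φ i (T a) x‖ ≤ g a) :
    @Continuous F E _ (supTopology φ) T := by
  let _ := supTopology φ
  have := isTopologicalAddGroup_supTopology φ
  refine continuous_of_continuousAt_zero T ?_
  rw [ContinuousAt, map_zero]
  refine tendsto_supTopology.mpr fun i ε hε => ?_
  obtain ⟨g, hg, hb⟩ := h i
  filter_upwards [hg.eventually (gt_mem_nhds hε)] with a ha x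
  rw [map_zero, Pi.zero_apply, sub_zero]
  exact (hb a x).trans_lt ha

/-- The supremum of `φ a`. -/
def supBound (φ : E →ₗ[ℂ] (X → ℂ)) (a : E) : ℝ := ⨆ x, ‖φ a x‖

theorem le_supBound {φ : E →ₗ[ℂ] (X → ℂ)} {a : E} (h : ∃ C : ℝ, ∀ x, ‖φ a x‖ ≤ C) (x : X) :
    ‖φ a x‖ ≤ supBound φ a := by
  obtain ⟨C, hC⟩ := h
  exact le_ciSup (f := fun x => ‖φ a x‖) ⟨C, by rintro _ ⟨y, rfl⟩; exact hC y⟩ x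

theorem supBound_nonneg (φ : E →ₗ[ℂ] (X → ℂ)) (a : E) : 0 ≤ supBound φ a :=
  Real.iSup_nonneg fun _ => norm_nonneg _

theorem tendsto_supBound (φ : ι → E →ₗ[ℂ] (X → ℂ)) (i : ι) :
    Filter.Tendsto (supBound (φ i)) (@nhds E (supTopology φ) 0) (nhds 0) := by
  let _ := supTopology φ
  rw [Metric.tendsto_nhds]
  intro ε hε
  have h := tendsto_supTopology.mp (Filter.tendsto_id (α := E) (x := nhds 0)) i (ε / 2) (half_pos hε)
  filter_upwards [h] with a ha
  rw [dist_zero_right, Real.norm_eq_abs, abs_of_nonneg (supBound_nonneg _ _)]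
  refine lt_of_le_of_lt (Real.iSup_le (fun x => ?_) (half_pos hε).le) (half_lt_self hε)
  simpa using (ha x).le

end SupTopology
end

noncomputable section

open FreeModule RapidSeq

/-! ## The commutant of the free module of rank one -/

namespace FreeModule

/-- The map `a ↦ (p ↦ (1 + |p|)^k a p)`. -/
def weightMap (k : ℕ) : Space →ₗ[ℂ] (ℤ × ℤ → ℂ) where
  toFun a p := (weight p ^ k : ℂ) * a.1 p
  map_add' a b := by ext p; simp [mul_add]
  map_smul' c a := by ext p; simp [mul_left_comm]

theorem norm_weightMap (k : ℕ) (a : Space) (p : ℤ × ℤ) :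
    ‖weightMap k a p‖ = weight p ^ k * ‖a.1 p‖ := by
  simp [weightMap, abs_of_nonneg (weight_nonneg p)]

theorem weightMap_bounded (k : ℕ) (a : Space) : ∃ C : ℝ, ∀ p, ‖weightMap k a p‖ ≤ C := by
  obtain ⟨C, hC⟩ := a.2 k
  exact ⟨C, fun p => by rw [norm_weightMap]; exact hC p⟩

instance : IsTopologicalAddGroup Space := isTopologicalAddGroup_supTopology weightMap

instance : ContinuousSMul ℂ Space := continuousSMul_supTopology weightMap_bounded

theorem continuous_into {F : Type*} [AddCommGroup F] [Module ℂ F]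
    [TopologicalSpace F] [IsTopologicalAddGroup F] (T : F →ₗ[ℂ] Space)
    (h : ∀ k : ℕ, ∃ g : F → ℝ, Filter.Tendsto g (nhds 0) (nhds 0) ∧
      ∀ a p, weight p ^ k * ‖(T a).1 p‖ ≤ g a) : Continuous T :=
  continuous_supTopology (φ := weightMap) T fun k => by
    obtain ⟨g, hg, hb⟩ := h k
    exact ⟨g, hg, fun a p => by rw [norm_weightMap]; exact hb a p⟩

/-- The seminorm `sup_p (1 + |p|)^k |a p|`. -/
def supNorm (k : ℕ) (a : Space) : ℝ := supBound (weightMap k) a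

theorem le_supNorm (k : ℕ) (a : Space) (p : ℤ × ℤ) : weight p ^ k * ‖a.1 p‖ ≤ supNorm k a := by
  rw [← norm_weightMap]
  exact le_supBound (weightMap_bounded k a) p

theorem supNorm_nonneg (k : ℕ) (a : Space) : 0 ≤ supNorm k a := supBound_nonneg _ _

theorem tendsto_supNorm (k : ℕ) : Filter.Tendsto (supNorm k) (nhds (0 : Space)) (nhds 0) :=
  tendsto_supBound weightMap k

theorem norm_le_supNorm (a : Space) (p : ℤ × ℤ) : ‖a.1 p‖ ≤ supNorm 0 a := by
  simpa using le_supNorm 0 a p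

theorem hasSum_single (a : Space) : HasSum (fun p => a.1 p • single p) a := by
  refine (tendsto_supTopology (φ := weightMap) (a := a)).mpr fun k ε hε => ?_
  have h := (summable_weight_mul a k).tendsto_cofinite_zero.eventually (gt_mem_nhds hε)
  have hfin : {p | ¬ weight p ^ k * ‖a.1 p‖ < ε}.Finite := Filter.eventually_cofinite.mp h
  filter_upwards [Filter.eventually_ge_atTop hfin.toFinset] with s hs x
  rw [← Pi.sub_apply, ← map_sub, norm_weightMap]
  have hv : (∑ p ∈ s, a.1 p • single p).1 x = if x ∈ s then a.1 x else 0 := by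
    simp [single_apply, Finset.sum_ite_eq, AddSubmonoidClass.coe_finsetSum, Finset.sum_apply]
  rw [AddSubgroupClass.coe_sub, Pi.sub_apply, hv]
  split_ifs with hx
  · simpa using hε
  · rw [zero_sub, norm_neg]
    by_contra hc
    exact hx (hs (hfin.mem_toFinset.mpr hc))

theorem conv_single (ϑ : ℝ) (q : ℤ × ℤ) (b : Space) (p : ℤ × ℤ) :
    (conv ϑ (single q) b).1 p = twist ϑ q (p - q) * b.1 (p - q) := by
  rw [conv_apply, tsum_eq_single q (fun r hr => by simp [single_apply, hr])]
  simp [single_apply]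

theorem U₁_apply (a : Space) (p : ℤ × ℤ) : (U₁ a).1 p = a.1 (p - (1, 0)) := by
  simp [U₁]

theorem U₂_apply (θ : ℝ) (a : Space) (p : ℤ × ℤ) :
    (U₂ θ a).1 p = twist θ p (0, 1) * a.1 (p - (0, 1)) := by
  simp [U₂, twist]

theorem conv_U₁ (θ : ℝ) (c a : Space) : conv θ c (U₁ a) = U₁ (conv θ c a) := by
  ext p
  rw [U₁_apply, conv_apply, conv_apply]
  refine tsum_congr fun q => ?_
  rw [U₁_apply, show p - q - (1, 0) = p - (1, 0) - q by abel]
  congr 2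
  simp [twist]

theorem conv_U₂ (θ : ℝ) (c a : Space) : conv θ c (U₂ θ a) = U₂ θ (conv θ c a) := by
  ext p
  rw [U₂_apply, conv_apply, conv_apply, ← tsum_mul_left]
  refine tsum_congr fun q => ?_
  have h : twist θ q (p - q) * twist θ (p - q) (0, 1) =
      twist θ p (0, 1) * twist θ q (p - (0, 1) - q) := by
    unfold twist; rw [← Complex.exp_add, ← Complex.exp_add]; congr 1
    push_cast [Prod.fst_sub, Prod.snd_sub]; ring
  rw [U₂_apply, show p - q - (0, 1) = p - (0, 1) - q by abel]
  linear_combination (c.1 q * a.1 (p - (0, 1) - q)) * h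

theorem continuous_conv (ϑ : ℝ) (a : Space) : Continuous (conv ϑ a) :=
  continuous_into _ fun k => ⟨fun b => (∑' q, weight q ^ k * ‖a.1 q‖) * supNorm k b, by
    simpa using (tendsto_supNorm k).const_mul (∑' q, weight q ^ k * ‖a.1 q‖),
    fun b p => weight_mul_convFun_le ϑ a k (le_supNorm k b) p⟩

theorem summable_conj_mul (a b : Space) : Summable fun p => conj (a.1 p) * b.1 p := by
  refine Summable.of_norm_bounded (g := fun p => ‖a.1 p‖ * supNorm 0 b)
    ((summable_norm a).mul_right _) fun p => ?_
  rw [norm_mul, RCLike.norm_conj]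
  exact mul_le_mul_of_nonneg_left (norm_le_supNorm _ p) (norm_nonneg _)

/-- The Hermitian form on rapidly decreasing sequences. -/
def pairing (a : Space) : Space →ₗ[ℂ] ℂ where
  toFun b := ∑' p, conj (a.1 p) * b.1 p
  map_add' b c := by
    rw [← (summable_conj_mul a b).tsum_add (summable_conj_mul a c)]
    exact tsum_congr fun p => by simp [mul_add]
  map_smul' c b := by
    rw [RingHom.id_apply, smul_eq_mul, ← tsum_mul_left]
    exact tsum_congr fun p => by simp [mul_left_comm]

theorem pairing_apply (a b : Space) : pairing a b = ∑' p, conj (a.1 p) * b.1 p := rfl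

theorem norm_pairing_le (a b : Space) : ‖pairing a b‖ ≤ (∑' p, ‖a.1 p‖) * supNorm 0 b := by
  rw [← tsum_mul_right]
  refine tsum_of_norm_bounded (((summable_norm a).mul_right _).hasSum) fun p => ?_
  rw [norm_mul, RCLike.norm_conj]
  exact mul_le_mul_of_nonneg_left (norm_le_supNorm _ p) (norm_nonneg _)

theorem continuous_pairing (a : Space) : Continuous (pairing a) := by
  refine continuous_of_continuousAt_zero (pairing a) ?_
  rw [ContinuousAt, map_zero]
  refine squeeze_zero_norm (norm_pairing_le a) ?_
  simpa using (tendsto_supNorm 0).const_mul (∑' p, ‖a.1 p‖)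

theorem tendsto_pairing_self :
    Filter.Tendsto (fun a : Space => pairing a a) (nhds 0) (nhds 0) := by
  have hb : ∀ a : Space, ‖pairing a a‖ ≤ (∑' p, (weight p ^ 4)⁻¹) * (supNorm 4 a * supNorm 0 a) := by
    intro a
    rw [← tsum_mul_right]
    refine tsum_of_norm_bounded ((summable_inv_weight_pow_four.mul_right _).hasSum) fun p => ?_
    rw [norm_mul, RCLike.norm_conj, ← div_eq_inv_mul, le_div_iff₀ (pow_pos (weight_pos p) 4)]
    calc ‖a.1 p‖ * ‖a.1 p‖ * weight p ^ 4 = (weight p ^ 4 * ‖a.1 p‖) * ‖a.1 p‖ := by ring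
      _ ≤ supNorm 4 a * supNorm 0 a := mul_le_mul (le_supNorm 4 a p) (norm_le_supNorm a p)
          (norm_nonneg _) (supNorm_nonneg _ _)
  refine squeeze_zero_norm hb ?_
  simpa using ((tendsto_supNorm 4).mul (tendsto_supNorm 0)).const_mul
    (∑' p, (weight p ^ 4)⁻¹)

theorem pairing_conv (ϑ : ℝ) (c a b : Space) :
    pairing a (conv ϑ c b) = ∑' q, c.1 q * pairing a (conv ϑ (single q) b) := by
  have hac : Summable fun x : (ℤ × ℤ) × (ℤ × ℤ) => ‖a.1 x.1‖ * ‖c.1 x.2‖ :=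
    (summable_norm a).mul_of_nonneg (summable_norm c) (fun _ => norm_nonneg _)
      (fun _ => norm_nonneg _)
  have hs : Summable (Function.uncurry fun p q : ℤ × ℤ =>
      conj (a.1 p) * (c.1 q * (twist ϑ q (p - q) * b.1 (p - q)))) := by
    refine Summable.of_norm_bounded (hac.mul_right (supNorm 0 b)) (fun x => ?_)
    simp only [Function.uncurry]
    rw [norm_mul, norm_mul, norm_mul, norm_twist, one_mul, RCLike.norm_conj, ← mul_assoc]
    exact mul_le_mul_of_nonneg_left (norm_le_supNorm _ _) (by positivity)
  calc pairing a (conv ϑ c b)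
      = ∑' p, ∑' q, conj (a.1 p) * (c.1 q * (twist ϑ q (p - q) * b.1 (p - q))) :=
        tsum_congr fun p => by rw [conv_apply, tsum_mul_left]
    _ = ∑' q, ∑' p, conj (a.1 p) * (c.1 q * (twist ϑ q (p - q) * b.1 (p - q))) :=
        hs.tsum_comm.symm
    _ = _ := tsum_congr fun q => by
        rw [pairing_apply, ← tsum_mul_left]
        exact tsum_congr fun p => by rw [conv_single]; ring

theorem pairing_single (p : ℤ × ℤ) (a : Space) : pairing (single p) a = a.1 p := by
  rw [pairing_apply, tsum_eq_single p (fun r hr => by simp [single_apply, hr])]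
  simp [single_apply]

theorem conj_pairing (a b : Space) : conj (pairing a b) = pairing b a := by
  rw [pairing_apply, pairing_apply, Complex.conj_tsum]
  exact tsum_congr fun p => by simp [mul_comm]

theorem pairing_shift {q : ℤ × ℤ} {z : ℤ × ℤ → ℂ} {a b a' b' : Space}
    (hb : ∀ p, b'.1 p = z p * b.1 (p - q))
    (ha : ∀ p, a'.1 p = conj (z (p + q)) * a.1 (p + q)) : pairing a b' = pairing a' b := by
  rw [pairing_apply, pairing_apply, ← (Equiv.addRight q).tsum_eq]
  refine tsum_congr fun p => ?_
  simp only [Equiv.coe_addRight, hb, ha, add_sub_cancel_right, map_mul, Complex.conj_conj]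
  ring

/-- An operator that commutes with `U₁, U₂` and is weakly continuous is a right convolution. -/
theorem eq_conv_of_commute (θ : ℝ) (T : Module.End ℂ Space) (h₁ : ∀ a, T (U₁ a) = U₁ (T a))
    (h₂ : ∀ a, T (U₂ θ a) = U₂ θ (T a)) (hT : ∀ a, Continuous fun b => pairing a (T b)) :
    T = conv θ (T (single 0)) := by
  -- `R` commutes with the injective operators `U₁, U₂` and kills the unit, so by induction in both
  -- directions it kills every monomial. Weak continuity and the expansion `hasSum_single` then give
  -- `R = 0`.
  set R : Module.End ℂ Space := T - conv θ (T (single 0)) with hR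
  have hR₁ : ∀ a, R (U₁ a) = U₁ (R a) := fun a => by
    simp only [hR, LinearMap.sub_apply, h₁, conv_U₁, map_sub]
  have hR₂ : ∀ a, R (U₂ θ a) = U₂ θ (R a) := fun a => by
    simp only [hR, LinearMap.sub_apply, h₂, conv_U₂, map_sub]
  have inj₁ : ∀ a, U₁ a = 0 → a = 0 := fun a h => by
    ext p
    have := congrArg (fun b : Space => b.1 (p + (1, 0))) h
    simpa [U₁_apply] using this
  have inj₂ : ∀ a, U₂ θ a = 0 → a = 0 := fun a h => by
    ext p
    have := congrArg (fun b : Space => b.1 (p + (0, 1))) h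
    simpa [U₂_apply, twist_ne_zero] using this
  have s₁ : ∀ p, U₁ (single p) = single (p + (1, 0)) := fun p => by
    ext r
    rw [U₁_apply, single_apply, single_apply]
    exact if_congr sub_eq_iff_eq_add rfl rfl
  have s₂ : ∀ p, U₂ θ (single p) = twist θ p (0, 1) • single (p + (0, 1)) := fun p => by
    ext r
    rw [U₂_apply, Submodule.coe_smul, Pi.smul_apply, single_apply, single_apply, smul_eq_mul]
    by_cases h : r - (0, 1) = p
    · rw [if_pos h, if_pos (sub_eq_iff_eq_add.mp h), ← h, mul_one, mul_one]
      simp [twist]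
    · rw [if_neg h, if_neg (fun h' => h (sub_eq_iff_eq_add.mpr h')), mul_zero, mul_zero]
  have k₁ : ∀ p, R (single p) = 0 ↔ R (single (p + (1, 0))) = 0 := fun p => by
    rw [← s₁, hR₁]
    exact ⟨fun h => by rw [h, map_zero], inj₁ _⟩
  have k₂ : ∀ p, R (single p) = 0 ↔ R (single (p + (0, 1))) = 0 := fun p => by
    have e : R (twist θ p (0, 1) • single (p + (0, 1))) = 0 ↔ R (single (p + (0, 1))) = 0 := by
      rw [map_smul, smul_eq_zero, or_iff_right (twist_ne_zero _ _ _)]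
    rw [← e, ← s₂, hR₂]
    exact ⟨fun h => by rw [h, map_zero], inj₂ _⟩
  have z₀ : R (single 0) = 0 := by
    rw [hR, LinearMap.sub_apply, sub_eq_zero]
    ext p
    rw [conv_apply, tsum_eq_single p (fun r hr => ?_)]
    · simp [single_apply, twist_zero_right]
    · simp [single_apply, sub_eq_zero, hr.symm]
  have z₁ : ∀ i : ℤ, R (single (i, 0)) = 0 := fun i => by
    induction i using Int.induction_on with
    | zero => exact z₀
    | succ i ih => simpa using (k₁ _).mp ih
    | pred i ih => exact (k₁ _).mpr (by simpa using ih)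
  have z₂ : ∀ i j : ℤ, R (single (i, j)) = 0 := fun i j => by
    induction j using Int.induction_on with
    | zero => exact z₁ i
    | succ j ih => simpa using (k₂ _).mp ih
    | pred j ih => exact (k₂ _).mpr (by simpa using ih)
  have hc : ∀ a, Continuous (pairing a ∘ₗ R) := fun a => by
    have h := (hT a).sub ((continuous_pairing a).comp (continuous_conv θ (T (single 0))))
    refine h.congr fun b => ?_
    simp [hR]
  refine sub_eq_zero.mp (LinearMap.ext fun b => Subtype.ext (funext fun p => ?_))
  change (R b).1 p = 0
  rw [← pairing_single]
  have h := (hasSum_single b).map (pairing (single p) ∘ₗ R) (hc _)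
  have h0 : (pairing (single p) ∘ₗ R) ∘ (fun q => b.1 q • single q) = fun _ => 0 := by
    funext q
    simp [z₂ q.1 q.2]
  rw [h0] at h
  exact h.unique hasSum_zero

theorem connection_freeModule (θ : ℝ) :
    IsConstCurvConnection (freeModule θ) 0 FreeModule.nabla₁ FreeModule.nabla₂ where
  leibniz₁₁ := fun (a : Space) => Subtype.ext <| funext fun p => by
    change 2 * Real.pi * Complex.I * p.1 * (U₁ a).1 p =
      (U₁ (FreeModule.nabla₁ a)).1 p + 2 * Real.pi * Complex.I * (U₁ a).1 p
    rw [U₁_apply, U₁_apply, nabla₁_coe]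
    push_cast [Prod.fst_sub]
    ring
  leibniz₁₂ := fun (a : Space) => Subtype.ext <| funext fun p => by
    change 2 * Real.pi * Complex.I * p.1 * (U₂ θ a).1 p = (U₂ θ (FreeModule.nabla₁ a)).1 p
    rw [U₂_apply, U₂_apply, nabla₁_coe]
    push_cast [Prod.fst_sub]
    ring
  leibniz₂₁ := fun (a : Space) => Subtype.ext <| funext fun p => by
    change 2 * Real.pi * Complex.I * p.2 * (U₁ a).1 p = (U₁ (FreeModule.nabla₂ a)).1 p
    rw [U₁_apply, U₁_apply, nabla₂_coe]
    push_cast [Prod.snd_sub]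
    ring
  leibniz₂₂ := fun (a : Space) => Subtype.ext <| funext fun p => by
    change 2 * Real.pi * Complex.I * p.2 * (U₂ θ a).1 p =
      (U₂ θ (FreeModule.nabla₂ a)).1 p + 2 * Real.pi * Complex.I * (U₂ θ a).1 p
    rw [U₂_apply, U₂_apply, nabla₂_coe]
    push_cast [Prod.snd_sub]
    ring
  skew₁ := fun (a b : Space) => by
    change ∑' p, conj ((FreeModule.nabla₁ a).1 p) * b.1 p =
      -∑' p, conj (a.1 p) * (FreeModule.nabla₁ b).1 p
    rw [← tsum_neg]
    refine tsum_congr fun p => ?_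
    simp only [nabla₁_coe, map_mul, Complex.conj_ofReal, Complex.conj_I, Complex.conj_ofNat,
      map_intCast]
    ring
  skew₂ := fun (a b : Space) => by
    change ∑' p, conj ((FreeModule.nabla₂ a).1 p) * b.1 p =
      -∑' p, conj (a.1 p) * (FreeModule.nabla₂ b).1 p
    rw [← tsum_neg]
    refine tsum_congr fun p => ?_
    simp only [nabla₂_coe, map_mul, Complex.conj_ofReal, Complex.conj_I, Complex.conj_ofNat,
      map_intCast]
    ring
  curvature := fun (a : Space) => Subtype.ext <| funext fun p => by
    change 2 * Real.pi * Complex.I * p.1 * (2 * Real.pi * Complex.I * p.2 * a.1 p) -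
      2 * Real.pi * Complex.I * p.2 * (2 * Real.pi * Complex.I * p.1 * a.1 p) =
      (-(2 * Real.pi * Complex.I * (0 : ℝ))) * a.1 p
    push_cast
    ring

/-- The commutant of `A_θ` is `A_θ`, acting from the right. -/
def commutantModel (θ : ℝ) : CommutantModel (freeModule θ) 0 1 θ where
  topAddGroup := inferInstanceAs (IsTopologicalAddGroup Space)
  contSMul := inferInstanceAs (ContinuousSMul ℂ Space)
  connection := connection_freeModule θ
  herm_add ξ := map_add (pairing ξ)
  herm_smul z ξ := map_smul (pairing ξ) z
  herm_conj := conj_pairing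
  herm_ext := fun (η : Space) h => Subtype.ext <| funext fun p =>
    (pairing_single p η).symm.trans (h (single p))
  herm_continuous := continuous_pairing
  herm_diag := tendsto_pairing_self
  U₁_adj := ⟨fun a => ⟨fun p => 1 * a.1 (p - (-1, 0)), shift_mem (-1, 0) _ (by simp) a⟩,
    fun (ξ η : Space) => pairing_shift (q := (1, 0)) (z := fun _ => 1) (b' := U₁ η)
      (fun p => by rw [U₁_apply, one_mul]) fun p => by simp [sub_eq_add_neg]⟩
  U₂_adj := ⟨fun a => ⟨fun p => twist θ (-p) (0, 1) * a.1 (p - (0, -1)),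
      shift_mem (0, -1) _ (fun _ => norm_twist _ _ _) a⟩,
    fun (ξ η : Space) => pairing_shift (q := (0, 1)) (z := fun p => twist θ p (0, 1))
      (fun p => U₂_apply θ η p) fun p => by
        simp only [conj_twist, sub_eq_add_neg, Prod.neg_mk, neg_zero, neg_neg]
        congr 1
        simp [twist]⟩
  W q := conv θ (single q)
  W_zero := conv_single_zero θ
  W_mul := fun p q (ξ : Space) => Subtype.ext <| funext fun r => by
    change (conv θ (single p) (conv θ (single q) ξ)).1 r = twist θ p q * (conv θ (single (p + q)) ξ).1 r
    rw [conv_single, conv_single]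
    rw [conv_single, show r - p - q = r - (p + q) by abel]
    have h : twist θ p (r - p) = twist θ p q * twist θ p (r - (p + q)) := by
      rw [← twist_add_right]; congr 1; abel
    rw [h, twist_add_left]
    ring
  W_adj := fun q (ξ η : Space) => by
    refine Eq.trans ?_ (map_smul (pairing ξ) (twist θ q q) (conv θ (single (-q)) η))
    refine (pairing_shift (q := -q) (z := fun p => twist θ q q * twist θ (-q) (p - -q))
      (fun p => ?_) fun p => ?_).symm
    · change twist θ q q * (conv θ (single (-q)) η).1 p = _
      rw [conv_single, mul_assoc]
    · refine (conv_single θ q ξ p).trans ?_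
      rw [map_mul, conj_twist, conj_twist, neg_neg, sub_neg_eq_add,
        neg_add_cancel_right, ← sub_eq_add_neg]
      congr 1
      rw [← twist_neg_right, ← twist_add_right]
      congr 1
      abel
  W_U₁ q := conv_U₁ θ _
  W_U₂ q := conv_U₂ θ _
  W_nabla₁ := fun q (ξ : Space) => Subtype.ext <| funext fun p => by
    change 2 * Real.pi * Complex.I * p.1 * (conv θ (single q) ξ).1 p =
      (conv θ (single q) (FreeModule.nabla₁ ξ)).1 p +
        ((1 : ℝ) * (2 * Real.pi * Complex.I * q.1)) * (conv θ (single q) ξ).1 p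
    rw [conv_single, conv_single, nabla₁_coe]
    push_cast [Prod.fst_sub]
    ring
  W_nabla₂ := fun q (ξ : Space) => Subtype.ext <| funext fun p => by
    change 2 * Real.pi * Complex.I * p.2 * (conv θ (single q) ξ).1 p =
      (conv θ (single q) (FreeModule.nabla₂ ξ)).1 p +
        ((1 : ℝ) * (2 * Real.pi * Complex.I * q.2)) * (conv θ (single q) ξ).1 p
    rw [conv_single, conv_single, nabla₂_coe]
    push_cast [Prod.snd_sub]
    ring
  W_bound := fun (ξ η : Space) => ⟨(∑' p, ‖ξ.1 p‖) * supNorm 0 η, fun q => by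
    change ‖∑' p, conj (ξ.1 p) * (conv θ (single q) η).1 p‖ ≤ _
    rw [← tsum_mul_right]
    refine tsum_of_norm_bounded (((summable_norm ξ).mul_right _).hasSum) fun p => ?_
    rw [norm_mul, RCLike.norm_conj, conv_single, norm_mul, norm_twist, one_mul]
    exact mul_le_mul_of_nonneg_left (norm_le_supNorm _ _) (norm_nonneg _)⟩
  rho := conv θ
  herm_rho a ξ η := pairing_conv θ a ξ η
  rho_continuous := continuous_conv θ
  commutant T h₁ h₂ hT := ⟨_, eq_conv_of_commute θ T h₁ h₂ hT⟩
  frameSize := 1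
  frame _ := single 0
  density := 1
  density_pos := one_pos
  frame_trace q := by
    rw [Fin.sum_univ_one]
    change pairing (single 0) (conv θ (single q) (single 0)) = _
    rw [pairing_single, conv_single, single_apply]
    by_cases h : q = 0
    · simp [h, twist_zero_left]
    · simp [h]

end FreeModule

end

noncomputable section

open FreeModule RapidSeq

/-! ## Series in the Schwartz space of the real line -/

namespace SchwartzMap

theorem tendsto_of_seminorm {β : Type*} {l : Filter β} {F : β → 𝓢(ℝ, ℂ)} {f : 𝓢(ℝ, ℂ)}
    (h : ∀ k n : ℕ, Filter.Tendsto (fun b => SchwartzMap.seminorm ℂ k n (F b - f)) l (nhds 0)) :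
    Filter.Tendsto F l (nhds f) := by
  rw [(schwartz_withSeminorms ℂ ℝ ℂ).tendsto_nhds]
  exact fun i ε hε => (h i.1 i.2).eventually (gt_mem_nhds hε)

theorem continuous_of_seminorm {F : Type*} [AddCommGroup F] [Module ℂ F]
    [TopologicalSpace F] [IsTopologicalAddGroup F] (T : F →ₗ[ℂ] 𝓢(ℝ, ℂ))
    (h : ∀ k n : ℕ, ∃ g : F → ℝ, Filter.Tendsto g (nhds 0) (nhds 0) ∧
      ∀ a, SchwartzMap.seminorm ℂ k n (T a) ≤ g a) : Continuous T := by
  refine continuous_of_continuousAt_zero T ?_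
  rw [ContinuousAt, map_zero]
  refine tendsto_of_seminorm fun k n => ?_
  obtain ⟨g, hg, hb⟩ := h k n
  exact squeeze_zero (fun _ => apply_nonneg _ _) (fun a => by rw [sub_zero]; exact hb a) hg

theorem tendsto_seminorm (k n : ℕ) :
    Filter.Tendsto (fun f : 𝓢(ℝ, ℂ) => SchwartzMap.seminorm ℂ k n f) (nhds 0) (nhds 0) := by
  have h := ((schwartz_withSeminorms ℂ ℝ ℂ).continuous_seminorm (k, n)).tendsto 0
  rwa [map_zero] at h

/-- Absolute convergence in every seminorm, proved for the pointwise sum directly. A bound for the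
sum over an arbitrary subset of indices is established first; its use for the complement of a finite
set estimates the remainder. -/
theorem exists_hasSum {ι : Type*} {G : ι → 𝓢(ℝ, ℂ)}
    (h : ∀ k n : ℕ, Summable fun i => SchwartzMap.seminorm ℂ k n (G i)) :
    ∃ F : 𝓢(ℝ, ℂ), HasSum G F := by
  have hv : ∀ k : ℕ, (k : ℕ∞) ≤ ⊤ → Summable fun i => SchwartzMap.seminorm ℂ 0 k (G i) :=
    fun k _ => h 0 k
  have hb : ∀ (s : Set ι) (k : ℕ) (i : s) (x : ℝ), (k : ℕ∞) ≤ ⊤ →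
      ‖iteratedFDeriv ℝ k (G i) x‖ ≤ SchwartzMap.seminorm ℂ 0 k (G i) :=
    fun s k i x _ => norm_iteratedFDeriv_le_seminorm ℂ (G i) k x
  have key : ∀ s : Set ι, ∃ F : 𝓢(ℝ, ℂ), (∀ x, F x = ∑' i : s, G i x) ∧
      ∀ k n, SchwartzMap.seminorm ℂ k n F ≤ ∑' i : s, SchwartzMap.seminorm ℂ k n (G i) := by
    intro s
    have hbd : ∀ k n : ℕ, ∀ x : ℝ, ‖x‖ ^ k * ‖iteratedFDeriv ℝ n (fun x => ∑' i : s, G i x) x‖ ≤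
        ∑' i : s, SchwartzMap.seminorm ℂ k n (G i) := by
      intro k n x
      rw [iteratedFDeriv_tsum_apply (N := ⊤) (fun i : s => (G i).smooth ⊤)
        (fun k hk => (hv k hk).subtype s) (fun k i x hk => hb s k i x hk) le_top]
      have hs : Summable fun i : s => ‖iteratedFDeriv ℝ n (G i) x‖ :=
        Summable.of_nonneg_of_le (fun _ => norm_nonneg _) (fun i => hb s n i x le_top)
          ((h 0 n).subtype s)
      calc ‖x‖ ^ k * ‖∑' i : s, iteratedFDeriv ℝ n (G i) x‖
          ≤ ‖x‖ ^ k * ∑' i : s, ‖iteratedFDeriv ℝ n (G i) x‖ := by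
            gcongr; exact norm_tsum_le_tsum_norm hs
        _ = ∑' i : s, ‖x‖ ^ k * ‖iteratedFDeriv ℝ n (G i) x‖ := tsum_mul_left.symm
        _ ≤ _ := (hs.mul_left _).tsum_le_tsum (fun i => le_seminorm ℂ k n (G i) x)
            ((h k n).subtype s)
    refine ⟨⟨fun x => ∑' i : s, G i x, ?_, fun k n => ⟨_, hbd k n⟩⟩, fun x => rfl, fun k n => ?_⟩
    · exact contDiff_tsum (N := ⊤) (fun i : s => (G i).smooth ⊤)
        (fun k hk => (hv k hk).subtype s) (fun k i x hk => hb s k i x hk)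
    · exact seminorm_le_bound ℂ k n _ (tsum_nonneg fun i => apply_nonneg _ _) (hbd k n)
  obtain ⟨F, hF, -⟩ := key Set.univ
  refine ⟨F, tendsto_of_seminorm fun k n => ?_⟩
  have ht := tendsto_tsum_compl_atTop_zero fun i => SchwartzMap.seminorm ℂ k n (G i)
  refine squeeze_zero (fun _ => apply_nonneg _ _) (fun s => ?_) ht
  obtain ⟨F', hF', hle⟩ := key {i | i ∉ s}
  have e : ∑ i ∈ s, G i - F = -F' := by
    ext x
    have hs : Summable fun i => G i x :=
      Summable.of_norm_bounded (h 0 0) fun i => norm_le_seminorm ℂ (G i) x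
    rw [sub_apply, neg_apply, hF, hF', sum_apply, tsum_univ (f := fun i => G i x),
      ← hs.sum_add_tsum_compl (s := s)]
    simp
    rfl
  rw [e, map_neg_eq_map]
  exact hle k n

theorem seminorm_le_tsum {ι : Type*} {G : ι → 𝓢(ℝ, ℂ)} {F : 𝓢(ℝ, ℂ)} (hF : HasSum G F) (k n : ℕ)
    (h : Summable fun i => SchwartzMap.seminorm ℂ k n (G i)) :
    SchwartzMap.seminorm ℂ k n F ≤ ∑' i, SchwartzMap.seminorm ℂ k n (G i) := by
  have hc := ((schwartz_withSeminorms ℂ ℝ ℂ).continuous_seminorm (k, n)).tendsto F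
  refine le_of_tendsto (hc.comp hF) (Filter.Eventually.of_forall fun s => ?_)
  exact (Finset.le_sum_of_subadditive _ (map_zero _).le (map_add_le_add _) s G).trans (h.sum_le_tsum s fun i _ => apply_nonneg _ _)

/-! ### Modulations and translations -/

theorem hasTemperateGrowth_character_mul (c : ℝ) :
    (fun s : ℝ => SchwartzModule.character (c * s)).HasTemperateGrowth :=
  SchwartzModule.character_hasTemperateGrowth.comp
    (c • ContinuousLinearMap.id ℝ ℝ).hasTemperateGrowth

/-- The operator `f ↦ (s ↦ e^{2πi c s} f(s - d))`. -/
def modShift (c d : ℝ) : 𝓢(ℝ, ℂ) →L[ℂ] 𝓢(ℝ, ℂ) :=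
  smulLeftCLM ℂ (fun s : ℝ => SchwartzModule.character (c * s)) ∘L compSubConstCLM ℂ d

theorem modShift_apply (c d : ℝ) (f : 𝓢(ℝ, ℂ)) (s : ℝ) :
    modShift c d f s = SchwartzModule.character (c * s) * f (s - d) := by
  simp [modShift, smulLeftCLM_apply_apply (hasTemperateGrowth_character_mul c)]

theorem norm_character (s : ℝ) : ‖SchwartzModule.character s‖ = 1 := by
  unfold SchwartzModule.character
  rw [show 2 * (Real.pi : ℂ) * Complex.I * s = ((2 * Real.pi * s : ℝ) : ℂ) * Complex.I by
    push_cast; ring]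
  exact Complex.norm_exp_ofReal_mul_I _

theorem hasDerivAt_character (s : ℝ) : HasDerivAt SchwartzModule.character
    (2 * Real.pi * Complex.I * SchwartzModule.character s) s := by
  have := ((hasDerivAt_id s).ofReal_comp.const_mul (2 * (Real.pi : ℂ) * Complex.I)).cexp
  unfold SchwartzModule.character
  simpa [mul_comm] using this

theorem derivCLM_modShift (c d : ℝ) (f : 𝓢(ℝ, ℂ)) : derivCLM ℂ ℂ (modShift c d f) =
    modShift c d (derivCLM ℂ ℂ f) + (2 * Real.pi * Complex.I * c) • modShift c d f := by
  ext s
  have h1 : HasDerivAt (fun s : ℝ => SchwartzModule.character (c * s))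
      (2 * Real.pi * Complex.I * SchwartzModule.character (c * s) * c) s := by
    have := (hasDerivAt_character (c * s)).scomp s ((hasDerivAt_id s).const_mul c)
    refine (this.congr_deriv ?_ : HasDerivAt (SchwartzModule.character ∘ fun s => c * s) _ s)
    simp [mul_comm]
  have h2 : HasDerivAt (fun s : ℝ => f (s - d)) (deriv f (s - d)) s :=
    (f.differentiableAt (x := s - d)).hasDerivAt.comp_sub_const s d
  have h3 : (modShift c d f : ℝ → ℂ) = fun s => SchwartzModule.character (c * s) * f (s - d) :=
    funext fun s => modShift_apply c d f s
  rw [derivCLM_apply, h3, (h1.fun_mul h2).deriv, add_apply, smul_apply, modShift_apply, modShift_apply,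
    derivCLM_apply, smul_eq_mul]
  ring

theorem seminorm_succ (k n : ℕ) (f : 𝓢(ℝ, ℂ)) :
    SchwartzMap.seminorm ℂ k (n + 1) f = SchwartzMap.seminorm ℂ k n (derivCLM ℂ ℂ f) := by
  have h : ∀ x, iteratedDeriv (n + 1) f x = iteratedDeriv n (derivCLM ℂ ℂ f) x := fun x => by
    rw [iteratedDeriv_succ']
    congr 1
  apply le_antisymm
  · refine seminorm_le_bound' ℂ k _ f (apply_nonneg _ _) fun x => ?_
    rw [h]
    exact le_seminorm' ℂ k n _ x
  · refine seminorm_le_bound' ℂ k _ _ (apply_nonneg _ _) fun x => ?_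
    rw [← h]
    exact le_seminorm' ℂ k _ f x

/-- Modulations and translations grow at most polynomially in the Schwartz seminorms. -/
theorem exists_seminorm_modShift_le (k n : ℕ) : ∃ g : 𝓢(ℝ, ℂ) → ℝ,
    Filter.Tendsto g (nhds 0) (nhds 0) ∧ (∀ f, 0 ≤ g f) ∧
    ∀ c d f, SchwartzMap.seminorm ℂ k n (modShift c d f) ≤ (1 + |c| + |d|) ^ (k + n) * g f := by
  induction n with
  | zero =>
    refine ⟨fun f => 2 ^ k * ∑ i ∈ Finset.Iic (k, 0), schwartzSeminormFamily ℂ ℝ ℂ i f, ?_,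
      fun f => by positivity, fun c d f => ?_⟩
    · have h : Filter.Tendsto (fun f => ∑ i ∈ Finset.Iic ((k, 0) : ℕ × ℕ),
          schwartzSeminormFamily ℂ ℝ ℂ i f) (nhds 0) (nhds (∑ i ∈ Finset.Iic ((k, 0) : ℕ × ℕ), 0)) :=
        tendsto_finsetSum _ fun i _ => tendsto_seminorm i.1 i.2
      simpa using h.const_mul (2 ^ k)
    · refine seminorm_le_bound' ℂ k 0 _ (by positivity) fun x => ?_
      have h := one_add_le_sup_seminorm_apply (𝕜 := ℂ) (m := (k, 0)) le_rfl le_rfl f (x - d)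
      have h' : ((Finset.Iic (k, 0)).sup (schwartzSeminormFamily ℂ ℝ ℂ)) f ≤
          ∑ i ∈ Finset.Iic (k, 0), schwartzSeminormFamily ℂ ℝ ℂ i f := by
        have := Seminorm.finset_sup_le_sum (schwartzSeminormFamily ℂ ℝ ℂ) (Finset.Iic (k, 0)) f
        simpa using this
      rw [norm_iteratedFDeriv_zero] at h
      rw [iteratedDeriv_zero, modShift_apply, norm_mul, norm_character, one_mul, add_zero]
      have hx : |x| ≤ (1 + |c| + |d|) * (1 + ‖x - d‖) := by
        rw [Real.norm_eq_abs]
        have h1 : |x| ≤ |x - d| + |d| := by simpa using abs_add_le (x - d) d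
        nlinarith [abs_nonneg c, abs_nonneg d, abs_nonneg (x - d), mul_nonneg (abs_nonneg c)
          (abs_nonneg (x - d)), mul_nonneg (abs_nonneg d) (abs_nonneg (x - d))]
      calc |x| ^ k * ‖f (x - d)‖ ≤ ((1 + |c| + |d|) * (1 + ‖x - d‖)) ^ k * ‖f (x - d)‖ := by gcongr
        _ = (1 + |c| + |d|) ^ k * ((1 + ‖x - d‖) ^ k * ‖f (x - d)‖) := by rw [mul_pow, mul_assoc]
        _ ≤ _ := by gcongr; exact h.trans (mul_le_mul_of_nonneg_left h' (by positivity))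
  | succ n ih =>
    obtain ⟨g, hg, hg0, hb⟩ := ih
    -- A derivative either falls on `f` or brings down the factor `2πic`, and so costs at most one
    -- more power of `1 + |c| + |d|`.
    refine ⟨fun f => g (derivCLM ℂ ℂ f) + 2 * Real.pi * g f, ?_, fun f => ?_, fun c d f => ?_⟩
    · have h1 : Filter.Tendsto (fun f => g (derivCLM ℂ ℂ f)) (nhds 0) (nhds 0) :=
        hg.comp ((derivCLM ℂ ℂ).continuous.tendsto' 0 0 (map_zero _))
      simpa using h1.add (hg.const_mul (2 * Real.pi))
    · have := hg0 f
      have := hg0 (derivCLM ℂ ℂ f)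
      positivity
    · have hc : ‖2 * (Real.pi : ℂ) * Complex.I * c‖ = 2 * Real.pi * |c| := by
        simp [abs_of_pos Real.pi_pos]
      have hc1 : |c| ≤ 1 + |c| + |d| := by linarith [abs_nonneg d]
      have hc2 : 1 ≤ 1 + |c| + |d| := by linarith [abs_nonneg d, abs_nonneg c]
      rw [seminorm_succ, derivCLM_modShift]
      refine (map_add_le_add _ _ _).trans ?_
      rw [map_smul_eq_mul, hc]
      calc _ ≤ (1 + |c| + |d|) ^ (k + n) * g (derivCLM ℂ ℂ f) +
            2 * Real.pi * |c| * ((1 + |c| + |d|) ^ (k + n) * g f) :=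
            add_le_add (hb _ _ _) (mul_le_mul_of_nonneg_left (hb _ _ _) (by positivity))
        _ ≤ (1 + |c| + |d|) ^ (k + n + 1) * g (derivCLM ℂ ℂ f) +
            2 * Real.pi * (1 + |c| + |d|) * ((1 + |c| + |d|) ^ (k + n) * g f) := by
            have := hg0 f
            have := hg0 (derivCLM ℂ ℂ f)
            have := pow_le_pow_right₀ hc2 (Nat.le_succ (k + n))
            gcongr
        _ = _ := by ring

end SchwartzMap

end

noncomputable section

open FreeModule RapidSeq

/-! ## Modulations and translations on `ℝ × ℤ/m` -/

namespace SchwartzModule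

theorem character_add (x y : ℝ) : character (x + y) = character x * character y := by
  unfold character; rw [← Complex.exp_add]; congr 1; push_cast; ring

theorem character_zero : character 0 = 1 := by simp [character]

theorem character_intCast (k : ℤ) : character k = 1 := by
  unfold character
  rw [Complex.exp_eq_one_iff]
  exact ⟨k, by push_cast; ring⟩

theorem character_zpow (x : ℝ) (k : ℤ) : character x ^ k = character (k * x) := by
  unfold character; rw [← Complex.exp_int_mul]; congr 1; push_cast; ring

theorem conj_character (x : ℝ) : conj (character x) = character (-x) := by
  unfold character; rw [← Complex.exp_conj]; congr 1; simp [Complex.conj_ofNat]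

theorem twist_eq_character (ϑ : ℝ) (p q : ℤ × ℤ) :
    twist ϑ p q = character (-(ϑ * p.1 * q.2)) := by
  unfold twist character; congr 1; push_cast; ring

/-- The character `α ↦ e^{-2πiα/m}` of `ℤ/m`. -/
def phase (m : ℤ) (α : ZMod m.natAbs) : ℂ := Complex.exp (-(2 * Real.pi * Complex.I * α.val / m))

variable {m : ℤ}

theorem phase_sub_intCast (hm : m ≠ 0) (α : ZMod m.natAbs) (n : ℤ) :
    phase m (α - (n : ZMod m.natAbs)) = character (n / m) * phase m α := by
  unfold phase character
  rw [exp_val_shift n m hm α]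
  congr 3
  push_cast
  rfl

theorem phase_zero : phase m 0 = 1 := by simp [phase]

theorem phase_ne_zero (α : ZMod m.natAbs) : phase m α ≠ 0 := Complex.exp_ne_zero _

theorem conj_phase (α : ZMod m.natAbs) : conj (phase m α) = (phase m α)⁻¹ := by
  unfold phase; rw [← Complex.exp_conj, ← Complex.exp_neg]; congr 1; simp [Complex.conj_ofNat, neg_div]

theorem norm_phase (α : ZMod m.natAbs) : ‖phase m α‖ = 1 := by
  unfold phase
  rw [show -(2 * (Real.pi : ℂ) * Complex.I * α.val / m) =
    ((-(2 * Real.pi * α.val / m) : ℝ) : ℂ) * Complex.I by push_cast; ring]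
  exact Complex.norm_exp_ofReal_mul_I _

/-- A character of `ℝ × ℤ/m`, `(s, α) ↦ e^{2πi (a s - r' α / m)}`, together with the element
`(b, r)` of this group. -/
structure Modulation where
  a : ℝ
  b : ℝ
  r' : ℤ
  r : ℤ

namespace Modulation

variable (D : Modulation)

/-- The operator of translation by `q₁ (b, r)`, followed by multiplication with the `q₂`-th power of
the character. -/
def op (m : ℤ) (q : ℤ × ℤ) : Module.End ℂ (Space m) where
  toFun f α := phase m α ^ (q.2 * D.r') •
    SchwartzMap.modShift (q.2 * D.a) (q.1 * D.b) (f (α - ((q.1 * D.r : ℤ) : ZMod m.natAbs)))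
  map_add' f g := by funext α; simp
  map_smul' c f := by funext α; simp [smul_comm c]

theorem op_eq (q : ℤ × ℤ) (f : Space m) (α : ZMod m.natAbs) :
    D.op m q f α = phase m α ^ (q.2 * D.r') •
    SchwartzMap.modShift (q.2 * D.a) (q.1 * D.b) (f (α - ((q.1 * D.r : ℤ) : ZMod m.natAbs))) := rfl

theorem op_apply (q : ℤ × ℤ) (f : Space m) (α : ZMod m.natAbs) (s : ℝ) :
    D.op m q f α s = phase m α ^ (q.2 * D.r') * (character (q.2 * D.a * s) *
      f (α - ((q.1 * D.r : ℤ) : ZMod m.natAbs)) (s - q.1 * D.b)) := by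
  rw [op_eq, smul_apply, SchwartzMap.modShift_apply, smul_eq_mul]

/-- The real number `ϑ` such that the character takes the value `e^{2πiϑ}` at `(b, r)`. -/
def angle (m : ℤ) : ℝ := D.a * D.b - D.r * D.r' / m

theorem op_mul (hm : m ≠ 0) (p q : ℤ × ℤ) (f : Space m) :
    D.op m p (D.op m q f) = twist (D.angle m) p q • D.op m (p + q) f := by
  funext α
  ext s
  have hα : α - ((p.1 * D.r : ℤ) : ZMod m.natAbs) - ((q.1 * D.r : ℤ) : ZMod m.natAbs) =
      α - (((p + q).1 * D.r : ℤ) : ZMod m.natAbs) := by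
    push_cast [Prod.fst_add]; ring
  have hs : s - p.1 * D.b - q.1 * D.b = s - ((p + q).1 : ℤ) * D.b := by
    push_cast [Prod.fst_add]; ring
  have hphase : phase m α ^ (p.2 * D.r') * phase m α ^ (q.2 * D.r') =
      phase m α ^ ((p + q).2 * D.r') := by
    rw [← zpow_add₀ (phase_ne_zero α), Prod.snd_add, add_mul]
  have hchar : character (p.2 * D.a * s) *
      (character ((q.2 * D.r' : ℤ) * ((p.1 * D.r : ℤ) / m)) * character (q.2 * D.a * (s - p.1 * D.b)))
      = twist (D.angle m) p q * character ((p + q).2 * D.a * s) := by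
    rw [twist_eq_character, ← character_add, ← character_add, ← character_add, angle]
    congr 1
    push_cast [Prod.snd_add]
    ring
  rw [op_apply, op_apply, Pi.smul_apply, smul_apply, op_apply, hα, hs, phase_sub_intCast hm,
    mul_zpow, character_zpow, smul_eq_mul, ← hphase]
  linear_combination (phase m α ^ (p.2 * D.r') * phase m α ^ (q.2 * D.r') *
    f (α - (((p + q).1 * D.r : ℤ) : ZMod m.natAbs)) (s - ((p + q).1 : ℤ) * D.b)) * hchar

theorem op_zero (f : Space m) : D.op m 0 f = f := by
  funext α
  ext s
  simp [op_apply, character_zero]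

theorem op_op_neg (hm : m ≠ 0) (q : ℤ × ℤ) (f : Space m) :
    D.op m q (D.op m (-q) f) = twist (D.angle m) q (-q) • f := by
  rw [op_mul D hm, add_neg_cancel, op_zero]

/-- The operators of two modulations commute if their characters are trivial on each other's
group elements. -/
theorem op_comm (hm : m ≠ 0) {D D' : Modulation} (h : character (D.a * D'.b - D'.r * D.r' / m) = 1)
    (h' : character (D'.a * D.b - D.r * D'.r' / m) = 1) (p q : ℤ × ℤ) (f : Space m) :
    D.op m p (D'.op m q f) = D'.op m q (D.op m p f) := by
  funext α
  ext s
  have e1 : character (q.2 * D'.a * (s - p.1 * D.b)) *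
      character ((q.2 * D'.r' : ℤ) * ((p.1 * D.r : ℤ) / m)) = character (q.2 * D'.a * s) := by
    have := character_zpow (D'.a * D.b - D.r * D'.r' / m) (-(p.1 * q.2))
    rw [h', one_zpow] at this
    rw [← character_add, ← mul_one (character (q.2 * D'.a * s)), this, ← character_add]
    congr 1
    push_cast
    ring
  have e2 : character (p.2 * D.a * (s - q.1 * D'.b)) *
      character ((p.2 * D.r' : ℤ) * ((q.1 * D'.r : ℤ) / m)) = character (p.2 * D.a * s) := by
    have := character_zpow (D.a * D'.b - D'.r * D.r' / m) (-(q.1 * p.2))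
    rw [h, one_zpow] at this
    rw [← character_add, ← mul_one (character (p.2 * D.a * s)), this, ← character_add]
    congr 1
    push_cast
    ring
  rw [op_apply, op_apply, op_apply, op_apply, phase_sub_intCast hm, phase_sub_intCast hm, mul_zpow,
    mul_zpow, character_zpow, character_zpow, sub_right_comm α, sub_right_comm s, ← e1, ← e2]
  ring

/-! ### Estimates and series -/

theorem continuous_eval (α : ZMod m.natAbs) (s : ℝ) : Continuous fun f : Space m => f α s := by
  have h : Continuous fun f : 𝓢(ℝ, ℂ) => f s :=
    (continuous_eval_const (F := BoundedContinuousFunction ℝ ℂ) s).comp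
      (SchwartzMap.toBoundedContinuousFunctionCLM ℂ ℝ ℂ).continuous
  exact h.comp (continuous_apply α)

section Series

variable [NeZero m.natAbs]

/-- Polynomial growth in `q` is absorbed by rapidly decreasing coefficients, which gives convergence
of `∑ c_q V_q`. That `g` is small near zero gives the continuity of the sum. -/
theorem exists_seminorm_op_le (k n : ℕ) : ∃ g : Space m → ℝ,
    Filter.Tendsto g (nhds 0) (nhds 0) ∧
    ∀ q f α, SchwartzMap.seminorm ℂ k n (D.op m q f α) ≤ weight q ^ (k + n) * g f := by
  obtain ⟨g, hg, hg0, hb⟩ := SchwartzMap.exists_seminorm_modShift_le k n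
  refine ⟨fun f => (1 + |D.a| + |D.b|) ^ (k + n) * ∑ β, g (f β), ?_, fun q f α => ?_⟩
  · have h : Filter.Tendsto (fun f : Space m => ∑ β, g (f β)) (nhds 0)
        (nhds (∑ β : ZMod m.natAbs, 0)) :=
      tendsto_finsetSum _ fun β _ => hg.comp ((continuous_apply β).tendsto' _ _ rfl)
    simpa using h.const_mul ((1 + |D.a| + |D.b|) ^ (k + n))
  · rw [op_eq, map_smul_eq_mul, norm_zpow, norm_phase, one_zpow, one_mul]
    refine (hb _ _ _).trans ?_
    rw [← mul_assoc, ← mul_pow]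
    have h1 : 1 + |(q.2 : ℝ) * D.a| + |(q.1 : ℝ) * D.b| ≤ weight q * (1 + |D.a| + |D.b|) := by
      rw [abs_mul, abs_mul]
      have := mul_le_mul_of_nonneg_right (abs_snd_le_weight q) (abs_nonneg D.a)
      have := mul_le_mul_of_nonneg_right (abs_fst_le_weight q) (abs_nonneg D.b)
      linarith [one_le_weight q]
    have h2 : g (f (α - ((q.1 * D.r : ℤ) : ZMod m.natAbs))) ≤ ∑ β, g (f β) :=
      Finset.single_le_sum (f := fun β => g (f β)) (fun β _ => hg0 _) (Finset.mem_univ _)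
    have h3 : 0 ≤ 1 + |(q.2 : ℝ) * D.a| + |(q.1 : ℝ) * D.b| := by positivity
    exact mul_le_mul (pow_le_pow_left₀ h3 h1 _) h2 (hg0 _) (pow_nonneg (h3.trans h1) _)

theorem summable_seminorm (c : RapidSeq) (f : Space m) (α : ZMod m.natAbs) (k n : ℕ) :
    Summable fun q => SchwartzMap.seminorm ℂ k n (c.1 q • D.op m q f α) := by
  obtain ⟨g, -, hb⟩ := D.exists_seminorm_op_le (m := m) k n
  refine Summable.of_nonneg_of_le (fun _ => apply_nonneg _ _) (fun q => ?_)
    ((summable_weight_mul c (k + n)).mul_right (g f))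
  rw [map_smul_eq_mul]
  calc ‖c.1 q‖ * SchwartzMap.seminorm ℂ k n (D.op m q f α)
      ≤ ‖c.1 q‖ * (weight q ^ (k + n) * g f) := by gcongr; exact hb q f α
    _ = _ := by ring

theorem summable_op (c : RapidSeq) (f : Space m) : Summable fun q => c.1 q • D.op m q f :=
  Pi.summable.mpr fun α => (SchwartzMap.exists_hasSum (D.summable_seminorm c f α)).imp fun _ h => h

/-- The operator `∑ c_q V_q`, where `V_q` are the operators of the modulation. -/
def series (m : ℤ) [NeZero m.natAbs] (c : RapidSeq) : Module.End ℂ (Space m) where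
  toFun f := ∑' q, c.1 q • D.op m q f
  map_add' f g := by
    rw [← (D.summable_op c f).tsum_add (D.summable_op c g)]
    exact tsum_congr fun q => by rw [map_add, smul_add]
  map_smul' z f := by
    rw [RingHom.id_apply, ← (D.summable_op c f).tsum_const_smul z]
    exact tsum_congr fun q => by rw [map_smul, smul_comm]

theorem hasSum_series (c : RapidSeq) (f : Space m) :
    HasSum (fun q => c.1 q • D.op m q f) (D.series m c f) := (D.summable_op c f).hasSum

theorem continuous_series (c : RapidSeq) : Continuous (D.series m c) := by
  refine continuous_pi fun α => ?_
  refine SchwartzMap.continuous_of_seminorm (LinearMap.proj α ∘ₗ D.series m c) fun k n => ?_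
  obtain ⟨g, hg, hb⟩ := D.exists_seminorm_op_le (m := m) k n
  refine ⟨fun f => (∑' q, weight q ^ (k + n) * ‖c.1 q‖) * g f, by
    simpa using hg.const_mul (∑' q, weight q ^ (k + n) * ‖c.1 q‖), fun f => ?_⟩
  have h := Pi.hasSum.mp (D.hasSum_series c f) α
  refine (SchwartzMap.seminorm_le_tsum h k n (D.summable_seminorm c f α k n)).trans ?_
  simp only [← tsum_mul_right]
  refine (D.summable_seminorm c f α k n).tsum_le_tsum (fun q => ?_)
    ((summable_weight_mul c (k + n)).mul_right (g f))
  rw [Pi.smul_apply, map_smul_eq_mul]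
  calc ‖c.1 q‖ * SchwartzMap.seminorm ℂ k n (D.op m q f α)
      ≤ ‖c.1 q‖ * (weight q ^ (k + n) * g f) := by gcongr; exact hb q f α
    _ = _ := by ring

theorem hasSum_series_apply (c : RapidSeq) (f : Space m) (α : ZMod m.natAbs) (s : ℝ) :
    HasSum (fun q => c.1 q * D.op m q f α s) (D.series m c f α s) :=
  (D.hasSum_series c f).map (⟨⟨fun f : Space m => f α s, rfl⟩, fun _ _ => rfl⟩ : Space m →+ ℂ)
    (continuous_eval α s)

end Series

end Modulation

end SchwartzModule

end

noncomputable section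

open FreeModule RapidSeq

/-! ## The Hermitian form on the Schwartz space of `ℝ × ℤ/m` -/

namespace SchwartzModule

/-- The bilinear map `(z, w) ↦ conj z * w`. -/
def conjMul : ℂ →L[ℝ] ℂ →L[ℝ] ℂ := (ContinuousLinearMap.mul ℝ ℂ).comp (Complex.conjCLE : ℂ →L[ℝ] ℂ)

theorem conjMul_apply (z w : ℂ) : conjMul z w = conj z * w := rfl

/-- The product `conj f * g` of Schwartz functions. -/
def conjProd (f g : 𝓢(ℝ, ℂ)) : 𝓢(ℝ, ℂ) := SchwartzMap.pairing conjMul f g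

theorem conjProd_apply (f g : 𝓢(ℝ, ℂ)) (s : ℝ) : conjProd f g s = conj (f s) * g s := by
  rw [conjProd, SchwartzMap.pairing_apply_apply, conjMul_apply]

variable {m : ℤ} (hm : m ≠ 0)

theorem neZero_natAbs (hm : m ≠ 0) : NeZero m.natAbs := ⟨Int.natAbs_ne_zero.mpr hm⟩

theorem herm_eq [NeZero m.natAbs] (f g : Space m) :
    herm m hm f g = ∑ α, ∫ s : ℝ, conj (f α s) * g α s := rfl

/-- The inclusion of the Schwartz space into `L²(ℝ)`. -/
def toL2 : 𝓢(ℝ, ℂ) →L[ℂ] MeasureTheory.Lp ℂ 2 (MeasureTheory.volume (α := ℝ)) :=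
  SchwartzMap.toLpCLM ℂ ℂ 2 MeasureTheory.volume

theorem herm_eq_inner [NeZero m.natAbs] (f g : Space m) :
    herm m hm f g = ∑ α, inner ℂ (toL2 (f α)) (toL2 (g α)) := by
  rw [herm_eq]
  refine Finset.sum_congr rfl fun α _ => ?_
  refine Eq.trans ?_ (SchwartzMap.inner_toL2_toL2_eq (f α) (g α) MeasureTheory.volume).symm
  exact MeasureTheory.integral_congr_ae (Filter.Eventually.of_forall fun s => by
    simp [mul_comm])

theorem herm_add (f g g' : Space m) : herm m hm f (g + g') = herm m hm f g + herm m hm f g' := by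
  have := neZero_natAbs hm
  simp only [herm_eq_inner, Pi.add_apply, map_add, inner_add_right, Finset.sum_add_distrib]

theorem herm_smul (c : ℂ) (f g : Space m) : herm m hm f (c • g) = c * herm m hm f g := by
  have := neZero_natAbs hm
  simp only [herm_eq_inner, Pi.smul_apply, map_smul, inner_smul_right, Finset.mul_sum]

theorem herm_conj (f g : Space m) : conj (herm m hm f g) = herm m hm g f := by
  have := neZero_natAbs hm
  simp only [herm_eq_inner, map_sum, inner_conj_symm]

theorem herm_smul_left (c : ℂ) (f g : Space m) : herm m hm (c • f) g = conj c * herm m hm f g := by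
  rw [← herm_conj, herm_smul, map_mul, herm_conj]

theorem herm_add_left (f f' g : Space m) :
    herm m hm (f + f') g = herm m hm f g + herm m hm f' g := by
  rw [← herm_conj, herm_add, map_add, herm_conj, herm_conj]

/-- The Hermitian form, as a linear map in the second variable. -/
def hermLinear (f : Space m) : Space m →ₗ[ℂ] ℂ where
  toFun g := herm m hm f g
  map_add' := herm_add hm f
  map_smul' c g := herm_smul hm c f g

theorem hermLinear_apply (f g : Space m) : hermLinear hm f g = herm m hm f g := rfl

theorem continuous_herm (f : Space m) : Continuous (herm m hm f) := by
  have := neZero_natAbs hm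
  simp only [funext (herm_eq_inner hm f)]
  exact continuous_finsetSum _ fun α _ =>
    continuous_const.inner (toL2.continuous.comp (continuous_apply α))

theorem tendsto_herm_self : Filter.Tendsto (fun f : Space m => herm m hm f f) (nhds 0) (nhds 0) := by
  have := neZero_natAbs hm
  have hc : Continuous fun f : Space m => herm m hm f f := by
    simp only [herm_eq_inner hm]
    exact continuous_finsetSum _ fun α _ =>
      (toL2.continuous.comp (continuous_apply α)).inner (toL2.continuous.comp (continuous_apply α))
  refine hc.tendsto' _ _ ?_
  have h := herm_smul hm 0 0 (0 : Space m)
  rwa [zero_smul, zero_mul] at h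

theorem eq_zero_of_herm (g : Space m) (h : ∀ f, herm m hm f g = 0) : g = 0 := by
  have := neZero_natAbs hm
  have h1 := h g
  rw [herm_eq_inner] at h1
  have h2 : ∑ α, ‖toL2 (g α)‖ ^ 2 = 0 := by
    have : ((∑ α, ‖toL2 (g α)‖ ^ 2 : ℝ) : ℂ) = 0 := by
      rw [← h1]
      push_cast
      exact Finset.sum_congr rfl fun α _ => by rw [inner_self_eq_norm_sq_to_K]; rfl
    exact_mod_cast this
  funext α
  have h3 := (Finset.sum_eq_zero_iff_of_nonneg fun α _ => by positivity).mp h2 α (Finset.mem_univ _)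
  have h4 : toL2 (g α) = toL2 0 := by simpa using h3
  exact SchwartzMap.injective_toLp 2 (MeasureTheory.volume (α := ℝ)) h4

/-! ### Adjoints -/

theorem Modulation.herm_op (D : Modulation) (q : ℤ × ℤ) (f g : Space m) :
    herm m hm (D.op m q f) g = twist (D.angle m) q q * herm m hm f (D.op m (-q) g) := by
  have := neZero_natAbs hm
  rw [← herm_smul, herm_eq, herm_eq,
    ← Equiv.sum_comp (Equiv.addRight ((q.1 * D.r : ℤ) : ZMod m.natAbs))]
  refine Finset.sum_congr rfl fun α _ => ?_
  rw [← MeasureTheory.integral_add_right_eq_self _ (q.1 * D.b)]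
  refine MeasureTheory.integral_congr_ae (Filter.Eventually.of_forall fun s => ?_)
  simp only [Equiv.coe_addRight]
  have h1 : α + ((q.1 * D.r : ℤ) : ZMod m.natAbs) =
      α - (((-q).1 * D.r : ℤ) : ZMod m.natAbs) := by
    push_cast [Prod.fst_neg]; ring
  have h2 : s + q.1 * D.b = s - ((-q).1 : ℤ) * D.b := by push_cast [Prod.fst_neg]; ring
  have h3 : conj (phase m (α + ((q.1 * D.r : ℤ) : ZMod m.natAbs))) =
      character ((q.1 * D.r : ℤ) / m) * (phase m α)⁻¹ := by
    have := phase_sub_intCast hm α (-(q.1 * D.r))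
    rw [Int.cast_neg, sub_neg_eq_add] at this
    rw [this, map_mul, conj_character, conj_phase]
    congr 2
    push_cast
    ring
  have h4 : character ((q.2 * D.r' : ℤ) * ((q.1 * D.r : ℤ) / m)) *
      character (-(q.2 * D.a * (s + q.1 * D.b))) =
      twist (D.angle m) q q * character (((-q).2 : ℤ) * D.a * s) := by
    rw [twist_eq_character, ← character_add, ← character_add, angle]
    congr 1
    push_cast [Prod.snd_neg]
    ring
  have h5 : phase m α ^ ((-q).2 * D.r') = (phase m α)⁻¹ ^ (q.2 * D.r') := by
    rw [Prod.snd_neg, neg_mul, zpow_neg, inv_zpow]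
  rw [op_apply, Pi.smul_apply, smul_apply, op_apply, ← h1, ← h2, add_sub_cancel_right,
    add_sub_cancel_right, map_mul, map_mul, map_zpow₀, h3, conj_character, mul_zpow, character_zpow,
    h5, smul_eq_mul]
  linear_combination ((phase m α)⁻¹ ^ (q.2 * D.r') * conj (f α s) *
    g (α + ((q.1 * D.r : ℤ) : ZMod m.natAbs)) (s + q.1 * D.b)) * h4

theorem herm_nabla₁ (n : ℤ) (θ : ℝ) (f g : Space m) :
    herm m hm (nabla₁ n m θ f) g = -herm m hm f (nabla₁ n m θ g) := by
  have := neZero_natAbs hm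
  rw [herm_eq, herm_eq, ← Finset.sum_neg_distrib]
  refine Finset.sum_congr rfl fun α _ => ?_
  rw [← MeasureTheory.integral_neg]
  refine MeasureTheory.integral_congr_ae (Filter.Eventually.of_forall fun s => ?_)
  simp only [nabla₁_apply, map_mul, map_div₀, map_sub, Complex.conj_ofReal, Complex.conj_I,
    Complex.conj_ofNat, map_intCast]
  ring

theorem herm_nabla₂ (f g : Space m) :
    herm m hm (nabla₂ m f) g = -herm m hm f (nabla₂ m g) := by
  have := neZero_natAbs hm
  rw [herm_eq, herm_eq, ← Finset.sum_neg_distrib]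
  refine Finset.sum_congr rfl fun α _ => ?_
  have h := SchwartzMap.integral_bilinear_deriv_right_eq_neg_left (f α) (g α) conjMul
  simp only [conjMul_apply] at h
  simp only [nabla₂_apply]
  rw [h, neg_neg]

theorem nabla₁_op (n : ℤ) (θ : ℝ) (D : Modulation) (q : ℤ × ℤ) (f : Space m) :
    nabla₁ n m θ (D.op m q f) = D.op m q (nabla₁ n m θ f) +
      (2 * Real.pi * Complex.I * (m / (n - m * θ) * D.b) * q.1) • D.op m q f := by
  funext α
  ext s
  rw [nabla₁_apply, Pi.add_apply, add_apply, Pi.smul_apply, smul_apply, D.op_apply, D.op_apply,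
    nabla₁_apply, smul_eq_mul]
  push_cast
  ring

theorem nabla₂_op (D : Modulation) (q : ℤ × ℤ) (f : Space m) :
    nabla₂ m (D.op m q f) = D.op m q (nabla₂ m f) +
      (2 * Real.pi * Complex.I * D.a * q.2) • D.op m q f := by
  funext α
  rw [Pi.add_apply, Pi.smul_apply, D.op_eq, D.op_eq]
  change SchwartzMap.derivCLM ℂ ℂ (D.op m q f α) = _ • SchwartzMap.modShift _ _
    (SchwartzMap.derivCLM ℂ ℂ (f (α - ((q.1 * D.r : ℤ) : ZMod m.natAbs)))) + _
  rw [D.op_eq]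
  rw [map_smul, SchwartzMap.derivCLM_modShift, smul_add, smul_comm (phase m α ^ (q.2 * D.r'))]
  congr 2
  push_cast
  ring

/-- The matrix coefficients of the operators of a modulation decay rapidly. -/
theorem Modulation.exists_coeff_bound (D : Modulation) (ha : D.a ≠ 0) (hb : D.b ≠ 0) (k : ℕ) :
    ∀ f g : Space m, ∃ C : ℝ, ∀ q, weight q ^ k * ‖herm m hm (D.op m q f) g‖ ≤ C := by
  have := neZero_natAbs hm
  induction k with
  | zero =>
    intro f g
    have hf : ∀ α : ZMod m.natAbs, ∃ C : ℝ, 0 ≤ C ∧ ∀ s, ‖f α s‖ ≤ C := fun α =>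
      ⟨SchwartzMap.seminorm ℂ 0 0 (f α), apply_nonneg _ _, SchwartzMap.norm_le_seminorm ℂ (f α)⟩
    choose C hC0 hC using hf
    refine ⟨∑ α, ∫ s : ℝ, (∑ β, C β) * ‖g α s‖, fun q => ?_⟩
    rw [pow_zero, one_mul, herm_eq]
    refine (norm_sum_le _ _).trans (Finset.sum_le_sum fun α _ => ?_)
    refine MeasureTheory.norm_integral_le_of_norm_le ((g α).integrable.norm.const_mul _)
      (Filter.Eventually.of_forall fun s => ?_)
    rw [norm_mul, RCLike.norm_conj, D.op_apply, norm_mul, norm_mul, norm_zpow, norm_phase, one_zpow,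
      SchwartzMap.norm_character, one_mul, one_mul]
    refine mul_le_mul_of_nonneg_right ((hC _ _).trans ?_) (norm_nonneg _)
    exact Finset.single_le_sum (f := C) (fun β _ => hC0 β) (Finset.mem_univ _)
  | succ k ih =>
    intro f g
    obtain ⟨C₀, h₀⟩ := ih f g
    -- With `n = 1` and `θ = 0` this operator is plain multiplication by `2πims`. Its commutator
    -- with `V_q` produces `q₁`, that of `d/ds` produces `q₂`; since both operators are skew, each
    -- factor of `q` is traded for coefficients of other Schwartz functions.
    obtain ⟨C₁, h₁⟩ := ih (nabla₁ 1 m 0 f) g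
    obtain ⟨C₁', h₁'⟩ := ih f (nabla₁ 1 m 0 g)
    obtain ⟨C₂, h₂⟩ := ih (nabla₂ m f) g
    obtain ⟨C₂', h₂'⟩ := ih f (nabla₂ m g)
    have hmR : (m : ℝ) ≠ 0 := by exact_mod_cast hm
    have e₁ : ∀ q, 2 * Real.pi * |m * D.b| * (|(q.1 : ℝ)| * ‖herm m hm (D.op m q f) g‖) ≤
        ‖herm m hm (D.op m q (nabla₁ 1 m 0 f)) g‖ +
          ‖herm m hm (D.op m q f) (nabla₁ 1 m 0 g)‖ := fun q => by
      have h := herm_nabla₁ hm 1 0 (D.op m q f) g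
      rw [nabla₁_op, herm_add_left, herm_smul_left] at h
      have h' := (eq_sub_of_add_eq' h).symm
      have hn := congrArg norm h'
      rw [norm_mul, RCLike.norm_conj] at hn
      have hz : ‖2 * (Real.pi : ℂ) * Complex.I * (m / ((1 : ℤ) - m * (0 : ℝ)) * D.b) * q.1‖ =
          2 * Real.pi * |m * D.b| * |(q.1 : ℝ)| := by
        simp [abs_of_pos Real.pi_pos, abs_mul]
      rw [hz] at hn
      rw [← mul_assoc, ← hn]
      refine (norm_sub_le _ _).trans ?_
      rw [norm_neg, add_comm]
    have e₂ : ∀ q, 2 * Real.pi * |D.a| * (|(q.2 : ℝ)| * ‖herm m hm (D.op m q f) g‖) ≤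
        ‖herm m hm (D.op m q (nabla₂ m f)) g‖ +
          ‖herm m hm (D.op m q f) (nabla₂ m g)‖ := fun q => by
      have h := herm_nabla₂ hm (D.op m q f) g
      rw [nabla₂_op, herm_add_left, herm_smul_left] at h
      have h' := (eq_sub_of_add_eq' h).symm
      have hn := congrArg norm h'
      rw [norm_mul, RCLike.norm_conj] at hn
      have hz : ‖2 * (Real.pi : ℂ) * Complex.I * D.a * q.2‖ =
          2 * Real.pi * |D.a| * |(q.2 : ℝ)| := by
        simp [abs_of_pos Real.pi_pos]
      rw [hz] at hn
      rw [← mul_assoc, ← hn]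
      refine (norm_sub_le _ _).trans ?_
      rw [norm_neg, add_comm]
    have p₁ : 0 < 2 * Real.pi * |m * D.b| := by
      have := abs_pos.mpr (mul_ne_zero hmR hb)
      have := Real.pi_pos
      positivity
    have p₂ : 0 < 2 * Real.pi * |D.a| := by
      have := abs_pos.mpr ha
      have := Real.pi_pos
      positivity
    refine ⟨C₀ + (2 * Real.pi * |m * D.b|)⁻¹ * (C₁ + C₁') + (2 * Real.pi * |D.a|)⁻¹ * (C₂ + C₂'),
      fun q => ?_⟩
    have hw := weight_pow_nonneg q k
    have b₁ : weight q ^ k * (|(q.1 : ℝ)| * ‖herm m hm (D.op m q f) g‖) ≤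
        (2 * Real.pi * |m * D.b|)⁻¹ * (C₁ + C₁') := by
      rw [← div_eq_inv_mul, le_div_iff₀ p₁]
      have := mul_le_mul_of_nonneg_left (e₁ q) hw
      linarith [h₁ q, h₁' q]
    have b₂ : weight q ^ k * (|(q.2 : ℝ)| * ‖herm m hm (D.op m q f) g‖) ≤
        (2 * Real.pi * |D.a|)⁻¹ * (C₂ + C₂') := by
      rw [← div_eq_inv_mul, le_div_iff₀ p₂]
      have := mul_le_mul_of_nonneg_left (e₂ q) hw
      linarith [h₂ q, h₂' q]
    calc weight q ^ (k + 1) * ‖herm m hm (D.op m q f) g‖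
        = weight q ^ k * ‖herm m hm (D.op m q f) g‖ +
          weight q ^ k * (|(q.1 : ℝ)| * ‖herm m hm (D.op m q f) g‖) +
          weight q ^ k * (|(q.2 : ℝ)| * ‖herm m hm (D.op m q f) g‖) := by
          rw [pow_succ, weight]; ring
      _ ≤ _ := add_le_add (add_le_add (h₀ q) b₁) b₂

/-- The matrix coefficients `⟨V_q f, g⟩` of the operators of a modulation. -/
def Modulation.coeff (D : Modulation) (ha : D.a ≠ 0) (hb : D.b ≠ 0) (f g : Space m) : RapidSeq :=
  ⟨fun q => herm m hm (D.op m q f) g, fun k => D.exists_coeff_bound hm ha hb k f g⟩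

end SchwartzModule

end

noncomputable section

open FreeModule RapidSeq

/-! ## Poisson summation on `ℝ × ℤ/m` -/

theorem summable_prod_of_fintype {ι κ : Type*} [Fintype ι] {f : ι × κ → ℂ}
    (h : ∀ i, Summable fun k => ‖f (i, k)‖) : Summable f := by
  have h' : Summable fun i => ∑' k, ‖f (i, k)‖ := (hasSum_fintype _).summable
  exact Summable.of_norm ((summable_prod_of_nonneg fun _ => norm_nonneg _).mpr ⟨h, h'⟩)

namespace SchwartzMap

theorem summable_norm_add_mul (f : 𝓢(ℝ, ℂ)) (y : ℝ) {c : ℝ} (hc : c ≠ 0) :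
    Summable fun k : ℤ => ‖f (y + k * c)‖ := by
  have h := fun x => one_add_le_sup_seminorm_apply (𝕜 := ℂ) (m := (2, 0)) le_rfl le_rfl f x
  simp only [norm_iteratedFDeriv_zero] at h
  set C := 2 ^ 2 * ((Finset.Iic ((2, 0) : ℕ × ℕ)).sup fun m => SchwartzMap.seminorm ℂ m.1 m.2) f
  have hC : ∀ x : ℝ, (1 + ‖x‖) ^ 2 * ‖f x‖ ≤ C := h
  refine Summable.of_nonneg_of_le (fun _ => norm_nonneg _) (fun k => ?_)
    (summable_inv_one_add_abs_sq.mul_left (((1 + |c|⁻¹) * (1 + |y|)) ^ 2 * C))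
  rw [← div_eq_mul_inv, le_div_iff₀ (by positivity)]
  have hk : 1 + |(k : ℝ)| ≤ ((1 + |c|⁻¹) * (1 + |y|)) * (1 + ‖y + k * c‖) := by
    have h1 : |(k : ℝ)| = |c|⁻¹ * |k * c| := by
      rw [abs_mul]; field_simp
    have h2 : |(k : ℝ) * c| ≤ |y| + |y + k * c| := by
      have := abs_sub (y + k * c) y
      rw [add_sub_cancel_left] at this
      linarith
    have hc' : 0 ≤ |c|⁻¹ := by positivity
    rw [h1, Real.norm_eq_abs]
    nlinarith [mul_le_mul_of_nonneg_left h2 hc', abs_nonneg y, abs_nonneg (y + k * c),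
      mul_nonneg (abs_nonneg y) (abs_nonneg (y + k * c)), mul_nonneg hc' (mul_nonneg (abs_nonneg y)
      (abs_nonneg (y + k * c))), mul_nonneg hc' (abs_nonneg y),
      mul_nonneg hc' (abs_nonneg (y + k * c))]
  calc ‖f (y + k * c)‖ * (1 + |(k : ℝ)|) ^ 2
      ≤ ‖f (y + k * c)‖ * (((1 + |c|⁻¹) * (1 + |y|)) * (1 + ‖y + k * c‖)) ^ 2 := by gcongr
    _ = ((1 + |c|⁻¹) * (1 + |y|)) ^ 2 * ((1 + ‖y + k * c‖) ^ 2 * ‖f (y + k * c)‖) := by ring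
    _ ≤ _ := by gcongr; exact hC _

theorem summable_add_mul (f : 𝓢(ℝ, ℂ)) (y : ℝ) {c : ℝ} (hc : c ≠ 0) :
    Summable fun k : ℤ => f (y + k * c) := (f.summable_norm_add_mul y hc).of_norm

open SchwartzModule (character)

-- Ordinary Poisson summation for `s ↦ f(s/a)` at the point `ay`; the factor `|a|` is the Jacobian
-- of the rescaling.
open FourierTransform MeasureTheory in
theorem hasSum_poisson (f : 𝓢(ℝ, ℂ)) {a : ℝ} (ha : a ≠ 0) (y : ℝ) :
    HasSum (fun l : ℤ => ((|a| : ℝ) : ℂ) * ((∫ s, character (-(l * a * s)) * f s) * character (l * a * y)))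
      (∑' k : ℤ, f (y + k * a⁻¹)) := by
  let A : ℝ ≃L[ℝ] ℝ := ContinuousLinearEquiv.smulLeft (Units.mk0 a⁻¹ (inv_ne_zero ha))
  have hA : ∀ s, A s = s * a⁻¹ := fun s => by
    change a⁻¹ * s = _; ring
  let g : 𝓢(ℝ, ℂ) := compCLMOfContinuousLinearEquiv ℂ A f
  have hg : ∀ s, g s = f (s * a⁻¹) := fun s => by
    change f (A s) = _; rw [hA]
  set G : 𝓢(ℝ, ℂ) := 𝓕 g with hG
  have hF : ∀ l : ℤ, G l = |a| * ∫ s, character (-(l * a * s)) * f s := fun l => by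
    rw [hG, fourier_coe, Real.fourier_eq']
    have e : ∀ v : ℝ, Complex.exp ((-2 * Real.pi * inner ℝ v (l : ℝ) : ℝ) * Complex.I) • g v =
        (fun s => character (-(l * a * s)) * f s) (v / a) := fun v => by
      rw [hg, smul_eq_mul, ← div_eq_mul_inv]
      congr 1
      unfold character
      congr 1
      have : (a : ℂ) ≠ 0 := by exact_mod_cast ha
      simp only [RCLike.inner_apply, conj_trivial]
      push_cast
      field_simp
    rw [integral_congr_ae (Filter.Eventually.of_forall e),
      Measure.integral_comp_div (fun s => character (-(l * a * s)) * f s) a, Complex.real_smul]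
  have hs : Summable fun l : ℤ => G l :=
    (G.summable_add_mul 0 one_ne_zero).congr fun l => by rw [zero_add, mul_one]
  have hfour : ∀ l : ℤ, fourier l ((a * y : ℝ) : UnitAddCircle) = character (l * a * y) := fun l => by
    rw [fourier_coe_apply]
    unfold character
    congr 1
    push_cast
    ring
  have h : ∑' k : ℤ, g (a * y + k) = ∑' l : ℤ, G l * fourier l ((a * y : ℝ) : UnitAddCircle) :=
    tsum_eq_tsum_fourier g (a * y)
  have hl : ∀ k : ℤ, g (a * y + k) = f (y + k * a⁻¹) := fun k => by
    rw [hg]; congr 1; field_simp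
  simp only [hl] at h
  have hs' : Summable fun l : ℤ => G l * fourier l ((a * y : ℝ) : UnitAddCircle) := by
    refine Summable.of_norm_bounded hs.norm fun l => ?_
    rw [norm_mul, hfour, norm_character, mul_one]
  have e : (fun l : ℤ => ((|a| : ℝ) : ℂ) * ((∫ s, character (-(l * a * s)) * f s) *
      character (l * a * y))) = fun l : ℤ => G l * fourier l ((a * y : ℝ) : UnitAddCircle) :=
    funext fun l => by rw [hF, hfour]; ring
  rw [h, e]
  exact hs'.hasSum

end SchwartzMap

namespace SchwartzModule

variable {m : ℤ}

/-- Division with remainder by `m`. -/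
def divModEquiv (hm : m ≠ 0) : ℤ ≃ ZMod m.natAbs × ℤ where
  toFun j := ((j : ZMod m.natAbs), j / m)
  invFun x := x.1.val + m * x.2
  left_inv j := by
    have := neZero_natAbs hm
    simp only [ZMod.val_intCast]
    have h : j % (m.natAbs : ℤ) = j % m := by
      rw [Int.natCast_natAbs, Int.emod_abs]
    rw [h, Int.emod_add_mul_ediv]
  right_inv x := by
    have := neZero_natAbs hm
    have h0 : ((m : ℤ) : ZMod m.natAbs) = 0 := (ZMod.intCast_zmod_eq_zero_iff_dvd _ _).mpr
      (Int.natAbs_dvd.mpr dvd_rfl)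
    have h1 : (x.1.val : ℤ) / m = 0 := by
      refine Int.ediv_eq_zero_of_lt_abs (by positivity) ?_
      rw [← Int.natCast_natAbs]
      exact_mod_cast ZMod.val_lt x.1
    refine Prod.ext ?_ ?_
    · push_cast
      simp [h0]
    · change ((x.1.val : ℤ) + m * x.2) / m = x.2
      rw [Int.add_mul_ediv_left _ _ hm, h1, zero_add]

theorem divModEquiv_symm_apply (hm : m ≠ 0) (x : ZMod m.natAbs × ℤ) :
    (divModEquiv hm).symm x = x.1.val + m * x.2 := rfl

namespace Modulation

variable (D : Modulation)

/-- Poisson summation for the subgroup generated by `(b, r)`, the kernel of the character. -/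
theorem hasSum_poisson [NeZero m.natAbs] (hm : m ≠ 0) (ha : D.a ≠ 0) (hb : D.b = (m * D.a)⁻¹)
    (hr : m ∣ D.r * D.r' - 1) (F : Space m) (α : ZMod m.natAbs) (s : ℝ) :
    HasSum (fun l : ℤ => ((|D.a| : ℝ) : ℂ) * (phase m α ^ (l * D.r') * character (l * D.a * s) *
      ∑ β, ∫ u, phase m β ^ (-(l * D.r')) * (character (-(l * D.a * u)) * F β u)))
      (∑' j : ℤ, F (α + ((j * D.r : ℤ) : ZMod m.natAbs)) (s + j * D.b)) := by
  have hmR : (m : ℝ) ≠ 0 := by exact_mod_cast hm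
  have hm0 : ((m : ℤ) : ZMod m.natAbs) = 0 := (ZMod.intCast_zmod_eq_zero_iff_dvd _ _).mpr
    (Int.natAbs_dvd.mpr dvd_rfl)
  have hr1 : ((D.r : ℤ) : ZMod m.natAbs) * ((D.r' : ℤ) : ZMod m.natAbs) = 1 := by
    have h := (ZMod.intCast_zmod_eq_zero_iff_dvd _ _).mpr (Int.natAbs_dvd.mpr hr)
    push_cast at h
    exact sub_eq_zero.mp h
  obtain ⟨z, hz⟩ := hr
  -- Writing `j = t + mk`, the component depends only on `t`, and `e` is a bijection since `r r' ≡
  -- 1` modulo `m`. As `mb = 1/a`, the remaining sum over `k` has step `1/a` and Poisson summation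
  -- on the line applies for each `t`.
  let e : ZMod m.natAbs ≃ ZMod m.natAbs :=
    { toFun := fun t => α + t * D.r
      invFun := fun β => (β - α) * D.r'
      left_inv := fun t => by linear_combination t * hr1
      right_inv := fun β => by linear_combination (β - α) * hr1 }
  have hterm : ∀ t k, F (α + (((divModEquiv hm).symm (t, k) * D.r : ℤ) : ZMod m.natAbs))
      (s + ((divModEquiv hm).symm (t, k) : ℤ) * D.b) =
      F (e t) (s + t.val * D.b + k * D.a⁻¹) := fun t k => by
    rw [divModEquiv_symm_apply]
    congr 1
    · congr 1
      change _ = α + t * D.r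
      push_cast
      rw [hm0, ZMod.natCast_val, ZMod.cast_id]
      ring
    · rw [hb]; push_cast; field_simp; ring
  have hsum : Summable fun x : ZMod m.natAbs × ℤ =>
      F (e x.1) (s + x.1.val * D.b + x.2 * D.a⁻¹) := by
    exact summable_prod_of_fintype fun t =>
      (F (e t)).summable_norm_add_mul (s + t.val * D.b) (inv_ne_zero ha)
  have hlhs : ∑' j : ℤ, F (α + ((j * D.r : ℤ) : ZMod m.natAbs)) (s + j * D.b) =
      ∑ t : ZMod m.natAbs, ∑' k : ℤ, F (e t) (s + t.val * D.b + k * D.a⁻¹) := by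
    rw [← (divModEquiv hm).symm.tsum_eq, ← tsum_fintype (L := .unconditional _), ← hsum.tsum_prod]
    exact tsum_congr fun x => hterm x.1 x.2
  rw [hlhs]
  have h := hasSum_sum (s := Finset.univ) fun (t : ZMod m.natAbs) _ =>
    (F (e t)).hasSum_poisson ha (s + t.val * D.b)
  have hfun : (fun l : ℤ => ((|D.a| : ℝ) : ℂ) * (phase m α ^ (l * D.r') * character (l * D.a * s) *
      ∑ β, ∫ u, phase m β ^ (-(l * D.r')) * (character (-(l * D.a * u)) * F β u))) =
      fun l : ℤ => ∑ t, ((|D.a| : ℝ) : ℂ) * ((∫ u, character (-(l * D.a * u)) * F (e t) u) *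
        character (l * D.a * (s + t.val * D.b))) := by
    funext l
    rw [← Finset.mul_sum, ← Equiv.sum_comp e, Finset.mul_sum]
    congr 1
    refine Finset.sum_congr rfl fun t _ => ?_
    rw [MeasureTheory.integral_const_mul]
    have h1 : phase m (e t) = character (-((t.val : ℤ) * D.r : ℤ) / m) * phase m α := by
      have := phase_sub_intCast hm α (-((t.val : ℤ) * D.r))
      rw [Int.cast_neg, sub_neg_eq_add] at this
      change phase m (α + t * D.r) = _
      rw [← Int.cast_neg, ← this]
      congr 2
      push_cast
      rw [ZMod.natCast_val, ZMod.cast_id]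
    -- The discrete phase and the real character agree because `ab = 1/m`, and `r r'/m` differs from
    -- `1/m` by the integer `z`.
    have h2 : character ((-(l * D.r') : ℤ) * (-((t.val : ℤ) * D.r : ℤ) / m)) =
        character (l * D.a * (t.val * D.b)) := by
      rw [← mul_one (character (l * D.a * (t.val * D.b))),
        ← character_intCast (l * t.val * z), ← character_add]
      congr 1
      have hz' : (D.r : ℝ) * D.r' - 1 = m * z := by exact_mod_cast hz
      rw [hb]
      push_cast
      field_simp
      linear_combination (l * t.val : ℝ) * hz'
    have h3 : phase m α ^ (l * D.r') * phase m α ^ (-(l * D.r')) = 1 := by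
      rw [zpow_neg, mul_inv_cancel₀ (zpow_ne_zero _ (phase_ne_zero α))]
    rw [h1, mul_zpow, character_zpow, h2, mul_add, character_add]
    linear_combination (character (l * D.a * s) * character (l * D.a * (t.val * D.b)) *
      ∫ u, character (-(l * D.a * u)) * F (e t) u) * h3
  rw [hfun]
  exact h

end Modulation

end SchwartzModule

end

noncomputable section

open FreeModule RapidSeq

/-! ## Duality of modulations -/

namespace SchwartzModule

namespace Modulation

variable {m : ℤ}

/-- The group element of `D'` generates the kernel of the character of `D`. -/
structure IsDual (m : ℤ) (D D' : Modulation) : Prop where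
  a_ne : D.a ≠ 0
  b_eq : D'.b = (m * D.a)⁻¹
  dvd : m ∣ D'.r * D.r' - 1

theorem IsDual.b_ne {D D' : Modulation} (h : IsDual m D D') (hm : m ≠ 0) : D'.b ≠ 0 := by
  rw [h.b_eq]
  exact inv_ne_zero (mul_ne_zero (by exact_mod_cast hm) h.a_ne)

variable {D D' : Modulation}

/-- For a fixed translation index `i`, the sum over the powers `l` of the character is a Fourier
series; Poisson summation turns it into a sum over the subgroup on which the character is trivial,
and this subgroup is generated by the translation of `D'`. -/
theorem IsDual.tsum_coeff (h : IsDual m D D') (hm : m ≠ 0) (η f ζ : Space m)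
    (α : ZMod m.natAbs) (s : ℝ) (i : ℤ) :
    ((|D.a| : ℝ) : ℂ) * ∑' l : ℤ, herm m hm (D.op m (i, l) η) f * D.op m (i, l) ζ α s =
      ∑' j : ℤ, conj (η (α + ((j * D'.r : ℤ) : ZMod m.natAbs) - ((i * D.r : ℤ) : ZMod m.natAbs))
        (s + j * D'.b - i * D.b)) * f (α + ((j * D'.r : ℤ) : ZMod m.natAbs)) (s + j * D'.b) *
        ζ (α - ((i * D.r : ℤ) : ZMod m.natAbs)) (s - i * D.b) := by
  have := neZero_natAbs hm
  let F : Space m := fun β => conjProd (D.op m (i, 0) η β) (f β)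
  have hF : ∀ β u, F β u = conj (η (β - ((i * D.r : ℤ) : ZMod m.natAbs)) (u - i * D.b)) * f β u :=
    fun β u => by
      rw [conjProd_apply, op_apply]
      simp [character_zero]
  -- The auxiliary modulation pairs the character of `D` with the group element of `D'`.
  have hp := hasSum_poisson (⟨D.a, D'.b, D.r', D'.r⟩ : Modulation) hm h.a_ne h.b_eq h.dvd F α s
  have hp' := hp.mul_right (ζ (α - ((i * D.r : ℤ) : ZMod m.natAbs)) (s - i * D.b))
  simp only [hF] at hp'
  rw [← tsum_mul_right] at hp'
  rw [← hp'.tsum_eq, ← tsum_mul_left]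
  refine tsum_congr fun l => ?_
  have hc : herm m hm (D.op m (i, l) η) f =
      ∑ β, ∫ u, phase m β ^ (-(l * D.r')) * (character (-(l * D.a * u)) *
        (conj (η (β - ((i * D.r : ℤ) : ZMod m.natAbs)) (u - i * D.b)) * f β u)) := by
    rw [herm_eq]
    refine Finset.sum_congr rfl fun β _ => MeasureTheory.integral_congr_ae
      (Filter.Eventually.of_forall fun u => ?_)
    simp only [op_apply, map_mul, map_zpow₀, conj_phase, conj_character, inv_zpow', mul_assoc]
  rw [hc, op_apply]
  ring

/-- The reconstruction formulas of two dual modulations agree. -/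
theorem IsDual.series_coeff [NeZero m.natAbs] (h : IsDual m D D') (h' : IsDual m D' D) (hm : m ≠ 0)
    (η f ζ : Space m) :
    ((|D.a| : ℝ) : ℂ) • D.series m (D.coeff hm h.a_ne (h'.b_ne hm) η f) ζ =
      ((|D'.a| : ℝ) : ℂ) • D'.series m (D'.coeff hm h'.a_ne (h.b_ne hm) η ζ) f := by
  funext α
  ext s
  -- Poisson summation reduces both sides to the same absolutely convergent double series over the
  -- translations of `D` and `D'`, taken in the two orders of summation.
  let K : ℤ × ℤ → ℂ := fun x =>
    conj (η (α + ((x.1 * D.r : ℤ) : ZMod m.natAbs) + ((x.2 * D'.r : ℤ) : ZMod m.natAbs))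
      (s + x.1 * D.b + x.2 * D'.b)) *
    (ζ (α + ((x.1 * D.r : ℤ) : ZMod m.natAbs)) (s + x.1 * D.b) *
      f (α + ((x.2 * D'.r : ℤ) : ZMod m.natAbs)) (s + x.2 * D'.b))
  have hsum : ∀ {E E' : Modulation}, IsDual m E E' → ∀ g : Space m,
      Summable fun j : ℤ => ‖g (α + ((j * E'.r : ℤ) : ZMod m.natAbs)) (s + j * E'.b)‖ := by
    intro E E' hE g
    have hs : Summable fun j : ℤ => ∑ β, ‖g β (s + j * E'.b)‖ :=
      summable_sum fun β _ => (g β).summable_norm_add_mul s (hE.b_ne hm)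
    exact Summable.of_nonneg_of_le (fun _ => norm_nonneg _) (fun j =>
      Finset.single_le_sum (f := fun β => ‖g β (s + j * E'.b)‖) (fun _ _ => norm_nonneg _)
        (Finset.mem_univ _)) hs
  have hK : Summable K := by
    have hη : ∃ C : ℝ, ∀ β u, ‖η β u‖ ≤ C := by
      refine ⟨∑ β, SchwartzMap.seminorm ℂ 0 0 (η β), fun β u => ?_⟩
      exact (SchwartzMap.norm_le_seminorm ℂ (η β) u).trans (Finset.single_le_sum
        (f := fun β => SchwartzMap.seminorm ℂ 0 0 (η β)) (fun _ _ => apply_nonneg _ _)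
        (Finset.mem_univ β))
    obtain ⟨C, hC⟩ := hη
    have hprod := (hsum h' ζ).mul_of_nonneg (hsum h f) (fun _ => norm_nonneg _)
      (fun _ => norm_nonneg _)
    refine Summable.of_norm_bounded (hprod.mul_left C) fun x => ?_
    rw [norm_mul, norm_mul, RCLike.norm_conj]
    exact mul_le_mul_of_nonneg_right (hC _ _) (by positivity)
  have e₁ := D.hasSum_series_apply (D.coeff hm h.a_ne (h'.b_ne hm) η f) ζ α s
  have e₂ := D'.hasSum_series_apply (D'.coeff hm h'.a_ne (h.b_ne hm) η ζ) f α s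
  rw [Pi.smul_apply, smul_apply, Pi.smul_apply, smul_apply, smul_eq_mul, smul_eq_mul,
    ← e₁.tsum_eq, ← e₂.tsum_eq, e₁.summable.tsum_prod, e₂.summable.tsum_prod]
  have l₁ : ((|D.a| : ℝ) : ℂ) * ∑' i : ℤ, ∑' l : ℤ,
      herm m hm (D.op m (i, l) η) f * D.op m (i, l) ζ α s = ∑' i : ℤ, ∑' j : ℤ, K (i, j) := by
    rw [← tsum_mul_left, ← (Equiv.neg ℤ).tsum_eq (fun i => ∑' j : ℤ, K (i, j))]
    refine tsum_congr fun i => ?_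
    rw [h.tsum_coeff hm]
    refine tsum_congr fun j => ?_
    have a1 : α + (((-i : ℤ) * D.r : ℤ) : ZMod m.natAbs) = α - ((i * D.r : ℤ) : ZMod m.natAbs) := by
      push_cast; ring
    have a2 : s + ((-i : ℤ) : ℝ) * D.b = s - i * D.b := by push_cast; ring
    simp only [K, Equiv.neg_apply, a1, a2]
    rw [add_sub_right_comm α, add_sub_right_comm s]
    ring
  have l₂ : ((|D'.a| : ℝ) : ℂ) * ∑' i : ℤ, ∑' l : ℤ,
      herm m hm (D'.op m (i, l) η) ζ * D'.op m (i, l) f α s = ∑' j : ℤ, ∑' i : ℤ, K (i, j) := by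
    rw [← tsum_mul_left, ← (Equiv.neg ℤ).tsum_eq (fun j => ∑' i : ℤ, K (i, j))]
    refine tsum_congr fun j => ?_
    rw [h'.tsum_coeff hm]
    refine tsum_congr fun i => ?_
    have a1 : α + (((-j : ℤ) * D'.r : ℤ) : ZMod m.natAbs) =
        α - ((j * D'.r : ℤ) : ZMod m.natAbs) := by
      push_cast; ring
    have a2 : s + ((-j : ℤ) : ℝ) * D'.b = s - j * D'.b := by push_cast; ring
    have a3 : α + ((i * D.r : ℤ) : ZMod m.natAbs) + (((-j : ℤ) * D'.r : ℤ) : ZMod m.natAbs) =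
        α + ((i * D.r : ℤ) : ZMod m.natAbs) - ((j * D'.r : ℤ) : ZMod m.natAbs) := by
      push_cast; ring
    have a4 : s + i * D.b + ((-j : ℤ) : ℝ) * D'.b = s + i * D.b - j * D'.b := by push_cast; ring
    simp only [K, Equiv.neg_apply, a1, a2, a3, a4]
    ring
  refine l₁.trans (Eq.trans ?_ l₂.symm)
  exact (Summable.tsum_comm (f := fun i j => K (i, j)) hK).symm

end Modulation

end SchwartzModule

end

noncomputable section

open FreeModule RapidSeq

/-! ## A finite frame -/

namespace SchwartzModule

theorem character_pow (x : ℝ) (k : ℕ) : character x ^ k = character (k * x) := by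
  exact_mod_cast character_zpow x k

/-- A smooth function with support in `[0, 2]` such that the squares of its integral translates
sum to one. -/
def bump (s : ℝ) : ℝ :=
  Real.sin (Real.pi / 2 * Real.smoothTransition s) *
    Real.cos (Real.pi / 2 * Real.smoothTransition (s - 1))

theorem bump_of_nonpos {s : ℝ} (hs : s ≤ 0) : bump s = 0 := by
  simp [bump, Real.smoothTransition.zero_of_nonpos hs]

theorem bump_of_two_le {s : ℝ} (hs : 2 ≤ s) : bump s = 0 := by
  have h : Real.smoothTransition (s - 1) = 1 := Real.smoothTransition.one_of_one_le (by linarith)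
  simp [bump, h]

theorem contDiff_bump : ContDiff ℝ ∞ bump :=
  (Real.contDiff_sin.comp (contDiff_const.mul Real.smoothTransition.contDiff)).mul
    (Real.contDiff_cos.comp (contDiff_const.mul
      (Real.smoothTransition.contDiff.comp (contDiff_id.sub contDiff_const))))

/-- On `[0, 1]` the two values are the sine and the cosine of the same angle. -/
theorem bump_sq_add {s : ℝ} (h0 : 0 ≤ s) (h1 : s ≤ 1) : bump s ^ 2 + bump (s + 1) ^ 2 = 1 := by
  have e1 : Real.smoothTransition (s - 1) = 0 :=
    Real.smoothTransition.zero_of_nonpos (by linarith)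
  have e2 : Real.smoothTransition (s + 1) = 1 :=
    Real.smoothTransition.one_of_one_le (by linarith)
  simp [bump, e1, e2]

/-- Folding `[0, 2]` onto `[0, 1]` leaves the character unchanged, and the squares add up to one, so
the integral is that of a character over a period. -/
theorem integral_bump_sq_mul (l : ℤ) :
    ∫ u, (bump u : ℂ) ^ 2 * character (l * u) = if l = 0 then 1 else 0 := by
  have hc : Continuous fun u => (bump u : ℂ) ^ 2 * character (l * u) := by
    have h1 : Continuous bump := contDiff_bump.continuous
    have h2 : Continuous character := by unfold character; fun_prop
    fun_prop
  have hsupp : Function.support (fun u => (bump u : ℂ) ^ 2 * character (l * u)) ⊆ Set.Ioc 0 2 := by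
    intro u hu
    by_contra hn
    rw [Set.mem_Ioc, not_and_or, not_lt, not_le] at hn
    refine hu ?_
    rcases hn with h | h
    · simp [bump_of_nonpos h]
    · simp [bump_of_two_le h.le]
  rw [← intervalIntegral.integral_eq_integral_of_support_subset hsupp,
    ← intervalIntegral.integral_add_adjacent_intervals (b := 1)
      (hc.intervalIntegrable _ _) (hc.intervalIntegrable _ _)]
  have h2 : ∫ u in (1 : ℝ)..2, (bump u : ℂ) ^ 2 * character (l * u) =
      ∫ u in (0 : ℝ)..1, (bump (u + 1) : ℂ) ^ 2 * character (l * u) := by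
    have := intervalIntegral.integral_comp_add_right (a := 0) (b := 1)
      (fun u => (bump u : ℂ) ^ 2 * character (l * u)) 1
    rw [show (0 : ℝ) + 1 = 1 by norm_num, show (1 : ℝ) + 1 = 2 by norm_num] at this
    rw [← this]
    refine intervalIntegral.integral_congr fun u _ => ?_
    rw [mul_add, character_add, mul_one, character_intCast, mul_one]
  have hc' : Continuous fun u => (bump (u + 1) : ℂ) ^ 2 * character (l * u) := by
    have h1 : Continuous bump := contDiff_bump.continuous
    have h2 : Continuous character := by unfold character; fun_prop
    fun_prop
  rw [h2, ← intervalIntegral.integral_add (hc.intervalIntegrable _ _)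
    (hc'.intervalIntegrable _ _)]
  have h3 : ∫ u in (0 : ℝ)..1, ((bump u : ℂ) ^ 2 * character (l * u) +
      (bump (u + 1) : ℂ) ^ 2 * character (l * u)) = ∫ u in (0 : ℝ)..1, character (l * u) := by
    refine intervalIntegral.integral_congr fun u hu => ?_
    rw [Set.uIcc_of_le zero_le_one] at hu
    have : ((bump u : ℂ) ^ 2 + (bump (u + 1) : ℂ) ^ 2) = 1 := by
      exact_mod_cast bump_sq_add hu.1 hu.2
    rw [← add_mul, this, one_mul]
  rw [h3]
  split_ifs with hl
  · simp [hl, character_zero]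
  · have hz : 2 * (Real.pi : ℂ) * Complex.I * l ≠ 0 := by
      simp [hl, Real.pi_ne_zero, Complex.I_ne_zero]
    have e : ∀ u : ℝ, character (l * u) = Complex.exp (2 * Real.pi * Complex.I * l * u) := fun u => by
      unfold character; congr 1; push_cast; ring
    simp only [e]
    rw [integral_exp_mul_complex hz]
    have h1 : Complex.exp (2 * Real.pi * Complex.I * l * (1 : ℝ)) = 1 := by
      rw [← e, mul_one, character_intCast]
    rw [h1]
    simp

/-- The dilated and translated function `s ↦ bump (s / c - i)`. -/
def bumpSchwartz (c : ℝ) (hc : 0 < c) (i : ℕ) : 𝓢(ℝ, ℂ) :=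
  HasCompactSupport.toSchwartzMap (f := fun s : ℝ => (bump (s / c - i) : ℂ))
    (HasCompactSupport.of_support_subset_isCompact (K := Set.Icc (c * i) (c * (i + 2)))
      isCompact_Icc (fun s hs => by
        by_contra hn
        rw [Set.mem_Icc, not_and_or, not_le, not_le] at hn
        refine hs ?_
        rcases hn with h | h
        · have : s / c - i ≤ 0 := by
            rw [sub_nonpos, div_le_iff₀ hc]; linarith
          simp [bump_of_nonpos this]
        · have : 2 ≤ s / c - i := by
            rw [le_sub_iff_add_le, le_div_iff₀ hc]; linarith
          simp [bump_of_two_le this]))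
    (Complex.ofRealCLM.contDiff.comp (contDiff_bump.comp
      ((contDiff_id.div_const c).sub contDiff_const)))

theorem bumpSchwartz_apply (c : ℝ) (hc : 0 < c) (i : ℕ) (s : ℝ) :
    bumpSchwartz c hc i s = bump (s / c - i) := rfl

variable {m : ℤ}

/-- The elements of the frame. -/
def frame (m : ℤ) (c : ℝ) (hc : 0 < c) (i : ℕ) : Space m := Pi.single 0 (bumpSchwartz c hc i)

theorem herm_frame_op_eq [NeZero m.natAbs] (hm : m ≠ 0) (D : Modulation) (c : ℝ) (hc : 0 < c)
    (i : ℕ) (q : ℤ × ℤ) : herm m hm (frame m c hc i) (D.op m q (frame m c hc i)) =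
      ∫ s, (bump (s / c - i) : ℂ) * (character (q.2 * D.a * s) *
        frame m c hc i (-((q.1 * D.r : ℤ) : ZMod m.natAbs)) (s - q.1 * D.b)) := by
  rw [herm_eq, Finset.sum_eq_single 0]
  · refine MeasureTheory.integral_congr_ae (Filter.Eventually.of_forall fun s => ?_)
    simp only [D.op_apply, frame, Pi.single_eq_same, bumpSchwartz_apply, Complex.conj_ofReal,
      phase_zero, one_zpow, one_mul, zero_sub]
  · intro α _ hα
    simp [frame, hα]
  · simp

/-- If `m` does not divide `q₁`, the translate lives on another component of `ℝ × ℤ/m`. If it does,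
the translation is by a nonzero integer, while the supports have length `2c < 1`. -/
theorem herm_frame_op_of_ne (hm : m ≠ 0) (D : Modulation) (hr : D.r = 1) (hb : D.b = (m : ℝ)⁻¹)
    (c : ℝ) (hc : 0 < c) (hc2 : 2 * c < 1) (i : ℕ) (q : ℤ × ℤ) (hq : q.1 ≠ 0) :
    herm m hm (frame m c hc i) (D.op m q (frame m c hc i)) = 0 := by
  have := neZero_natAbs hm
  rw [herm_frame_op_eq]
  refine (MeasureTheory.integral_congr_ae (Filter.Eventually.of_forall fun s => ?_)).trans
    (MeasureTheory.integral_zero _ _)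
  by_cases hd : m ∣ q.1
  · obtain ⟨k, hk⟩ := hd
    have hk0 : k ≠ 0 := by rintro rfl; exact hq (by simpa using hk)
    have h0 : (-((q.1 * D.r : ℤ) : ZMod m.natAbs)) = 0 := by
      rw [neg_eq_zero, ZMod.intCast_zmod_eq_zero_iff_dvd, hr, hk]
      exact Int.natAbs_dvd.mpr ⟨k, by ring⟩
    have hmR : (m : ℝ) ≠ 0 := by exact_mod_cast hm
    have hs : s - q.1 * D.b = s - k := by
      rw [hb, hk]; push_cast; field_simp
    rw [h0, frame, Pi.single_eq_same, bumpSchwartz_apply, hs]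
    have hk1 : (1 : ℝ) ≤ |(k : ℝ)| := by exact_mod_cast Int.one_le_abs hk0
    by_contra hne
    have hb1 : bump (s / c - i) ≠ 0 := fun h => hne (by simp [h])
    have hb2 : bump ((s - k) / c - i) ≠ 0 := fun h => hne (by simp [h])
    have b1 : 0 < s / c - i := not_le.mp fun h => hb1 (bump_of_nonpos h)
    have b2 : s / c - i < 2 := not_le.mp fun h => hb1 (bump_of_two_le h)
    have b3 : 0 < (s - k) / c - i := not_le.mp fun h => hb2 (bump_of_nonpos h)
    have b4 : (s - k) / c - i < 2 := not_le.mp fun h => hb2 (bump_of_two_le h)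
    rw [sub_div] at b3 b4
    have hkc : |(k : ℝ) / c| < 2 := by rw [abs_lt]; constructor <;> linarith
    rw [abs_div, abs_of_pos hc, div_lt_iff₀ hc] at hkc
    linarith
  · have h0 : (-((q.1 * D.r : ℤ) : ZMod m.natAbs)) ≠ 0 := by
      rw [Ne, neg_eq_zero, ZMod.intCast_zmod_eq_zero_iff_dvd, hr, mul_one, Int.natAbs_dvd]
      exact hd
    rw [frame, Pi.single_eq_of_ne h0, zero_apply, mul_zero, mul_zero]

/-- For `q₁ = 0` the `i`-th term is a fixed integral times the `i`-th power of an `N`-th root of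
unity. Unless `N` divides `q₂`, the geometric sum vanishes; if `q₂ = Nl`, the integral vanishes for
`l ≠ 0`, and `l = 0` leaves `cN = |a|⁻¹`. -/
theorem sum_herm_frame_op (hm : m ≠ 0) (D : Modulation) (ha : D.a ≠ 0) (hr : D.r = 1)
    (hb : D.b = (m : ℝ)⁻¹) {N : ℕ} (hN : N ≠ 0) (c : ℝ) (hc : 0 < c) (hc2 : 2 * c < 1)
    (hcN : c * N * |D.a| = 1) (q : ℤ × ℤ) :
    ∑ i : Fin N, herm m hm (frame m c hc i) (D.op m q (frame m c hc i)) =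
      if q = 0 then ((|D.a|⁻¹ : ℝ) : ℂ) else 0 := by
  have := neZero_natAbs hm
  by_cases hq : q.1 = 0
  swap
  · rw [if_neg (fun h => hq (by rw [h]; rfl))]
    exact Finset.sum_eq_zero fun i _ => herm_frame_op_of_ne hm D hr hb c hc hc2 i q hq
  have hNR : (N : ℝ) ≠ 0 := by exact_mod_cast hN
  -- `σ` is the sign of `a`; since `cN|a| = 1`, the rescaled frequency `ac` is `±1/N`.
  obtain ⟨σ, hσ, hσ'⟩ : ∃ σ : ℤ, σ ≠ 0 ∧ IsUnit σ ∧ D.a * c = σ / N := by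
    rcases lt_or_gt_of_ne ha with h | h
    · refine ⟨-1, by norm_num, by simp, ?_⟩
      rw [abs_of_neg h] at hcN
      rw [eq_div_iff hNR]; push_cast; linarith
    · refine ⟨1, by norm_num, by simp, ?_⟩
      rw [abs_of_pos h] at hcN
      rw [eq_div_iff hNR]; push_cast; linarith
  obtain ⟨hσu, hac⟩ := hσ'
  have hterm : ∀ i : Fin N, herm m hm (frame m c hc i) (D.op m q (frame m c hc i)) =
      c * ((∫ u, (bump u : ℂ) ^ 2 * character (q.2 * σ / N * u)) *
        character (q.2 * σ / N) ^ (i : ℕ)) := fun i => by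
    rw [herm_frame_op_eq, hq]
    have e : ∀ s : ℝ, (bump (s / c - i) : ℂ) * (character (q.2 * D.a * s) *
        frame m c hc i (-(((0 : ℤ) * D.r : ℤ) : ZMod m.natAbs)) (s - (0 : ℤ) * D.b)) =
        (fun u => (bump (u - i) : ℂ) ^ 2 * character (q.2 * σ / N * u)) (s / c) := fun s => by
      have e1 : q.2 * D.a * s = q.2 * σ / N * (s / c) := by
        have : D.a = σ / N / c := by rw [← hac]; field_simp
        rw [this]; field_simp
      rw [zero_mul, Int.cast_zero, neg_zero, frame, Pi.single_eq_same, bumpSchwartz_apply,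
        Int.cast_zero, zero_mul, sub_zero, e1]
      ring
    rw [MeasureTheory.integral_congr_ae (Filter.Eventually.of_forall e),
      MeasureTheory.Measure.integral_comp_div
        (fun u => (bump (u - i) : ℂ) ^ 2 * character (q.2 * σ / N * u)) c, abs_of_pos hc,
      Complex.real_smul, ← MeasureTheory.integral_add_right_eq_self _ ((i : ℕ) : ℝ),
      ← MeasureTheory.integral_mul_const]
    congr 1
    refine MeasureTheory.integral_congr_ae (Filter.Eventually.of_forall fun u => ?_)
    simp only
    rw [add_sub_cancel_right, mul_add, character_add, character_pow, mul_comm ((i : ℕ) : ℝ), mul_assoc]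
  simp only [hterm]
  rw [← Finset.mul_sum, ← Finset.mul_sum, Fin.sum_univ_eq_sum_range
    (fun i => character (q.2 * σ / N) ^ i) N]
  by_cases hd : (N : ℤ) ∣ q.2
  · obtain ⟨l, hl⟩ := hd
    have e : (q.2 * σ / N : ℝ) = ((l * σ : ℤ) : ℝ) := by
      rw [hl]; push_cast; field_simp
    rw [e, integral_bump_sq_mul, character_intCast]
    have hiff : l * σ = 0 ↔ q = 0 := by
      rw [Prod.ext_iff]
      simp [hσ, hq, hl, hN]
    by_cases h0 : q = 0
    · rw [if_pos (hiff.mpr h0), if_pos h0]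
      simp only [one_pow, Finset.sum_const, Finset.card_range, nsmul_eq_mul, mul_one, one_mul]
      have : c * N = |D.a|⁻¹ := eq_inv_of_mul_eq_one_left hcN
      exact_mod_cast this
    · rw [if_neg (fun h => h0 (hiff.mp h)), if_neg h0]
      simp
  · have h0 : q ≠ 0 := fun h => hd (by rw [h]; exact dvd_zero _)
    have hz : character (q.2 * σ / N) ≠ 1 := by
      intro h
      unfold character at h
      rw [Complex.exp_eq_one_iff] at h
      obtain ⟨k, hk⟩ := h
      have hk' : (q.2 * σ / N : ℝ) = k := by
        have h2 : (2 * (Real.pi : ℂ) * Complex.I) ≠ 0 := Complex.two_pi_I_ne_zero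
        have : ((q.2 * σ / N : ℝ) : ℂ) = k := by
          apply mul_left_cancel₀ h2
          rw [hk]; ring
        exact_mod_cast this
      rw [div_eq_iff hNR] at hk'
      have hk2 : q.2 * σ = k * N := by exact_mod_cast hk'
      exact hd ((IsUnit.dvd_mul_right hσu).mp ⟨k, by rw [hk2, mul_comm]⟩)
    have hpow : character (q.2 * σ / N) ^ N = 1 := by
      rw [character_pow, mul_div_cancel₀ _ hNR]
      exact_mod_cast character_intCast (q.2 * σ)
    have hg := mul_neg_geom_sum (character (q.2 * σ / N)) N
    rw [hpow, sub_self] at hg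
    rw [(mul_eq_zero.mp hg).resolve_left (sub_ne_zero.mpr hz.symm), if_neg h0]
    simp

end SchwartzModule

end

noncomputable section

open FreeModule RapidSeq

/-! ## The commutant of the Schwartz module -/

namespace SchwartzModule

variable {m : ℤ}

namespace Modulation

variable (D : Modulation)

theorem series_add [NeZero m.natAbs] (c c' : RapidSeq) :
    D.series m (c + c') = D.series m c + D.series m c' :=
  LinearMap.ext fun f => ((D.hasSum_series c f).add (D.hasSum_series c' f)).unique
    (by simpa [add_smul] using D.hasSum_series (c + c') f) |>.symm

theorem series_smul [NeZero m.natAbs] (z : ℂ) (c : RapidSeq) :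
    D.series m (z • c) = z • D.series m c :=
  LinearMap.ext fun f => (((D.hasSum_series c f).const_smul z).unique
    (by simpa [mul_smul] using D.hasSum_series (z • c) f)).symm

/-- The map `c ↦ ∑ c_q V_q`. -/
def seriesMap (m : ℤ) [NeZero m.natAbs] : RapidSeq →ₗ[ℂ] Module.End ℂ (Space m) where
  toFun := D.series m
  map_add' := D.series_add
  map_smul' := D.series_smul

theorem series_single [NeZero m.natAbs] (q : ℤ × ℤ) (f : Space m) :
    D.series m (single q) f = D.op m q f := by
  refine (D.hasSum_series (single q) f).unique ?_
  have h := hasSum_single (f := fun p => (single q).1 p • D.op m p f) q fun p hp => by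
    rw [single_apply, if_neg hp, zero_smul]
  rwa [single_apply, if_pos rfl, one_smul] at h

theorem herm_series [NeZero m.natAbs] (hm : m ≠ 0) (c : RapidSeq) (ξ f : Space m) :
    herm m hm ξ (D.series m c f) = ∑' q, c.1 q * herm m hm ξ (D.op m q f) := by
  have h := (D.hasSum_series c f).map (hermLinear hm ξ) (continuous_herm hm ξ)
  rw [← hermLinear_apply, ← h.tsum_eq]
  exact tsum_congr fun q => by simp [hermLinear_apply]

theorem op_commute_of_generators (hm : m ≠ 0) (T : Module.End ℂ (Space m))
    (h₁ : ∀ f, T (D.op m (1, 0) f) = D.op m (1, 0) (T f))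
    (h₂ : ∀ f, T (D.op m (0, 1) f) = D.op m (0, 1) (T f)) (q : ℤ × ℤ) (f : Space m) :
    T (D.op m q f) = D.op m q (T f) := by
  have key : ∀ p q : ℤ × ℤ, (∀ f, T (D.op m p f) = D.op m p (T f)) →
      (∀ f, T (D.op m q f) = D.op m q (T f)) → ∀ f, T (D.op m (p + q) f) = D.op m (p + q) (T f) := by
    intro p q hp hq f
    have h := D.op_mul hm p q f
    have h' := D.op_mul hm p q (T f)
    apply smul_right_injective _ (twist_ne_zero (D.angle m) p q)
    simp only
    rw [← h', ← map_smul, ← h, hp, hq]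
  have kneg : ∀ q : ℤ × ℤ, (∀ f, T (D.op m q f) = D.op m q (T f)) →
      ∀ f, T (D.op m (-q) f) = D.op m (-q) (T f) := by
    intro q hq f
    have h := D.op_op_neg hm q f
    have h' := D.op_op_neg hm (-q) (T (D.op m (-q) f))
    have h2 := D.op_op_neg hm (-q) f
    rw [neg_neg] at h' h2
    apply smul_right_injective _ (twist_ne_zero (D.angle m) (-q) q)
    simp only
    rw [← h', ← hq, h, map_smul, map_smul]
    congr 1
    rw [twist_neg_right]
  have k₁ : ∀ i : ℤ, ∀ f, T (D.op m (i, 0) f) = D.op m (i, 0) (T f) := fun i => by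
    induction i using Int.induction_on with
    | zero => intro f; rw [← Prod.zero_eq_mk, op_zero, op_zero]
    | succ i ih => simpa using key _ _ ih h₁
    | pred i ih => simpa [sub_eq_add_neg] using key _ _ ih (kneg _ h₁)
  have k₂ : ∀ i : ℤ, ∀ f, T (D.op m (0, i) f) = D.op m (0, i) (T f) := fun i => by
    induction i using Int.induction_on with
    | zero => intro f; rw [← Prod.zero_eq_mk, op_zero, op_zero]
    | succ i ih => simpa using key _ _ ih h₂
    | pred i ih => simpa [sub_eq_add_neg] using key _ _ ih (kneg _ h₂)
  simpa using key _ _ (k₁ q.1) (k₂ q.2) f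

/-- An operator that commutes with the operators of a modulation and is weakly continuous is a
series in the operators of the dual modulation. -/
theorem IsDual.eq_series_of_commute [NeZero m.natAbs] {D D' : Modulation} (h : IsDual m D D')
    (h' : IsDual m D' D) (hm : m ≠ 0) {N : ℕ} (χ : Fin N → Space m) {d : ℝ} (hd : d ≠ 0)
    (hχ : ∀ q, ∑ i, herm m hm (χ i) (D'.op m q (χ i)) = if q = 0 then (d : ℂ) else 0)
    (T : Module.End ℂ (Space m)) (hT : ∀ q f, T (D.op m q f) = D.op m q (T f))
    (hc : ∀ ξ, Continuous fun f => herm m hm ξ (T f)) : ∃ c, T = D'.series m c := by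
  have ha : ((|D.a| : ℝ) : ℂ) ≠ 0 := by
    exact_mod_cast abs_ne_zero.mpr h.a_ne
  have ha' : ((|D'.a| : ℝ) : ℂ) ≠ 0 := by
    exact_mod_cast abs_ne_zero.mpr h'.a_ne
  have hdC : (d : ℂ) ≠ 0 := by exact_mod_cast hd
  set A := fun f i => D.coeff hm h.a_ne (h'.b_ne hm) (χ i) f with hA
  set B := fun ζ i => D'.coeff hm h'.a_ne (h.b_ne hm) (χ i) ζ with hB
  -- The trace condition on the frame: the dual coefficients sum to a multiple of the unit.
  have hone : ∑ i, B (χ i) i = (d : ℂ) • single 0 := by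
    ext q
    have hq := congrArg conj (hχ q)
    rw [map_sum] at hq
    simp only [herm_conj] at hq
    rw [AddSubmonoidClass.coe_finsetSum, Finset.sum_apply, Submodule.coe_smul, Pi.smul_apply,
      single_apply]
    refine hq.trans ?_
    split_ifs <;> simp
  -- The reconstruction formula. By duality the left side is the series of `D'` with the
  -- coefficients just computed, applied to `f`.
  have hrec : ∀ f, ∑ i, D.series m (A f i) (χ i) = (((|D'.a| : ℝ) : ℂ) / (|D.a| : ℝ) * d) • f := by
    intro f
    apply smul_right_injective _ ha
    simp only
    rw [Finset.smul_sum, smul_smul]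
    have e : ∀ i, ((|D.a| : ℝ) : ℂ) • D.series m (A f i) (χ i) =
        ((|D'.a| : ℝ) : ℂ) • D'.series m (B (χ i) i) f := fun i => h.series_coeff h' hm _ _ _
    simp only [e]
    rw [← Finset.smul_sum]
    have e2 : ∑ i, D'.series m (B (χ i) i) f = (d : ℂ) • f := by
      have := congrArg (fun S : Module.End ℂ (Space m) => S f)
        (map_sum (D'.seriesMap m) (fun i => B (χ i) i) Finset.univ)
      simp only [hone, LinearMap.sum_apply] at this
      change ((D'.seriesMap m) ((d : ℂ) • single 0)) f = _ at this
      rw [map_smul, LinearMap.smul_apply] at this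
      change (d : ℂ) • D'.series m (single 0) f = ∑ i, D'.series m (B (χ i) i) f at this
      rw [← this, series_single, op_zero]
    rw [e2, smul_smul]
    congr 1
    field_simp
  set z : ℂ := ((|D'.a| : ℝ) : ℂ) / (|D.a| : ℝ) * d with hz
  have hz0 : z ≠ 0 := mul_ne_zero (div_ne_zero ha' ha) hdC
  -- `T` passes through the series of `D` because it commutes with each term; weak continuity of `T`
  -- justifies this for the infinite sum after pairing with any `ξ`.
  have hTs : ∀ f, z • T f = ∑ i, D.series m (A f i) (T (χ i)) := by
    intro f
    rw [← map_smul, ← hrec f, map_sum]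
    refine Finset.sum_congr rfl fun i _ => ?_
    have hs : ∀ ξ, herm m hm ξ (T (D.series m (A f i) (χ i))) =
        herm m hm ξ (D.series m (A f i) (T (χ i))) := by
      intro ξ
      have h1 := (D.hasSum_series (A f i) (χ i)).map (hermLinear hm ξ ∘ₗ T) (hc ξ)
      have h2 := (D.hasSum_series (A f i) (T (χ i))).map (hermLinear hm ξ) (continuous_herm hm ξ)
      have e : (hermLinear hm ξ ∘ₗ T) ∘ (fun q => (A f i).1 q • D.op m q (χ i)) =
          hermLinear hm ξ ∘ fun q => (A f i).1 q • D.op m q (T (χ i)) :=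
        funext fun q => by simp [hT]
      rw [e] at h1
      exact h1.unique h2
    refine sub_eq_zero.mp (eq_zero_of_herm hm _ fun ξ => ?_)
    rw [← hermLinear_apply, map_sub, sub_eq_zero]
    exact hs ξ
  -- A second use of duality, now with `T χ_i` in place of `χ_i`, turns the series of `D` applied to
  -- `T χ_i` into a series of `D'` applied to `f`; its coefficients are the matrix elements of `T`
  -- on the frame.
  refine ⟨z⁻¹ • ∑ i, (((|D'.a| : ℝ) : ℂ) / (|D.a| : ℝ)) • B (T (χ i)) i, LinearMap.ext fun f => ?_⟩
  apply smul_right_injective _ hz0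
  simp only
  rw [hTs]
  change _ = z • (D'.seriesMap m _) f
  rw [map_smul, LinearMap.smul_apply, smul_inv_smul₀ hz0, map_sum, LinearMap.sum_apply]
  refine Finset.sum_congr rfl fun i _ => ?_
  rw [map_smul, LinearMap.smul_apply]
  apply smul_right_injective _ ha
  simp only
  rw [smul_smul, mul_div_cancel₀ _ ha]
  exact h.series_coeff h' hm _ _ _

end Modulation

/-! ### The Schwartz module as a pair of dual modulations. -/

/-- The modulation of the operators `U₁, U₂`. -/
def gauge (n m : ℤ) (θ : ℝ) : Modulation := ⟨1, (n : ℝ) / m - θ, 1, n⟩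

/-- The modulation whose operators span the commutant of `U₁, U₂`; here `n'` is inverse to `n`
modulo `m`. -/
def dualGauge (n m n' : ℤ) (θ : ℝ) : Modulation := ⟨(n - m * θ)⁻¹, (m : ℝ)⁻¹, n', 1⟩

theorem U₁_eq (n m : ℤ) (θ : ℝ) (f : Space m) : U₁ n m θ f = (gauge n m θ).op m (1, 0) f := by
  funext α
  ext s
  simp [U₁_apply, Modulation.op_apply, gauge, character_zero]

theorem U₂_eq (n m : ℤ) (θ : ℝ) (f : Space m) : U₂ m f = (gauge n m θ).op m (0, 1) f := by
  funext α
  ext s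
  simp [U₂_apply, Modulation.op_apply, gauge, phase, character]

variable {n n' : ℤ} {θ : ℝ}

theorem isDual_gauge : Modulation.IsDual m (gauge n m θ) (dualGauge n m n' θ) where
  a_ne := one_ne_zero
  b_eq := by simp [gauge, dualGauge]
  dvd := by simp [gauge, dualGauge]

theorem isDual_dualGauge (hm : m ≠ 0) (hθ : (n : ℝ) - m * θ ≠ 0) (hn : m ∣ n * n' - 1) :
    Modulation.IsDual m (dualGauge n m n' θ) (gauge n m θ) where
  a_ne := inv_ne_zero hθ
  b_eq := by
    have : (m : ℝ) ≠ 0 := by exact_mod_cast hm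
    simp only [gauge, dualGauge]
    field_simp
  dvd := hn

/-- Of the two characters to be compared, one has exponent `(1 - nn')/m`, an integer by the choice
of `n'`, and the other has exponent `1/m - 1/m`. -/
theorem dualGauge_op_comm (hm : m ≠ 0) (hθ : (n : ℝ) - m * θ ≠ 0) (hn : m ∣ n * n' - 1)
    (p q : ℤ × ℤ) (f : Space m) : (dualGauge n m n' θ).op m p ((gauge n m θ).op m q f) =
      (gauge n m θ).op m q ((dualGauge n m n' θ).op m p f) := by
  have hmR : (m : ℝ) ≠ 0 := by exact_mod_cast hm
  refine Modulation.op_comm hm ?_ ?_ p q f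
  · obtain ⟨k, hk⟩ := hn
    have hk' : (n : ℝ) * n' - 1 = m * k := by exact_mod_cast hk
    rw [← character_intCast (-k)]
    congr 1
    simp only [gauge, dualGauge]
    push_cast
    field_simp
    linear_combination -hk'
  · rw [← character_zero]
    congr 1
    simp only [gauge, dualGauge]
    push_cast
    field_simp
    ring

theorem connection_schwartzModule (hm : m ≠ 0) (hθ : (n : ℝ) - m * θ ≠ 0) :
    IsConstCurvConnection (schwartzModule n m θ hm) (m / (n - m * θ)) (nabla₁ n m θ) (nabla₂ m) where
  leibniz₁₁ := fun (f : Space m) => by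
    have hmC : (m : ℂ) ≠ 0 := by exact_mod_cast hm
    have hθC : (n : ℂ) - m * θ ≠ 0 := by exact_mod_cast hθ
    change nabla₁ n m θ (U₁ n m θ f) =
      U₁ n m θ (nabla₁ n m θ f) + (2 * Real.pi * Complex.I) • U₁ n m θ f
    rw [U₁_eq, U₁_eq, nabla₁_op]
    congr 2
    simp only [gauge]
    push_cast
    field_simp
  leibniz₁₂ := fun (f : Space m) => by
    change nabla₁ n m θ (U₂ m f) = U₂ m (nabla₁ n m θ f)
    rw [U₂_eq n m θ, U₂_eq n m θ, nabla₁_op]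
    simp
  leibniz₂₁ := fun (f : Space m) => by
    change nabla₂ m (U₁ n m θ f) = U₁ n m θ (nabla₂ m f)
    rw [U₁_eq, U₁_eq, nabla₂_op]
    simp
  leibniz₂₂ := fun (f : Space m) => by
    change nabla₂ m (U₂ m f) = U₂ m (nabla₂ m f) + (2 * Real.pi * Complex.I) • U₂ m f
    rw [U₂_eq n m θ, U₂_eq n m θ, nabla₂_op]
    simp [gauge]
  skew₁ := herm_nabla₁ hm n θ
  skew₂ := herm_nabla₂ hm
  curvature := fun (f : Space m) => by
    change nabla₁ n m θ (nabla₂ m f) - nabla₂ m (nabla₁ n m θ f) =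
      (-(2 * Real.pi * Complex.I * ((m / (n - m * θ) : ℝ) : ℂ))) • f
    funext α
    ext s
    have e : ((nabla₁ n m θ f) α : ℝ → ℂ) =
        fun s : ℝ => 2 * Real.pi * Complex.I * (m / (n - m * θ)) * (s * f α s) :=
      funext fun s => nabla₁_apply n m θ f α s
    have h1 : HasDerivAt (fun s : ℝ => (s : ℂ)) 1 s := Complex.ofRealCLM.hasDerivAt
    have h2 := (h1.fun_mul (f α).differentiableAt.hasDerivAt).const_mul
      (2 * (Real.pi : ℂ) * Complex.I * (m / (n - m * θ)))
    rw [Pi.sub_apply, sub_apply, nabla₁_apply, nabla₂_apply, nabla₂_apply, e, h2.deriv,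
      Pi.smul_apply, smul_apply, smul_eq_mul]
    push_cast
    ring

/-- The commutant of the Schwartz module. -/
def commutantModel (hm : m ≠ 0) (hθ : (n : ℝ) - m * θ ≠ 0) (hn : m ∣ n * n' - 1) {N : ℕ}
    (hN : N ≠ 0) (hN' : 2 * |(n : ℝ) - m * θ| < N) :
    CommutantModel (schwartzModule n m θ hm) (m / (n - m * θ)) (n - m * θ)⁻¹
      ((dualGauge n m n' θ).angle m) :=
  haveI := neZero_natAbs hm
  have hNR : (0 : ℝ) < N := by exact_mod_cast Nat.pos_of_ne_zero hN
  have habs : 0 < |(n : ℝ) - m * θ| := abs_pos.mpr hθ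
  -- The dilation of the frame: `c = |n - mθ|/N` satisfies `cN|a| = 1`, and `N` is so large that `2c
  -- < 1`.
  have hc : 0 < |(n : ℝ) - m * θ| / N := div_pos habs hNR
  have htrace : ∀ q, ∑ i : Fin N, herm m hm (frame m _ hc i)
      ((dualGauge n m n' θ).op m q (frame m _ hc i)) =
      if q = 0 then ((|(n : ℝ) - m * θ| : ℝ) : ℂ) else 0 := fun q => by
    have h := sum_herm_frame_op hm (dualGauge n m n' θ) (inv_ne_zero hθ) rfl rfl hN _ hc
      (by rw [← mul_div_assoc, div_lt_one hNR]; exact hN')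
      (by simp only [dualGauge, abs_inv]; field_simp) q
    simpa only [dualGauge, abs_inv, inv_inv] using h
  { topAddGroup := inferInstanceAs (IsTopologicalAddGroup (Space m))
    contSMul := inferInstanceAs (ContinuousSMul ℂ (Space m))
    connection := connection_schwartzModule hm hθ
    herm_add := herm_add hm
    herm_smul := herm_smul hm
    herm_conj := herm_conj hm
    herm_ext := eq_zero_of_herm hm
    herm_continuous := continuous_herm hm
    herm_diag := tendsto_herm_self hm
    U₁_adj := ⟨(gauge n m θ).op m (-(1, 0)), fun (f g : Space m) => by
      change herm m hm f (U₁ n m θ g) = herm m hm ((gauge n m θ).op m (-(1, 0)) f) g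
      rw [Modulation.herm_op, neg_neg, U₁_eq]
      simp [twist]⟩
    U₂_adj := ⟨(gauge n m θ).op m (-(0, 1)), fun (f g : Space m) => by
      change herm m hm f (U₂ m g) = herm m hm ((gauge n m θ).op m (-(0, 1)) f) g
      rw [Modulation.herm_op, neg_neg, U₂_eq n m θ]
      simp [twist]⟩
    W := (dualGauge n m n' θ).op m
    W_zero := (dualGauge n m n' θ).op_zero
    W_mul := (dualGauge n m n' θ).op_mul hm
    W_adj := (dualGauge n m n' θ).herm_op hm
    W_U₁ := fun q (f : Space m) => by
      change (dualGauge n m n' θ).op m q (U₁ n m θ f) = U₁ n m θ ((dualGauge n m n' θ).op m q f)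
      rw [U₁_eq, U₁_eq, dualGauge_op_comm hm hθ hn]
    W_U₂ := fun q (f : Space m) => by
      change (dualGauge n m n' θ).op m q (U₂ m f) = U₂ m ((dualGauge n m n' θ).op m q f)
      rw [U₂_eq n m θ, U₂_eq n m θ, dualGauge_op_comm hm hθ hn]
    W_nabla₁ := fun q (f : Space m) => by
      refine (nabla₁_op n θ (dualGauge n m n' θ) q f).trans ?_
      have hmC : (m : ℂ) ≠ 0 := by exact_mod_cast hm
      have e : 2 * Real.pi * Complex.I * (m / (n - m * θ) * ((dualGauge n m n' θ).b : ℂ)) * q.1 =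
          (((n - m * θ)⁻¹ : ℝ) : ℂ) * (2 * Real.pi * Complex.I * q.1) := by
        simp only [dualGauge]
        push_cast
        field_simp
      rw [e]
      rfl
    W_nabla₂ := fun q (f : Space m) => by
      refine (nabla₂_op (dualGauge n m n' θ) q f).trans ?_
      have e : 2 * Real.pi * Complex.I * ((dualGauge n m n' θ).a : ℂ) * q.2 =
          (((n - m * θ)⁻¹ : ℝ) : ℂ) * (2 * Real.pi * Complex.I * q.2) := by
        simp only [dualGauge]
        ring
      rw [e]
      rfl
    W_bound := fun (f g : Space m) => by
      obtain ⟨C, hC⟩ := (dualGauge n m n' θ).exists_coeff_bound hm (inv_ne_zero hθ)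
        ((isDual_gauge (n' := n')).b_ne hm) 0 g f
      refine ⟨C, fun q => ?_⟩
      have h := hC q
      rw [pow_zero, one_mul, ← herm_conj, RCLike.norm_conj] at h
      exact h
    rho := (dualGauge n m n' θ).series m
    herm_rho := (dualGauge n m n' θ).herm_series hm
    rho_continuous := (dualGauge n m n' θ).continuous_series
    commutant := fun T h₁ h₂ hT =>
      isDual_gauge.eq_series_of_commute (isDual_dualGauge hm hθ hn) hm _ habs.ne' htrace T
        ((gauge n m θ).op_commute_of_generators hm T
          (fun f => by rw [← U₁_eq, ← U₁_eq]; exact h₁ f)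
          (fun f => by rw [← U₂_eq n m θ, ← U₂_eq n m θ]; exact h₂ f)) hT
    frameSize := N
    frame := fun i => frame m _ hc i
    density := |(n : ℝ) - m * θ|
    density_pos := habs
    frame_trace := htrace }

end SchwartzModule

end

noncomputable section

/-! ## Leafwise paths -/

/-- Bézout: `σ = aA + bB` with `an + bm = 1`. No division in the group is needed, so this works on
the circle. -/
theorem exists_zsmul_eq_of_isCoprime {G : Type*} [AddCommGroup G] {n m : ℤ} (hnm : IsCoprime n m)
    {A B : G} (h : m • A = n • B) : ∃ σ : G, n • σ = A ∧ m • σ = B := by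
  obtain ⟨a, b, hab⟩ := hnm
  refine ⟨a • A + b • B, ?_, ?_⟩
  · calc n • (a • A + b • B) = a • n • A + b • n • B := by
          rw [smul_add, smul_comm n a, smul_comm n b]
      _ = (a * n + b * m) • A := by rw [← h, smul_smul, smul_smul, ← add_smul]
      _ = A := by rw [hab, one_smul]
  · calc m • (a • A + b • B) = a • m • A + b • m • B := by
          rw [smul_add, smul_comm m a, smul_comm m b]
      _ = (a * n + b * m) • B := by rw [h, smul_smul, smul_smul, ← add_smul]
      _ = B := by rw [hab, one_smul]

theorem eq_of_zsmul_eq_of_isCoprime {G : Type*} [AddCommGroup G] {n m : ℤ} (hnm : IsCoprime n m)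
    {s s' : G} (h₁ : n • s = n • s') (h₂ : m • s = m • s') : s = s' := by
  obtain ⟨a, b, hab⟩ := hnm
  rw [← one_smul ℤ s, ← one_smul ℤ s', ← hab, add_smul, add_smul, mul_smul, mul_smul, mul_smul,
    mul_smul, h₁, h₂]

theorem AddCircle.zsmul_coe (k : ℤ) (x : ℝ) :
    k • (x : UnitAddCircle) = ((k * x : ℝ) : UnitAddCircle) := by
  rw [← AddCircle.coe_zsmul, zsmul_eq_mul]

namespace LeafPath

variable {n m : ℤ} {θ : ℝ} {C : Supercycle n m}

theorem point_param (p : LeafPath θ C) : C.point p.param =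
    (p.start + ((θ * p.height : ℝ) : UnitAddCircle), (p.height : UnitAddCircle)) := p.2

/-- Start and height fix the end point, and coprimality makes `s ↦ (ns, ms)` injective on the
circle. -/
theorem ext_of_isCoprime (hnm : IsCoprime n m) {p p' : LeafPath θ C} (h₁ : p.start = p'.start)
    (h₂ : p.height = p'.height) : p = p' := by
  have h := p.point_param
  have h' := p'.point_param
  simp only [Supercycle.point, Prod.mk.injEq] at h h'
  have h₃ : p.param = p'.param := by
    refine eq_of_zsmul_eq_of_isCoprime hnm ?_ ?_
    · apply add_left_cancel (a := C.base.1)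
      rw [h.1, h'.1, h₁, h₂]
    · apply add_left_cancel (a := C.base.2)
      rw [h.2, h'.2, h₂]
  exact Subtype.ext (Prod.ext h₁ (Prod.ext h₂ h₃))

/-- The start points and heights of the leafwise paths to the line through `(X, Y)`. -/
theorem exists_iff (hnm : IsCoprime n m) (C : Supercycle n m) (X Y : ℝ)
    (h : ((X : UnitAddCircle), (Y : UnitAddCircle)) ∈ C.line) (x : UnitAddCircle) (t : ℝ) :
    (∃ p : LeafPath θ C, p.start = x ∧ p.height = t) ↔
      m • (x - (X : UnitAddCircle)) + n • (Y : UnitAddCircle) =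
        (((n - m * θ) * t : ℝ) : UnitAddCircle) := by
  obtain ⟨s₀, hs₀⟩ := h
  simp only [Supercycle.point, Prod.mk.injEq] at hs₀
  have e1 : (((n - m * θ) * t : ℝ) : UnitAddCircle) =
      n • (t : UnitAddCircle) - m • ((θ * t : ℝ) : UnitAddCircle) := by
    rw [AddCircle.zsmul_coe, AddCircle.zsmul_coe, ← AddCircle.coe_sub]
    congr 1
    ring
  -- The condition says that the vector from `(X, Y)` to the end point satisfies the equation of
  -- multiples of `(n, m)`.
  have key : m • (x - (X : UnitAddCircle)) + n • (Y : UnitAddCircle) =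
        (((n - m * θ) * t : ℝ) : UnitAddCircle) ↔
      m • (x + ((θ * t : ℝ) : UnitAddCircle) - X) = n • ((t : UnitAddCircle) - Y) := by
    rw [e1, smul_sub, smul_sub, smul_sub, smul_add, ← sub_eq_zero, ← sub_eq_zero (b := _ - _)]
    refine Eq.congr ?_ rfl
    abel
  rw [key]
  constructor
  · rintro ⟨p, rfl, rfl⟩
    have hp := p.point_param
    simp only [Supercycle.point, Prod.mk.injEq] at hp
    rw [← hp.1, ← hp.2, ← hs₀.1, ← hs₀.2, add_sub_add_left_eq_sub, add_sub_add_left_eq_sub,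
      ← smul_sub, ← smul_sub, smul_comm]
  · intro h
    obtain ⟨σ, h1, h2⟩ := exists_zsmul_eq_of_isCoprime hnm h
    refine ⟨⟨(x, t, s₀ + σ), ?_⟩, rfl, rfl⟩
    simp only [Supercycle.point]
    rw [smul_add, smul_add, ← add_assoc, ← add_assoc, hs₀.1, hs₀.2, h1, h2, add_sub_cancel,
      add_sub_cancel]

theorem move_start (p : LeafPath θ C) (v : ℝ) :
    (p.move v).start = p.start + (((n - m * θ) * v : ℝ) : UnitAddCircle) := rfl

theorem move_height (p : LeafPath θ C) (v : ℝ) : (p.move v).height = p.height + m * v := rfl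

theorem move_param (p : LeafPath θ C) (v : ℝ) :
    (p.move v).param = p.param + (v : UnitAddCircle) := rfl

theorem next_start (p : LeafPath θ C) : p.next.start = p.start + (θ : UnitAddCircle) := rfl

theorem next_height (p : LeafPath θ C) : p.next.height = p.height - 1 := rfl

theorem next_param (p : LeafPath θ C) : p.next.param = p.param := rfl

theorem move_zero (p : LeafPath θ C) : p.move 0 = p := by
  refine Subtype.ext (Prod.ext ?_ (Prod.ext ?_ ?_))
  · change p.start + (((n - m * θ) * 0 : ℝ) : UnitAddCircle) = p.start
    simp
  · change p.height + m * 0 = p.height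
    simp
  · change p.param + ((0 : ℝ) : UnitAddCircle) = p.param
    simp

theorem move_move (p : LeafPath θ C) (v w : ℝ) : (p.move v).move w = p.move (v + w) := by
  refine Subtype.ext (Prod.ext ?_ (Prod.ext ?_ ?_))
  · change p.start + (((n - m * θ) * v : ℝ) : UnitAddCircle) +
      (((n - m * θ) * w : ℝ) : UnitAddCircle) = p.start + (((n - m * θ) * (v + w) : ℝ) : UnitAddCircle)
    rw [add_assoc, ← AddCircle.coe_add, mul_add]
  · change p.height + m * v + m * w = p.height + m * (v + w)
    ring
  · change p.param + (v : UnitAddCircle) + (w : UnitAddCircle) =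
      p.param + ((v + w : ℝ) : UnitAddCircle)
    rw [add_assoc, ← AddCircle.coe_add]

/-! ### The topology of the Schwartz space -/

theorem contDiffAt_move (f : Schwartz θ C) (l : ℕ) (p : LeafPath θ C) :
    ContDiffAt ℝ l (fun v : ℝ => f.1 (p.move v)) 0 :=
  ((f.2.1 p).of_le (by exact_mod_cast le_top)).contDiffAt

/-- The map `f ↦ t^k ∂^l f`. -/
def termMap (i : ℕ × ℕ) : Schwartz θ C →ₗ[ℂ] (LeafPath θ C → ℂ) where
  toFun f := term i.1 i.2 f.1
  map_add' f g := by
    funext p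
    have h := iteratedDeriv_fun_add (n := i.2) (x := (0 : ℝ))
      (contDiffAt_move f i.2 p) (contDiffAt_move g i.2 p)
    simp only [term, Submodule.coe_add, Pi.add_apply, h, mul_add]
  map_smul' c f := by
    funext p
    have h := iteratedDeriv_const_mul_field (n := i.2) (x := (0 : ℝ)) c
      (fun v : ℝ => f.1 (p.move v))
    simp only [term, Submodule.coe_smul, Pi.smul_apply, smul_eq_mul, h, RingHom.id_apply]
    ring

theorem termMap_apply (i : ℕ × ℕ) (f : Schwartz θ C) (p : LeafPath θ C) :
    termMap i f p = (p.height : ℂ) ^ i.1 * iteratedDeriv i.2 (fun v : ℝ => f.1 (p.move v)) 0 := rfl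

theorem topology_eq : (inferInstance : TopologicalSpace (Schwartz θ C)) = supTopology termMap := by
  unfold supTopology
  rw [iInf_prod]
  exact iInf_congr fun k => iInf_congr fun l => rfl

instance : IsTopologicalAddGroup (Schwartz θ C) := by
  have h := isTopologicalAddGroup_supTopology (termMap (θ := θ) (C := C))
  rwa [← topology_eq] at h

/-- The seminorm `sup_p |t^k ∂^l f|`. -/
def supNorm (k l : ℕ) (f : Schwartz θ C) : ℝ := supBound (termMap (k, l)) f

theorem le_supNorm (k l : ℕ) (f : Schwartz θ C) (p : LeafPath θ C) :
    ‖termMap (k, l) f p‖ ≤ supNorm k l f := le_supBound (f.2.2 k l) p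

theorem supNorm_nonneg (k l : ℕ) (f : Schwartz θ C) : 0 ≤ supNorm k l f := supBound_nonneg _ _

theorem tendsto_supNorm (k l : ℕ) :
    Filter.Tendsto (supNorm k l) (nhds (0 : Schwartz θ C)) (nhds 0) := by
  have h := tendsto_supBound (termMap (θ := θ) (C := C)) (k, l)
  rwa [← topology_eq] at h

theorem continuous_into {F : Type*} [AddCommGroup F] [Module ℂ F]
    [TopologicalSpace F] [IsTopologicalAddGroup F] (T : F →ₗ[ℂ] Schwartz θ C)
    (h : ∀ k l : ℕ, ∃ g : F → ℝ, Filter.Tendsto g (nhds 0) (nhds 0) ∧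
      ∀ a p, ‖termMap (k, l) (T a) p‖ ≤ g a) : Continuous T := by
  have h := continuous_supTopology (φ := termMap) T fun i => h i.1 i.2
  rwa [← topology_eq] at h

end LeafPath

end

noncomputable section

/-! ## Gauge transformations -/

/-- The primitive of a function on the circle with integral mean value exponentiates to a function
on the circle. -/
theorem exists_circle_of_integral_eq_int (g : C(UnitAddCircle, ℝ)) (k : ℤ)
    (hk : ∫ s in (0 : ℝ)..1, g (s : UnitAddCircle) = k) :
    ∃ u : UnitAddCircle → Circle, (∀ s : ℝ, HasDerivAt (fun v : ℝ => (u (v : UnitAddCircle) : ℂ))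
      (2 * Real.pi * Complex.I * g (s : UnitAddCircle) * u (s : UnitAddCircle)) s) ∧
      (ContDiff ℝ ∞ (fun s : ℝ => g (s : UnitAddCircle)) →
        ContDiff ℝ ∞ fun s : ℝ => (u (s : UnitAddCircle) : ℂ)) := by
  have hc : Continuous fun s : ℝ => g (s : UnitAddCircle) :=
    g.continuous.comp (AddCircle.continuous_mk' 1)
  set H : ℝ → ℝ := fun s => ∫ v in (0 : ℝ)..s, g (v : UnitAddCircle) with hH
  have hd : ∀ s : ℝ, HasDerivAt H (g (s : UnitAddCircle)) s := fun s =>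
    intervalIntegral.integral_hasDerivAt_right (hc.intervalIntegrable _ _)
      (hc.stronglyMeasurableAtFilter _ _) hc.continuousAt
  have hper : Function.Periodic (fun s : ℝ => g (s : UnitAddCircle)) 1 := fun s => by
    simp
  have hadd : ∀ s, H (s + 1) = H s + k := fun s => by
    have h1 := hper.intervalIntegral_add_eq s 0
    rw [zero_add, hk] at h1
    rw [← h1, hH]
    simp only
    rw [intervalIntegral.integral_add_adjacent_intervals (hc.intervalIntegrable _ _)
      (hc.intervalIntegrable _ _)]
  -- The primitive grows by the integer `k` over a period, so its exponential descends to the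
  -- circle.
  have hu : Function.Periodic (fun s : ℝ => Circle.exp (2 * Real.pi * H s)) 1 := fun s => by
    simp only
    rw [hadd, mul_add, mul_comm (2 * Real.pi) (k : ℝ), Circle.exp_add]
    have : Circle.exp (k * (2 * Real.pi)) = 1 := by
      rw [Circle.exp_eq_one]
      exact ⟨k, rfl⟩
    rw [this, mul_one]
  have hval : ∀ s : ℝ, ((hu.lift (s : UnitAddCircle) : Circle) : ℂ) =
      Complex.exp (2 * Real.pi * Complex.I * H s) := fun s => by
    rw [Function.Periodic.lift_coe, Circle.coe_exp]
    congr 1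
    push_cast
    ring
  refine ⟨hu.lift, fun s => ?_, fun hg => ?_⟩
  · simp only [hval]
    have := ((hd s).ofReal_comp.const_mul (2 * (Real.pi : ℂ) * Complex.I)).cexp
    exact this.congr_deriv (mul_comm _ _)
  · simp only [hval]
    have hHs : ContDiff ℝ ∞ H := by
      rw [contDiff_infty_iff_deriv]
      refine ⟨fun s => (hd s).differentiableAt, ?_⟩
      rwa [funext fun s => (hd s).deriv]
    exact Complex.contDiff_exp.comp (contDiff_const.mul (Complex.ofRealCLM.contDiff.comp hHs))

namespace LeafPath

variable {n m : ℤ} {θ : ℝ} {C : Supercycle n m}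

/-- The function `G(s) f` of leafwise paths. -/
def mulParamFun (G : UnitAddCircle → ℂ) (f : LeafPath θ C → ℂ) (p : LeafPath θ C) : ℂ :=
  G p.param * f p

theorem contDiff_param {G : UnitAddCircle → ℂ} (hG : ContDiff ℝ ∞ fun s : ℝ => G s)
    (p : LeafPath θ C) : ContDiff ℝ ∞ fun v : ℝ => G (p.move v).param := by
  simp only [move_param]
  induction p.param using QuotientAddGroup.induction_on with
  | H σ => exact hG.comp (contDiff_const.add contDiff_id)

/-- The derivatives depend on the path only through its parameter, which has a representative in the
compact interval `[0, 1]`. -/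
theorem exists_bound_param {G : UnitAddCircle → ℂ} (hG : ContDiff ℝ ∞ fun s : ℝ => G s) (i : ℕ) :
    ∃ B : ℝ, ∀ p : LeafPath θ C, ‖iteratedDeriv i (fun v : ℝ => G (p.move v).param) 0‖ ≤ B := by
  have hc : Continuous (iteratedDeriv i fun s : ℝ => G s) :=
    hG.continuous_iteratedDeriv i (by exact_mod_cast le_top)
  obtain ⟨B, hB⟩ := (isCompact_Icc (a := (0 : ℝ)) (b := 1)).exists_bound_of_continuousOn
    hc.continuousOn
  refine ⟨B, fun p => ?_⟩
  obtain ⟨σ, hσ, hp⟩ : ∃ σ ∈ Set.Icc (0 : ℝ) 1, (σ : UnitAddCircle) = p.param := by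
    obtain ⟨r, hr⟩ := QuotientAddGroup.mk_surjective p.param
    refine ⟨Int.fract r, ⟨Int.fract_nonneg r, (Int.fract_lt_one r).le⟩, ?_⟩
    rw [← hr, ← Int.self_sub_floor, AddCircle.coe_sub]
    have : ((⌊r⌋ : ℝ) : UnitAddCircle) = 0 := by
      rw [AddCircle.coe_eq_zero_iff]
      exact ⟨⌊r⌋, by simp⟩
    rw [this, sub_zero]
  have e : (fun v : ℝ => G (p.move v).param) = fun v : ℝ => (fun s : ℝ => G s) (σ + v) := by
    funext v
    rw [move_param, ← hp, ← AddCircle.coe_add]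
  have h := congrFun (iteratedDeriv_comp_const_add i (fun s : ℝ => G s) σ) 0
  simp only [add_zero] at h
  rw [e, h]
  exact hB σ hσ

theorem norm_term_mulParam_le {G : UnitAddCircle → ℂ} (hG : ContDiff ℝ ∞ fun s : ℝ => G s)
    (k l : ℕ) : ∃ B : ℕ → ℝ, (∀ i, 0 ≤ B i) ∧ ∀ (f : Schwartz θ C) (p : LeafPath θ C),
      ‖term k l (mulParamFun G f.1) p‖ ≤ ∑ i ∈ Finset.range (l + 1), B i * supNorm k (l - i) f := by
  choose B hB using fun i => exists_bound_param (θ := θ) (C := C) hG i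
  refine ⟨fun i => l.choose i * |B i|, fun i => by positivity, fun f p => ?_⟩
  have h := iteratedDeriv_mul (n := l) (x := (0 : ℝ))
    (((contDiff_param hG p).of_le (by exact_mod_cast le_top)).contDiffAt) (contDiffAt_move f l p)
  have e : term k l (mulParamFun G f.1) p = ∑ i ∈ Finset.range (l + 1),
      l.choose i * iteratedDeriv i (fun v : ℝ => G (p.move v).param) 0 * termMap (k, l - i) f p := by
    have e' : term k l (mulParamFun G f.1) p = (p.height : ℂ) ^ k * iteratedDeriv l
      ((fun v : ℝ => G (p.move v).param) * fun v : ℝ => f.1 (p.move v)) 0 := rfl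
    rw [e', h, Finset.mul_sum]
    exact Finset.sum_congr rfl fun i _ => by rw [termMap_apply]; ring
  rw [e]
  refine (norm_sum_le _ _).trans (Finset.sum_le_sum fun i _ => ?_)
  rw [norm_mul, norm_mul, Complex.norm_natCast]
  have h1 := (hB i p).trans (le_abs_self _)
  exact mul_le_mul (mul_le_mul_of_nonneg_left h1 (Nat.cast_nonneg _)) (le_supNorm k (l - i) f p)
    (norm_nonneg _) (by positivity)

/-- Multiplication with a smooth function of the parameter of the end point. -/
def mulParam (G : UnitAddCircle → ℂ) (hG : ContDiff ℝ ∞ fun s : ℝ => G s) :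
    Schwartz θ C →ₗ[ℂ] Schwartz θ C where
  toFun f := ⟨mulParamFun G f.1, fun p => (contDiff_param hG p).mul (f.2.1 p), fun k l => by
    obtain ⟨B, -, hB⟩ := norm_term_mulParam_le (θ := θ) (C := C) hG k l
    exact ⟨_, hB f⟩⟩
  map_add' f g := Subtype.ext (funext fun p => mul_add _ _ _)
  map_smul' c f := Subtype.ext (funext fun p => mul_left_comm _ _ _)

theorem continuous_mulParam {G : UnitAddCircle → ℂ} (hG : ContDiff ℝ ∞ fun s : ℝ => G s) :
    Continuous (mulParam (θ := θ) (C := C) G hG) := by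
  refine continuous_into _ fun k l => ?_
  obtain ⟨B, -, hB⟩ := norm_term_mulParam_le (θ := θ) (C := C) hG k l
  refine ⟨_, ?_, hB⟩
  have h : Filter.Tendsto (fun f : Schwartz θ C => ∑ i ∈ Finset.range (l + 1),
      B i * supNorm k (l - i) f) (nhds 0) (nhds (∑ i ∈ Finset.range (l + 1), B i * 0)) :=
    tendsto_finsetSum _ fun i _ => (tendsto_supNorm k (l - i)).const_mul (B i)
  simpa using h

/-- Multiplication with a smooth function of the parameter without zeros. -/
def mulParamEquiv (G : UnitAddCircle → ℂ) (hG : ContDiff ℝ ∞ fun s : ℝ => G s)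
    (h0 : ∀ s, G s ≠ 0) : Schwartz θ C ≃L[ℂ] Schwartz θ C where
  toLinearEquiv := LinearEquiv.ofLinearMap (mulParam G hG)
    (mulParam (fun s => (G s)⁻¹) (hG.inv fun s => h0 s))
    (LinearMap.ext fun f => Subtype.ext (funext fun p => mul_inv_cancel_left₀ (h0 p.param) (f.1 p)))
    (LinearMap.ext fun f => Subtype.ext (funext fun p => inv_mul_cancel_left₀ (h0 p.param) (f.1 p)))
  continuous_toFun := continuous_mulParam hG
  continuous_invFun := continuous_mulParam _

theorem mulParamEquiv_apply {G : UnitAddCircle → ℂ} (hG : ContDiff ℝ ∞ fun s : ℝ => G s)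
    (h0 : ∀ s, G s ≠ 0) (f : Schwartz θ C) (p : LeafPath θ C) :
    (mulParamEquiv G hG h0 f).1 p = G p.param * f.1 p := rfl

end LeafPath

/-! ## Modules of leafwise paths -/

namespace TorusModule

variable {n m : ℤ} {θ : ℝ}

/-- `ψ` identifies the operator `D` on the module `M` with the holomorphic structure
of the leafwise paths to the line of `C`, for the connection `2πi h ds`. -/
structure IsLeafIso (M : TorusModule θ) (C : Supercycle n m) (h : UnitAddCircle → ℝ) (τ : ℂ)
    (D : Module.End ℂ M.E) (ψ : M.E ≃L[ℂ] LeafPath.Schwartz θ C) : Prop where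
  map_U₁ : ∀ ξ p, (ψ (M.U₁ ξ)).1 p = (ψ ξ).1 p.next
  map_U₂ : ∀ ξ p, (ψ (M.U₂ ξ)).1 p = (AddCircle.toCircle p.start : ℂ) * (ψ ξ).1 p
  map_D : ∀ ξ p, (ψ (D ξ)).1 p = τ * (2 * Real.pi * Complex.I * p.height * (ψ ξ).1 p) +
    ((n : ℂ) - m * θ)⁻¹ * (deriv (fun v : ℝ => (ψ ξ).1 (p.move v)) 0 +
      2 * Real.pi * Complex.I * h p.param * (ψ ξ).1 p)

variable {M : TorusModule θ} {C : Supercycle n m} {τ : ℂ} {D D' : Module.End ℂ M.E}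

/-- Change of the connection by a gauge transformation. -/
theorem IsLeafIso.gauge {h h' : UnitAddCircle → ℝ} {ψ : M.E ≃L[ℂ] LeafPath.Schwartz θ C}
    (hψ : M.IsLeafIso C h τ D ψ) (G : UnitAddCircle → ℂ) (hG : ContDiff ℝ ∞ fun s : ℝ => G s)
    (h0 : ∀ s, G s ≠ 0) (hd : ∀ s : ℝ, HasDerivAt (fun v : ℝ => G v)
      (2 * Real.pi * Complex.I * ((h s : ℂ) - h' s) * G s) s) :
    M.IsLeafIso C h' τ D (ψ.trans (LeafPath.mulParamEquiv G hG h0)) where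
  map_U₁ ξ p := by
    simp only [ContinuousLinearEquiv.trans_apply, LeafPath.mulParamEquiv_apply, hψ.map_U₁,
      LeafPath.next_param]
  map_U₂ ξ p := by
    simp only [ContinuousLinearEquiv.trans_apply, LeafPath.mulParamEquiv_apply, hψ.map_U₂]
    ring
  map_D ξ p := by
    simp only [ContinuousLinearEquiv.trans_apply, LeafPath.mulParamEquiv_apply, hψ.map_D]
    have h1 : HasDerivAt (fun v : ℝ => G (p.move v).param)
        (2 * Real.pi * Complex.I * ((h p.param : ℂ) - h' p.param) * G p.param) 0 := by
      simp only [LeafPath.move_param]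
      induction p.param using QuotientAddGroup.induction_on with
      | H σ =>
        have := (hd (σ + 0)).comp_const_add σ 0
        rw [add_zero] at this
        exact this
    have h2 : HasDerivAt (fun v : ℝ => (ψ ξ).1 (p.move v))
        (deriv (fun v : ℝ => (ψ ξ).1 (p.move v)) 0) 0 :=
      (((ψ ξ).2.1 p).differentiable (by simp)).differentiableAt.hasDerivAt
    rw [(h1.fun_mul h2).deriv, LeafPath.move_zero]
    ring

/-- Modules of leafwise paths determine the holomorphic structure up to conjugation. -/
theorem IsLeafIso.conjugate {h : UnitAddCircle → ℝ} {ψ ψ' : M.E ≃L[ℂ] LeafPath.Schwartz θ C}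
    (hψ : M.IsLeafIso C h τ D ψ) (hψ' : M.IsLeafIso C h τ D' ψ') : M.Conjugate D D' := by
  refine ⟨ψ.trans ψ'.symm, fun ξ => ?_, fun ξ => ?_, fun ξ => ?_⟩ <;>
    refine ψ'.injective (Subtype.ext (funext fun p => ?_)) <;>
    simp only [ContinuousLinearEquiv.trans_apply, ContinuousLinearEquiv.apply_symm_apply]
  · rw [hψ.map_U₁, hψ'.map_U₁, ContinuousLinearEquiv.apply_symm_apply]
  · rw [hψ.map_U₂, hψ'.map_U₂, ContinuousLinearEquiv.apply_symm_apply]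
  · rw [hψ.map_D, hψ'.map_D, ContinuousLinearEquiv.apply_symm_apply]

theorem IsLeafIso.of_conjugate {h : UnitAddCircle → ℝ} {ψ : M.E ≃L[ℂ] LeafPath.Schwartz θ C}
    (hψ : M.IsLeafIso C h τ D ψ) (hD : M.Conjugate D' D) :
    ∃ ψ' : M.E ≃L[ℂ] LeafPath.Schwartz θ C, M.IsLeafIso C h τ D' ψ' := by
  obtain ⟨g, h1, h2, h3⟩ := hD
  refine ⟨g.trans ψ, ⟨fun ξ p => ?_, fun ξ p => ?_, fun ξ p => ?_⟩⟩ <;>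
    simp only [ContinuousLinearEquiv.trans_apply]
  · rw [h1, hψ.map_U₁]
  · rw [h2, hψ.map_U₂]
  · rw [h3, hψ.map_D]

end TorusModule

end

noncomputable section

/-! ## The leafwise paths to a line that is not parallel to `y = 0` -/

theorem UnitAddCircle.coe_eq_coe_iff {x y : ℝ} :
    (x : UnitAddCircle) = y ↔ ∃ k : ℤ, x = y + k := by
  rw [← sub_eq_zero, ← AddCircle.coe_sub, AddCircle.coe_eq_zero_iff]
  refine exists_congr fun k => ?_
  rw [zsmul_eq_mul, mul_one, eq_sub_iff_add_eq', eq_comm]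

theorem toCircle_coe_eq_character (x : ℝ) :
    (AddCircle.toCircle (x : UnitAddCircle) : ℂ) = SchwartzModule.character x := by
  rw [AddCircle.toCircle_apply_mk, Circle.coe_exp, SchwartzModule.character]
  congr 1
  push_cast
  ring

namespace SchwartzModule

variable {m : ℤ}

/-- Any representative of `α` may be used in place of `val`: changing it by a multiple of `m` moves
the point by an integer. -/
theorem coe_sub_val_div (hm : m ≠ 0) (x : ℝ) {α : ZMod m.natAbs} {k : ℤ}
    (h : (k : ZMod m.natAbs) = α) :
    ((x - (α.val : ℝ) / m : ℝ) : UnitAddCircle) = ((x - k / m : ℝ) : UnitAddCircle) := by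
  have := neZero_natAbs hm
  have h0 : (k : ZMod m.natAbs) = ((α.val : ℤ) : ZMod m.natAbs) := by
    rw [h]
    simp
  obtain ⟨j, hj⟩ := Int.natAbs_dvd.mp ((ZMod.intCast_eq_intCast_iff_dvd_sub _ _ _).mp h0)
  have hj' : (α.val : ℝ) - k = m * j := by exact_mod_cast hj
  have hmR : (m : ℝ) ≠ 0 := by exact_mod_cast hm
  refine UnitAddCircle.coe_eq_coe_iff.mpr ⟨-j, ?_⟩
  rw [sub_eq_iff_eq_add.mp hj']
  field_simp
  push_cast
  linarith

end SchwartzModule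

namespace LeafPath

variable {n m : ℤ} {θ : ℝ}

/-- A parametrisation of the leafwise paths to `C` by `ℤ/m × ℝ`. -/
structure Chart (θ : ℝ) (C : Supercycle n m) (x₀ : ℝ) where
  e : ZMod m.natAbs × ℝ ≃ LeafPath θ C
  start_e : ∀ α u, (e (α, u)).start = ((u - (α.val : ℝ) / m : ℝ) : UnitAddCircle)
  height_e : ∀ α u, (e (α, u)).height = m / (n - m * θ) * (u - x₀)

/-- For `m ≠ 0` the height fixes a real number `u` through `(n - mθ)t = m(u - x₀)`, and the
condition of `exists_iff` leaves `m` possible starting points `u - α/m`. The offset `x₀ = X - nY/m`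
is the `x`-intercept of the lifted line. -/
theorem exists_chart (hnm : IsCoprime n m) (hm : m ≠ 0) (hθ : (n : ℝ) - m * θ ≠ 0)
    (C : Supercycle n m) (X Y : ℝ) (h : ((X : UnitAddCircle), (Y : UnitAddCircle)) ∈ C.line) :
    Nonempty (Chart θ C (X - n * Y / m)) := by
  have := SchwartzModule.neZero_natAbs hm
  have hmR : (m : ℝ) ≠ 0 := by exact_mod_cast hm
  have hex : ∀ i : ZMod m.natAbs × ℝ, ∃ p : LeafPath θ C,
      p.start = ((i.2 - (i.1.val : ℝ) / m : ℝ) : UnitAddCircle) ∧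
      p.height = m / (n - m * θ) * (i.2 - (X - n * Y / m)) := fun i => by
    rw [exists_iff hnm C X Y h, ← AddCircle.coe_sub, AddCircle.zsmul_coe, AddCircle.zsmul_coe,
      ← AddCircle.coe_add, UnitAddCircle.coe_eq_coe_iff]
    refine ⟨-(i.1.val : ℤ), ?_⟩
    field_simp
    push_cast
    ring
  choose e hs hh using hex
  refine ⟨⟨Equiv.ofBijective e ⟨?_, fun p => ?_⟩, fun α u => hs (α, u), fun α u => hh (α, u)⟩⟩
  · rintro ⟨α, u⟩ ⟨α', u'⟩ he
    have h1 := hh (α, u)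
    rw [he, hh (α', u')] at h1
    have h2 : u' = u := by
      have := mul_left_cancel₀ (div_ne_zero hmR hθ) h1
      simpa using this
    subst h2
    have h3 := hs (α, u')
    rw [he, hs (α', u'), UnitAddCircle.coe_eq_coe_iff] at h3
    obtain ⟨k, hk⟩ := h3
    have h4 : ((α.val : ℤ) : ℤ) - α'.val = m * k := by
      field_simp at hk
      have : (α.val : ℝ) - α'.val = m * k := by linarith
      exact_mod_cast this
    have h5 : (α'.val : ℤ) ≡ α.val [ZMOD m.natAbs] :=
      (Int.modEq_iff_dvd).mpr (Int.natAbs_dvd.mpr ⟨k, h4⟩)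
    have h6 := (ZMod.intCast_eq_intCast_iff _ _ _).mpr h5
    rw [Int.cast_natCast, Int.cast_natCast, ZMod.natCast_zmod_val, ZMod.natCast_zmod_val] at h6
    rw [h6]
  · obtain ⟨x, hx⟩ := QuotientAddGroup.mk_surjective p.start
    have h1 := (exists_iff hnm C X Y h p.start p.height).mp ⟨p, rfl, rfl⟩
    rw [← hx] at h1
    change m • ((x : UnitAddCircle) - (X : UnitAddCircle)) + _ = _ at h1
    rw [← AddCircle.coe_sub, AddCircle.zsmul_coe, AddCircle.zsmul_coe,
      ← AddCircle.coe_add, UnitAddCircle.coe_eq_coe_iff] at h1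
    obtain ⟨k, hk⟩ := h1
    -- Here `u` is solved from the height; the path condition then reads `x = u + k/m`, so the
    -- residue is `-k`.
    refine ⟨(((-k : ℤ) : ZMod m.natAbs), X - n * Y / m + (n - m * θ) / m * p.height),
      ext_of_isCoprime hnm ?_ ?_⟩
    · rw [hs, SchwartzModule.coe_sub_val_div hm _ rfl, ← hx]
      refine congrArg _ ?_
      field_simp
      push_cast
      linarith
    · rw [hh]
      field_simp
      ring

namespace Chart

variable {C : Supercycle n m} {x₀ : ℝ} (c : Chart θ C x₀)
include c

theorem move_e (hnm : IsCoprime n m) (hθ : (n : ℝ) - m * θ ≠ 0) (α : ZMod m.natAbs) (u v : ℝ) :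
    (c.e (α, u)).move v = c.e (α, u + (n - m * θ) * v) := by
  refine ext_of_isCoprime hnm ?_ ?_
  · rw [move_start, c.start_e, c.start_e, ← AddCircle.coe_add]
    congr 1
    ring
  · rw [move_height, c.height_e, c.height_e]
    field_simp
    ring

/-- In the chart the foliation acts by the formula for `U₁` on `ℝ × ℤ/m`: replacing `α` by `α - n`
compensates the shift of `u` by `n/m` in the starting point, and the total shift of `u` lowers the
height by exactly one. -/
theorem next_e (hnm : IsCoprime n m) (hm : m ≠ 0) (hθ : (n : ℝ) - m * θ ≠ 0)
    (α : ZMod m.natAbs) (u : ℝ) :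
    (c.e (α, u)).next = c.e (α - (n : ZMod m.natAbs), u - ((n : ℝ) / m - θ)) := by
  have := SchwartzModule.neZero_natAbs hm
  have hmR : (m : ℝ) ≠ 0 := by exact_mod_cast hm
  refine ext_of_isCoprime hnm ?_ ?_
  · rw [next_start, c.start_e, c.start_e,
      SchwartzModule.coe_sub_val_div hm _ (α := α - (n : ZMod m.natAbs)) (k := (α.val : ℤ) - n) (by simp), ← AddCircle.coe_add]
    congr 1
    field_simp
    push_cast
    ring
  · rw [next_height, c.height_e, c.height_e]
    field_simp
    ring

theorem iteratedDeriv_move (hnm : IsCoprime n m) (hθ : (n : ℝ) - m * θ ≠ 0) {f : ℝ → ℂ}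
    {F : LeafPath θ C → ℂ} {α : ZMod m.natAbs} (hF : ∀ u, F (c.e (α, u)) = f u)
    (hf : ContDiff ℝ ∞ f) (l : ℕ) (u : ℝ) :
    iteratedDeriv l (fun v : ℝ => F ((c.e (α, u)).move v)) 0 =
      ((n - m * θ : ℝ) ^ l : ℝ) • iteratedDeriv l f u := by
  have e1 : (fun v : ℝ => F ((c.e (α, u)).move v)) =
      fun v => (fun w => f (u + w)) ((n - m * θ) • v) := by
    funext v
    rw [c.move_e hnm hθ, hF, smul_eq_mul]
  have hf' : ContDiff ℝ l fun w => f (u + w) :=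
    (hf.of_le (by exact_mod_cast le_top)).comp (contDiff_const.add contDiff_id)
  have h1 := congrFun (iteratedDeriv_comp_const_smul hf' (n - m * θ : ℝ)) 0
  simp only [iteratedDeriv_comp_const_add] at h1
  rw [e1]
  refine h1.trans ?_
  rw [mul_zero, add_zero]

theorem norm_pow_height_mul_le (k : ℕ) (α : ZMod m.natAbs) (u : ℝ) :
    |(c.e (α, u)).height| ^ k ≤
      |(m : ℝ) / (n - m * θ)| ^ k * 2 ^ (k - 1) * (|u| ^ k + |x₀| ^ k) := by
  rw [c.height_e, abs_mul, mul_pow, mul_assoc]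
  refine mul_le_mul_of_nonneg_left ?_ (by positivity)
  exact (pow_le_pow_left₀ (abs_nonneg _) (abs_sub _ _) k).trans
    (add_pow_le (abs_nonneg _) (abs_nonneg _) k)

theorem norm_pow_coordinate_le (hm : m ≠ 0) (hθ : (n : ℝ) - m * θ ≠ 0) (k : ℕ)
    (α : ZMod m.natAbs) (u : ℝ) :
    |u| ^ k ≤ 2 ^ (k - 1) *
      (|((n : ℝ) - m * θ) / m| ^ k * |(c.e (α, u)).height| ^ k + |x₀| ^ k) := by
  have hmR : (m : ℝ) ≠ 0 := by exact_mod_cast hm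
  have h : u = (n - m * θ) / m * (c.e (α, u)).height + x₀ := by
    rw [c.height_e]
    field_simp
    ring
  rw [← mul_pow, ← abs_mul]
  refine le_trans (pow_le_pow_left₀ (abs_nonneg _) ?_ k)
    (add_pow_le (abs_nonneg _) (abs_nonneg _) k)
  nth_rw 1 [h]
  exact abs_add_le _ _

/-! ### The identification with the basic module -/

open SchwartzModule

theorem norm_term_le (hnm : IsCoprime n m) (hθ : (n : ℝ) - m * θ ≠ 0) {f : 𝓢(ℝ, ℂ)}
    {F : LeafPath θ C → ℂ} {α : ZMod m.natAbs} (hF : ∀ u, F (c.e (α, u)) = f u) (k l : ℕ) (u : ℝ) :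
    ‖term k l F (c.e (α, u))‖ ≤ |(m : ℝ) / (n - m * θ)| ^ k * 2 ^ (k - 1) * |(n : ℝ) - m * θ| ^ l *
      (SchwartzMap.seminorm ℂ k l f + |x₀| ^ k * SchwartzMap.seminorm ℂ 0 l f) := by
  rw [term, c.iteratedDeriv_move hnm hθ hF (f.smooth ⊤), norm_mul, norm_pow, Complex.norm_real,
    Real.norm_eq_abs, norm_smul, norm_pow, Real.norm_eq_abs]
  have h1 := c.norm_pow_height_mul_le k α u
  have h2 := SchwartzMap.le_seminorm' ℂ k l f u
  have h3 := SchwartzMap.le_seminorm' ℂ 0 l f u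
  rw [pow_zero, one_mul] at h3
  calc _ ≤ |(m : ℝ) / (n - m * θ)| ^ k * 2 ^ (k - 1) * (|u| ^ k + |x₀| ^ k) *
        (|(n : ℝ) - m * θ| ^ l * ‖iteratedDeriv l f u‖) :=
        mul_le_mul_of_nonneg_right h1 (by positivity)
    _ = |(m : ℝ) / (n - m * θ)| ^ k * 2 ^ (k - 1) * |(n : ℝ) - m * θ| ^ l *
        (|u| ^ k * ‖iteratedDeriv l f u‖ + |x₀| ^ k * ‖iteratedDeriv l f u‖) := by ring
    _ ≤ _ := by gcongr

/-- A Schwartz function on `ℝ × ℤ/m` as a function of leafwise paths. -/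
def toLeafFun (ξ : Space m) (p : LeafPath θ C) : ℂ := ξ (c.e.symm p).1 (c.e.symm p).2

omit c in
theorem toLeafFun_e (c : Chart θ C x₀) (ξ : Space m) (α : ZMod m.natAbs) (u : ℝ) :
    c.toLeafFun ξ (c.e (α, u)) = ξ α u := by
  simp [toLeafFun]

theorem norm_term_toLeafFun_le [NeZero m.natAbs] (hnm : IsCoprime n m)
    (hθ : (n : ℝ) - m * θ ≠ 0) (k l : ℕ) (ξ : Space m) (p : LeafPath θ C) :
    ‖term k l (c.toLeafFun ξ) p‖ ≤ ∑ α, |(m : ℝ) / (n - m * θ)| ^ k * 2 ^ (k - 1) *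
      |(n : ℝ) - m * θ| ^ l * (SchwartzMap.seminorm ℂ k l (ξ α) +
        |x₀| ^ k * SchwartzMap.seminorm ℂ 0 l (ξ α)) := by
  obtain ⟨⟨α, u⟩, rfl⟩ := c.e.surjective p
  refine (c.norm_term_le hnm hθ (c.toLeafFun_e ξ α) k l u).trans ?_
  exact Finset.single_le_sum (f := fun α => |(m : ℝ) / (n - m * θ)| ^ k * 2 ^ (k - 1) *
      |(n : ℝ) - m * θ| ^ l * (SchwartzMap.seminorm ℂ k l (ξ α) +
        |x₀| ^ k * SchwartzMap.seminorm ℂ 0 l (ξ α)))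
    (fun i _ => by positivity) (Finset.mem_univ α)

/-- Schwartz functions on `ℝ × ℤ/m` as Schwartz functions of leafwise paths. -/
def toLeaf [NeZero m.natAbs] (hnm : IsCoprime n m) (hθ : (n : ℝ) - m * θ ≠ 0) :
    Space m →ₗ[ℂ] Schwartz θ C where
  toFun ξ := ⟨c.toLeafFun ξ, fun p => by
    obtain ⟨⟨α, u⟩, rfl⟩ := c.e.surjective p
    simp only [c.move_e hnm hθ, c.toLeafFun_e]
    exact ((ξ α).smooth ⊤).comp (contDiff_const.add (contDiff_const.mul contDiff_id)),
    fun k l => ⟨_, c.norm_term_toLeafFun_le hnm hθ k l ξ⟩⟩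
  map_add' ξ η := rfl
  map_smul' z ξ := rfl

theorem continuous_toLeaf [NeZero m.natAbs] (hnm : IsCoprime n m) (hθ : (n : ℝ) - m * θ ≠ 0) :
    Continuous (c.toLeaf hnm hθ) := by
  refine continuous_into _ fun k l => ⟨_, ?_, c.norm_term_toLeafFun_le hnm hθ k l⟩
  have h : ∀ k l, ∀ α : ZMod m.natAbs, Filter.Tendsto
      (fun ξ : Space m => SchwartzMap.seminorm ℂ k l (ξ α)) (nhds 0) (nhds 0) := fun k l α =>
    (SchwartzMap.tendsto_seminorm k l).comp ((continuous_apply α).tendsto 0)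
  have h1 := tendsto_finsetSum Finset.univ fun α _ => (((h k l α).add
    ((h 0 l α).const_mul (|x₀| ^ k))).const_mul (|(m : ℝ) / (n - m * θ)| ^ k * 2 ^ (k - 1) *
      |(n : ℝ) - m * θ| ^ l))
  simpa using h1

theorem contDiff_e (hnm : IsCoprime n m) (hθ : (n : ℝ) - m * θ ≠ 0) (F : Schwartz θ C)
    (α : ZMod m.natAbs) : ContDiff ℝ ∞ fun u => F.1 (c.e (α, u)) := by
  have h : (fun u => F.1 (c.e (α, u))) =
      (fun v : ℝ => F.1 ((c.e (α, 0)).move v)) ∘ fun u => u / (n - m * θ) := by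
    funext u
    rw [Function.comp_apply, c.move_e hnm hθ, zero_add, mul_div_cancel₀ _ hθ]
  rw [h]
  exact (F.2.1 _).comp (contDiff_id.div_const _)

theorem pow_mul_norm_iteratedDeriv_le (hnm : IsCoprime n m) (hm : m ≠ 0)
    (hθ : (n : ℝ) - m * θ ≠ 0) (k l : ℕ) (F : Schwartz θ C) (α : ZMod m.natAbs) (u : ℝ) :
    |u| ^ k * ‖iteratedDeriv l (fun u => F.1 (c.e (α, u))) u‖ ≤ 2 ^ (k - 1) *
      (|((n : ℝ) - m * θ) / m| ^ k * supNorm k l F + |x₀| ^ k * supNorm 0 l F) *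
        (|(n : ℝ) - m * θ| ^ l)⁻¹ := by
  have hε : 0 < |(n : ℝ) - m * θ| ^ l := pow_pos (abs_pos.mpr hθ) l
  have h := c.iteratedDeriv_move hnm hθ (F := F.1) (fun _ => rfl) (c.contDiff_e hnm hθ F α) l u
  have h1 : ‖iteratedDeriv l (fun u => F.1 (c.e (α, u))) u‖ =
      ‖iteratedDeriv l (fun v : ℝ => F.1 ((c.e (α, u)).move v)) 0‖ *
        (|(n : ℝ) - m * θ| ^ l)⁻¹ := by
    rw [h, norm_smul, norm_pow, Real.norm_eq_abs]
    field_simp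
  rw [h1, ← mul_assoc]
  refine mul_le_mul_of_nonneg_right ?_ (by positivity)
  have h2 := c.norm_pow_coordinate_le hm hθ k α u
  have h3 := le_supNorm k l F (c.e (α, u))
  have h4 := le_supNorm 0 l F (c.e (α, u))
  rw [termMap_apply, norm_mul, norm_pow, Complex.norm_real, Real.norm_eq_abs] at h3 h4
  rw [pow_zero, one_mul] at h4
  set N := ‖iteratedDeriv l (fun v : ℝ => F.1 ((c.e (α, u)).move v)) 0‖
  calc |u| ^ k * N ≤ 2 ^ (k - 1) * (|((n : ℝ) - m * θ) / m| ^ k * |(c.e (α, u)).height| ^ k +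
        |x₀| ^ k) * N := mul_le_mul_of_nonneg_right h2 (norm_nonneg _)
    _ = 2 ^ (k - 1) * (|((n : ℝ) - m * θ) / m| ^ k * (|(c.e (α, u)).height| ^ k * N) +
        |x₀| ^ k * N) := by ring
    _ ≤ _ := by gcongr

/-- Schwartz functions of leafwise paths as Schwartz functions on `ℝ × ℤ/m`. -/
def ofLeaf (hnm : IsCoprime n m) (hm : m ≠ 0) (hθ : (n : ℝ) - m * θ ≠ 0) :
    Schwartz θ C →ₗ[ℂ] Space m where
  toFun F α := ⟨fun u => F.1 (c.e (α, u)), c.contDiff_e hnm hθ F α, fun k l =>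
    ⟨_, fun u => by
      rw [norm_iteratedFDeriv_eq_norm_iteratedDeriv]
      exact c.pow_mul_norm_iteratedDeriv_le hnm hm hθ k l F α u⟩⟩
  map_add' F G := rfl
  map_smul' z F := rfl

theorem continuous_ofLeaf (hnm : IsCoprime n m) (hm : m ≠ 0) (hθ : (n : ℝ) - m * θ ≠ 0) :
    Continuous (c.ofLeaf hnm hm hθ) := by
  refine continuous_pi fun α => ?_
  refine SchwartzMap.continuous_of_seminorm (LinearMap.proj α ∘ₗ c.ofLeaf hnm hm hθ) fun k l => ?_
  refine ⟨_, ?_, fun F => SchwartzMap.seminorm_le_bound' ℂ k l _ ?_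
    (c.pow_mul_norm_iteratedDeriv_le hnm hm hθ k l F α)⟩
  · have h1 := ((((tendsto_supNorm (θ := θ) (C := C) k l).const_mul
      (|((n : ℝ) - m * θ) / m| ^ k)).add ((tendsto_supNorm 0 l).const_mul
        (|x₀| ^ k))).const_mul (2 ^ (k - 1))).mul_const ((|(n : ℝ) - m * θ| ^ l)⁻¹)
    simpa using h1
  · have := supNorm_nonneg k l F
    have := supNorm_nonneg 0 l F
    positivity

/-- The identification of the two Schwartz spaces. -/
def leafEquiv [NeZero m.natAbs] (hnm : IsCoprime n m) (hm : m ≠ 0) (hθ : (n : ℝ) - m * θ ≠ 0) :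
    Space m ≃L[ℂ] Schwartz θ C where
  toLinearEquiv := LinearEquiv.ofLinearMap (c.toLeaf hnm hθ) (c.ofLeaf hnm hm hθ)
    (LinearMap.ext fun F => Subtype.ext (funext fun p => by
      obtain ⟨⟨α, u⟩, rfl⟩ := c.e.surjective p
      exact c.toLeafFun_e _ α u))
    (LinearMap.ext fun ξ => funext fun α => SchwartzMap.ext fun u => c.toLeafFun_e ξ α u)
  continuous_toFun := c.continuous_toLeaf hnm hθ
  continuous_invFun := c.continuous_ofLeaf hnm hm hθ

theorem leafEquiv_e [NeZero m.natAbs] (hnm : IsCoprime n m) (hm : m ≠ 0)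
    (hθ : (n : ℝ) - m * θ ≠ 0) (ξ : Space m) (α : ZMod m.natAbs) (u : ℝ) :
    (c.leafEquiv hnm hm hθ ξ).1 (c.e (α, u)) = ξ α u := c.toLeafFun_e ξ α u

end Chart

end LeafPath

namespace SchwartzModule

variable {n m : ℤ} {θ : ℝ}

/-- In the chart the height is `μ(u - x₀)`, so `2πit` is the reference `∇₁` translated by `r₁ =
-μx₀`. Moving the end point changes `u` with speed `n - mθ`, which the normalising factor of the
leafwise `∇₂` cancels. -/
theorem exists_isLeafIso_const (hnm : IsCoprime n m) (hm : m ≠ 0) (hθ : (n : ℝ) - m * θ ≠ 0)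
    (τ : ℂ) (C : Supercycle n m) (X Y H : ℝ)
    (h : ((X : UnitAddCircle), (Y : UnitAddCircle)) ∈ C.line) :
    ∃ ψ, (schwartzModule n m θ hm).IsLeafIso C (fun _ => H) τ
      ((schwartzModule n m θ hm).translated τ (-((m * X - n * Y) / (n - m * θ)), H / (n - m * θ)))
      ψ := by
  have := neZero_natAbs hm
  have hmC : (m : ℂ) ≠ 0 := by exact_mod_cast hm
  have hθC : (n : ℂ) - m * θ ≠ 0 := by exact_mod_cast hθ
  obtain ⟨c⟩ := LeafPath.exists_chart hnm hm hθ C X Y h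
  refine ⟨c.leafEquiv hnm hm hθ, fun (ξ : Space m) p => ?_, fun (ξ : Space m) p => ?_,
    fun (ξ : Space m) p => ?_⟩ <;> obtain ⟨⟨α, u⟩, rfl⟩ := c.e.surjective p
  · rw [c.next_e hnm hm hθ]
    refine (c.leafEquiv_e hnm hm hθ (U₁ n m θ ξ) α u).trans ?_
    rw [U₁_apply]
    exact (c.leafEquiv_e hnm hm hθ ξ _ _).symm
  · refine (c.leafEquiv_e hnm hm hθ (U₂ m ξ) α u).trans ?_
    rw [U₂_apply, c.start_e, toCircle_coe_eq_character, sub_eq_add_neg, character_add]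
    have h1 : character (-((α.val : ℝ) / m)) =
        Complex.exp (-(2 * Real.pi * Complex.I * α.val / m)) := by
      rw [character]
      congr 1
      push_cast
      ring
    rw [h1, mul_comm (character u), mul_assoc (Complex.exp _) (character u)]
    exact congrArg _ (congrArg _ (c.leafEquiv_e hnm hm hθ ξ α u).symm)
  · refine (congrArg (fun η : Space m => (c.leafEquiv hnm hm hθ η).1 (c.e (α, u)))
      ((schwartzModule n m θ hm).translated_apply τ _ ξ)).trans ?_
    refine (c.leafEquiv_e hnm hm hθ (τ • nabla₁ n m θ ξ + nabla₂ m ξ +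
      (2 * Real.pi * Complex.I * (τ * (-((m * X - n * Y) / (n - m * θ)) : ℝ) +
        (H / (n - m * θ) : ℝ)) : ℂ) • ξ : Space m) α u).trans ?_
    have h1 : (c.leafEquiv hnm hm hθ ξ).1 (c.e (α, u)) = ξ α u := c.leafEquiv_e hnm hm hθ ξ α u
    have h2 : deriv (fun v : ℝ => (c.leafEquiv hnm hm hθ ξ).1 ((c.e (α, u)).move v)) 0 =
        (n - m * θ) * deriv (ξ α) u := by
      have := c.iteratedDeriv_move hnm hθ (F := (c.leafEquiv hnm hm hθ ξ).1)
        (c.leafEquiv_e hnm hm hθ ξ α) ((ξ α).smooth ⊤) 1 u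
      rw [iteratedDeriv_one, iteratedDeriv_one, pow_one, Complex.real_smul] at this
      rw [this]
      push_cast
      rfl
    change τ * nabla₁ n m θ ξ α u + nabla₂ m ξ α u + _ * ξ α u = τ * (_ * _ *
      (c.leafEquiv hnm hm hθ ξ).1 (c.e (α, u))) + _ * (deriv (fun v : ℝ =>
        (c.leafEquiv hnm hm hθ ξ).1 ((c.e (α, u)).move v)) 0 + _ *
          (c.leafEquiv hnm hm hθ ξ).1 (c.e (α, u)))
    rw [h1, h2, nabla₁_apply, nabla₂_apply, c.height_e]
    push_cast
    field_simp
    ring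

end SchwartzModule

end

noncomputable section

/-! ## Fourier series of smooth functions on the circle -/

theorem contDiff_of_hasDerivAt_succ {F : ℕ → ℝ → ℂ}
    (h : ∀ l v, HasDerivAt (F l) (F (l + 1) v) v) :
    (∀ l, iteratedDeriv l (F 0) = F l) ∧ ContDiff ℝ ∞ (F 0) := by
  have h1 : ∀ l, iteratedDeriv l (F 0) = F l := fun l => by
    induction l with
    | zero => exact iteratedDeriv_zero
    | succ l ih => rw [iteratedDeriv_succ, ih, funext fun v => (h l v).deriv]
  refine ⟨h1, contDiff_of_differentiable_iteratedDeriv fun l _ => ?_⟩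
  rw [h1]
  exact fun v => (h l v).differentiableAt

theorem fourierCoeff_of_hasDerivAt {g g' : UnitAddCircle → ℂ}
    (hd : ∀ x : ℝ, HasDerivAt (fun y : ℝ => g y) (g' x) x) (hc : Continuous fun x : ℝ => g' x)
    (j : ℤ) : fourierCoeff g' j = 2 * Real.pi * Complex.I * j * fourierCoeff g j := by
  have hF : ∀ x : ℝ, HasDerivAt (fun y : ℝ => fourier (-j) (y : UnitAddCircle))
      (-2 * Real.pi * Complex.I * j / (1 : ℝ) * fourier (-j) (x : UnitAddCircle)) x :=
    hasDerivAt_fourier_neg 1 j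
  have hcF : Continuous fun x : ℝ => fourier (-j) (x : UnitAddCircle) :=
    (map_continuous _).comp (AddCircle.continuous_mk' 1)
  have h := intervalIntegral.integral_mul_deriv_eq_deriv_mul (a := 0) (b := 1)
    (fun x _ => hF x) (fun x _ => hd x)
    ((continuous_const.mul hcF).intervalIntegrable _ _) (hc.intervalIntegrable _ _)
  rw [fourierCoeff_eq_intervalIntegral _ _ 0, fourierCoeff_eq_intervalIntegral _ _ 0]
  simp only [smul_eq_mul, zero_add, div_one, one_smul] at h ⊢
  rw [h]
  have e : ((1 : ℝ) : UnitAddCircle) = ((0 : ℝ) : UnitAddCircle) := by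
    rw [AddCircle.coe_period]; rfl
  rw [e, sub_self, zero_sub, ← intervalIntegral.integral_const_mul,
    ← intervalIntegral.integral_neg]
  refine intervalIntegral.integral_congr fun x _ => ?_
  push_cast
  ring

theorem norm_fourierCoeff_le {g : UnitAddCircle → ℂ} {B : ℝ} (h : ∀ x, ‖g x‖ ≤ B) (j : ℤ) :
    ‖fourierCoeff g j‖ ≤ B := by
  have h1 : ∀ x : UnitAddCircle, ‖fourier (-j) x • g x‖ ≤ B := fun x => by
    rw [norm_smul, fourier_apply, Circle.norm_coe, one_mul]
    exact h x
  have := MeasureTheory.norm_integral_le_of_norm_le_const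
    (μ := AddCircle.haarAddCircle) (Filter.Eventually.of_forall h1)
  simpa [fourierCoeff] using this

theorem fourierCoeff_tsum {a : ℤ → ℂ} (ha : Summable fun j => ‖a j‖) (k : ℤ) :
    fourierCoeff (fun x : UnitAddCircle => ∑' j, a j * fourier j x) k = a k := by
  have hs : ∀ j, Continuous fun x : UnitAddCircle => fourier (-k) x • (a j * fourier j x) :=
    fun j => (map_continuous (fourier (-k))).smul (continuous_const.mul (map_continuous (fourier j)))
  have hn : ∀ j (x : UnitAddCircle), ‖fourier (-k) x • (a j * fourier j x)‖ = ‖a j‖ := fun j x => by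
    rw [norm_smul, norm_mul, fourier_apply, fourier_apply, Circle.norm_coe, Circle.norm_coe,
      one_mul, mul_one]
  have h := MeasureTheory.hasSum_integral_of_summable_integral_norm
    (μ := AddCircle.haarAddCircle (T := 1))
    (F := fun j (x : UnitAddCircle) => fourier (-k) x • (a j * fourier j x))
    (fun j => (hs j).integrable_of_hasCompactSupport (HasCompactSupport.of_compactSpace _))
    (by simp only [hn]; simpa using ha)
  have e : ∀ j, ∫ x : UnitAddCircle, fourier (-k) x • (a j * fourier j x) ∂AddCircle.haarAddCircle
      = if j = k then a k else 0 := fun j => by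
    have := congrFun (fourierCoeff_fourier (T := 1) j) k
    change fourierCoeff (fun x : UnitAddCircle => a j * fourier j x) k = _
    rw [fourierCoeff.const_mul, this, Pi.single_apply]
    split_ifs with h1 h2 h2
    · rw [h2, mul_one]
    · exact absurd h1.symm h2
    · exact absurd h2.symm h1
    · exact mul_zero _
  simp only [e] at h
  have h' := h.unique (hasSum_ite_eq k (a k))
  rw [← h', fourierCoeff]
  simp only [smul_eq_mul, tsum_mul_left]

/-! ## The leafwise paths to a line that is parallel to `y = 0` -/

namespace LeafPath

variable {n : ℤ} {θ : ℝ}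

/-- A parametrisation of the leafwise paths to `C` by `ℤ × ℝ/ℤ`. -/
structure CircleChart (θ : ℝ) (C : Supercycle n 0) (Y : ℝ) where
  e : ℤ × UnitAddCircle ≃ LeafPath θ C
  start_e : ∀ i x, (e (i, x)).start = x
  height_e : ∀ i x, (e (i, x)).height = i + Y

/-- For `m = 0` the integer `n` is `±1`, and the path condition does not involve the starting point:
it only says that the height lies in `Y + ℤ`. -/
theorem exists_circleChart (hnm : IsCoprime n 0) (hn : n * n = 1) (C : Supercycle n 0) (X Y : ℝ)
    (h : ((X : UnitAddCircle), (Y : UnitAddCircle)) ∈ C.line) :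
    Nonempty (CircleChart θ C Y) := by
  have hnR : (n : ℝ) * n = 1 := by exact_mod_cast hn
  have hiff : ∀ (x : UnitAddCircle) (t : ℝ), (∃ p : LeafPath θ C, p.start = x ∧ p.height = t) ↔
      ∃ k : ℤ, n * Y = n * t + k := fun x t => by
    rw [exists_iff hnm C X Y h, zero_smul, zero_add, AddCircle.zsmul_coe, Int.cast_zero, zero_mul,
      sub_zero, UnitAddCircle.coe_eq_coe_iff]
  have hex : ∀ i : ℤ × UnitAddCircle, ∃ p : LeafPath θ C,
      p.start = i.2 ∧ p.height = i.1 + Y := fun i => by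
    rw [hiff]
    refine ⟨-(n * i.1), ?_⟩
    push_cast
    ring
  choose e hs hh using hex
  refine ⟨⟨Equiv.ofBijective e ⟨?_, fun p => ?_⟩, fun i x => hs (i, x), fun i x => hh (i, x)⟩⟩
  · rintro ⟨i, x⟩ ⟨i', x'⟩ he
    have h1 := hh (i, x)
    have h2 := hs (i, x)
    rw [he, hh (i', x')] at h1
    rw [he, hs (i', x')] at h2
    have h3 : (i' : ℝ) = i := add_right_cancel h1
    exact Prod.ext (by exact_mod_cast h3.symm) h2.symm
  · obtain ⟨k, hk⟩ := (hiff p.start p.height).mp ⟨p, rfl, rfl⟩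
    refine ⟨(-(n * k), p.start), ext_of_isCoprime hnm (hs _) ?_⟩
    rw [hh]
    push_cast
    linear_combination (n : ℝ) * hk + (p.height - Y) * hnR

namespace CircleChart

variable {C : Supercycle n 0} {Y : ℝ} (c : CircleChart θ C Y)
include c

theorem move_e (hnm : IsCoprime n 0) (i : ℤ) (x : UnitAddCircle) (v : ℝ) :
    (c.e (i, x)).move v = c.e (i, x + ((n * v : ℝ) : UnitAddCircle)) := by
  refine ext_of_isCoprime hnm ?_ ?_
  · rw [move_start, c.start_e, c.start_e, Int.cast_zero, zero_mul, sub_zero]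
  · rw [move_height, c.height_e, c.height_e, Int.cast_zero, zero_mul, add_zero]

theorem next_e (hnm : IsCoprime n 0) (i : ℤ) (x : UnitAddCircle) :
    (c.e (i, x)).next = c.e (i - 1, x + (θ : UnitAddCircle)) := by
  refine ext_of_isCoprime hnm ?_ ?_
  · rw [next_start, c.start_e, c.start_e]
  · rw [next_height, c.height_e, c.height_e, Int.cast_sub, Int.cast_one]
    ring

end CircleChart

end LeafPath

end

noncomputable section

open FreeModule RapidSeq

/-! ### Rows of rapidly decreasing families as Fourier series -/

namespace FreeModule

variable {n : ℤ} {θ : ℝ}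

/-- The Fourier coefficients of the `l`-th derivative of the `i`-th row of `a`. -/
def rowCoeff (n : ℤ) (θ : ℝ) (l : ℕ) (a : Space) (i j : ℤ) : ℂ :=
  (2 * Real.pi * Complex.I * n * j) ^ l * (SchwartzModule.character (θ * i * j) * a.1 (i, j))

theorem abs_eq_one_of_mul_self (hn : n * n = 1) : |(n : ℝ)| = 1 := by
  have h : (n : ℝ) * n = 1 := by exact_mod_cast hn
  rw [← sq, ← sq_abs] at h
  exact (pow_eq_one_iff_of_nonneg (abs_nonneg _) two_ne_zero).mp h

/-- Of the `k + l + 2` orders of decay, `l` are spent on the derivative and two on making the series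
over `j` converge. -/
theorem weight_pow_mul_norm_rowCoeff_le (hn : n * n = 1) (k l : ℕ) (a : Space) (i j : ℤ) :
    weight (i, j) ^ k * ‖rowCoeff n θ l a i j‖ ≤
      (2 * Real.pi) ^ l * supNorm (k + l + 2) a * ((1 + |(j : ℝ)|) ^ 2)⁻¹ := by
  have h1 : ‖rowCoeff n θ l a i j‖ = (2 * Real.pi) ^ l * |(j : ℝ)| ^ l * ‖a.1 (i, j)‖ := by
    rw [rowCoeff, norm_mul, norm_mul, SchwartzMap.norm_character, one_mul, norm_pow, ← mul_pow]
    simp only [norm_mul, Complex.norm_I, Complex.norm_intCast, Complex.norm_ofNat,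
      Complex.norm_real, Real.norm_eq_abs, abs_of_pos Real.pi_pos, mul_one,
      abs_eq_one_of_mul_self hn]
  have h2 := le_supNorm (k + l + 2) a (i, j)
  have h3 := abs_snd_le_weight (i, j)
  have h4 : 1 + |(j : ℝ)| ≤ weight (i, j) := by
    unfold weight
    linarith [abs_nonneg (i : ℝ)]
  have h5 := weight_nonneg (i, j)
  rw [h1, ← div_eq_mul_inv, le_div_iff₀ (by positivity)]
  calc _ = (2 * Real.pi) ^ l * (weight (i, j) ^ k * |(j : ℝ)| ^ l * (1 + |(j : ℝ)|) ^ 2 *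
        ‖a.1 (i, j)‖) := by ring
    _ ≤ (2 * Real.pi) ^ l * (weight (i, j) ^ k * weight (i, j) ^ l * weight (i, j) ^ 2 *
        ‖a.1 (i, j)‖) := by
      have := Real.pi_pos
      gcongr
    _ ≤ _ := by
      rw [← pow_add, ← pow_add]
      have := Real.pi_pos
      gcongr

theorem summable_rowCoeff (hn : n * n = 1) (l : ℕ) (a : Space) (i : ℤ) :
    Summable fun j => ‖rowCoeff n θ l a i j‖ := by
  refine Summable.of_nonneg_of_le (fun j => norm_nonneg _) (fun j => ?_)
    (summable_inv_one_add_abs_sq.mul_left ((2 * Real.pi) ^ l * supNorm (0 + l + 2) a))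
  simpa using weight_pow_mul_norm_rowCoeff_le (θ := θ) hn 0 l a i j

/-- The `l`-th derivative of the `i`-th row of `a`. -/
def row (n : ℤ) (θ : ℝ) (l : ℕ) (a : Space) (i : ℤ) (x : UnitAddCircle) : ℂ :=
  ∑' j, rowCoeff n θ l a i j * fourier j x

theorem norm_rowCoeff_mul_fourier (l : ℕ) (a : Space) (i j : ℤ) (x : UnitAddCircle) :
    ‖rowCoeff n θ l a i j * fourier j x‖ = ‖rowCoeff n θ l a i j‖ := by
  rw [norm_mul, fourier_apply, Circle.norm_coe, mul_one]

theorem summable_row (hn : n * n = 1) (l : ℕ) (a : Space) (i : ℤ) (x : UnitAddCircle) :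
    Summable fun j => rowCoeff n θ l a i j * fourier j x := by
  refine Summable.of_norm ?_
  simp only [norm_rowCoeff_mul_fourier]
  exact summable_rowCoeff hn l a i

theorem abs_pow_mul_norm_row_le (hn : n * n = 1) (Y : ℝ) (k l : ℕ) (a : Space) (i : ℤ)
    (x : UnitAddCircle) : |i + Y| ^ k * ‖row n θ l a i x‖ ≤ (1 + |Y|) ^ k *
      ((2 * Real.pi) ^ l * supNorm (k + l + 2) a * ∑' j : ℤ, ((1 + |(j : ℝ)|) ^ 2)⁻¹) := by
  have h1 : ‖row n θ l a i x‖ ≤ ∑' j, ‖rowCoeff n θ l a i j‖ := by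
    have hs := summable_rowCoeff (θ := θ) hn l a i
    simp only [← norm_rowCoeff_mul_fourier (n := n) (θ := θ) l a i _ x] at hs ⊢
    exact norm_tsum_le_tsum_norm hs
  have hw : ∀ j : ℤ, |i + Y| ≤ (1 + |Y|) * weight (i, j) := fun j => by
    have := abs_add_le (i : ℝ) Y
    unfold weight
    nlinarith [abs_nonneg Y, abs_nonneg (i : ℝ), abs_nonneg (j : ℝ),
      mul_nonneg (abs_nonneg Y) (abs_nonneg (i : ℝ)), mul_nonneg (abs_nonneg Y) (abs_nonneg (j : ℝ))]
  refine (mul_le_mul_of_nonneg_left h1 (by positivity)).trans ?_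
  rw [← tsum_mul_left, ← tsum_mul_left, ← tsum_mul_left]
  refine Summable.tsum_le_tsum (fun j => ?_) ((summable_rowCoeff hn l a i).mul_left _)
    ((summable_inv_one_add_abs_sq.mul_left _).mul_left _)
  calc |i + Y| ^ k * ‖rowCoeff n θ l a i j‖ ≤
      ((1 + |Y|) * weight (i, j)) ^ k * ‖rowCoeff n θ l a i j‖ := by
        gcongr
        exact hw j
    _ = (1 + |Y|) ^ k * (weight (i, j) ^ k * ‖rowCoeff n θ l a i j‖) := by
      rw [mul_pow, mul_assoc]
    _ ≤ _ := mul_le_mul_of_nonneg_left (weight_pow_mul_norm_rowCoeff_le hn k l a i j)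
      (by positivity)

theorem hasDerivAt_row (hn : n * n = 1) (l : ℕ) (a : Space) (i : ℤ) (x : UnitAddCircle) (v : ℝ) :
    HasDerivAt (fun v : ℝ => row n θ l a i (x + ((n * v : ℝ) : UnitAddCircle)))
      (row n θ (l + 1) a i (x + ((n * v : ℝ) : UnitAddCircle))) v := by
  obtain ⟨ξ, rfl⟩ := QuotientAddGroup.mk_surjective x
  change HasDerivAt (fun v : ℝ => row n θ l a i ((ξ : UnitAddCircle) + _))
    (row n θ (l + 1) a i ((ξ : UnitAddCircle) + _)) v
  simp only [← AddCircle.coe_add]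
  refine hasDerivAt_tsum
    (g := fun j (w : ℝ) => rowCoeff n θ l a i j * fourier j ((ξ + n * w : ℝ) : UnitAddCircle))
    (g' := fun j (w : ℝ) => rowCoeff n θ (l + 1) a i j * fourier j ((ξ + n * w : ℝ) : UnitAddCircle))
    (summable_rowCoeff (θ := θ) hn (l + 1) a i) (fun j w => ?_)
    (fun j w => (norm_rowCoeff_mul_fourier (l + 1) a i j _).le) (y₀ := 0)
    (summable_row hn l a i _) v
  have h1 : HasDerivAt (fun v : ℝ => ξ + n * v) (n : ℝ) w := by
    simpa using ((hasDerivAt_id w).const_mul (n : ℝ)).const_add ξ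
  have h2 := ((hasDerivAt_fourier 1 j (ξ + n * w)).scomp w h1).const_mul (rowCoeff n θ l a i j)
  refine h2.congr_deriv ?_
  simp only [rowCoeff, pow_succ, Complex.real_smul]
  push_cast
  ring

end FreeModule

namespace LeafPath

/-! ### Schwartz functions of leafwise paths as rapidly decreasing families -/

theorem hasDerivAt_termMap {n m : ℤ} {θ : ℝ} {C : Supercycle n m} (F : Schwartz θ C) (l : ℕ)
    (p : LeafPath θ C) (v : ℝ) : HasDerivAt (fun v : ℝ => termMap (0, l) F (p.move v))
      (termMap (0, l + 1) F (p.move v)) v := by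
  have h : ∀ l, ∀ v : ℝ, termMap (0, l) F (p.move v) =
      iteratedDeriv l (fun w : ℝ => F.1 (p.move w)) v := fun l v => by
    have := congrFun (iteratedDeriv_comp_const_add l (fun w : ℝ => F.1 (p.move w)) v) 0
    rw [add_zero] at this
    rw [termMap_apply, pow_zero, one_mul, ← this]
    simp only [move_move]
  simp only [h]
  rw [iteratedDeriv_succ]
  exact (((F.2.1 p).differentiable_iteratedDeriv l (by exact_mod_cast WithTop.coe_lt_top _)) v).hasDerivAt

namespace CircleChart

variable {n : ℤ} {θ : ℝ} {C : Supercycle n 0} {Y : ℝ} (c : CircleChart θ C Y)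
include c

theorem hasDerivAt_e (hnm : IsCoprime n 0) (hn : n * n = 1) (F : Schwartz θ C) (l : ℕ) (i : ℤ)
    (x : ℝ) : HasDerivAt (fun y : ℝ => termMap (0, l) F (c.e (i, (y : UnitAddCircle))))
      (n * termMap (0, l + 1) F (c.e (i, (x : UnitAddCircle)))) x := by
  have hnR : (n : ℝ) * n = 1 := by exact_mod_cast hn
  have h : ∀ y : ℝ, c.e (i, (y : UnitAddCircle)) = (c.e (i, 0)).move (n * y) := fun y => by
    rw [c.move_e hnm, ← mul_assoc, hnR, one_mul, zero_add]
  simp only [h]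
  have h1 : HasDerivAt (fun v : ℝ => n * v) (n : ℝ) x := by
    simpa using (hasDerivAt_id x).const_mul (n : ℝ)
  have h2 := (hasDerivAt_termMap F l (c.e (i, 0)) (n * x)).scomp x h1
  refine h2.congr_deriv ?_
  rw [Complex.real_smul, Complex.ofReal_intCast]

theorem continuous_e (hnm : IsCoprime n 0) (hn : n * n = 1) (F : Schwartz θ C) (l : ℕ) (i : ℤ) :
    Continuous fun y : ℝ => termMap (0, l) F (c.e (i, (y : UnitAddCircle))) :=
  continuous_iff_continuousAt.mpr fun x => (c.hasDerivAt_e hnm hn F l i x).continuousAt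

theorem norm_fourierCoeff_termMap (hnm : IsCoprime n 0) (hn : n * n = 1) (F : Schwartz θ C) (l : ℕ)
    (i j : ℤ) : ‖fourierCoeff (fun x => termMap (0, l) F (c.e (i, x))) j‖ =
      (2 * Real.pi * |(j : ℝ)|) ^ l * ‖fourierCoeff (fun x => F.1 (c.e (i, x))) j‖ := by
  induction l with
  | zero =>
    simp only [termMap_apply, iteratedDeriv_zero, pow_zero, one_mul, move_zero]
  | succ l ih =>
    have h := fourierCoeff_of_hasDerivAt (g := fun x => termMap (0, l) F (c.e (i, x)))
      (g' := fun x => n * termMap (0, l + 1) F (c.e (i, x))) (c.hasDerivAt_e hnm hn F l i)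
      (continuous_const.mul (c.continuous_e hnm hn F (l + 1) i)) j
    rw [fourierCoeff.const_mul] at h
    have h' := congrArg norm h
    simp only [norm_mul, Complex.norm_I, Complex.norm_intCast, Complex.norm_ofNat,
      Complex.norm_real, Real.norm_eq_abs, abs_of_pos Real.pi_pos, mul_one,
      abs_eq_one_of_mul_self hn, one_mul, ih] at h'
    rw [h']
    ring

theorem abs_pow_mul_norm_fourierCoeff_le (hnm : IsCoprime n 0) (hn : n * n = 1) (F : Schwartz θ C)
    (k l : ℕ) (i j : ℤ) : |i + Y| ^ k * |(j : ℝ)| ^ l *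
      ‖fourierCoeff (fun x => F.1 (c.e (i, x))) j‖ ≤ LeafPath.supNorm k l F := by
  have h1 : ∀ x, ‖((i + Y : ℝ) : ℂ) ^ k * termMap (0, l) F (c.e (i, x))‖ ≤ LeafPath.supNorm k l F :=
    fun x => by
      have := LeafPath.le_supNorm k l F (c.e (i, x))
      rw [termMap_apply, c.height_e] at this
      rwa [termMap_apply, pow_zero, one_mul]
  have h2 := norm_fourierCoeff_le h1 j
  rw [fourierCoeff.const_mul, norm_mul, norm_pow, Complex.norm_real, Real.norm_eq_abs,
    c.norm_fourierCoeff_termMap hnm hn, mul_pow] at h2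
  refine le_trans ?_ h2
  rw [mul_assoc]
  have h3 : (1 : ℝ) ≤ (2 * Real.pi) ^ l := one_le_pow₀ (by linarith [Real.pi_gt_three])
  gcongr
  exact le_mul_of_one_le_left (by positivity) h3

/-- The coefficients of a Schwartz function of leafwise paths. -/
def coeff (F : Schwartz θ C) (p : ℤ × ℤ) : ℂ :=
  SchwartzModule.character (-(θ * p.1 * p.2)) * fourierCoeff (fun x => F.1 (c.e (p.1, x))) p.2

/-- Decay in `i` comes from the height `i + Y`, decay in `j` from derivatives along the circle. The
weight is at most `((1 + |Y|) + |i + Y|)(1 + |j|)`, and expanding its power by convexity leaves four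
mixed seminorms. -/
theorem weight_pow_mul_norm_coeff_le (hnm : IsCoprime n 0) (hn : n * n = 1) (k : ℕ)
    (F : Schwartz θ C) (p : ℤ × ℤ) : weight p ^ k * ‖c.coeff F p‖ ≤ 2 ^ (k - 1) * 2 ^ (k - 1) *
      ((1 + |Y|) ^ k * (LeafPath.supNorm 0 0 F + LeafPath.supNorm 0 k F) +
        (LeafPath.supNorm k 0 F + LeafPath.supNorm k k F)) := by
  obtain ⟨i, j⟩ := p
  have hb := fun k l => c.abs_pow_mul_norm_fourierCoeff_le hnm hn F k l i j
  rw [coeff, norm_mul, SchwartzMap.norm_character, one_mul]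
  simp only
  set N := ‖fourierCoeff (fun x => F.1 (c.e (i, x))) j‖ with hN
  have hN0 : 0 ≤ N := norm_nonneg _
  have h1 : weight (i, j) ≤ ((1 + |Y|) + |i + Y|) * (1 + |(j : ℝ)|) := by
    have h := abs_sub (i + Y) Y
    rw [add_sub_cancel_right] at h
    unfold weight
    nlinarith [abs_nonneg Y, abs_nonneg (i + Y), abs_nonneg (j : ℝ),
      mul_nonneg (abs_nonneg Y) (abs_nonneg (j : ℝ)),
      mul_nonneg (abs_nonneg (i + Y)) (abs_nonneg (j : ℝ))]
  have h2 : weight (i, j) ^ k ≤ (2 ^ (k - 1) * ((1 + |Y|) ^ k + |i + Y| ^ k)) *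
      (2 ^ (k - 1) * (1 ^ k + |(j : ℝ)| ^ k)) := by
    refine (pow_le_pow_left₀ (weight_nonneg _) h1 k).trans ?_
    rw [mul_pow]
    exact mul_le_mul (add_pow_le (by positivity) (by positivity) k)
      (add_pow_le (by positivity) (by positivity) k) (by positivity) (by positivity)
  refine (mul_le_mul_of_nonneg_right h2 hN0).trans ?_
  have h00 := hb 0 0
  have h0k := hb 0 k
  have hk0 := hb k 0
  have hkk := hb k k
  simp only [pow_zero, one_mul, mul_one] at h00 h0k hk0
  calc _ = 2 ^ (k - 1) * 2 ^ (k - 1) * ((1 + |Y|) ^ k * (N + |(j : ℝ)| ^ k * N) +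
        (|i + Y| ^ k * N + |i + Y| ^ k * |(j : ℝ)| ^ k * N)) := by ring
    _ ≤ _ := by gcongr

theorem continuous_circle (hnm : IsCoprime n 0) (hn : n * n = 1) (F : Schwartz θ C)
    (i : ℤ) : Continuous fun x : UnitAddCircle => F.1 (c.e (i, x)) := by
  have h := c.continuous_e hnm hn F 0 i
  simp only [termMap_apply, iteratedDeriv_zero, pow_zero, one_mul, move_zero] at h
  exact isQuotientMap_quotient_mk'.continuous_iff.mpr h

end CircleChart
end LeafPath
end

noncomputable section

open FreeModule RapidSeq

/-! ### The identification with the free module -/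

namespace LeafPath.CircleChart

variable {n : ℤ} {θ : ℝ} {C : Supercycle n 0} {Y : ℝ} (c : CircleChart θ C Y)

/-- A rapidly decreasing family as a function of leafwise paths. -/
def toLeafFun (a : Space) (p : LeafPath θ C) : ℂ := row n θ 0 a (c.e.symm p).1 (c.e.symm p).2

theorem toLeafFun_e (a : Space) (i : ℤ) (x : UnitAddCircle) :
    c.toLeafFun a (c.e (i, x)) = row n θ 0 a i x := by
  simp [toLeafFun]

theorem contDiff_toLeafFun (hnm : IsCoprime n 0) (hn : n * n = 1) (a : Space) (i : ℤ)
    (x : UnitAddCircle) :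
    (∀ l, iteratedDeriv l (fun v : ℝ => c.toLeafFun a ((c.e (i, x)).move v)) =
      fun v : ℝ => row n θ l a i (x + ((n * v : ℝ) : UnitAddCircle))) ∧
    ContDiff ℝ ∞ fun v : ℝ => c.toLeafFun a ((c.e (i, x)).move v) := by
  simp only [c.move_e hnm, c.toLeafFun_e]
  exact contDiff_of_hasDerivAt_succ
    (F := fun l (v : ℝ) => row n θ l a i (x + ((n * v : ℝ) : UnitAddCircle)))
    fun l v => hasDerivAt_row hn l a i x v

theorem term_toLeafFun (hnm : IsCoprime n 0) (hn : n * n = 1) (k l : ℕ) (a : Space) (i : ℤ)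
    (x : UnitAddCircle) : term k l (c.toLeafFun a) (c.e (i, x)) =
      ((i + Y : ℝ) : ℂ) ^ k * row n θ l a i x := by
  rw [term, (c.contDiff_toLeafFun hnm hn a i x).1 l, c.height_e]
  simp only
  rw [mul_zero, AddCircle.coe_zero, add_zero]

theorem norm_term_toLeafFun_le (hnm : IsCoprime n 0) (hn : n * n = 1) (k l : ℕ) (a : Space)
    (p : LeafPath θ C) : ‖term k l (c.toLeafFun a) p‖ ≤ (1 + |Y|) ^ k * ((2 * Real.pi) ^ l *
      FreeModule.supNorm (k + l + 2) a * ∑' j : ℤ, ((1 + |(j : ℝ)|) ^ 2)⁻¹) := by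
  obtain ⟨⟨i, x⟩, rfl⟩ := c.e.surjective p
  rw [c.term_toLeafFun hnm hn, norm_mul, norm_pow, Complex.norm_real, Real.norm_eq_abs]
  exact abs_pow_mul_norm_row_le hn Y k l a i x

/-- Rapidly decreasing families as Schwartz functions of leafwise paths. -/
def toLeaf (hnm : IsCoprime n 0) (hn : n * n = 1) : Space →ₗ[ℂ] Schwartz θ C where
  toFun a := ⟨c.toLeafFun a, fun p => by
    obtain ⟨⟨i, x⟩, rfl⟩ := c.e.surjective p
    exact (c.contDiff_toLeafFun hnm hn a i x).2,
    fun k l => ⟨_, c.norm_term_toLeafFun_le hnm hn k l a⟩⟩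
  map_add' a b := Subtype.ext <| funext fun p => by
    have h := (summable_row (θ := θ) hn 0 a (c.e.symm p).1 (c.e.symm p).2).tsum_add
      (summable_row (θ := θ) hn 0 b (c.e.symm p).1 (c.e.symm p).2)
    refine Eq.trans (tsum_congr fun j => ?_) h
    simp only [rowCoeff, Submodule.coe_add, Pi.add_apply]
    ring
  map_smul' z a := Subtype.ext <| funext fun p => by
    refine Eq.trans (tsum_congr fun j => ?_) tsum_mul_left
    simp only [rowCoeff, Submodule.coe_smul, Pi.smul_apply, smul_eq_mul, RingHom.id_apply]
    ring

theorem toLeaf_e (hnm : IsCoprime n 0) (hn : n * n = 1) (a : Space) (i : ℤ) (x : UnitAddCircle) :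
    (c.toLeaf hnm hn a).1 (c.e (i, x)) = row n θ 0 a i x := c.toLeafFun_e a i x

theorem continuous_toLeaf (hnm : IsCoprime n 0) (hn : n * n = 1) :
    Continuous (c.toLeaf hnm hn) := by
  refine continuous_into _ fun k l => ⟨_, ?_, c.norm_term_toLeafFun_le hnm hn k l⟩
  have h := (((FreeModule.tendsto_supNorm (k + l + 2)).const_mul ((2 * Real.pi) ^ l)).mul_const
    (∑' j : ℤ, ((1 + |(j : ℝ)|) ^ 2)⁻¹)).const_mul ((1 + |Y|) ^ k)
  simpa using h

theorem integrable_fourier_smul (hnm : IsCoprime n 0) (hn : n * n = 1) (F : Schwartz θ C) (i : ℤ) :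
    MeasureTheory.Integrable (fun x : UnitAddCircle => F.1 (c.e (i, x)))
      AddCircle.haarAddCircle :=
  (c.continuous_circle hnm hn F i).integrable_of_hasCompactSupport
    (HasCompactSupport.of_compactSpace _)

/-- Schwartz functions of leafwise paths as rapidly decreasing families. -/
def ofLeaf (hnm : IsCoprime n 0) (hn : n * n = 1) : Schwartz θ C →ₗ[ℂ] Space where
  toFun F := ⟨c.coeff F, fun k => ⟨_, c.weight_pow_mul_norm_coeff_le hnm hn k F⟩⟩
  map_add' F G := Subtype.ext <| funext fun p => by
    have h := congrFun (fourierCoeff.add (c.integrable_fourier_smul hnm hn F p.1)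
      (c.integrable_fourier_smul hnm hn G p.1)) p.2
    refine (congrArg (SchwartzModule.character (-(θ * p.1 * p.2)) * ·) h).trans ?_
    exact mul_add _ _ _
  map_smul' z F := Subtype.ext <| funext fun p => by
    have h := fourierCoeff.const_mul (fun x => F.1 (c.e (p.1, x))) z p.2
    refine (congrArg (SchwartzModule.character (-(θ * p.1 * p.2)) * ·) h).trans ?_
    exact mul_left_comm _ _ _

theorem continuous_ofLeaf (hnm : IsCoprime n 0) (hn : n * n = 1) :
    Continuous (c.ofLeaf hnm hn) := by
  refine FreeModule.continuous_into _ fun k => ⟨_, ?_, fun F p =>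
    c.weight_pow_mul_norm_coeff_le hnm hn k F p⟩
  have t := fun k l => LeafPath.tendsto_supNorm (θ := θ) (C := C) k l
  have h := ((((t 0 0).add (t 0 k)).const_mul ((1 + |Y|) ^ k)).add ((t k 0).add (t k k))).const_mul
    (2 ^ (k - 1) * 2 ^ (k - 1))
  simpa using h

theorem toLeaf_ofLeaf (hnm : IsCoprime n 0) (hn : n * n = 1) (F : Schwartz θ C) :
    c.toLeaf hnm hn (c.ofLeaf hnm hn F) = F := by
  refine Subtype.ext (funext fun p => ?_)
  obtain ⟨⟨i, x⟩, rfl⟩ := c.e.surjective p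
  rw [c.toLeaf_e]
  let f : C(UnitAddCircle, ℂ) := ⟨fun x => F.1 (c.e (i, x)), c.continuous_circle hnm hn F i⟩
  have e : ∀ j, rowCoeff n θ 0 (c.ofLeaf hnm hn F) i j = fourierCoeff f j := fun j => by
    change _ * (_ * (_ * fourierCoeff (fun x => F.1 (c.e (i, x))) j)) = _
    rw [pow_zero, one_mul, ← mul_assoc, ← SchwartzModule.character_add, add_neg_cancel,
      SchwartzModule.character_zero, one_mul]
    rfl
  have hs : Summable (fourierCoeff f) := by
    have := summable_rowCoeff (θ := θ) hn 0 (c.ofLeaf hnm hn F) i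
    simp only [e] at this
    exact this.of_norm
  have h := (has_pointwise_sum_fourier_series_of_summable hs x).tsum_eq
  simp only [row, e]
  exact h

theorem ofLeaf_toLeaf (hnm : IsCoprime n 0) (hn : n * n = 1) (a : Space) :
    c.ofLeaf hnm hn (c.toLeaf hnm hn a) = a := by
  refine Subtype.ext (funext fun p => ?_)
  have h := fourierCoeff_tsum (summable_rowCoeff (θ := θ) hn 0 a p.1) p.2
  change _ * fourierCoeff (fun x => c.toLeafFun a (c.e (p.1, x))) p.2 = _
  simp only [c.toLeafFun_e]
  refine (congrArg _ h).trans ?_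
  rw [rowCoeff, pow_zero, one_mul, ← mul_assoc, ← SchwartzModule.character_add, neg_add_cancel,
    SchwartzModule.character_zero, one_mul]

/-- The identification of the free module with the Schwartz space. -/
def leafEquiv (hnm : IsCoprime n 0) (hn : n * n = 1) : Space ≃L[ℂ] Schwartz θ C where
  toLinearEquiv := LinearEquiv.ofLinearMap (c.toLeaf hnm hn) (c.ofLeaf hnm hn)
    (LinearMap.ext fun F => c.toLeaf_ofLeaf hnm hn F)
    (LinearMap.ext fun a => c.ofLeaf_toLeaf hnm hn a)
  continuous_toFun := c.continuous_toLeaf hnm hn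
  continuous_invFun := c.continuous_ofLeaf hnm hn

theorem leafEquiv_e (hnm : IsCoprime n 0) (hn : n * n = 1) (a : Space) (i : ℤ)
    (x : UnitAddCircle) : (c.leafEquiv hnm hn a).1 (c.e (i, x)) = row n θ 0 a i x :=
  c.toLeafFun_e a i x

end LeafPath.CircleChart

namespace FreeModule

variable {n : ℤ} {θ : ℝ}

/-- The phase `e^{2πiθij}` in `rowCoeff` is chosen for this and the next lemma: it absorbs the
cocycle of the monomials `U₁^i U₂^j`, so that `U₁` translates by `θ` and `U₂` is multiplication by
`e^{2πix}`. -/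
theorem row_U₁ (a : Space) (i : ℤ) (x : UnitAddCircle) :
    row n θ 0 (U₁ a) i x = row n θ 0 a (i - 1) (x + (θ : UnitAddCircle)) := by
  refine tsum_congr fun j => ?_
  have h : fourier j (x + (θ : UnitAddCircle)) =
      SchwartzModule.character (θ * j) * fourier j x := by
    rw [fourier_apply, fourier_apply, smul_add, AddCircle.toCircle_add, Circle.coe_mul,
      AddCircle.zsmul_coe, toCircle_coe_eq_character, mul_comm, mul_comm θ]
  have h' : SchwartzModule.character (θ * i * j) =
      SchwartzModule.character (θ * (i - 1 : ℤ) * j) * SchwartzModule.character (θ * j) := by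
    rw [← SchwartzModule.character_add]
    congr 1
    push_cast
    ring
  rw [rowCoeff, rowCoeff, U₁_apply, h, h', Prod.mk_sub_mk, sub_zero]
  ring

theorem row_U₂ (a : Space) (i : ℤ) (x : UnitAddCircle) :
    row n θ 0 (U₂ θ a) i x = (AddCircle.toCircle x : ℂ) * row n θ 0 a i x := by
  rw [row, row, ← tsum_mul_left, ← (Equiv.addRight (1 : ℤ)).tsum_eq]
  refine tsum_congr fun j => ?_
  have h : fourier (j + 1) x = (AddCircle.toCircle x : ℂ) * fourier j x := by
    rw [fourier_add, fourier_one, mul_comm]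
  have h' : SchwartzModule.character (θ * i * (j + 1 : ℤ)) * twist θ (i, j + 1) (0, 1) =
      SchwartzModule.character (θ * i * j) := by
    rw [SchwartzModule.twist_eq_character, ← SchwartzModule.character_add]
    congr 1
    push_cast
    ring
  rw [Equiv.coe_addRight, rowCoeff, rowCoeff, U₂_apply, h, Prod.mk_sub_mk, sub_zero,
    add_sub_cancel_right, ← h']
  ring

theorem row_nabla₁ (a : Space) (i : ℤ) (x : UnitAddCircle) :
    row n θ 0 (nabla₁ a) i x = 2 * Real.pi * Complex.I * i * row n θ 0 a i x := by
  rw [row, row, ← tsum_mul_left]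
  refine tsum_congr fun j => ?_
  rw [rowCoeff, rowCoeff, nabla₁_coe]
  ring

theorem row_nabla₂ (hn : n * n = 1) (a : Space) (i : ℤ) (x : UnitAddCircle) :
    row n θ 0 (nabla₂ a) i x = n * row n θ 1 a i x := by
  have hnC : (n : ℂ) * n = 1 := by exact_mod_cast hn
  rw [row, row, ← tsum_mul_left]
  refine tsum_congr fun j => ?_
  rw [rowCoeff, rowCoeff, nabla₂_coe]
  linear_combination (-(2 * Real.pi * Complex.I * j * (SchwartzModule.character (θ * i * j) *
    a.1 (i, j)) * fourier j x)) * hnC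

/-- The heights `i + Y` translate `δ₁` by `r₁ = Y`. Moving the end point differentiates along `n
d/dx`, and `n² = 1` turns the factor `n⁻¹` into the derivation `δ₂`. -/
theorem exists_isLeafIso_const (hnm : IsCoprime n 0) (τ : ℂ) (C : Supercycle n 0) (X Y H : ℝ)
    (h : ((X : UnitAddCircle), (Y : UnitAddCircle)) ∈ C.line) :
    ∃ ψ, (freeModule θ).IsLeafIso C (fun _ => H) τ ((freeModule θ).translated τ
      (-(((0 : ℤ) * X - n * Y) / (n - (0 : ℤ) * θ)), H / (n - (0 : ℤ) * θ))) ψ := by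
  have hn : n * n = 1 := by
    have := Int.isUnit_iff.mp (isCoprime_zero_right.mp hnm)
    rcases this with rfl | rfl <;> rfl
  have hnC : (n : ℂ) * n = 1 := by exact_mod_cast hn
  obtain ⟨c⟩ := LeafPath.exists_circleChart (θ := θ) hnm hn C X Y h
  refine ⟨c.leafEquiv hnm hn, fun (a : Space) p => ?_, fun (a : Space) p => ?_,
    fun (a : Space) p => ?_⟩ <;> obtain ⟨⟨i, x⟩, rfl⟩ := c.e.surjective p
  · rw [c.next_e hnm]
    refine (c.leafEquiv_e hnm hn (U₁ a) i x).trans ?_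
    rw [row_U₁]
    exact (c.leafEquiv_e hnm hn a _ _).symm
  · refine (c.leafEquiv_e hnm hn (U₂ θ a) i x).trans ?_
    rw [row_U₂, c.start_e]
    exact congrArg _ (c.leafEquiv_e hnm hn a i x).symm
  · refine (congrArg (fun b : Space => (c.leafEquiv hnm hn b).1 (c.e (i, x)))
      ((freeModule θ).translated_apply τ _ a)).trans ?_
    have e1 := fun b => c.leafEquiv_e hnm hn b i x
    have e2 : deriv (fun v : ℝ => (c.leafEquiv hnm hn a).1 ((c.e (i, x)).move v)) 0 =
        row n θ 1 a i x := by
      have := congrFun ((c.contDiff_toLeafFun hnm hn a i x).1 1) 0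
      rw [iteratedDeriv_one, mul_zero, AddCircle.coe_zero, add_zero] at this
      exact this
    set z : ℂ := 2 * Real.pi * Complex.I * (τ * (-(((0 : ℤ) * X - n * Y) / (n - (0 : ℤ) * θ)) : ℝ) +
        (H / (n - (0 : ℤ) * θ) : ℝ)) with hz
    have e3 : (c.leafEquiv hnm hn (τ • nabla₁ a + nabla₂ a + z • a)).1 (c.e (i, x)) =
        τ * row n θ 0 (nabla₁ a) i x + row n θ 0 (nabla₂ a) i x + z * row n θ 0 a i x := by
      rw [map_add, map_add, map_smul, map_smul, Submodule.coe_add, Submodule.coe_add,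
        Submodule.coe_smul, Submodule.coe_smul, Pi.add_apply, Pi.add_apply, Pi.smul_apply,
        Pi.smul_apply, e1, e1, e1, smul_eq_mul, smul_eq_mul]
    refine e3.trans ?_
    change _ = τ * (_ * _ * (c.leafEquiv hnm hn a).1 (c.e (i, x))) + _ * (deriv (fun v : ℝ =>
        (c.leafEquiv hnm hn a).1 ((c.e (i, x)).move v)) 0 + _ *
          (c.leafEquiv hnm hn a).1 (c.e (i, x)))
    rw [e1, e2, row_nabla₁, row_nabla₂ hn, hz, c.height_e]
    have h1 : (n : ℂ)⁻¹ = n := inv_eq_of_mul_eq_one_right hnC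
    push_cast
    simp only [zero_mul, sub_zero, zero_sub, div_eq_mul_inv, h1]
    linear_combination (τ * 2 * Real.pi * Complex.I * Y * row n θ 0 a i x) * hnC

end FreeModule

end

noncomputable section

/-! ## The basic modules -/

section BasicModule

variable {n m : ℤ} {θ : ℝ}

/-- The sign `δ` reconciles the two cases: the free module has `κ = 1 = n/n`, the Schwartz module `κ
= 1/(n - mθ)`. In both, `κℤ²` is the lattice `(n - mθ)⁻¹ℤ²`. -/
theorem exists_commutantModel (hnm : IsCoprime n m) (hθ : (n : ℝ) - m * θ ≠ 0) :
    ∃ (δ : ℤ) (ϑ : ℝ), δ * δ = 1 ∧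
      Nonempty (CommutantModel (basicModule n m θ) (m / (n - m * θ)) (δ / (n - m * θ)) ϑ) := by
  by_cases hm : m = 0
  · subst hm
    have hn : n * n = 1 := by
      rcases Int.isUnit_iff.mp (isCoprime_zero_right.mp hnm) with rfl | rfl <;> rfl
    have hn0 : (n : ℝ) ≠ 0 := by simpa using hθ
    have e : basicModule n 0 θ = freeModule θ := dif_pos rfl
    refine ⟨n, θ, hn, ?_⟩
    rw [e, Int.cast_zero, zero_mul, sub_zero, zero_div, div_self hn0]
    exact ⟨FreeModule.commutantModel θ⟩
  · have e : basicModule n m θ = schwartzModule n m θ hm := dif_neg hm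
    obtain ⟨a, b, hab⟩ := hnm
    have hn : m ∣ n * a - 1 := ⟨-b, by linear_combination hab⟩
    obtain ⟨N, hN⟩ := exists_nat_gt (2 * |(n : ℝ) - m * θ|)
    have hN0 : N ≠ 0 := by
      rintro rfl
      have := abs_nonneg ((n : ℝ) - m * θ)
      rw [Nat.cast_zero] at hN
      linarith
    refine ⟨1, (SchwartzModule.dualGauge n m a θ).angle m, one_mul 1, ?_⟩
    rw [e, Int.cast_one, one_div]
    exact ⟨SchwartzModule.commutantModel hm hθ hn hN0 hN⟩

theorem exists_isLeafIso_const (hnm : IsCoprime n m) (hθ : (n : ℝ) - m * θ ≠ 0) (τ : ℂ)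
    (C : Supercycle n m) (X Y H : ℝ) (h : ((X : UnitAddCircle), (Y : UnitAddCircle)) ∈ C.line) :
    ∃ ψ, (basicModule n m θ).IsLeafIso C (fun _ => H) τ
      ((basicModule n m θ).translated τ (-((m * X - n * Y) / (n - m * θ)), H / (n - m * θ))) ψ := by
  by_cases hm : m = 0
  · subst hm
    have e : basicModule n 0 θ = freeModule θ := dif_pos rfl
    rw [e]
    exact FreeModule.exists_isLeafIso_const hnm τ C X Y H h
  · have e : basicModule n m θ = schwartzModule n m θ hm := dif_neg hm
    rw [e]
    exact SchwartzModule.exists_isLeafIso_const hnm hm hθ τ C X Y H h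

theorem continuous_coe_circle (g : C(UnitAddCircle, ℝ)) :
    Continuous fun s : ℝ => g (s : UnitAddCircle) :=
  g.continuous.comp (AddCircle.continuous_mk' 1)

/-- The module of leafwise paths of a supercycle. -/
theorem exists_isLeafIso (hnm : IsCoprime n m) (hθ : (n : ℝ) - m * θ ≠ 0) (τ : ℂ)
    (C : Supercycle n m) (X Y : ℝ) (h : ((X : UnitAddCircle), (Y : UnitAddCircle)) ∈ C.line) :
    ∃ ψ, (basicModule n m θ).IsLeafIso C C.form τ ((basicModule n m θ).translated τ
      (-((m * X - n * Y) / (n - m * θ)),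
        (∫ s in (0 : ℝ)..1, C.form (s : UnitAddCircle)) / (n - m * θ))) ψ := by
  set H := ∫ s in (0 : ℝ)..1, C.form (s : UnitAddCircle) with hH
  obtain ⟨ψ, hψ⟩ := exists_isLeafIso_const hnm hθ τ C X Y H h
  -- The difference between `h` and its mean value has integral zero, so it is removed by a gauge
  -- transformation of winding number zero.
  obtain ⟨u, hu, hu'⟩ := exists_circle_of_integral_eq_int (ContinuousMap.const _ H - C.form) 0 (by
    simp only [ContinuousMap.sub_apply, ContinuousMap.const_apply]
    rw [intervalIntegral.integral_sub (continuous_const.intervalIntegrable _ _)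
      ((continuous_coe_circle C.form).intervalIntegrable _ _), ← hH]
    simp)
  refine ⟨_, hψ.gauge (fun s => (u s : ℂ)) (hu' (contDiff_const.sub C.smooth))
    (fun s => Circle.coe_ne_zero _) fun s => ?_⟩
  simpa using hu s

end BasicModule

/-! ## The moduli space of supercycles -/

namespace Supercycle

variable {n m : ℤ}

theorem integral_form_add (g : C(UnitAddCircle, ℝ)) (c : ℝ) :
    ∫ s in (0 : ℝ)..1, g ((s + c : ℝ) : UnitAddCircle) =
      ∫ s in (0 : ℝ)..1, g (s : UnitAddCircle) := by
  have hper : Function.Periodic (fun s : ℝ => g (s : UnitAddCircle)) 1 := fun s => by simp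
  have h := hper.intervalIntegral_add_eq c 0
  rw [intervalIntegral.integral_comp_add_right (fun s : ℝ => g (s : UnitAddCircle)) c, zero_add,
    add_comm 1 c, h, zero_add]

/-- A gauge transformation has an integral winding number. -/
theorem exists_int_of_gauge {g : ℝ → ℝ} (hg : Continuous g) {u : UnitAddCircle → Circle}
    (hu : ∀ s : ℝ, HasDerivAt (fun v : ℝ => (u (v : UnitAddCircle) : ℂ))
      (2 * Real.pi * Complex.I * g s * u (s : UnitAddCircle)) s) :
    ∃ k : ℤ, ∫ s in (0 : ℝ)..1, g s = k := by
  set H : ℝ → ℝ := fun s => ∫ v in (0 : ℝ)..s, g v with hH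
  have hd : ∀ s : ℝ, HasDerivAt H (g s) s := fun s =>
    intervalIntegral.integral_hasDerivAt_right (hg.intervalIntegrable _ _)
      (hg.stronglyMeasurableAtFilter _ _) hg.continuousAt
  -- The quotient of `u` by the exponential of the primitive is constant. As `u` takes equal values
  -- at `0` and `1`, so does the exponential.
  have hv : ∀ s : ℝ, HasDerivAt (fun v : ℝ => (u (v : UnitAddCircle) : ℂ) *
      Complex.exp (-(2 * Real.pi * Complex.I * H v))) 0 s := fun s => by
    have h1 := ((hd s).ofReal_comp.const_mul (2 * (Real.pi : ℂ) * Complex.I)).fun_neg.cexp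
    refine ((hu s).fun_mul h1).congr_deriv ?_
    ring
  have hc := is_const_of_deriv_eq_zero (fun s => (hv s).differentiableAt) (fun s => (hv s).deriv) 1 0
  have hu1 : ((1 : ℝ) : UnitAddCircle) = ((0 : ℝ) : UnitAddCircle) := by
    rw [AddCircle.coe_period, AddCircle.coe_zero]
  have hH0 : H 0 = 0 := by simp [hH]
  rw [hu1] at hc
  have h2 := mul_left_cancel₀ (Circle.coe_ne_zero _) hc
  rw [hH0, Complex.ofReal_zero, mul_zero, neg_zero, Complex.exp_zero, Complex.exp_eq_one_iff] at h2
  obtain ⟨k, hk⟩ := h2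
  refine ⟨-k, ?_⟩
  have hpi : (2 * (Real.pi : ℂ) * Complex.I) ≠ 0 := by simp [Real.pi_ne_zero]
  have h3 : ((H 1 : ℝ) : ℂ) = ((-k : ℤ) : ℂ) := by
    refine mul_left_cancel₀ hpi ?_
    push_cast
    linear_combination -hk
  exact_mod_cast h3

/-- Position and holonomy of a supercycle. -/
def invariant (C : Supercycle n m) : UnitAddCircle × UnitAddCircle :=
  (n • C.base.2 - m • C.base.1,
    ((∫ s in (0 : ℝ)..1, C.form (s : UnitAddCircle) : ℝ) : UnitAddCircle))

theorem invariant_of_mem_line (C : Supercycle n m) {X Y : ℝ}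
    (h : ((X : UnitAddCircle), (Y : UnitAddCircle)) ∈ C.line) :
    C.invariant = (((n * Y - m * X : ℝ) : UnitAddCircle),
      ((∫ s in (0 : ℝ)..1, C.form (s : UnitAddCircle) : ℝ) : UnitAddCircle)) := by
  obtain ⟨s, hs⟩ := h
  simp only [point, Prod.mk.injEq] at hs
  refine Prod.ext ?_ rfl
  simp only [invariant]
  rw [AddCircle.coe_sub, ← AddCircle.zsmul_coe, ← AddCircle.zsmul_coe, ← hs.1, ← hs.2, smul_add,
    smul_add, smul_comm n m, add_sub_add_right_eq_sub]

/-- Equal positions mean that the difference of base points satisfies the equation of multiples of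
`(n, m)`, hence is one by coprimality. The reparametrised forms are gauge equivalent exactly when
their integrals differ by an integer, the winding number of the gauge transformation. -/
theorem invariant_eq_iff (hnm : IsCoprime n m) (C C' : Supercycle n m) :
    C.invariant = C'.invariant ↔ (setoid n m).r C C' := by
  have hshift : ∀ c : ℝ, ∫ s in (0 : ℝ)..1, (C'.form (s : UnitAddCircle) -
      C.form ((s + c : ℝ) : UnitAddCircle)) = (∫ s in (0 : ℝ)..1, C'.form (s : UnitAddCircle)) -
        ∫ s in (0 : ℝ)..1, C.form (s : UnitAddCircle) := fun c => by
    have h : Continuous fun s : ℝ => C.form ((s + c : ℝ) : UnitAddCircle) :=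
      (continuous_coe_circle C.form).comp (continuous_id.add continuous_const)
    rw [intervalIntegral.integral_sub ((continuous_coe_circle C'.form).intervalIntegrable _ _)
      (h.intervalIntegrable _ _), integral_form_add]
  constructor
  · intro h
    simp only [invariant, Prod.mk.injEq] at h
    obtain ⟨h1, h2⟩ := h
    have h3 : m • (C'.base.1 - C.base.1) = n • (C'.base.2 - C.base.2) := by
      rw [smul_sub, smul_sub]
      rw [sub_eq_sub_iff_add_eq_add] at h1 ⊢
      rw [add_comm, add_comm (n • _), ← h1, add_comm]
    obtain ⟨σ, hσ1, hσ2⟩ := exists_zsmul_eq_of_isCoprime hnm h3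
    obtain ⟨c, rfl⟩ := QuotientAddGroup.mk_surjective σ
    obtain ⟨k, hk⟩ := UnitAddCircle.coe_eq_coe_iff.mp h2.symm
    let g : C(UnitAddCircle, ℝ) := C'.form -
      C.form.comp ⟨fun s => s + (c : UnitAddCircle), continuous_id.add continuous_const⟩
    have hg : ∀ s : ℝ, g (s : UnitAddCircle) = C'.form (s : UnitAddCircle) -
        C.form ((s + c : ℝ) : UnitAddCircle) := fun s => rfl
    obtain ⟨u, hu, -⟩ := exists_circle_of_integral_eq_int g k (by
      simp only [hg]
      rw [hshift c, hk, add_sub_cancel_left])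
    refine ⟨c, ?_, u, fun s => ?_⟩
    · refine Prod.ext ?_ ?_
      · exact (add_sub_cancel C.base.1 C'.base.1).symm.trans (congrArg _ hσ1.symm)
      · exact (add_sub_cancel C.base.2 C'.base.2).symm.trans (congrArg _ hσ2.symm)
    · have := hu s
      rw [hg, Complex.ofReal_sub] at this
      exact this
  · rintro ⟨c, hc, u, hu⟩
    refine Prod.ext ?_ ?_
    · simp only [invariant, hc, point]
      rw [smul_add, smul_add, smul_comm n m, add_sub_add_right_eq_sub]
    · obtain ⟨k, hk⟩ := exists_int_of_gauge (g := fun s => C'.form (s : UnitAddCircle) -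
        C.form ((s + c : ℝ) : UnitAddCircle)) ((continuous_coe_circle C'.form).sub
          ((continuous_coe_circle C.form).comp (continuous_id.add continuous_const)))
        (u := u) (fun s => by
          rw [Complex.ofReal_sub]
          exact hu s)
      rw [hshift] at hk
      exact (UnitAddCircle.coe_eq_coe_iff.mpr ⟨k, by linarith⟩).symm

theorem continuous_invariant : Continuous (invariant (n := n) (m := m)) := by
  have h : Continuous fun C : Supercycle n m => (C.base, C.form) := continuous_induced_dom
  have h1 : Continuous fun C : Supercycle n m => C.base := continuous_fst.comp h
  have h2 : Continuous fun C : Supercycle n m => C.form := continuous_snd.comp h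
  have h3 : Continuous fun C : Supercycle n m => ∫ s in (0 : ℝ)..1, C.form (s : UnitAddCircle) := by
    refine intervalIntegral.continuous_parametric_intervalIntegral_of_continuous'
      (f := fun (C : Supercycle n m) (s : ℝ) => C.form (s : UnitAddCircle)) ?_ 0 1
    exact (h2.comp continuous_fst).eval ((AddCircle.continuous_mk' 1).comp continuous_snd)
  exact (((continuous_snd.comp h1).zsmul n).sub ((continuous_fst.comp h1).zsmul m)).prodMk
    ((AddCircle.continuous_mk' 1).comp h3)

end Supercycle

/-- The quotient map from the plane to the torus. -/
theorem isQuotientMap_torus :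
    Topology.IsQuotientMap fun ρ : ℝ × ℝ => ((ρ.1 : UnitAddCircle), (ρ.2 : UnitAddCircle)) := by
  have h : IsOpenQuotientMap (fun x : ℝ => (x : UnitAddCircle)) :=
    QuotientAddGroup.isOpenQuotientMap_mk
  exact (h.prodMap h).isQuotientMap

namespace Supercycle

variable {n m : ℤ}

/-- The moduli space of supercycles is a torus. -/
theorem exists_homeomorph (hnm : IsCoprime n m) :
    ∃ e : SupercycleModuli n m ≃ₜ UnitAddCircle × UnitAddCircle,
      ∀ C : Supercycle n m, e (Quotient.mk _ C) = C.invariant := by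
  obtain ⟨a, b, hab⟩ := id hnm
  let f : SupercycleModuli n m → UnitAddCircle × UnitAddCircle :=
    Quotient.lift invariant fun C C' h => (invariant_eq_iff hnm C C').mpr h
  -- A continuous family with invariant `ρ`: since `an + bm = 1`, the form `nY - mX` takes the value
  -- `ρ₁` at `(-bρ₁, aρ₁)`, and the constant form `ρ₂` has integral `ρ₂`. It makes the inverse
  -- continuous, because the plane is a quotient cover of the torus.
  let S : ℝ × ℝ → Supercycle n m := fun ρ =>
    ⟨((-b : ℤ) • (ρ.1 : UnitAddCircle), a • (ρ.1 : UnitAddCircle)), ContinuousMap.const _ ρ.2,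
      contDiff_const⟩
  have hfS : ∀ ρ, f (Quotient.mk _ (S ρ)) = ((ρ.1 : UnitAddCircle), (ρ.2 : UnitAddCircle)) :=
    fun ρ => by
      change (S ρ).invariant = _
      refine Prod.ext ?_ ?_
      · simp only [invariant, S]
        rw [smul_smul, smul_smul, ← sub_smul]
        have : n * a - m * -b = 1 := by linear_combination hab
        rw [this, one_smul]
      · simp [invariant, S]
  have hS : Continuous S := by
    refine continuous_induced_rng.mpr ?_
    have h1 : Continuous fun ρ : ℝ × ℝ => (ρ.1 : UnitAddCircle) :=
      (AddCircle.continuous_mk' 1).comp continuous_fst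
    exact ((h1.zsmul (-b)).prodMk (h1.zsmul a)).prodMk (ContinuousMap.continuous_const'.comp continuous_snd)
  have hinj : Function.Injective f := by
    rintro ⟨C⟩ ⟨C'⟩ h
    exact Quotient.sound ((invariant_eq_iff hnm C C').mp h)
  have hsurj : Function.Surjective f := fun y => by
    obtain ⟨ρ, rfl⟩ := isQuotientMap_torus.surjective y
    exact ⟨_, hfS ρ⟩
  let e := Equiv.ofBijective f ⟨hinj, hsurj⟩
  refine ⟨⟨e, ?_, ?_⟩, fun C => rfl⟩
  · exact continuous_quot_lift _ continuous_invariant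
  · refine isQuotientMap_torus.continuous_iff.mpr ?_
    have : e.symm ∘ (fun ρ : ℝ × ℝ => ((ρ.1 : UnitAddCircle), (ρ.2 : UnitAddCircle))) =
        fun ρ => Quotient.mk _ (S ρ) := by
      funext ρ
      rw [Function.comp_apply, Equiv.symm_apply_eq]
      exact (hfS ρ).symm
    exact this ▸ continuous_quotient_mk'.comp hS

end Supercycle

end

noncomputable section

/-! ## The moduli space of standard holomorphic structures -/

namespace StdHolStructure

variable {n m : ℤ} {θ : ℝ} {τ : ℂ}

theorem mk_eq_mk_iff (D D' : StdHolStructure n m θ τ) :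
    (Quotient.mk _ D : StdHolModuli n m θ τ) = Quotient.mk _ D' ↔
      (basicModule n m θ).Conjugate D.1 D'.1 := Quotient.eq

theorem tendsto_apply (D : StdHolStructure n m θ τ) (ξ : (basicModule n m θ).E) :
    Filter.Tendsto (fun D' : StdHolStructure n m θ τ => D'.1 ξ) (nhds D) (nhds (D.1 ξ)) :=
  ((continuous_apply ξ).comp continuous_induced_dom).tendsto D

/-- The class of `τ(∇₁ + 2πi ρ₁ / (n - mθ)) + (∇₂ + 2πi ρ₂ / (n - mθ))` is determined by `ρ`
modulo one, and the moduli space is a torus. -/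
theorem exists_homeomorph (hnm : IsCoprime n m) (hθ : (n : ℝ) - m * θ ≠ 0) (hτ : τ.im ≠ 0) :
    ∃ T : ℝ × ℝ → StdHolStructure n m θ τ,
      (∀ ρ, (T ρ).1 = (basicModule n m θ).translated τ (ρ.1 / (n - m * θ), ρ.2 / (n - m * θ))) ∧
      ∃ e : UnitAddCircle × UnitAddCircle ≃ₜ StdHolModuli n m θ τ,
        ∀ ρ : ℝ × ℝ, e ((ρ.1 : UnitAddCircle), (ρ.2 : UnitAddCircle)) = Quotient.mk _ (T ρ) := by
  obtain ⟨δ, ϑ, hδ, ⟨S⟩⟩ := exists_commutantModel hnm hθ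
  have := S.topAddGroup
  have := S.contSMul
  have hδR : (δ : ℝ) * δ = 1 := by exact_mod_cast hδ
  have hδ0 : (δ : ℝ) ≠ 0 := fun h => by simp [h] at hδR
  have hκ : (δ : ℝ) / (n - m * θ) ≠ 0 := div_ne_zero hδ0 hθ
  set M := basicModule n m θ with hM
  let T : ℝ × ℝ → StdHolStructure n m θ τ := fun ρ =>
    ⟨M.translated τ (ρ.1 / (n - m * θ), ρ.2 / (n - m * θ)), S.isStandard_translated τ _⟩
  have hT : ∀ ρ, (T ρ).1 = M.translated τ (ρ.1 / (n - m * θ), ρ.2 / (n - m * θ)) := fun ρ => rfl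
  have hiff : ∀ ρ ρ' : ℝ × ℝ, (Quotient.mk _ (T ρ) : StdHolModuli n m θ τ) = Quotient.mk _ (T ρ') ↔
      ((ρ.1 : UnitAddCircle), (ρ.2 : UnitAddCircle)) = ((ρ'.1 : UnitAddCircle), (ρ'.2 : UnitAddCircle)) :=
    fun ρ ρ' => by
      rw [mk_eq_mk_iff, Prod.mk.injEq, UnitAddCircle.coe_eq_coe_iff, UnitAddCircle.coe_eq_coe_iff]
      constructor
      · intro h
        obtain ⟨q, h1, h2⟩ := S.exists_lattice_of_conjugate hτ h
        simp only at h1 h2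
        field_simp at h1 h2
        refine ⟨⟨δ * q.1, ?_⟩, ⟨δ * q.2, ?_⟩⟩ <;> push_cast <;> linarith
      · rintro ⟨⟨k, hk⟩, ⟨l, hl⟩⟩
        refine S.conjugate_translated_of_lattice τ (q := (δ * k, δ * l)) ?_ ?_
        · simp only [hk]
          push_cast
          field_simp
          linear_combination (k : ℝ) * hδR
        · simp only [hl]
          push_cast
          field_simp
          linear_combination (l : ℝ) * hδR
  have hTc : Continuous T := by
    refine continuous_induced_rng.mpr (continuous_pi fun ξ => ?_)
    have e : ∀ ρ : ℝ × ℝ, (T ρ).1 ξ = τ • M.nabla₁ ξ + M.nabla₂ ξ + (2 * Real.pi * Complex.I *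
        (τ * (ρ.1 / (n - m * θ) : ℝ) + (ρ.2 / (n - m * θ) : ℝ))) • ξ := fun ρ =>
      M.translated_apply τ _ ξ
    change Continuous fun ρ : ℝ × ℝ => (T ρ).1 ξ
    simp only [e]
    refine continuous_const.add (Continuous.smul ?_ continuous_const)
    fun_prop
  let f : ℝ × ℝ → StdHolModuli n m θ τ := fun ρ => Quotient.mk _ (T ρ)
  have hf : Continuous f := continuous_quotient_mk'.comp hTc
  have hex : ∀ D : StdHolStructure n m θ τ, ∃ ρ, f ρ = Quotient.mk _ D := fun D => by
    obtain ⟨r, hr⟩ := S.exists_conjugate_translated hκ D.2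
    refine ⟨((n - m * θ) * r.1, (n - m * θ) * r.2), (mk_eq_mk_iff _ _).mpr ?_⟩
    rw [hT, mul_div_cancel_left₀ _ hθ, mul_div_cancel_left₀ _ hθ]
    exact hr
  let π : C(ℝ × ℝ, UnitAddCircle × UnitAddCircle) :=
    ⟨fun ρ => ((ρ.1 : UnitAddCircle), (ρ.2 : UnitAddCircle)), isQuotientMap_torus.continuous⟩
  have hπ : Topology.IsQuotientMap π := isQuotientMap_torus
  let g : UnitAddCircle × UnitAddCircle → StdHolModuli n m θ τ :=
    -- The choice of a lift to the plane is harmless: by `hiff` the class of `T ρ` depends on `ρ`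
    -- modulo `ℤ²` only.
    fun y => f (hπ.surjective y).choose
  have hg : ∀ ρ, g (π ρ) = f ρ := fun ρ =>
    (hiff _ _).mpr (hπ.surjective (π ρ)).choose_spec
  have hinj : Function.Injective g := fun y y' h => by
    obtain ⟨ρ, rfl⟩ := hπ.surjective y
    obtain ⟨ρ', rfl⟩ := hπ.surjective y'
    rw [hg, hg] at h
    exact (hiff _ _).mp h
  have hsurj : Function.Surjective g := by
    rintro ⟨D⟩
    obtain ⟨ρ, hρ⟩ := hex D
    exact ⟨π ρ, (hg ρ).trans hρ⟩
  let e := Equiv.ofBijective g ⟨hinj, hsurj⟩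
  have he : ∀ ρ, e (π ρ) = f ρ := hg
  refine ⟨T, hT, ⟨e, ?_, ?_⟩, hg⟩
  · refine hπ.continuous_iff.mpr ?_
    have : g ∘ π = f := funext hg
    exact this ▸ hf
  -- Continuity on the quotient is checked on the structures themselves, where `eventually_close`
  -- applies at each `D`.
  · refine continuous_coinduced_dom.mpr (continuous_iff_continuousAt.mpr fun D => ?_)
    obtain ⟨ρ₀, hρ₀⟩ := hex D
    have h0 : e.symm (Quotient.mk _ D) = π ρ₀ := by rw [Equiv.symm_apply_eq, he, hρ₀]
    change Filter.Tendsto (fun D' : StdHolStructure n m θ τ => e.symm (Quotient.mk _ D')) (nhds D)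
      (nhds (e.symm (Quotient.mk _ D)))
    rw [h0]
    refine Filter.tendsto_def.mpr fun V hV => ?_
    obtain ⟨η, hη, hball⟩ := Metric.mem_nhds_iff.mp (π.continuous.continuousAt hV)
    have habs : 0 < |(n : ℝ) - m * θ| := abs_pos.mpr hθ
    have hev := S.eventually_close hκ hτ D.2 (fun D' : StdHolStructure n m θ τ => D'.2)
      (fun ξ => tendsto_apply D ξ) ((mk_eq_mk_iff (T ρ₀) D).mp hρ₀) (div_pos hη habs)
    filter_upwards [hev] with D' hD'
    obtain ⟨ρ, hρ⟩ := hex D'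
    obtain ⟨q, h1, h2⟩ := hD' _ ((mk_eq_mk_iff (T ρ) D').mp hρ)
    -- The parameter of `D'` is replaced by the representative modulo `ℤ²` that lies close to `ρ₀`;
    -- the point of the torus is unchanged because `δq` is an integer vector.
    have h3 : e.symm (Quotient.mk _ D') = π (δ * q.1 + ρ.1, δ * q.2 + ρ.2) := by
      rw [Equiv.symm_apply_eq, he, ← hρ]
      refine (hiff _ _).mpr (Prod.ext ?_ ?_)
      · exact UnitAddCircle.coe_eq_coe_iff.mpr ⟨-(δ * q.1), by push_cast; ring⟩
      · exact UnitAddCircle.coe_eq_coe_iff.mpr ⟨-(δ * q.2), by push_cast; ring⟩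
    have hsmall : ∀ k : ℤ, ∀ x y : ℝ, |(δ : ℝ) / (n - m * θ) * k + x / (n - m * θ) -
        y / (n - m * θ)| < η / |(n : ℝ) - m * θ| → |δ * k + x - y| < η := fun k x y h => by
      have e1 : (δ : ℝ) / (n - m * θ) * k + x / (n - m * θ) - y / (n - m * θ) =
          (δ * k + x - y) / (n - m * θ) := by ring
      rwa [e1, abs_div, div_lt_div_iff_of_pos_right habs] at h
    change e.symm (Quotient.mk _ D') ∈ V
    rw [h3]
    refine hball ?_
    rw [Metric.mem_ball, Prod.dist_eq, max_lt_iff, Real.dist_eq, Real.dist_eq]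
    exact ⟨hsmall q.1 _ _ h1, hsmall q.2 _ _ h2⟩

end StdHolStructure

end

/-! ### The main theorem. -/

theorem mainTheorem2 (n m : ℤ) (hnm : IsCoprime n m) (θ : ℝ) (hθ : (n : ℝ) - m * θ ≠ 0)
    (τ : ℂ) (hτ : τ.im ≠ 0) :
    -- the leafwise paths that end on the line through `(X, Y)`
    (∀ (C : Supercycle n m) (X Y : ℝ), ((X : UnitAddCircle), (Y : UnitAddCircle)) ∈ C.line →
      ∀ (x : UnitAddCircle) (t : ℝ), (∃ p : LeafPath θ C, p.start = x ∧ p.height = t) ↔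
        m • (x - (X : UnitAddCircle)) + n • (Y : UnitAddCircle) =
          (((n - m * θ) * t : ℝ) : UnitAddCircle)) ∧
    ∃ Φ : SupercycleModuli n m ≃ₜ StdHolModuli n m θ τ,
      -- the identification is given by the module of leafwise paths
      (∀ (C : Supercycle n m) (D : StdHolStructure n m θ τ),
        Φ (Quotient.mk _ C) = Quotient.mk _ D ↔ IsLeafPathModel C D) ∧
      -- position and holonomy correspond to the translations of `∇₁` and `∇₂`
      (∀ (C : Supercycle n m) (X Y : ℝ), ((X : UnitAddCircle), (Y : UnitAddCircle)) ∈ C.line →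
        ∃ D : StdHolStructure n m θ τ,
          D.1 = translatedStructure n m θ τ (-((m * X - n * Y) / (n - m * θ)))
            ((∫ s in (0 : ℝ)..1, C.form (s : UnitAddCircle)) / (n - m * θ)) ∧
          Φ (Quotient.mk _ C) = Quotient.mk _ D) := by
  refine ⟨fun C X Y h x t => LeafPath.exists_iff hnm C X Y h x t, ?_⟩
  obtain ⟨e, he⟩ := Supercycle.exists_homeomorph hnm
  obtain ⟨T, hT, e', he'⟩ := StdHolStructure.exists_homeomorph hnm hθ hτ
  -- Position and holonomy of the supercycle are fed into the torus coordinates of the holomorphic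
  -- structures; dividing by `n - mθ` gives the translations `r₁` and `r₂`.
  have key : ∀ (C : Supercycle n m) (X Y : ℝ),
      ((X : UnitAddCircle), (Y : UnitAddCircle)) ∈ C.line →
      e' (e (Quotient.mk _ C)) = Quotient.mk _ (T (n * Y - m * X,
        ∫ s in (0 : ℝ)..1, C.form (s : UnitAddCircle))) := fun C X Y h => by
    rw [he, C.invariant_of_mem_line h]
    exact he' (n * Y - m * X, ∫ s in (0 : ℝ)..1, C.form (s : UnitAddCircle))
  have hT' : ∀ X Y H : ℝ, (T (n * Y - m * X, H)).1 = (basicModule n m θ).translated τ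
      (-((m * X - n * Y) / (n - m * θ)), H / (n - m * θ)) := fun X Y H => by
    rw [hT, ← neg_div, neg_sub]
  refine ⟨e.trans e', fun C D => ?_, fun C X Y h => ⟨_, hT' X Y _, key C X Y h⟩⟩
  -- The base point serves as `(X, Y)`. The module of paths is then isomorphic to the translate that
  -- represents `Φ` of the class, and both directions follow by composing with this isomorphism.
  obtain ⟨⟨X, hX⟩, ⟨Y, hY⟩⟩ := And.intro (QuotientAddGroup.mk_surjective C.base.1)
    (QuotientAddGroup.mk_surjective C.base.2)
  have hXY : ((X : UnitAddCircle), (Y : UnitAddCircle)) ∈ C.line :=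
    ⟨0, by simp only [Supercycle.point, smul_zero, add_zero]; exact Prod.ext hX.symm hY.symm⟩
  obtain ⟨ψ, hψ⟩ := exists_isLeafIso hnm hθ τ C X Y hXY
  rw [Homeomorph.trans_apply, key C X Y hXY, StdHolStructure.mk_eq_mk_iff, hT']
  constructor
  · intro h
    obtain ⟨ψ', h'⟩ := hψ.of_conjugate h.symm
    exact ⟨ψ', h'.map_U₁, h'.map_U₂, h'.map_D⟩
  · rintro ⟨ψ', h₁, h₂, h₃⟩
    exact hψ.conjugate ⟨h₁, h₂, h₃⟩
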